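/- Let $p$ be an odd prime, $d\ge 0$ an integer, and $V$ a $2(d+1)$-dimensional $\mathbb F_p$-vector space with a nondegenerate nonsplit symmetric bilinear form $[\cdot,\cdot]$ (nonsplit: no totally isotropic subspace has dimension $d+1$). Fix a basis $e_1,\dots,e_{d+1},f_1,\dots,f_{d+1}$ of $V\otimes\mathbb F_{p^2}$ with $[e_i,f_j]=\delta_{ij}$, $[e_i,e_j]=[f_i,f_j]=0$, with $e_1,\dots,e_d,f_1,\dots,f_d\in V$, and such that the $p$-power Frobenius switches $e_{d+1}$ and $f_{d+1}$. Let $\mathrm{OGr}(d,d+1)$ be the $\mathbb F_{p^2}$-scheme whose $S$-points are the pairs $\mathcal L_d\subset\mathcal L_{d+1}\subset V\otimes\mathcal O_S$ of totally isotropic locally direct summands of ranks $d$ and $d+1$. Let $\mathrm{OGr}^{+}(d,d+1)$, respectively $\mathrm{OGr}^{-}(d,d+1)$, be its connected component containing $(\langle e_1,\dots,e_d\rangle,\langle e_1,\dots,e_{d+1}\rangle)$, respectively $(\langle e_1,\dots,e_d\rangle,\langle e_1,\dots,e_d,f_{d+1}\rangle)$. Fix a sign $\varepsilon$ and let $Y_V$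 be the $\mathbb F_{p^2}$-scheme whose $S$-points are the pairs $(\mathcal L_d,\mathcal L_{d+1})\in\mathrm{OGr}^{\varepsilon}(d,d+1)(S)$ such that $\mathcal L_d\subset\mathrm{Frob}^*\mathcal L_{d+1}$ and $\mathcal L_{d+1}+\mathrm{Frob}^*\mathcal L_{d+1}$ is a locally direct summand of $V\otimes\mathcal O_S$, where $\mathrm{Frob}$ is the absolute $p$-power Frobenius of $S$. Write $(\mathcal U_d,\mathcal U_{d+1})$ for the universal pair on $Y_V$ and $\mathcal L_{Y_V}=\mathcal U_{d+1}/\mathcal U_d$. Let $W\subset V$ be a totally isotropic subspace. Give $W^\perp/W$ the induced form, fix for $(W^\perp/W)\otimes\mathbb F_{p^2}$ a basis of the same kind as above, and define $Y_{W^\perp/W}$ and $\mathcal L_{Y_{W^\perp/W}}$ in the same way, with the same sign $\varepsilon$. Then the schemes $\mathrm{OGr}(d,d+1)$, $Y_V$ and $Y_{W^\perp/W}$ exist (the functors are representable). Assume moreover that the bases are compatible, i.e. that the inverse image in $V\otimes\mathbb F_{p^2}$ of the standard pair of sign $\varepsilon$ for $W^\perp/W$ lies in $\mathrm{OGr}^\varepsilon(d,d+1)$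 for $V$. Then there is a unique morphism of $\mathbb F_{p^2}$-schemes $$j_{W,V}\colon Y_{W^\perp/W}\to Y_V$$ that on $S$-points sends a pair to its inverse image under $W^\perp\otimes\mathcal O_S\to(W^\perp/W)\otimes\mathcal O_S$. It is a closed immersion, its conormal sheaf $I/I^2$ is locally free of rank $\dim W$, and its normal bundle $N_{j_{W,V}}=\underline{\mathrm{Hom}}(I/I^2,\mathcal O_{Y_{W^\perp/W}})$ satisfies $$N_{j_{W,V}}\simeq\underline{\mathrm{Hom}}\bigl(\mathcal L_{Y_{W^\perp/W}},\,(V/W^\perp)\otimes\mathcal O_{Y_{W^\perp/W}}\bigr).$$ -/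

import Mathlib

open CategoryTheory AlgebraicGeometry TopologicalSpace Opposite
open scoped TensorProduct

/-!
Orthogonal Deligne-Lusztig varieties `Y_V` as fine moduli schemes over `𝔽_{p²}`, the morphisms
`Y_{W^⊥/W} ⟶ Y_V`, and the normal bundle of a closed immersion.
-/
namespace OrthDL
noncomputable section

/-! ### The sheaf of homomorphisms between two sheaves of modules -/

/-- Sections over `U` of the sheaf `Hom(F, G)`: the `𝒪_U`-linear maps `F|_U ⟶ G|_U`, i.e. families
of `Γ(X, W)`-linear maps `Γ(F, W) → Γ(G, W)`, for `W ≤ U` open, compatible with restriction. -/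
def HomSections {X : Scheme.{0}} (F G : X.Modules) (U : X.Opens) :
    AddSubgroup (∀ W : {W : X.Opens // W ≤ U}, Γ(F, W.1) →ₗ[Γ(X, W.1)] Γ(G, W.1)) where
  carrier := {φ | ∀ (W W' : {W : X.Opens // W ≤ U}) (h : W'.1 ≤ W.1) (x : Γ(F, W.1)),
    φ W' (F.presheaf.map (homOfLE h).op x) = G.presheaf.map (homOfLE h).op (φ W x)}
  zero_mem' := by intro W W' h x; simp
  add_mem' := by intro a b ha hb W W' h x; simp [ha W W' h x, hb W W' h x]
  neg_mem' := by intro a ha W W' h x; simp [ha W W' h x]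

/-- Scalars act on homomorphisms through their restrictions to smaller open subsets. -/
instance {X : Scheme.{0}} (F G : X.Modules) (U : X.Opens) :
    Module Γ(X, U) (HomSections F G U) where
  smul r φ := ⟨fun W => X.presheaf.map (homOfLE W.2).op r • φ.1 W, by
    intro W W' h x
    have := φ.2 W W' h x
    simp only [LinearMap.smul_apply, this]
    rw [Scheme.Modules.map_smul]
    congr 1
    rw [← CommRingCat.comp_apply, ← Functor.map_comp]; rfl⟩
  one_smul φ := by
    ext W x
    change (X.presheaf.map (homOfLE W.2).op (1 : Γ(X,U)) • φ.1 W) x = φ.1 W x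
    simp
  mul_smul r s φ := by
    ext W x
    change (X.presheaf.map (homOfLE W.2).op (r * s) • φ.1 W) x =
      (X.presheaf.map (homOfLE W.2).op r • X.presheaf.map (homOfLE W.2).op s • φ.1 W) x
    simp [mul_smul]
  smul_zero r := by
    ext W x
    change (X.presheaf.map (homOfLE W.2).op r • (0 : Γ(F, W.1) →ₗ[Γ(X, W.1)] Γ(G, W.1))) x = 0
    simp
  smul_add r φ ψ := by
    ext W x
    change (X.presheaf.map (homOfLE W.2).op r • (φ.1 W + ψ.1 W)) x =
      (X.presheaf.map (homOfLE W.2).op r • φ.1 W + X.presheaf.map (homOfLE W.2).op r • ψ.1 W) x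
    simp
  add_smul r s φ := by
    ext W x
    change (X.presheaf.map (homOfLE W.2).op (r + s) • φ.1 W) x =
      (X.presheaf.map (homOfLE W.2).op r • φ.1 W + X.presheaf.map (homOfLE W.2).op s • φ.1 W) x
    simp [add_smul]
  zero_smul φ := by
    ext W x
    change (X.presheaf.map (homOfLE W.2).op (0 : Γ(X,U)) • φ.1 W) x = 0
    simp

/-- Restriction of homomorphisms to a smaller open subset. -/
def homRestrict {X : Scheme.{0}} (F G : X.Modules) {U U' : X.Opens} (h : U' ≤ U) :
    HomSections F G U →+ HomSections F G U' where
  toFun φ := ⟨fun W => φ.1 ⟨W.1, W.2.trans h⟩, fun W W' hW x => φ.2 ⟨W.1, _⟩ ⟨W'.1, _⟩ hW x⟩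
  map_zero' := rfl
  map_add' _ _ := rfl

/-- The presheaf of abelian groups underlying `Hom(F, G)`. -/
def homPresheaf {X : Scheme.{0}} (F G : X.Modules) : X.Opensᵒᵖ ⥤ Ab.{0} where
  obj U := AddCommGrpCat.of (HomSections F G U.unop)
  map f := AddCommGrpCat.ofHom (homRestrict F G (leOfHom f.unop))

instance {X : Scheme.{0}} (F G : X.Modules) (U : X.Opensᵒᵖ) :
    Module (X.ringCatSheaf.obj.obj U) ((homPresheaf F G).obj U) :=
  inferInstanceAs (Module Γ(X, U.unop) (HomSections F G U.unop))

/-- `Hom(F, G)` as a presheaf of modules. -/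
def homModule {X : Scheme.{0}} (F G : X.Modules) : X.PresheafOfModules :=
  PresheafOfModules.ofPresheaf (homPresheaf F G) (by
    intro U U' f r m
    apply Subtype.ext
    funext W
    change X.presheaf.map (homOfLE _).op r • m.1 ⟨W.1, _⟩ =
      X.presheaf.map (homOfLE _).op (X.presheaf.map f r) • m.1 ⟨W.1, _⟩
    have e : X.presheaf.map (homOfLE (W.2.trans (leOfHom f.unop))).op =
        X.presheaf.map f ≫ X.presheaf.map (homOfLE W.2).op := by
      rw [← Functor.map_comp]; rfl
    exact congrArg (fun t : Γ(X, W.1) => t • m.1 ⟨W.1, W.2.trans (leOfHom f.unop)⟩)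
      (ConcreteCategory.congr_hom e r))

theorem homPresheaf_isSheaf {X : Scheme.{0}} (F G : X.Modules) :
    TopCat.Presheaf.IsSheaf (X := X) (homPresheaf F G) := by
  rw [TopCat.Presheaf.isSheaf_iff_isSheafUniqueGluing]
  intro ι U sf hsf
  let s : ∀ i, HomSections F G (U i) := sf
  have hs : ∀ (i j : ι) (W : X.Opens) (hi : W ≤ U i) (hj : W ≤ U j),
      (s i).1 ⟨W, hi⟩ = (s j).1 ⟨W, hj⟩ := by
    intro i j W hi hj
    exact congrFun (congrArg Subtype.val (hsf i j)) ⟨W, le_inf hi hj⟩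
  let GS : TopCat.Sheaf Ab.{0} X := ⟨G.presheaf, G.isSheaf⟩
  have FF : ∀ {A B C : X.Opens} (h : B ≤ A) (h' : C ≤ B) (x : Γ(F, A)),
      F.presheaf.map (homOfLE h').op (F.presheaf.map (homOfLE h).op x) =
        F.presheaf.map (homOfLE (h'.trans h)).op x := by
    intro A B C h h' x
    rw [← ConcreteCategory.comp_apply, ← Functor.map_comp]; rfl
  have GG : ∀ {A B C : X.Opens} (h : B ≤ A) (h' : C ≤ B) (x : Γ(G, A)),
      G.presheaf.map (homOfLE h').op (G.presheaf.map (homOfLE h).op x) =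
        G.presheaf.map (homOfLE (h'.trans h)).op x := by
    intro A B C h h' x
    rw [← ConcreteCategory.comp_apply, ← Functor.map_comp]; rfl
  have cov : ∀ W : X.Opens, W ≤ iSup U → W ≤ ⨆ i, W ⊓ U i := by
    intro W hW
    rw [← inf_iSup_eq]; exact le_inf le_rfl hW
  have sep : ∀ (W : X.Opens), W ≤ iSup U → ∀ y z : Γ(G, W),
      (∀ i, G.presheaf.map (homOfLE (inf_le_left : W ⊓ U i ≤ W)).op y =
        G.presheaf.map (homOfLE (inf_le_left : W ⊓ U i ≤ W)).op z) → y = z := by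
    intro W hW y z h
    exact GS.eq_of_locally_eq' (fun i => W ⊓ U i) W (fun i => homOfLE inf_le_left) (cov W hW) y z h
  have glue : ∀ (W : X.Opens) (hW : W ≤ iSup U) (x : Γ(F, W)), ∃ y : Γ(G, W), ∀ i,
      G.presheaf.map (homOfLE (inf_le_left : W ⊓ U i ≤ W)).op y =
        (s i).1 ⟨W ⊓ U i, inf_le_right⟩ (F.presheaf.map (homOfLE inf_le_left).op x) := by
    intro W hW x
    obtain ⟨y, hy, -⟩ := GS.existsUnique_gluing' (fun i => W ⊓ U i) W (fun i => homOfLE inf_le_left)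
      (cov W hW) (fun i => (s i).1 ⟨W ⊓ U i, inf_le_right⟩
        (F.presheaf.map (homOfLE inf_le_left).op x)) (by
        intro i j
        have h1 := (s i).2 ⟨W ⊓ U i, inf_le_right⟩
          ⟨(W ⊓ U i) ⊓ (W ⊓ U j), inf_le_left.trans inf_le_right⟩ inf_le_left
          (F.presheaf.map (homOfLE inf_le_left).op x)
        have h2 := (s j).2 ⟨W ⊓ U j, inf_le_right⟩
          ⟨(W ⊓ U i) ⊓ (W ⊓ U j), inf_le_right.trans inf_le_right⟩ inf_le_right
          (F.presheaf.map (homOfLE inf_le_left).op x)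
        refine h1.symm.trans (Eq.trans ?_ h2)
        rw [FF, FF]
        exact congrFun (congrArg DFunLike.coe (hs i j _ _ _)) _)
    exact ⟨y, hy⟩
  choose g hg using glue
  refine ⟨(⟨fun W => ⟨⟨g W.1 W.2, ?_⟩, ?_⟩, ?_⟩ : HomSections F G (iSup U)), ?_, ?_⟩
  · intro x y
    refine sep _ W.2 _ _ fun i => ?_
    rw [map_add, hg, hg, hg, map_add, map_add]
  · intro r x
    refine sep _ W.2 _ _ fun i => ?_
    simp only [RingHom.id_apply]
    rw [Scheme.Modules.map_smul, hg, hg, Scheme.Modules.map_smul, map_smul]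
  · intro W W' h x
    refine sep _ W'.2 _ _ fun i => ?_
    change G.presheaf.map _ (g W'.1 W'.2 _) = G.presheaf.map _ (G.presheaf.map _ (g W.1 W.2 x))
    rw [hg, GG, FF]
    have := GG (inf_le_left : W.1 ⊓ U i ≤ W.1) (inf_le_inf_right (U i) h) (g W.1 W.2 x)
    rw [← this, hg, ← (s i).2 ⟨W.1 ⊓ U i, inf_le_right⟩ ⟨W'.1 ⊓ U i, inf_le_right⟩
      (inf_le_inf_right (U i) h), FF]
  · intro i
    apply Subtype.ext
    funext W
    ext x
    change g W.1 (W.2.trans (le_iSup U i)) x = (s i).1 W x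
    refine sep _ (W.2.trans (le_iSup U i)) _ _ fun j => ?_
    rw [hg, ← (s i).2 W ⟨W.1 ⊓ U j, inf_le_left.trans W.2⟩ inf_le_left]
    exact congrFun (congrArg DFunLike.coe (hs j i _ _ _)) _
  · intro t ht
    let t' : HomSections F G (iSup U) := t
    apply Subtype.ext
    funext W
    ext x
    change t'.1 W x = g W.1 W.2 x
    refine sep _ W.2 _ _ fun j => ?_
    rw [hg, ← t'.2 W ⟨W.1 ⊓ U j, inf_le_left.trans W.2⟩ inf_le_left]
    have := congrFun (congrArg Subtype.val (ht j)) ⟨W.1 ⊓ U j, inf_le_right⟩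
    exact congrFun (congrArg DFunLike.coe this) _

/-- The sheaf of modules `Hom(F, G)`. -/
def sheafHom {X : Scheme.{0}} (F G : X.Modules) : X.Modules where
  val := homModule F G
  isSheaf := homPresheaf_isSheaf F G

/-! ### The normal bundle of a closed immersion -/

/-- The structure sheaf as a sheaf of modules over itself. -/
abbrev structureSheaf (X : Scheme.{0}) : X.Modules := SheafOfModules.unit X.ringCatSheaf

/-- The comorphism `𝒪_Y ⟶ j_* 𝒪_Z` of `j : Z ⟶ Y`, as a morphism of `𝒪_Y`-modules. -/
def comorphism {Z Y : Scheme.{0}} (j : Z ⟶ Y) :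
    structureSheaf Y ⟶ (Scheme.Modules.pushforward j).obj (structureSheaf Z) :=
  SheafOfModules.unitToPushforwardObjUnit j.toRingCatSheafHom

/-- The conormal sheaf `j^* I`, where `I` is the kernel of `𝒪_Y ⟶ j_* 𝒪_Z`. If `j` is a closed
immersion, then `I` is its ideal sheaf and `j^* I = I / I²`. -/
def conormalSheaf {Z Y : Scheme.{0}} (j : Z ⟶ Y) : Z.Modules :=
  (Scheme.Modules.pullback j).obj (Limits.kernel (comorphism j))

/-- The normal bundle `Hom(I / I², 𝒪_Z)` of a closed immersion `j : Z ⟶ Y`. -/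
def normalBundle {Z Y : Scheme.{0}} (j : Z ⟶ Y) : Z.Modules :=
  sheafHom (conormalSheaf j) (structureSheaf Z)

/-- A sheaf of modules that is locally isomorphic to `𝒪_X^r`. -/
def IsLocallyFreeOfRank {X : Scheme.{0}} (F : X.Modules) (r : ℕ) : Prop :=
  ∀ x : X, ∃ U : X.Opens, x ∈ U ∧
    Nonempty (F.restrict U.ι ≅ SheafOfModules.free (R := (U : Scheme.{0}).ringCatSheaf) (Fin r))

/-! ### Constant bundles on schemes over `𝔽_{p²}` and their subsheaves -/

/-- Schemes over `𝔽_{p²}`. -/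
abbrev Sch (p : ℕ) [Fact p.Prime] := Over (Spec (CommRingCat.of (GaloisField p 2)))

variable {p : ℕ} [Fact p.Prime]

/-- The terminal object `Spec 𝔽_{p²}`. -/
abbrev basePoint (p : ℕ) [Fact p.Prime] : Sch p :=
  Over.mk (𝟙 (Spec (CommRingCat.of (GaloisField p 2))))

/-- The structure map `𝔽_{p²} → Γ(X, U)`. -/
def structMap (X : Sch p) (U : X.left.Opens) : GaloisField p 2 →+* Γ(X.left, U) :=
  (Scheme.Hom.appLE (Y := Spec (CommRingCat.of (GaloisField p 2))) X.hom ⊤ U le_top).hom.comp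
    (Scheme.ΓSpecIso (CommRingCat.of (GaloisField p 2))).inv.hom

instance (X : Sch p) (U : X.left.Opens) : Algebra (ZMod p) Γ(X.left, U) :=
  ((structMap X U).comp (algebraMap (ZMod p) (GaloisField p 2))).toAlgebra

/-- The map `φ ⊗ id : R ⊗ M → R' ⊗ M` for a ring homomorphism `φ` between `𝔽_p`-algebras. -/
def changeScalars {R R' : Type} [CommRing R] [CommRing R'] [Algebra (ZMod p) R]
    [Algebra (ZMod p) R'] (φ : R →+* R') (M : Type) [AddCommGroup M] [Module (ZMod p) M] :
    R ⊗[ZMod p] M →ₗ[ZMod p] R' ⊗[ZMod p] M :=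
  LinearMap.rTensor M (φ.toAddMonoidHom.toZModLinearMap p)

theorem changeScalars_smul {R R' : Type} [CommRing R] [CommRing R'] [Algebra (ZMod p) R]
    [Algebra (ZMod p) R'] (φ : R →+* R') (M : Type) [AddCommGroup M] [Module (ZMod p) M]
    (r : R) (x : R ⊗[ZMod p] M) :
    changeScalars φ M (r • x) = φ r • changeScalars φ M x := by
  induction x with
  | zero => simp
  | tmul a m => simp [changeScalars, TensorProduct.smul_tmul']
  | add x y hx hy => simp only [smul_add, map_add, hx, hy]

theorem changeScalars_id {R : Type} [CommRing R] [Algebra (ZMod p) R] (φ : R →+* R)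
    (h : ∀ r, φ r = r) (M : Type) [AddCommGroup M] [Module (ZMod p) M] (x : R ⊗[ZMod p] M) :
    changeScalars φ M x = x := by
  induction x with
  | zero => simp
  | tmul a m => simp [changeScalars, h]
  | add x y hx hy => rw [map_add, hx, hy]

theorem changeScalars_comp {R R' R'' : Type} [CommRing R] [CommRing R'] [CommRing R'']
    [Algebra (ZMod p) R] [Algebra (ZMod p) R'] [Algebra (ZMod p) R''] (φ : R →+* R')
    (ψ : R' →+* R'') (χ : R →+* R'') (h : ∀ r, ψ (φ r) = χ r)
    (M : Type) [AddCommGroup M] [Module (ZMod p) M] (x : R ⊗[ZMod p] M) :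
    changeScalars ψ M (changeScalars φ M x) = changeScalars χ M x := by
  induction x with
  | zero => simp
  | tmul a m => simp [changeScalars, h]
  | add x y hx hy => simp only [map_add, hx, hy]

theorem changeScalars_baseChange {R R' : Type} [CommRing R] [CommRing R'] [Algebra (ZMod p) R]
    [Algebra (ZMod p) R'] (φ : R →+* R') {M N : Type} [AddCommGroup M] [Module (ZMod p) M]
    [AddCommGroup N] [Module (ZMod p) N] (f : M →ₗ[ZMod p] N) (x : R ⊗[ZMod p] M) :
    changeScalars φ N (f.baseChange R x) = f.baseChange R' (changeScalars φ M x) := by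
  induction x with
  | zero => simp
  | tmul a m => simp [changeScalars]
  | add x y hx hy => simp only [map_add, hx, hy]

/-- The `p`-power Frobenius `r ↦ r ^ p` of an `𝔽_p`-algebra. -/
def frob (R : Type) [CommRing R] [Algebra (ZMod p) R] : R →+* R where
  toFun r := r ^ p
  map_one' := one_pow p
  map_mul' a b := mul_pow a b p
  map_zero' := zero_pow (Fact.out : p.Prime).ne_zero
  map_add' a b := by
    cases subsingleton_or_nontrivial R with
    | inl h => exact Subsingleton.elim _ _
    | inr h =>
      have : CharP R p := charP_of_injective_algebraMap (algebraMap (ZMod p) R).injective p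
      exact add_pow_char a b p

section ConstantBundle

variable (M : Type) [AddCommGroup M] [Module (ZMod p) M]

/-- Restriction of sections of `𝒪_X ⊗ M`. -/
abbrev res (X : Sch p) {U U' : X.left.Opens} (h : U' ≤ U) :
    Γ(X.left, U) ⊗[ZMod p] M →ₗ[ZMod p] Γ(X.left, U') ⊗[ZMod p] M :=
  changeScalars (X.left.presheaf.map (homOfLE h).op).hom M

/-- The presheaf of abelian groups `U ↦ Γ(X, U) ⊗ M`. -/
def constPresheaf (X : Sch p) : X.left.Opensᵒᵖ ⥤ Ab.{0} where
  obj U := AddCommGrpCat.of (Γ(X.left, U.unop) ⊗[ZMod p] M)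
  map f := AddCommGrpCat.ofHom (res M X (leOfHom f.unop)).toAddMonoidHom
  map_id U := by
    ext x
    refine changeScalars_id _ ?_ M x
    intro r
    exact ConcreteCategory.congr_hom (X.left.presheaf.map_id U) r
  map_comp f g := by
    ext x
    refine (changeScalars_comp _ _ _ ?_ M x).symm
    intro r
    have e : X.left.presheaf.map (homOfLE (leOfHom (f ≫ g).unop)).op =
      X.left.presheaf.map (homOfLE (leOfHom f.unop)).op ≫
        X.left.presheaf.map (homOfLE (leOfHom g.unop)).op := by
      rw [← Functor.map_comp]; rfl
    exact (ConcreteCategory.congr_hom e r).symm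

instance (X : Sch p) (U : X.left.Opensᵒᵖ) :
    Module (X.left.ringCatSheaf.obj.obj U) ((constPresheaf M X).obj U) :=
  inferInstanceAs (Module Γ(X.left, U.unop) (Γ(X.left, U.unop) ⊗[ZMod p] M))

/-- The presheaf of modules `U ↦ Γ(X, U) ⊗ M`. For finite-dimensional `M` it is a sheaf. -/
def constModule (X : Sch p) : X.left.PresheafOfModules :=
  PresheafOfModules.ofPresheaf (constPresheaf M X) (fun U U' f r m =>
    changeScalars_smul (R := Γ(X.left, U.unop)) (R' := Γ(X.left, U'.unop))
      (X.left.presheaf.map (homOfLE (leOfHom f.unop)).op).hom M r m)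

/-- The sheafification functor. -/
abbrev sheafify (X : Scheme.{0}) : X.PresheafOfModules ⥤ X.Modules :=
  PresheafOfModules.sheafification (𝟙 X.ringCatSheaf.obj)

/-- The sheaf of modules `M ⊗ 𝒪_X`. -/
def constSheaf (X : Sch p) : X.left.Modules := (sheafify X.left).obj (constModule M X)

/-- Families of submodules `L(U) ⊆ Γ(X, U) ⊗ M`, for `U` open in `X`, stable under restriction. -/
abbrev SubModule (X : Sch p) := (constModule M X).Submodule

variable {M}

/-- The submodule `L(U)` of `Γ(X, U) ⊗ M`. -/
def sec {X : Sch p} (L : SubModule M X) (U : X.left.Opens) :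
    Submodule Γ(X.left, U) (Γ(X.left, U) ⊗[ZMod p] M) := L.obj (op U)

theorem res_mem {X : Sch p} (L : SubModule M X) {U U' : X.left.Opens} (h : U' ≤ U)
    {x : Γ(X.left, U) ⊗[ZMod p] M} (hx : x ∈ sec L U) : res M X h x ∈ sec L U' :=
  L.map (homOfLE h).op hx

theorem res_res (X : Sch p) {U U' U'' : X.left.Opens} (h : U' ≤ U) (h' : U'' ≤ U')
    (x : Γ(X.left, U) ⊗[ZMod p] M) :
    res M X h' (res M X h x) = res M X (h'.trans h) x := by
  refine changeScalars_comp _ _ _ ?_ M x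
  intro r
  have e : X.left.presheaf.map (homOfLE (h'.trans h)).op =
      X.left.presheaf.map (homOfLE h).op ≫ X.left.presheaf.map (homOfLE h').op := by
    rw [← Functor.map_comp]; rfl
  exact (ConcreteCategory.congr_hom e r).symm

/-- Constructor for `SubModule`. -/
def mkSub (X : Sch p) (N : ∀ U : X.left.Opens, Submodule Γ(X.left, U) (Γ(X.left, U) ⊗[ZMod p] M))
    (hN : ∀ (U U' : X.left.Opens) (h : U' ≤ U), ∀ x ∈ N U, res M X h x ∈ N U') :
    SubModule M X where
  obj U := N U.unop
  map f := fun x hx => hN _ _ (leOfHom f.unop) x hx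

/-- The submodule of `Γ(X, W) ⊗ M` spanned by the restrictions to `W` of the sections in `S`. -/
def spanOn {X : Sch p} (S : ∀ U : X.left.Opens, Set (Γ(X.left, U) ⊗[ZMod p] M))
    (W : X.left.Opens) : Submodule Γ(X.left, W) (Γ(X.left, W) ⊗[ZMod p] M) :=
  Submodule.span _ {z | ∃ (U : X.left.Opens) (h : W ≤ U), ∃ y ∈ S U, res M X h y = z}

theorem res_mem_spanOn {X : Sch p} (S : ∀ U : X.left.Opens, Set (Γ(X.left, U) ⊗[ZMod p] M))
    {W W' : X.left.Opens} (h : W' ≤ W) (x : Γ(X.left, W) ⊗[ZMod p] M) (hx : x ∈ spanOn S W) :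
    res M X h x ∈ spanOn S W' := by
  refine Submodule.span_induction (p := fun x _ => res M X h x ∈ spanOn S W') ?_ ?_ ?_ ?_ hx
  · rintro z ⟨U, hU, y, hy, rfl⟩
    refine Submodule.subset_span ⟨U, h.trans hU, y, hy, ?_⟩
    rw [res_res]
  · rw [map_zero]; exact Submodule.zero_mem _
  · intro a b _ _ ha hb
    rw [map_add]; exact Submodule.add_mem _ ha hb
  · intro r a _ ha
    rw [res, changeScalars_smul]; exact Submodule.smul_mem _ _ ha

/-- The subsheaf of `𝒪_X`-modules of `M ⊗ 𝒪_X` generated by a family `S` of local sections. -/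
def generated {X : Sch p} (S : ∀ U : X.left.Opens, Set (Γ(X.left, U) ⊗[ZMod p] M)) :
    SubModule M X :=
  mkSub X (fun U =>
    { carrier := {x | ∀ s ∈ U, ∃ (W : X.left.Opens) (h : W ≤ U), s ∈ W ∧
        res M X h x ∈ spanOn S W}
      zero_mem' := fun s hs => ⟨U, le_rfl, hs, by rw [map_zero]; exact Submodule.zero_mem _⟩
      add_mem' := by
        intro a b ha hb s hs
        obtain ⟨W, hW, hsW, h1⟩ := ha s hs
        obtain ⟨W', hW', hsW', h2⟩ := hb s hs
        refine ⟨W ⊓ W', inf_le_left.trans hW, ⟨hsW, hsW'⟩, ?_⟩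
        rw [map_add]
        refine Submodule.add_mem _ ?_ ?_
        · have := res_mem_spanOn S (inf_le_left : W ⊓ W' ≤ W) _ h1
          rwa [res_res] at this
        · have := res_mem_spanOn S (inf_le_right : W ⊓ W' ≤ W') _ h2
          rwa [res_res] at this
      smul_mem' := by
        intro r a ha s hs
        obtain ⟨W, hW, hsW, h1⟩ := ha s hs
        refine ⟨W, hW, hsW, ?_⟩
        rw [res, changeScalars_smul]
        exact Submodule.smul_mem _ _ h1 })
    (by
      intro U U' h x hx s hs
      obtain ⟨W, hW, hsW, h1⟩ := hx s (h hs)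
      refine ⟨W ⊓ U', inf_le_right, ⟨hsW, hs⟩, ?_⟩
      have := res_mem_spanOn S (inf_le_left : W ⊓ U' ≤ W) _ h1
      rw [res_res] at this
      rwa [res_res])

theorem generated_mono {X : Sch p} {S S' : ∀ U : X.left.Opens, Set (Γ(X.left, U) ⊗[ZMod p] M)}
    (h : ∀ U, S U ⊆ S' U) : generated S ≤ generated S' := by
  intro U x hx s hs
  obtain ⟨W, hW, hsW, h1⟩ := hx s hs
  refine ⟨W, hW, hsW, Submodule.span_mono ?_ h1⟩
  rintro z ⟨U, hU, y, hy, rfl⟩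
  exact ⟨U, hU, y, h U hy, rfl⟩

/-- The sheaf condition: a section of `M ⊗ 𝒪_X` that lies locally in `L` lies in `L`. -/
def IsSubsheaf {X : Sch p} (L : SubModule M X) : Prop :=
  ∀ (U : X.left.Opens) (x : Γ(X.left, U) ⊗[ZMod p] M),
    (∀ s ∈ U, ∃ (W : X.left.Opens) (h : W ≤ U), s ∈ W ∧ res M X h x ∈ sec L W) → x ∈ sec L U

/-- Near `s`, the sheaf `M ⊗ 𝒪_X` has a basis whose first `r` members form a basis of `L`. -/
def IsSummandAt {X : Sch p} (L : SubModule M X) (s : X.left) (r : ℕ) : Prop :=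
  ∃ U : X.left.Opens, s ∈ U ∧ ∃ (m : ℕ)
    (b : Module.Basis (Fin r ⊕ Fin m) Γ(X.left, U) (Γ(X.left, U) ⊗[ZMod p] M)),
    ∀ (W : X.left.Opens) (h : W ≤ U),
      sec L W = Submodule.span _ (Set.range fun i : Fin r => res M X h (b (Sum.inl i)))

/-- `L` is a locally direct summand of `M ⊗ 𝒪_X`. -/
def IsLocallySummand {X : Sch p} (L : SubModule M X) : Prop :=
  IsSubsheaf L ∧ ∀ s : X.left, ∃ r : ℕ, IsSummandAt L s r

/-- `L ∈ Gr(r, M)(X)`: `L` is a locally direct summand of `M ⊗ 𝒪_X` of rank `r`. -/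
def IsSubbundle {X : Sch p} (L : SubModule M X) (r : ℕ) : Prop :=
  IsSubsheaf L ∧ ∀ s : X.left, IsSummandAt L s r

/-- The pull-back of `L` along `f : T ⟶ X`: the image of `f^* L` in `M ⊗ 𝒪_T`. -/
def pullbackSub {X T : Sch p} (f : T ⟶ X) (L : SubModule M X) : SubModule M T :=
  generated fun W => {z | ∃ (U : X.left.Opens) (h : W ≤ f.left ⁻¹ᵁ U), ∃ x ∈ sec L U,
    changeScalars (f.left.appLE U W h).hom M x = z}

/-- The pull-back of `L` along the absolute `p`-power Frobenius of `X`, which is the identity on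
the space and `r ↦ r ^ p` on functions, so that it pulls `M ⊗ 𝒪_X` back to itself. -/
def frobPullback {X : Sch p} (L : SubModule M X) : SubModule M X :=
  generated fun W => {z | ∃ x ∈ sec L W, changeScalars (p := p) (frob (p := p) Γ(X.left, W)) M x = z}

/-- The sum of two subsheaves. -/
def sheafSum {X : Sch p} (L L' : SubModule M X) : SubModule M X :=
  generated fun W => (sec L W : Set (Γ(X.left, W) ⊗[ZMod p] M)) ∪ sec L' W

/-- The subsheaf of `M ⊗ 𝒪_X` generated by a set of vectors of `𝔽_{p²} ⊗ M`. -/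
def constantSub (X : Sch p) (E : Set (GaloisField p 2 ⊗[ZMod p] M)) : SubModule M X :=
  generated fun W => changeScalars (structMap X W) M '' E

/-- A pair `L_d ⊆ L_{d+1}` of submodules of `M ⊗ 𝒪_X`. -/
@[ext]
structure Flag (M : Type) [AddCommGroup M] [Module (ZMod p) M] (X : Sch p) where
  /-- `L_d` -/
  small : SubModule M X
  /-- `L_{d+1}` -/
  big : SubModule M X
  le : small ≤ big

/-- The pull-back of a pair along `f : T ⟶ X`. -/
def Flag.pullback {X T : Sch p} (f : T ⟶ X) (F : Flag M X) : Flag M T where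
  small := pullbackSub f F.small
  big := pullbackSub f F.big
  le := generated_mono (by
    rintro W z ⟨U, h, x, hx, rfl⟩
    exact ⟨U, h, x, F.le _ hx, rfl⟩)

/-- The quotient sheaf `L_{d+1} / L_d`. -/
def Flag.quotient {X : Sch p} (F : Flag M X) : X.left.Modules :=
  Limits.cokernel ((sheafify X.left).map (PresheafOfModules.Submodule.homOfLE F.le))

/-- A moduli problem `P`, given by the condition that defines the admissible pairs on each scheme
over `𝔽_{p²}`, is represented by `Y` with universal pair `u`. -/
def Represents (P : ∀ X : Sch p, Flag M X → Prop) (Y : Sch p) (u : Flag M Y) : Prop :=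
  P Y u ∧ (∀ (T : Sch p) (f : T ⟶ Y), P T (u.pullback f)) ∧
    ∀ (T : Sch p) (F : Flag M T), P T F → ∃! f : T ⟶ Y, u.pullback f = F

/-- A moduli problem is representable. -/
def IsRepresentable (P : ∀ X : Sch p, Flag M X → Prop) : Prop :=
  ∃ (Y : Sch p) (u : Flag M Y), Represents P Y u

end ConstantBundle

/-! ### The varieties `Y_V` -/

section Varieties

variable {V : Type} [AddCommGroup V] [Module (ZMod p) V]

/-- `L` is totally isotropic. -/
def IsIsotropicSub (B : LinearMap.BilinForm (ZMod p) V) {X : Sch p} (L : SubModule V X) : Prop :=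
  ∀ U : X.left.Opens, ∀ x ∈ sec L U, ∀ y ∈ sec L U, B.baseChange Γ(X.left, U) x y = 0

/-- The functor `OGr(d, d + 1)`. -/
def IsOGr (B : LinearMap.BilinForm (ZMod p) V) (d : ℕ) (X : Sch p) (F : Flag V X) : Prop :=
  IsSubbundle F.small d ∧ IsSubbundle F.big (d + 1) ∧
    IsIsotropicSub B F.small ∧ IsIsotropicSub B F.big

/-- The functor `𝒴_V`: those members of `OGr(d, d + 1)` with `L_d ⊆ Frob^* L_{d+1}` such that
`L_{d+1} + Frob^* L_{d+1}` is a locally direct summand of `V ⊗ 𝒪_X`. -/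
def IsScriptY (B : LinearMap.BilinForm (ZMod p) V) (d : ℕ) (X : Sch p) (F : Flag V X) : Prop :=
  IsOGr B d X F ∧ F.small ≤ frobPullback F.big ∧
    IsLocallySummand (sheafSum F.big (frobPullback F.big))

/-- A basis `e_1, …, e_{d+1}, f_1, …, f_{d+1}` of `𝔽_{p²} ⊗ V` that is hyperbolic, with
`e_1, …, e_d, f_1, …, f_d` in `V`, and such that the Frobenius switches `e_{d+1}` and `f_{d+1}`. -/
structure StandardBasis (B : LinearMap.BilinForm (ZMod p) V) (d : ℕ) where
  /-- the basis, `e` on the left and `f` on the right -/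
  basis : Module.Basis (Fin (d + 1) ⊕ Fin (d + 1)) (GaloisField p 2) (GaloisField p 2 ⊗[ZMod p] V)
  pair_e_f : ∀ i j, B.baseChange (GaloisField p 2) (basis (Sum.inl i)) (basis (Sum.inr j)) =
    if i = j then 1 else 0
  pair_e_e : ∀ i j, B.baseChange (GaloisField p 2) (basis (Sum.inl i)) (basis (Sum.inl j)) = 0
  pair_f_f : ∀ i j, B.baseChange (GaloisField p 2) (basis (Sum.inr i)) (basis (Sum.inr j)) = 0
  rational_e : ∀ i : Fin d, ∃ v : V, basis (Sum.inl i.castSucc) = 1 ⊗ₜ v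
  rational_f : ∀ i : Fin d, ∃ v : V, basis (Sum.inr i.castSucc) = 1 ⊗ₜ v
  frob_e : changeScalars (p := p) (frob (p := p) (GaloisField p 2)) V (basis (Sum.inl (Fin.last d))) =
    basis (Sum.inr (Fin.last d))
  frob_f : changeScalars (p := p) (frob (p := p) (GaloisField p 2)) V (basis (Sum.inr (Fin.last d))) =
    basis (Sum.inl (Fin.last d))

/-- The choice of one of the signs `+` and `-`. -/
inductive Sign
  | plus
  | minus

/-- The set `{e_1, …, e_d}`. -/
def StandardBasis.smallGen {B : LinearMap.BilinForm (ZMod p) V} {d : ℕ} (b : StandardBasis B d) :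
    Set (GaloisField p 2 ⊗[ZMod p] V) :=
  Set.range fun i : Fin d => b.basis (Sum.inl i.castSucc)

/-- The vector `e_{d+1}` for the sign `+` and `f_{d+1}` for the sign `-`. -/
def StandardBasis.lastVector {B : LinearMap.BilinForm (ZMod p) V} {d : ℕ} (b : StandardBasis B d) :
    Sign → GaloisField p 2 ⊗[ZMod p] V
  | .plus => b.basis (Sum.inl (Fin.last d))
  | .minus => b.basis (Sum.inr (Fin.last d))

/-- The pair `⟨e_1, …, e_d⟩ ⊆ ⟨e_1, …, e_d, e_{d+1}⟩` for the sign `+`, and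
`⟨e_1, …, e_d⟩ ⊆ ⟨e_1, …, e_d, f_{d+1}⟩` for the sign `-`, as a pair on `Spec 𝔽_{p²}`. -/
def StandardBasis.flag {B : LinearMap.BilinForm (ZMod p) V} {d : ℕ} (b : StandardBasis B d)
    (ε : Sign) : Flag V (basePoint p) where
  small := constantSub _ b.smallGen
  big := constantSub _ (insert (b.lastVector ε) b.smallGen)
  le := generated_mono fun _ => Set.image_mono (Set.subset_insert _ _)

/-- `F ∈ OGr(d, d + 1)(X)` lies in `OGr^ε(d, d + 1)(X)`: its classifying morphism maps `X` into
the connected component of `OGr(d, d + 1)` that contains the standard pair of sign `ε`. -/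
def InComponent {B : LinearMap.BilinForm (ZMod p) V} {d : ℕ} (b : StandardBasis B d) (ε : Sign)
    (X : Sch p) (F : Flag V X) : Prop :=
  ∃ (G : Sch p) (u : Flag V G), Represents (IsOGr B d) G u ∧
    ∃ (f : X ⟶ G) (f₀ : basePoint p ⟶ G), u.pullback f = F ∧ u.pullback f₀ = b.flag ε ∧
      ∀ (x : X.left) (x₀ : (basePoint p).left), f.left x ∈ connectedComponent (f₀.left x₀)

/-- The functor `Y_V = Y_V^ε`: the members of `𝒴_V` that lie in `OGr^ε(d, d + 1)`. -/
def IsY {B : LinearMap.BilinForm (ZMod p) V} {d : ℕ} (b : StandardBasis B d) (ε : Sign)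
    (X : Sch p) (F : Flag V X) : Prop :=
  IsScriptY B d X F ∧ InComponent b ε X F

/-- `B` is nonsplit: no totally isotropic subspace has half the dimension of `V`. -/
def IsNonsplit (B : LinearMap.BilinForm (ZMod p) V) : Prop :=
  ∀ W : Submodule (ZMod p) V, W ≤ B.orthogonal W →
    2 * Module.finrank (ZMod p) W ≠ Module.finrank (ZMod p) V

/-! ### Isotropic subspaces and the morphisms `j_{W,V}` -/

/-- The space `W^⊥ / W`. -/
abbrev OrthQuot (B : LinearMap.BilinForm (ZMod p) V) (W : Submodule (ZMod p) V) : Type :=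
  B.orthogonal W ⧸ W.submoduleOf (B.orthogonal W)

/-- The symmetric form on `W^⊥ / W` induced by a symmetric form `B`. -/
def inducedForm (B : LinearMap.BilinForm (ZMod p) V) (hB : B.IsSymm)
    (W : Submodule (ZMod p) V) : LinearMap.BilinForm (ZMod p) (OrthQuot B W) :=
  (B.restrict (B.orthogonal W)).liftQ₂ _ _
    (fun x hx => LinearMap.ext fun y => y.2 x.1 hx)
    (fun y hy => LinearMap.ext fun x => (hB.eq _ _).trans (x.2 y.1 hy))

/-- The inverse image of `L ⊆ (W^⊥ / W) ⊗ 𝒪_X` under `W^⊥ ⊗ 𝒪_X ⟶ (W^⊥ / W) ⊗ 𝒪_X`, as a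
submodule of `V ⊗ 𝒪_X`. -/
def inverseImage (B : LinearMap.BilinForm (ZMod p) V) (W : Submodule (ZMod p) V) {X : Sch p}
    (L : SubModule (OrthQuot B W) X) : SubModule V X :=
  mkSub X (fun U => ((sec L U).comap
      ((W.submoduleOf (B.orthogonal W)).mkQ.baseChange Γ(X.left, U))).map
        ((B.orthogonal W).subtype.baseChange Γ(X.left, U)))
    (by
      rintro U U' h _ ⟨x, hx, rfl⟩
      refine ⟨res _ X h x, ?_, (changeScalars_baseChange _ _ _).symm⟩
      have := res_mem L h hx
      rwa [res, changeScalars_baseChange] at this)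

/-- The inverse image of a pair of submodules of `(W^⊥ / W) ⊗ 𝒪_X`. -/
def Flag.inverseImage (B : LinearMap.BilinForm (ZMod p) V) (W : Submodule (ZMod p) V) {X : Sch p}
    (F : Flag (OrthQuot B W) X) : Flag V X where
  small := OrthDL.inverseImage B W F.small
  big := OrthDL.inverseImage B W F.big
  le := fun _ => Submodule.map_mono (Submodule.comap_mono (F.le _))

/-- `j : Y_{W^⊥/W} ⟶ Y_V` is the morphism `j_{W,V}`: on `T`-valued points it sends a pair of
submodules of `(W^⊥ / W) ⊗ 𝒪_T` to its inverse image in `V ⊗ 𝒪_T`. -/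
def IsSpecialCycleMap (B : LinearMap.BilinForm (ZMod p) V) (W : Submodule (ZMod p) V)
    {Y Y' : Sch p} (u : Flag V Y) (u' : Flag (OrthQuot B W) Y') (j : Y' ⟶ Y) : Prop :=
  ∀ (T : Sch p) (g : T ⟶ Y'), u.pullback (g ≫ j) = (u'.pullback g).inverseImage B W

end Varieties

end

end OrthDL

/-! A totally isotropic summand of half rank in `R ⊗ V` is its own orthogonal, over every
`𝔽_p`-algebra `R` (`IsNormalized.mem_span_of_form_eq_zero`). Hence `L_d ⊆ Frob^* L_{d+1}` means that
`L_d` is orthogonal to `Frob^* L_{d+1}`, which is a set of polynomial equations in the coordinates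
of a frame. Over a field, a Frobenius-stable `L_{d+1}` would come from a totally isotropic subspace
of `V` of dimension `d + 1`. As `V` is nonsplit, `L_{d+1}` and `Frob^* L_{d+1}` differ at every
point: locally some `B(l, Frob y)` with `l`, `y` in `L_{d+1}` is a unit, and `L_{d+1} + Frob^*
L_{d+1}` is automatically a summand of rank `d + 2` (`IsModuli.exists_transversal`,
`isScriptY_iff`). So both `OGr(d, d+1)` and `𝒴_V` are instances of one moduli problem `IsModuli`,
with the Frobenius equation switched off or on by the proposition `c`. Pairs with frames in reduced
echelon form for fixed pivots are represented by an affine scheme, and these charts glue. The result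
is locally Noetherian, so its connected components are open, and `Y_V` is an open and closed part of
`𝒴_V`.

A point of `Y_V` comes from `W^⊥/W` exactly when `W ⊆ L_d`, up to the choice of component. For this
it is enough that `W` is orthogonal to `L_{d+1}`: then `W ⊆ L_{d+1}` by maximality, and sections of
`L_{d+1}` fixed by Frobenius lie in `L_d` (`IsModuli.mem_small_of_mem_big`). The ideal `I` of
`Y_{W^⊥/W}` is therefore generated locally by the functions `B(w_i, y)`, for a basis `w_i` of `W`
and sections `y` of `L_{d+1}`, and `j_{W,V}` is a closed immersion (`IsCycle.isClosedImmersion`).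

The conormal sheaf is a sum of `dim W` copies of `Q = L_{d+1} / L_d`
(`IsCycle.exists_decomposition`). The inclusions send the class of `x` to that of `B(w_i, x)`. They
are well defined because `L_d ⊆ Frob^* L_{d+1}` and `B(w_i, Frob y) = B(w_i, y)^p` lies in `I^p ⊆
I²` (`IsCycle.con_eq_zero`). The projections send `B(w_k, x)` to the class of `x` if `k = i` and to
zero otherwise. They are well defined because a relation `∑ B(w_i, x_i) = 0` on `Y_V` forces every
`x_i` into `L_d` on `Y_{W^⊥/W}` (`IsCycle.pull_mem_small`). To see this, a point of `Y_{W^⊥/W}` is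
deformed over the dual numbers by an infinitesimal rotation in the plane of `Frob y` and of a vector
dual to `w_i`. Frobenius kills `ε`, so the deformation stays in `Y_V`, and the relation becomes `ε
B(x_i, Frob y) = 0`.

Pairing with `Frob y` trivializes `Q` locally, so the conormal sheaf is locally free of rank `dim
W`. Since `V / W^⊥` has dimension `dim W`, both sides of the last claim are sums of `dim W` copies
of `Hom(Q, 𝒪)`. -/

set_option linter.unusedSectionVars false

namespace OrthDL
noncomputable section
variable {p : ℕ} [Fact p.Prime]

/-! ### Coordinates on `R ⊗ M` -/

section Coordinates

variable {R R' : Type} [CommRing R] [CommRing R'] [Algebra (ZMod p) R] [Algebra (ZMod p) R']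
variable {M : Type} [AddCommGroup M] [Module (ZMod p) M] [FiniteDimensional (ZMod p) M]

/-- There is at most one ring homomorphism out of `ZMod p`, so every ring homomorphism of
`𝔽_p`-algebras is `𝔽_p`-linear. Restriction, pull-back, evaluation at a point and Frobenius can thus
share the same lemmas on `changeScalars`. -/
theorem ringHom_algebraMap (φ : R →+* R') (a : ZMod p) :
    φ (algebraMap (ZMod p) R a) = algebraMap (ZMod p) R' a :=
  congrArg (fun f : ZMod p →+* R' => f a)
    (Subsingleton.elim (φ.comp (algebraMap (ZMod p) R)) (algebraMap (ZMod p) R'))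

theorem ringHom_smul (φ : R →+* R') (a : ZMod p) (r : R) : φ (a • r) = a • φ r := by
  rw [Algebra.smul_def, map_mul, ringHom_algebraMap, ← Algebra.smul_def]

/-- Coordinates on `R ⊗ M` with respect to a basis of `M`. -/
def coord : R ⊗[ZMod p] M ≃ₗ[R] (Fin (Module.finrank (ZMod p) M) → R) :=
  (Algebra.TensorProduct.basis R (Module.finBasis (ZMod p) M)).equivFun

theorem coord_tmul (r : R) (m : M) (i : Fin (Module.finrank (ZMod p) M)) :
    coord (r ⊗ₜ[ZMod p] m) i = (Module.finBasis (ZMod p) M).repr m i • r := by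
  simp [coord, Algebra.smul_def, mul_comm]

theorem coord_changeScalars (φ : R →+* R') (x : R ⊗[ZMod p] M)
    (i : Fin (Module.finrank (ZMod p) M)) :
    coord (changeScalars φ M x) i = φ (coord x i) := by
  induction x with
  | zero => simp
  | tmul r m =>
    have : changeScalars φ M (r ⊗ₜ[ZMod p] m) = φ r ⊗ₜ[ZMod p] m := rfl
    rw [this, coord_tmul, coord_tmul, ringHom_smul]
  | add x y hx hy => simp [hx, hy]

theorem coord_ext {x y : R ⊗[ZMod p] M} (h : ∀ i, coord x i = coord y i) : x = y :=
  coord.injective (funext h)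

theorem changeScalars_form (φ : R →+* R') (B : LinearMap.BilinForm (ZMod p) M)
    (x y : R ⊗[ZMod p] M) :
    B.baseChange R' (changeScalars φ M x) (changeScalars φ M y) = φ (B.baseChange R x y) := by
  induction x with
  | zero => simp
  | add x x' hx hx' => simp only [map_add, LinearMap.add_apply, hx, hx']
  | tmul r m =>
    induction y with
    | zero => simp
    | add y y' hy hy' => simp only [map_add, hy, hy']
    | tmul s n =>
      have h1 : changeScalars φ M (r ⊗ₜ[ZMod p] m) = φ r ⊗ₜ[ZMod p] m := rfl
      have h2 : changeScalars φ M (s ⊗ₜ[ZMod p] n) = φ s ⊗ₜ[ZMod p] n := rfl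
      rw [h1, h2]
      simp [LinearMap.BilinForm.baseChange_tmul, ringHom_algebraMap, Algebra.smul_def]

theorem baseChange_symm {B : LinearMap.BilinForm (ZMod p) M} (hB : B.IsSymm)
    (x y : R ⊗[ZMod p] M) : B.baseChange R x y = B.baseChange R y x := by
  induction x with
  | zero => simp
  | add x x' hx hx' => simp only [map_add, LinearMap.add_apply, hx, hx']
  | tmul r m =>
    induction y with
    | zero => simp
    | add y y' hy hy' => simp only [map_add, LinearMap.add_apply, hy, hy']
    | tmul s n =>
      rw [LinearMap.BilinForm.baseChange_tmul, LinearMap.BilinForm.baseChange_tmul, mul_comm r s,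
        show B m n = B n m from hB.eq m n]

theorem changeScalars_sum_smul {r : ℕ} (φ : R →+* R') (a : Fin r → R) (x : Fin r → R ⊗[ZMod p] M) :
    changeScalars φ M (∑ i, a i • x i) = ∑ i, φ (a i) • changeScalars φ M (x i) := by
  rw [map_sum]
  exact Finset.sum_congr rfl fun i _ => changeScalars_smul _ _ _ _

/-! ### Normalized tuples -/

variable {r : ℕ}

/-- The coordinates of the members of `x` at the positions `σ` form the identity matrix. -/
def IsNormalized (σ : Fin r ↪ Fin (Module.finrank (ZMod p) M)) (x : Fin r → R ⊗[ZMod p] M) : Prop :=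
  ∀ j i, coord (x j) (σ i) = if j = i then 1 else 0

theorem IsNormalized.map {σ : Fin r ↪ Fin (Module.finrank (ZMod p) M)} {x : Fin r → R ⊗[ZMod p] M}
    (h : IsNormalized σ x) (φ : R →+* R') : IsNormalized σ fun j => changeScalars φ M (x j) := by
  intro j i
  rw [coord_changeScalars, h]
  split_ifs <;> simp

theorem IsNormalized.coord_sum {σ : Fin r ↪ Fin (Module.finrank (ZMod p) M)}
    {x : Fin r → R ⊗[ZMod p] M} (h : IsNormalized σ x) (a : Fin r → R) (i : Fin r) :
    coord (∑ j, a j • x j) (σ i) = a i := by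
  rw [map_sum, Finset.sum_apply]
  simp [h _ _]

/-- The coefficients of a linear combination are read off at the pivots. Membership in the span is
thereby an equation, which can be checked locally and is preserved by ring homomorphisms. -/
theorem IsNormalized.mem_span {σ : Fin r ↪ Fin (Module.finrank (ZMod p) M)}
    {x : Fin r → R ⊗[ZMod p] M} (h : IsNormalized σ x) (z : R ⊗[ZMod p] M) :
    z ∈ Submodule.span R (Set.range x) ↔ z = ∑ j, coord z (σ j) • x j := by
  constructor
  · intro hz
    obtain ⟨a, rfl⟩ := (Submodule.mem_span_range_iff_exists_fun R).1 hz
    exact Finset.sum_congr rfl fun j _ => by rw [h.coord_sum]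
  · intro hz
    exact (Submodule.mem_span_range_iff_exists_fun R).2 ⟨_, hz.symm⟩

/-- Uniqueness of the reduced echelon form. It makes local frames with the same pivots agree on
overlaps. -/
theorem IsNormalized.eq_of_mem {σ : Fin r ↪ Fin (Module.finrank (ZMod p) M)}
    {x y : Fin r → R ⊗[ZMod p] M} (hx : IsNormalized σ x) (hy : IsNormalized σ y)
    (h : ∀ j, y j ∈ Submodule.span R (Set.range x)) : y = x := by
  funext j
  rw [(hx.mem_span _).1 (h j)]
  simp [hy _ _]

/-- The matrix of the coordinates of the members of `x` at the positions `σ`. -/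
def minor (σ : Fin r ↪ Fin (Module.finrank (ZMod p) M)) (x : Fin r → R ⊗[ZMod p] M) :
    Matrix (Fin r) (Fin r) R := Matrix.of fun j i => coord (x j) (σ i)

theorem minor_changeScalars (φ : R →+* R') (σ : Fin r ↪ Fin (Module.finrank (ZMod p) M))
    (x : Fin r → R ⊗[ZMod p] M) :
    minor σ (fun j => changeScalars φ M (x j)) = φ.mapMatrix (minor σ x) := by
  ext j i
  exact coord_changeScalars _ _ _

/-- Gaussian elimination: multiplication by the inverse of the pivot minor normalizes the tuple. The
minor itself is the second matrix and recovers the original tuple, so that the span does not change.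
-/
theorem exists_isNormalized {σ : Fin r ↪ Fin (Module.finrank (ZMod p) M)}
    {x : Fin r → R ⊗[ZMod p] M} (h : IsUnit (minor σ x).det) :
    ∃ (A A' : Matrix (Fin r) (Fin r) R), IsNormalized σ (fun j => ∑ k, A j k • x k) ∧
      ∀ j, x j = ∑ k, A' j k • ∑ l, A k l • x l := by
  have hA : (minor σ x)⁻¹ * minor σ x = 1 := Matrix.nonsing_inv_mul _ h
  have hA' : minor σ x * (minor σ x)⁻¹ = 1 := Matrix.mul_nonsing_inv _ h
  refine ⟨(minor σ x)⁻¹, minor σ x, ?_, ?_⟩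
  · intro j i
    rw [map_sum, Finset.sum_apply]
    have := congrFun (congrFun hA j) i
    rw [Matrix.mul_apply, Matrix.one_apply] at this
    rw [← this]
    exact Finset.sum_congr rfl fun k _ => by simp [minor]
  · intro j
    simp only [Finset.smul_sum, smul_smul]
    rw [Finset.sum_comm]
    simp only [← Finset.sum_smul]
    have : ∀ l, ∑ k, minor σ x j k * (minor σ x)⁻¹ k l = if j = l then 1 else 0 := by
      intro l
      rw [← Matrix.mul_apply, hA', Matrix.one_apply]
    simp [this]

theorem span_combination {x : Fin r → R ⊗[ZMod p] M} {A A' : Matrix (Fin r) (Fin r) R}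
    (h : ∀ j, x j = ∑ k, A' j k • ∑ l, A k l • x l) :
    Submodule.span R (Set.range fun j => ∑ k, A j k • x k) = Submodule.span R (Set.range x) := by
  apply le_antisymm <;> rw [Submodule.span_le] <;> rintro _ ⟨j, rfl⟩
  · exact Submodule.sum_mem _ fun k _ => Submodule.smul_mem _ _ (Submodule.subset_span ⟨k, rfl⟩)
  · rw [h]
    exact Submodule.sum_mem _ fun k _ => Submodule.smul_mem _ _ (Submodule.subset_span ⟨k, rfl⟩)

/-- A normalized tuple, completed by vectors of the fixed basis of `M`, is a basis. -/
theorem IsNormalized.exists_basis {σ : Fin r ↪ Fin (Module.finrank (ZMod p) M)}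
    {x : Fin r → R ⊗[ZMod p] M} (h : IsNormalized σ x) :
    ∃ (m : ℕ) (b : Module.Basis (Fin r ⊕ Fin m) R (R ⊗[ZMod p] M)),
      ∀ j, b (Sum.inl j) = x j := by
  classical
  let C := {i // i ∉ Set.range σ}
  let e : Fin (Fintype.card C) ≃ C := (Fintype.equivFin C).symm
  let v := Algebra.TensorProduct.basis R (Module.finBasis (ZMod p) M)
  have hv : ∀ (z : R ⊗[ZMod p] M) i, v.repr z i = coord z i := fun z i => rfl
  have hvi : ∀ i k, coord (v k) i = if k = i then 1 else 0 := by
    intro i k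
    rw [← hv, Module.Basis.repr_self, Finsupp.single_apply]
  let b : Fin r ⊕ Fin (Fintype.card C) → R ⊗[ZMod p] M := Sum.elim x fun k => v (e k).1
  have hli : LinearIndependent R b := by
    rw [Fintype.linearIndependent_iff]
    intro g hg
    rw [Fintype.sum_sum_type] at hg
    have h1 : ∀ i, g (Sum.inl i) = 0 := by
      intro i
      have := congrFun (congrArg coord hg) (σ i)
      rw [map_add] at this
      simp only [b, Sum.elim_inl, Sum.elim_inr, map_zero, Pi.zero_apply, Pi.add_apply] at this
      rw [h.coord_sum, map_sum, Finset.sum_apply, Finset.sum_eq_zero, add_zero] at this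
      · exact this
      · intro k _
        have : (e k).1 ≠ σ i := fun hh => (e k).2 ⟨i, hh.symm⟩
        simp [hvi, this]
    rintro (i | i)
    · exact h1 i
    · simp only [h1, zero_smul, Finset.sum_const_zero, zero_add] at hg
      have := congrFun (congrArg coord hg) (e i).1
      rw [map_sum, Finset.sum_apply, Finset.sum_eq_single i] at this
      · simpa [b, hvi] using this
      · intro k _ hk
        have : (e k).1 ≠ (e i).1 := fun hh => hk (e.injective (Subtype.ext hh))
        simp [b, hvi, this]
      · simp
  have hb : ∀ k, v k ∈ Submodule.span R (Set.range b) := by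
    have hC : ∀ k, k ∉ Set.range σ → v k ∈ Submodule.span R (Set.range b) := by
      intro k hk
      exact Submodule.subset_span ⟨Sum.inr (e.symm ⟨k, hk⟩), by simp [b]⟩
    intro k
    by_cases hk : k ∈ Set.range σ
    · obtain ⟨j, rfl⟩ := hk
      have hx := v.sum_repr (x j)
      rw [← Finset.add_sum_erase _ _ (Finset.mem_univ (σ j))] at hx
      -- The coordinate of `x j` is one at its own pivot and zero at the other pivots, so the basis
      -- vector at this pivot is `x j` up to basis vectors at positions that are not pivots.
      have h2 : v (σ j) = x j - ∑ i ∈ Finset.univ.erase (σ j), v.repr (x j) i • v i := by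
        rw [eq_sub_iff_add_eq]
        rwa [hv, h j j, if_pos rfl, one_smul] at hx
      rw [h2]
      refine Submodule.sub_mem _ (Submodule.subset_span ⟨Sum.inl j, rfl⟩)
        (Submodule.sum_mem _ fun i hi => ?_)
      by_cases hi' : i ∈ Set.range σ
      · obtain ⟨l, rfl⟩ := hi'
        have : j ≠ l := by rintro rfl; simp at hi
        rw [hv, h j l, if_neg this, zero_smul]
        exact Submodule.zero_mem _
      · exact Submodule.smul_mem _ _ (hC i hi')
    · exact hC k hk
  have htop : ⊤ ≤ Submodule.span R (Set.range b) := by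
    rw [← v.span_eq, Submodule.span_le]
    rintro _ ⟨k, rfl⟩
    exact hb k
  exact ⟨_, Module.Basis.mk hli htop, fun j => Module.Basis.mk_apply hli htop _⟩

/-- Row rank equals column rank: `r` independent rows leave `r` independent columns, whose positions
serve as pivots. -/
theorem exists_minor_ne_zero {K : Type} [Field K] [Algebra (ZMod p) K] {x : Fin r → K ⊗[ZMod p] M}
    (h : LinearIndependent K x) :
    ∃ σ : Fin r ↪ Fin (Module.finrank (ZMod p) M), (minor σ x).det ≠ 0 := by
  classical
  let A : Matrix (Fin r) (Fin (Module.finrank (ZMod p) M)) K := Matrix.of fun j => coord (x j)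
  have hA : LinearIndependent K A.row :=
    h.map' coord.toLinearMap (LinearMap.ker_eq_bot.2 coord.injective)
  have hrank : A.rank = r := by
    have := hA.rank_matrix
    simpa using this
  obtain ⟨κ, a, ha, hspan, hli⟩ := exists_linearIndependent' K A.col
  have hf : Finite κ := Finite.of_injective a ha
  have := Fintype.ofFinite κ
  have hcard : Fintype.card κ = r := by
    rw [← finrank_span_eq_card hli, hspan]
    exact (Matrix.rank_eq_finrank_span_cols A).symm.trans hrank
  let e : Fin r ≃ κ := (Fintype.equivFinOfCardEq hcard).symm
  refine ⟨⟨a ∘ e, ha.comp e.injective⟩, ?_⟩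
  have h2 : LinearIndependent K (minor (⟨a ∘ e, ha.comp e.injective⟩ :
      Fin r ↪ Fin (Module.finrank (ZMod p) M)) x).col :=
    hli.comp e e.injective
  rw [Matrix.linearIndependent_cols_iff_isUnit, Matrix.isUnit_iff_isUnit_det] at h2
  exact h2.ne_zero

theorem linearIndependent_of_minor {K : Type} [Field K] [Algebra (ZMod p) K]
    {x : Fin r → K ⊗[ZMod p] M} {σ : Fin r ↪ Fin (Module.finrank (ZMod p) M)}
    (h : (minor σ x).det ≠ 0) : LinearIndependent K x := by
  have h2 : LinearIndependent K (minor σ x).row := by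
    rw [Matrix.linearIndependent_rows_iff_isUnit, Matrix.isUnit_iff_isUnit_det]
    exact h.isUnit
  exact LinearIndependent.of_comp
    ((LinearMap.funLeft K K σ).comp (coord : K ⊗[ZMod p] M ≃ₗ[K] _).toLinearMap) h2

theorem IsNormalized.linearIndependent {σ : Fin r ↪ Fin (Module.finrank (ZMod p) M)}
    {x : Fin r → R ⊗[ZMod p] M} (h : IsNormalized σ x) : LinearIndependent R x := by
  rw [Fintype.linearIndependent_iff]
  intro g hg i
  rw [← h.coord_sum g i, hg, map_zero, Pi.zero_apply]

theorem IsNormalized.minor_eq {σ : Fin r ↪ Fin (Module.finrank (ZMod p) M)}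
    {x : Fin r → R ⊗[ZMod p] M} (h : IsNormalized σ x) : minor σ x = 1 := by
  ext j i
  rw [Matrix.one_apply]
  exact h j i

end Coordinates

end
end OrthDL

namespace OrthDL
noncomputable section
variable {p : ℕ} [Fact p.Prime]

/-! ### Local frames of subsheaves -/

theorem section_eq_of_locally {X : Scheme.{0}} {U : X.Opens} {a b : Γ(X, U)}
    (h : ∀ s ∈ U, ∃ (W : X.Opens) (hW : W ≤ U), s ∈ W ∧
      X.presheaf.map (homOfLE hW).op a = X.presheaf.map (homOfLE hW).op b) : a = b := by
  choose W hW hs h using h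
  exact X.sheaf.eq_of_locally_eq' (fun s : U => W s.1 s.2) U (fun s => homOfLE (hW s.1 s.2))
    (fun s hs' => Opens.mem_iSup.2 ⟨⟨s, hs'⟩, hs s hs'⟩) a b fun s => h s.1 s.2

theorem section_glue {X : Scheme.{0}} {U : X.Opens} (W : U → X.Opens) (hW : ∀ s, W s ≤ U)
    (hs : ∀ s : U, s.1 ∈ W s) (a : ∀ s, Γ(X, W s))
    (h : ∀ s t, X.presheaf.map (homOfLE (inf_le_left : W s ⊓ W t ≤ W s)).op (a s) =
      X.presheaf.map (homOfLE (inf_le_right : W s ⊓ W t ≤ W t)).op (a t)) :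
    ∃ b : Γ(X, U), ∀ s, X.presheaf.map (homOfLE (hW s)).op b = a s := by
  obtain ⟨b, hb, -⟩ := X.sheaf.existsUnique_gluing' W U (fun s => homOfLE (hW s))
    (fun s hs' => Opens.mem_iSup.2 ⟨⟨s, hs'⟩, hs ⟨s, hs'⟩⟩) a (fun s t => h s t)
  exact ⟨b, hb⟩

instance residueAlgebra (X : Sch p) (s : X.left) : Algebra (ZMod p) (X.left.residueField s) :=
  ((X.left.evaluation ⊤ s trivial).hom.comp (algebraMap (ZMod p) Γ(X.left, ⊤))).toAlgebra

/-- The value of a function at a point. -/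
abbrev evalAt (X : Sch p) {U : X.left.Opens} {s : X.left} (hs : s ∈ U) :
    Γ(X.left, U) →+* X.left.residueField s :=
  (X.left.evaluation U s hs).hom

section Frames

variable {M : Type} [AddCommGroup M] [Module (ZMod p) M] [FiniteDimensional (ZMod p) M]
variable {X : Sch p}

theorem evalAt_map {U W : X.left.Opens} {s : X.left} (hs : s ∈ W) (h : W ≤ U) (a : Γ(X.left, U)) :
    evalAt X hs (X.left.presheaf.map (homOfLE h).op a) = evalAt X (h hs) a := by
  have : X.left.presheaf.map (homOfLE h).op ≫ X.left.evaluation W s hs =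
      X.left.evaluation U s (h hs) := by
    rw [← Scheme.germ_residue, ← Scheme.germ_residue]
    exact X.left.presheaf.germ_res_assoc (homOfLE h) s hs _
  exact ConcreteCategory.congr_hom this a

theorem exists_isUnit_res {U : X.left.Opens} {s : X.left} (hs : s ∈ U) {a : Γ(X.left, U)}
    (ha : evalAt X hs a ≠ 0) : ∃ (W : X.left.Opens) (h : W ≤ U), s ∈ W ∧
      IsUnit (X.left.presheaf.map (homOfLE h).op a) :=
  ⟨X.left.basicOpen a, X.left.basicOpen_le a,
    (X.left.evaluation_ne_zero_iff_mem_basicOpen s hs a).1 ha,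
    X.left.toRingedSpace.isUnit_res_basicOpen a⟩

theorem res_smul {U W : X.left.Opens} (h : W ≤ U) (a : Γ(X.left, U)) (x : Γ(X.left, U) ⊗[ZMod p] M) :
    res M X h (a • x) = X.left.presheaf.map (homOfLE h).op a • res M X h x :=
  changeScalars_smul _ _ _ _

theorem res_refl {U : X.left.Opens} (h : U ≤ U) (x : Γ(X.left, U) ⊗[ZMod p] M) :
    res M X h x = x :=
  changeScalars_id _ (fun r => ConcreteCategory.congr_hom (X.left.presheaf.map_id (op U)) r) M x

theorem coord_res {U W : X.left.Opens} (h : W ≤ U) (x : Γ(X.left, U) ⊗[ZMod p] M)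
    (i : Fin (Module.finrank (ZMod p) M)) :
    coord (res M X h x) i = X.left.presheaf.map (homOfLE h).op (coord x i) :=
  coord_changeScalars _ _ _

theorem eq_of_locally {U : X.left.Opens} {x y : Γ(X.left, U) ⊗[ZMod p] M}
    (h : ∀ s ∈ U, ∃ (W : X.left.Opens) (hW : W ≤ U), s ∈ W ∧ res M X hW x = res M X hW y) :
    x = y := by
  refine coord_ext fun i => section_eq_of_locally fun s hs => ?_
  obtain ⟨W, hW, hsW, e⟩ := h s hs
  exact ⟨W, hW, hsW, by rw [← coord_res hW, ← coord_res hW, e]⟩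

theorem exists_glue {U : X.left.Opens} (W : U → X.left.Opens) (hW : ∀ s, W s ≤ U)
    (hs : ∀ s : U, s.1 ∈ W s) (x : ∀ s, Γ(X.left, W s) ⊗[ZMod p] M)
    (h : ∀ s t, res M X (inf_le_left : W s ⊓ W t ≤ W s) (x s) =
      res M X (inf_le_right : W s ⊓ W t ≤ W t) (x t)) :
    ∃ y : Γ(X.left, U) ⊗[ZMod p] M, ∀ s, res M X (hW s) y = x s := by
  have key : ∀ i, ∃ b : Γ(X.left, U), ∀ s,
      X.left.presheaf.map (homOfLE (hW s)).op b = coord (x s) i := by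
    intro i
    refine section_glue W hW hs (fun s => coord (x s) i) fun s t => ?_
    rw [← coord_res, h, coord_res]
  choose b hb using key
  refine ⟨coord.symm b, fun s => coord_ext fun i => ?_⟩
  rw [coord_res, LinearEquiv.apply_symm_apply, hb]

variable {r : ℕ}

/-- `x` is a normalized tuple of sections over `U` that generates `L` over every open subset
of `U`. -/
structure IsFrame (L : SubModule M X) (U : X.left.Opens)
    (σ : Fin r ↪ Fin (Module.finrank (ZMod p) M)) (x : Fin r → Γ(X.left, U) ⊗[ZMod p] M) :
    Prop where
  norm : IsNormalized σ x
  span : ∀ (W : X.left.Opens) (h : W ≤ U),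
    sec L W = Submodule.span _ (Set.range fun j => res M X h (x j))

variable {L L' : SubModule M X} {U : X.left.Opens} {σ : Fin r ↪ Fin (Module.finrank (ZMod p) M)}
  {x : Fin r → Γ(X.left, U) ⊗[ZMod p] M}

theorem IsFrame.restrict (hx : IsFrame L U σ x) {W : X.left.Opens} (h : W ≤ U) :
    IsFrame L W σ fun j => res M X h (x j) where
  norm := hx.norm.map _
  span W' h' := by
    simp only [res_res]
    exact hx.span W' (h'.trans h)

theorem IsFrame.span_self (hx : IsFrame L U σ x) :
    sec L U = Submodule.span _ (Set.range x) := by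
  have := hx.span U le_rfl
  simpa only [res_refl] using this

theorem IsFrame.mem_iff (hx : IsFrame L U σ x) {W : X.left.Opens} (h : W ≤ U)
    (z : Γ(X.left, W) ⊗[ZMod p] M) :
    z ∈ sec L W ↔ z = ∑ j, coord z (σ j) • res M X h (x j) := by
  rw [hx.span W h]
  exact (hx.norm.map _).mem_span z

theorem IsFrame.mem (hx : IsFrame L U σ x) (j : Fin r) : x j ∈ sec L U := by
  rw [hx.span_self]
  exact Submodule.subset_span ⟨j, rfl⟩

theorem IsFrame.isSummandAt (hx : IsFrame L U σ x) {s : X.left} (hs : s ∈ U) :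
    IsSummandAt L s r := by
  obtain ⟨m, b, hb⟩ := hx.norm.exists_basis
  refine ⟨U, hs, m, b, fun W h => ?_⟩
  simp only [hb]
  exact hx.span W h

theorem IsFrame.unique {x' : Fin r → Γ(X.left, U) ⊗[ZMod p] M} (hx : IsFrame L U σ x)
    (hx' : IsFrame L U σ x') : x' = x :=
  hx.norm.eq_of_mem hx'.norm fun j => hx.span_self ▸ hx'.mem j

theorem span_res_combination {W : X.left.Opens} (h : W ≤ U) {A A' : Matrix (Fin r) (Fin r) Γ(X.left, U)}
    (hA : ∀ j, x j = ∑ k, A' j k • ∑ l, A k l • x l) :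
    Submodule.span Γ(X.left, W) (Set.range fun j => res M X h (∑ k, A j k • x k)) =
      Submodule.span Γ(X.left, W) (Set.range fun j => res M X h (x j)) := by
  have := span_combination (A := A.map (X.left.presheaf.map (homOfLE h).op).hom)
    (A' := A'.map (X.left.presheaf.map (homOfLE h).op).hom) (x := fun j => res M X h (x j)) (by
      intro j
      rw [hA j]
      simp only [changeScalars_sum_smul, Matrix.map_apply])
  rw [← this]
  simp only [changeScalars_sum_smul, Matrix.map_apply]

theorem exists_isFrame_of_det {W : X.left.Opens} (h : W ≤ U)
    (hspan : ∀ (W : X.left.Opens) (h : W ≤ U),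
      sec L W = Submodule.span _ (Set.range fun j => res M X h (x j)))
    (hdet : IsUnit (X.left.presheaf.map (homOfLE h).op (minor σ x).det)) :
    ∃ x', IsFrame L W σ (x' : Fin r → Γ(X.left, W) ⊗[ZMod p] M) := by
  have hdet' : IsUnit (minor σ fun j => res M X h (x j)).det := by
    rw [minor_changeScalars, ← RingHom.map_det]
    exact hdet
  obtain ⟨A, A', hn, hA⟩ := exists_isNormalized hdet'
  refine ⟨_, hn, fun W' h' => ?_⟩
  rw [span_res_combination h' hA]
  simp only [res_res]
  exact hspan W' _

/-- Independence in the fibre at `s` gives a minor that does not vanish at `s`. It is a unit near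
`s`, and there the generators can be normalized. -/
theorem exists_isFrame {s : X.left} (hs : s ∈ U)
    (hspan : ∀ (W : X.left.Opens) (h : W ≤ U),
      sec L W = Submodule.span _ (Set.range fun j => res M X h (x j)))
    (hind : LinearIndependent (X.left.residueField s) fun j => changeScalars (evalAt X hs) M (x j)) :
    ∃ (W : X.left.Opens) (_ : W ≤ U) (σ : Fin r ↪ Fin (Module.finrank (ZMod p) M))
      (x' : Fin r → Γ(X.left, W) ⊗[ZMod p] M), s ∈ W ∧ IsFrame L W σ x' := by
  obtain ⟨σ, hσ⟩ := exists_minor_ne_zero hind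
  rw [minor_changeScalars, ← RingHom.map_det] at hσ
  obtain ⟨W, hW, hsW, hu⟩ := exists_isUnit_res hs hσ
  obtain ⟨x', hx'⟩ := exists_isFrame_of_det hW hspan hu
  exact ⟨W, hW, σ, x', hsW, hx'⟩

/-- The images of the basis vectors still span `K ⊗ M`, and their number is its dimension. -/
theorem linearIndependent_changeScalars {R K : Type} [CommRing R] [Algebra (ZMod p) R] [Field K]
    [Algebra (ZMod p) K] (φ : R →+* K) {ι : Type} [Fintype ι]
    (b : Module.Basis ι R (R ⊗[ZMod p] M)) :
    LinearIndependent K fun i => changeScalars φ M (b i) := by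
  classical
  have : Nontrivial R := φ.domain_nontrivial
  have htop : ⊤ ≤ Submodule.span K (Set.range fun i => changeScalars φ M (b i)) := by
    have h1 : ∀ z : R ⊗[ZMod p] M, changeScalars φ M z ∈
        Submodule.span K (Set.range fun i => changeScalars φ M (b i)) := by
      intro z
      rw [← b.sum_repr z, map_sum]
      refine Submodule.sum_mem _ fun i _ => ?_
      rw [changeScalars_smul]
      exact Submodule.smul_mem _ _ (Submodule.subset_span ⟨i, rfl⟩)
    intro z _
    induction z with
    | zero => exact Submodule.zero_mem _
    | tmul a m =>
      have : a ⊗ₜ[ZMod p] m = a • changeScalars φ M (1 ⊗ₜ m) := by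
        simp [changeScalars, TensorProduct.smul_tmul']
      rw [this]
      exact Submodule.smul_mem _ _ (h1 _)
    | add x y hx hy => exact Submodule.add_mem _ (hx trivial) (hy trivial)
  refine linearIndependent_of_top_le_span_of_card_eq_finrank htop ?_
  rw [Module.finrank_baseChange, ← Module.finrank_baseChange (R := R) (S := ZMod p),
    Module.finrank_eq_card_basis b]

theorem IsSummandAt.exists_isFrame {s : X.left} (h : IsSummandAt L s r) :
    ∃ (W : X.left.Opens) (σ : Fin r ↪ Fin (Module.finrank (ZMod p) M))
      (x : Fin r → Γ(X.left, W) ⊗[ZMod p] M), s ∈ W ∧ IsFrame L W σ x := by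
  obtain ⟨U, hs, m, b, hb⟩ := h
  obtain ⟨W, -, σ, x, hsW, hx⟩ := OrthDL.exists_isFrame (L := L) (x := fun i => b (Sum.inl i)) hs hb
    ((linearIndependent_changeScalars (evalAt X hs) b).comp Sum.inl Sum.inl_injective)
  exact ⟨W, σ, x, hsW, hx⟩

/-- Replaces arbitrary bases and complements by normalized frames, for which uniqueness and gluing
are available. -/
theorem isSubbundle_iff : IsSubbundle L r ↔ IsSubsheaf L ∧ ∀ s : X.left, ∃ (W : X.left.Opens)
    (σ : Fin r ↪ Fin (Module.finrank (ZMod p) M)) (x : Fin r → Γ(X.left, W) ⊗[ZMod p] M),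
    s ∈ W ∧ IsFrame L W σ x := by
  refine and_congr_right fun _ => forall_congr' fun s => ⟨fun h => h.exists_isFrame, ?_⟩
  rintro ⟨W, σ, x, hs, hx⟩
  exact hx.isSummandAt hs

theorem IsSubsheaf.le_of_locally (h' : IsSubsheaf L')
    (h : ∀ s : X.left, ∃ W : X.left.Opens, s ∈ W ∧ ∀ W' ≤ W, sec L W' ≤ sec L' W') : L ≤ L' := by
  rintro ⟨U⟩ x hx
  refine h' U x fun s hs => ?_
  obtain ⟨W, hsW, hW⟩ := h s
  exact ⟨W ⊓ U, inf_le_right, ⟨hsW, hs⟩, hW _ inf_le_left (res_mem L _ hx)⟩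

theorem IsSubsheaf.eq_of_locally (hL : IsSubsheaf L) (hL' : IsSubsheaf L')
    (h : ∀ s : X.left, ∃ W : X.left.Opens, s ∈ W ∧ ∀ W' ≤ W, sec L W' = sec L' W') : L = L' := by
  apply le_antisymm
  · exact hL'.le_of_locally fun s => (h s).imp fun W hW => ⟨hW.1, fun W' h' => (hW.2 W' h').le⟩
  · exact hL.le_of_locally fun s => (h s).imp fun W hW => ⟨hW.1, fun W' h' => (hW.2 W' h').ge⟩

theorem isFrame_of_mem_iff (hn : IsNormalized σ x)
    (h : ∀ (W : X.left.Opens) (h : W ≤ U) (z : Γ(X.left, W) ⊗[ZMod p] M),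
      z ∈ sec L W ↔ z = ∑ j, coord z (σ j) • res M X h (x j)) : IsFrame L U σ x where
  norm := hn
  span W hW := by
    ext z
    rw [h W hW]
    exact ((hn.map _).mem_span z).symm

theorem sum_coord_res {W W' : X.left.Opens} (h : W ≤ U) (h' : W' ≤ W) (z : Γ(X.left, W) ⊗[ZMod p] M) :
    res M X h' (∑ j, coord z (σ j) • res M X h (x j)) =
      ∑ j, coord (res M X h' z) (σ j) • res M X (h'.trans h) (x j) := by
  rw [res, changeScalars_sum_smul]
  refine Finset.sum_congr rfl fun j _ => ?_
  rw [res_res]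
  congr 1
  exact (coord_changeScalars _ _ _).symm

/-- Normalized frames with the same pivots glue. -/
theorem IsSubsheaf.exists_isFrame_of_locally (hL : IsSubsheaf L)
    (h : ∀ s ∈ U, ∃ (W : X.left.Opens) (x : Fin r → Γ(X.left, W) ⊗[ZMod p] M),
      s ∈ W ∧ IsFrame L W σ x) :
    ∃ x : Fin r → Γ(X.left, U) ⊗[ZMod p] M, IsFrame L U σ x := by
  choose W x hs hx using h
  let W' : U → X.left.Opens := fun s => W s.1 s.2 ⊓ U
  let x' : ∀ s : U, Fin r → Γ(X.left, W' s) ⊗[ZMod p] M := fun s j => res M X inf_le_left (x s.1 s.2 j)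
  have hx' : ∀ s, IsFrame L (W' s) σ (x' s) := fun s => (hx s.1 s.2).restrict _
  have hs' : ∀ s : U, s.1 ∈ W' s := fun s => ⟨hs s.1 s.2, s.2⟩
  have key : ∀ j, ∃ y : Γ(X.left, U) ⊗[ZMod p] M, ∀ s, res M X inf_le_right y = x' s j := by
    intro j
    refine exists_glue W' _ hs' (fun s => x' s j) fun s t => ?_
    -- Both restrictions are normalized frames of `L` with the same pivots on the overlap, hence
    -- equal.
    exact congrFun (((hx' t).restrict inf_le_right).unique ((hx' s).restrict inf_le_left)) j
  choose y hy using key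
  have hres : ∀ (s : U) (V : X.left.Opens) (hV : V ≤ W' s) j,
      res M X (hV.trans inf_le_right) (y j) = res M X hV (x' s j) := by
    intro s V hV j
    rw [← hy j s, res_res]
  refine ⟨y, isFrame_of_mem_iff ?_ ?_⟩
  · intro j i
    refine section_eq_of_locally fun s hsU => ⟨W' ⟨s, hsU⟩, inf_le_right, hs' ⟨s, hsU⟩, ?_⟩
    rw [← coord_res, hy, (hx' ⟨s, hsU⟩).norm]
    split_ifs <;> simp
  · intro V hV z
    constructor
    · intro hz
      refine OrthDL.eq_of_locally fun s hsV =>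
        ⟨V ⊓ W' ⟨s, hV hsV⟩, inf_le_left, ⟨hsV, hs' ⟨s, hV hsV⟩⟩, ?_⟩
      rw [sum_coord_res]
      have := ((hx' ⟨s, hV hsV⟩).mem_iff inf_le_right _).1
        (res_mem L (inf_le_left : V ⊓ W' ⟨s, hV hsV⟩ ≤ V) hz)
      simp only [hres ⟨s, hV hsV⟩ _ inf_le_right]
      exact this
    · intro hz
      refine hL V z fun s hsV => ⟨V ⊓ W' ⟨s, hV hsV⟩, inf_le_left, ⟨hsV, hs' ⟨s, hV hsV⟩⟩, ?_⟩
      rw [(hx' ⟨s, hV hsV⟩).mem_iff inf_le_right]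
      conv_lhs => rw [hz]
      rw [sum_coord_res]
      simp only [hres ⟨s, hV hsV⟩ _ inf_le_right]

theorem isSubsheaf_generated (S : ∀ U : X.left.Opens, Set (Γ(X.left, U) ⊗[ZMod p] M)) :
    IsSubsheaf (generated S) := by
  intro U x hx s hs
  obtain ⟨W, hW, hsW, h⟩ := hx s hs
  obtain ⟨W', hW', hsW', h'⟩ := h s hsW
  exact ⟨W', hW'.trans hW, hsW', by rwa [res_res] at h'⟩

theorem mem_generated {S : ∀ U : X.left.Opens, Set (Γ(X.left, U) ⊗[ZMod p] M)}
    {y : Γ(X.left, U) ⊗[ZMod p] M} (hy : y ∈ S U) : y ∈ sec (generated S) U :=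
  fun _ hs => ⟨U, le_rfl, hs, Submodule.subset_span ⟨U, le_rfl, y, hy, rfl⟩⟩

theorem generated_le {S : ∀ U : X.left.Opens, Set (Γ(X.left, U) ⊗[ZMod p] M)} (hL : IsSubsheaf L)
    (h : ∀ U, ∀ y ∈ S U, y ∈ sec L U) : generated S ≤ L := by
  rintro ⟨U⟩ x hx
  refine hL U x fun s hs => ?_
  obtain ⟨W, hW, hsW, h'⟩ := hx s hs
  refine ⟨W, hW, hsW, ?_⟩
  refine Submodule.span_le.2 ?_ h'
  rintro _ ⟨U', hU', y, hy, rfl⟩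
  exact res_mem L hU' (h U' y hy)

/-- A generated subsheaf is described by local membership in spans. For a normalized tuple such
membership is an equation of sections, so it passes from a cover to the whole open subset.
Pull-backs, Frobenius pull-backs, sums and constant subsheaves all obtain their frames from this
criterion. -/
theorem generated_isFrame {S : ∀ U : X.left.Opens, Set (Γ(X.left, U) ⊗[ZMod p] M)}
    (hn : IsNormalized σ x)
    (h₁ : ∀ (W' : X.left.Opens), ∀ y ∈ S W', ∀ (W : X.left.Opens) (h : W ≤ W') (hU : W ≤ U),
      res M X h y ∈ Submodule.span Γ(X.left, W) (Set.range fun j => res M X hU (x j)))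
    (h₂ : ∀ s ∈ U, ∃ (W : X.left.Opens) (h : W ≤ U), s ∈ W ∧ ∀ j, res M X h (x j) ∈ spanOn S W) :
    IsFrame (generated S) U σ x := by
  refine isFrame_of_mem_iff hn fun W hW z => ⟨fun hz => ?_, fun hz => ?_⟩
  · refine OrthDL.eq_of_locally fun s hs => ?_
    obtain ⟨V, hV, hsV, h⟩ := hz s hs
    refine ⟨V, hV, hsV, ?_⟩
    rw [sum_coord_res, ← (hn.map _).mem_span]
    refine Submodule.span_le.2 ?_ h
    rintro _ ⟨U', hU', y, hy, rfl⟩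
    exact h₁ U' y hy V hU' _
  · intro s hs
    obtain ⟨V, hV, hsV, h⟩ := h₂ s (hW hs)
    refine ⟨V ⊓ W, inf_le_right, ⟨hsV, hs⟩, ?_⟩
    rw [hz, sum_coord_res]
    refine Submodule.sum_mem _ fun j _ => Submodule.smul_mem _ _ ?_
    have := res_mem_spanOn S (inf_le_left : V ⊓ W ≤ V) _ (h j)
    rwa [res_res] at this

/-! ### Pull-backs of frames -/

variable {T : Sch p} (f : T ⟶ X)

/-- Pull-back of sections of `𝒪 ⊗ M`. -/
abbrev pull (M : Type) [AddCommGroup M] [Module (ZMod p) M] {X T : Sch p} (f : T ⟶ X)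
    (U : X.left.Opens) (W : T.left.Opens) (h : W ≤ f.left ⁻¹ᵁ U) :
    Γ(X.left, U) ⊗[ZMod p] M →ₗ[ZMod p] Γ(T.left, W) ⊗[ZMod p] M :=
  changeScalars (f.left.appLE U W h).hom M

theorem res_pull {U : X.left.Opens} {W W' : T.left.Opens} (h : W ≤ f.left ⁻¹ᵁ U) (h' : W' ≤ W)
    (x : Γ(X.left, U) ⊗[ZMod p] M) :
    res M T h' (pull M f U W h x) = pull M f U W' (h'.trans h) x :=
  changeScalars_comp _ _ _ (fun r => by
    rw [← Scheme.Hom.appLE_map f.left h (homOfLE h').op]; rfl) M x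

theorem pull_res {U U' : X.left.Opens} {W : T.left.Opens} (h : W ≤ f.left ⁻¹ᵁ U') (h' : U' ≤ U)
    (x : Γ(X.left, U) ⊗[ZMod p] M) :
    pull M f U' W h (res M X h' x) =
      pull M f U W (h.trans ((Opens.map f.left.base).map (homOfLE h')).le) x :=
  changeScalars_comp _ _ _ (fun r => by
    rw [← Scheme.Hom.map_appLE f.left h (homOfLE h').op]; rfl) M x

theorem pull_pull {S : Sch p} (g : S ⟶ T) {U : X.left.Opens} {W : T.left.Opens} {W' : S.left.Opens}
    (h : W ≤ f.left ⁻¹ᵁ U) (h' : W' ≤ g.left ⁻¹ᵁ W) (h'' : W' ≤ (g ≫ f).left ⁻¹ᵁ U)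
    (x : Γ(X.left, U) ⊗[ZMod p] M) :
    pull M g W W' h' (pull M f U W h x) = pull M (g ≫ f) U W' h'' x :=
  changeScalars_comp _ _ _ (fun r => by
    have := Scheme.Hom.appLE_comp_appLE g.left f.left U W W' h h'
    exact ConcreteCategory.congr_hom this r) M x

theorem pull_id {U W : X.left.Opens} (h : W ≤ U) (x : Γ(X.left, U) ⊗[ZMod p] M) :
    pull M (𝟙 X) U W h x = res M X h x := by
  have : Scheme.Hom.appLE (𝟙 X.left) U W h = X.left.presheaf.map (homOfLE h).op :=
    Category.id_comp _
  unfold pull res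
  congr 2

theorem mem_pullbackSub {U : X.left.Opens} {W : T.left.Opens} (h : W ≤ f.left ⁻¹ᵁ U)
    {x : Γ(X.left, U) ⊗[ZMod p] M} (hx : x ∈ sec L U) :
    pull M f U W h x ∈ sec (pullbackSub f L) W :=
  mem_generated ⟨U, h, x, hx, rfl⟩

theorem IsFrame.pullback (hx : IsFrame L U σ x) {W : T.left.Opens} (h : W ≤ f.left ⁻¹ᵁ U) :
    IsFrame (pullbackSub f L) W σ fun j => pull M f U W h (x j) := by
  refine generated_isFrame (hx.norm.map _) ?_ ?_
  · rintro W' _ ⟨U', h', y, hy, rfl⟩ V hV hVU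
    rw [res_pull]
    -- A generator may come from any open `U'`; it is expanded in the frame over `U' ⊓ U`, which
    -- still contains the image of `V`.
    have hV' : V ≤ f.left ⁻¹ᵁ (U' ⊓ U) := le_inf (hV.trans h') (hVU.trans h)
    have e := (hx.mem_iff (inf_le_right : U' ⊓ U ≤ U) _).1 (res_mem L inf_le_left hy)
    rw [← pull_res f hV' inf_le_left, e, changeScalars_sum_smul]
    refine Submodule.sum_mem _ fun j _ => Submodule.smul_mem _ _ (Submodule.subset_span ⟨j, ?_⟩)
    exact (res_pull f h hVU _).trans (pull_res f hV' inf_le_right _).symm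
  · intro s hs
    exact ⟨W, le_rfl, hs, fun j => Submodule.subset_span ⟨W, le_rfl, _, ⟨U, h, x j, hx.mem j, rfl⟩, rfl⟩⟩

theorem IsFrame.sec_eq {W : X.left.Opens} (hx : IsFrame L U σ x) (hx' : IsFrame L' U σ x)
    (h : W ≤ U) : sec L W = sec L' W := by
  rw [hx.span W h, hx'.span W h]

/-- Both sides are generated subsheaves, and near each point they have the same normalized frame.
Pull-back is thus strictly functorial on subbundles, which the functor of points requires. -/
theorem IsSubbundle.pullback_comp {S : Sch p} (g : S ⟶ T) (hL : IsSubbundle L r) :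
    pullbackSub g (pullbackSub f L) = pullbackSub (g ≫ f) L := by
  refine (isSubsheaf_generated _).eq_of_locally (isSubsheaf_generated _) fun s => ?_
  obtain ⟨W, σ, x, hs, hx⟩ := (isSubbundle_iff.1 hL).2 (f.left (g.left s))
  refine ⟨(g ≫ f).left ⁻¹ᵁ W, by simpa using hs, fun W' h' => ?_⟩
  have h₁ := (hx.pullback f (W := f.left ⁻¹ᵁ W) le_rfl).pullback g (W := (g ≫ f).left ⁻¹ᵁ W)
    (by simp)
  have e : (fun j => pull M g (f.left ⁻¹ᵁ W) ((g ≫ f).left ⁻¹ᵁ W) (by simp)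
      (pull M f W (f.left ⁻¹ᵁ W) le_rfl (x j))) =
      fun j => pull M (g ≫ f) W ((g ≫ f).left ⁻¹ᵁ W) le_rfl (x j) :=
    funext fun j => pull_pull f g le_rfl _ le_rfl _
  rw [e] at h₁
  exact h₁.sec_eq (hx.pullback (g ≫ f) le_rfl) h'

theorem IsSubbundle.pullback_id (hL : IsSubbundle L r) : pullbackSub (𝟙 X) L = L := by
  refine (isSubsheaf_generated _).eq_of_locally hL.1 fun s => ?_
  obtain ⟨W, σ, x, hs, hx⟩ := (isSubbundle_iff.1 hL).2 s
  refine ⟨W, hs, fun W' h' => ?_⟩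
  have h₁ := hx.pullback (𝟙 X) (W := W) le_rfl
  simp only [pull_id, res_refl] at h₁
  exact h₁.sec_eq hx h'

/-! ### Frobenius -/

theorem frob_map {R R' : Type} [CommRing R] [CommRing R'] [Algebra (ZMod p) R]
    [Algebra (ZMod p) R'] (φ : R →+* R') (r : R) :
    φ (frob (p := p) R r) = frob (p := p) R' (φ r) := map_pow φ r p

/-- The Frobenius of `R ⊗ M`. -/
abbrev frobM {R : Type} [CommRing R] [Algebra (ZMod p) R] (x : R ⊗[ZMod p] M) : R ⊗[ZMod p] M :=
  changeScalars (p := p) (frob (p := p) R) M x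

theorem frobM_map {R R' : Type} [CommRing R] [CommRing R'] [Algebra (ZMod p) R]
    [Algebra (ZMod p) R'] (φ : R →+* R') (x : R ⊗[ZMod p] M) :
    changeScalars φ M (frobM x) = frobM (changeScalars φ M x) := by
  have h₁ := changeScalars_comp (frob (p := p) R) φ (φ.comp (frob (p := p) R)) (fun _ => rfl) M x
  have h₂ := changeScalars_comp φ (frob (p := p) R') (φ.comp (frob (p := p) R))
    (fun a => (frob_map φ a).symm) M x
  exact h₁.trans h₂.symm

theorem mem_frobPullback {y : Γ(X.left, U) ⊗[ZMod p] M} (hy : y ∈ sec L U) :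
    frobM y ∈ sec (frobPullback L) U :=
  mem_generated ⟨y, hy, rfl⟩

theorem IsFrame.frobPullback (hx : IsFrame L U σ x) :
    IsFrame (frobPullback L) U σ fun j => frobM (x j) := by
  refine generated_isFrame (hx.norm.map _) ?_ ?_
  · rintro W' _ ⟨y, hy, rfl⟩ W hW hU
    have e := (hx.mem_iff hU _).1 (res_mem L hW hy)
    have e' : res M X hW (frobM y) = frobM (res M X hW y) := frobM_map _ _
    change res M X hW (frobM y) ∈ _
    rw [e', e, frobM, changeScalars_sum_smul]
    refine Submodule.sum_mem _ fun j _ => Submodule.smul_mem _ _ (Submodule.subset_span ⟨j, ?_⟩)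
    exact frobM_map _ _
  · intro s hs
    exact ⟨U, le_rfl, hs, fun j => Submodule.subset_span ⟨U, le_rfl, _, ⟨x j, hx.mem j, rfl⟩, rfl⟩⟩

end Frames
end
end OrthDL

namespace OrthDL
noncomputable section
variable {p : ℕ} [Fact p.Prime]

/-! ### Affine schemes over `𝔽_{p²}` -/

/-- The spectrum of an `𝔽_{p²}`-algebra. -/
abbrev affSch (A : Type) [CommRing A] [Algebra (GaloisField p 2) A] : Sch p :=
  Over.mk (Spec.map (CommRingCat.ofHom (algebraMap (GaloisField p 2) A)))

theorem appLE_top {X Y : Scheme.{0}} (f : X ⟶ Y) : f.appLE ⊤ ⊤ le_top = f.appTop :=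
  (congrArg (f.app ⊤ ≫ ·) (X.presheaf.map_id (op ⊤))).trans (Category.comp_id _)

theorem appLE_top_apply {X Y : Scheme.{0}} (f : X ⟶ Y) (b : Γ(Y, ⊤)) :
    f.appLE ⊤ ⊤ le_top b = f.appTop b :=
  ConcreteCategory.congr_hom (appLE_top f) b

variable (p) in
/-- The map `A → Γ(Spec A, ⊤)`. -/
abbrev toΓ (A : Type) [CommRing A] [Algebra (GaloisField p 2) A] :
    A →+* Γ((affSch (p := p) A).left, ⊤) :=
  (Scheme.ΓSpecIso (CommRingCat.of A)).inv.hom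

theorem structMap_appLE {X T : Sch p} (f : T ⟶ X) (U : X.left.Opens) (W : T.left.Opens)
    (h : W ≤ f.left ⁻¹ᵁ U) (a : GaloisField p 2) :
    f.left.appLE U W h (structMap X U a) = structMap T W a := by
  have e : f.left ≫ X.hom = T.hom := Over.w f
  have := Scheme.Hom.appLE_comp_appLE f.left
    (Y := X.left) (Z := Spec (CommRingCat.of (GaloisField p 2))) X.hom ⊤ U W le_top h
  have h2 := ConcreteCategory.congr_hom this
    ((Scheme.ΓSpecIso (CommRingCat.of (GaloisField p 2))).inv.hom a)
  refine Eq.trans h2 ?_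
  simp only [e]
  rfl

theorem structMap_res {X : Sch p} {U W : X.left.Opens} (h : W ≤ U) (a : GaloisField p 2) :
    X.left.presheaf.map (homOfLE h).op (structMap X U a) = structMap X W a := by
  have := structMap_appLE (𝟙 X) U W h a
  rw [← this]
  have : Scheme.Hom.appLE (𝟙 X.left) U W h = X.left.presheaf.map (homOfLE h).op :=
    Category.id_comp _
  exact congrArg (fun g => g (structMap X U a)) this.symm

section Affine

variable {A : Type} [CommRing A] [Algebra (GaloisField p 2) A] {T : Sch p}

theorem structMap_affSch (a : GaloisField p 2) :
    structMap (affSch (p := p) A) ⊤ a = toΓ p A (algebraMap (GaloisField p 2) A a) := by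
  have := ConcreteCategory.congr_hom (Scheme.ΓSpecIso_inv_naturality
    (CommRingCat.ofHom (algebraMap (GaloisField p 2) A))) a
  refine Eq.trans ?_ this.symm
  exact appLE_top_apply (Spec.map (CommRingCat.ofHom (algebraMap (GaloisField p 2) A)))
    ((Scheme.ΓSpecIso (CommRingCat.of (GaloisField p 2))).inv a)

theorem hom_affSch_ext {f g : T ⟶ affSch (p := p) A}
    (h : ∀ a : A, f.left.appTop (toΓ p A a) = g.left.appTop (toΓ p A a)) : f = g := by
  ext1
  refine ext_to_Spec ?_
  ext a
  exact h a

theorem exists_hom_affSch (φ : A →+* Γ(T.left, ⊤))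
    (hφ : ∀ a, φ (algebraMap (GaloisField p 2) A a) = structMap T ⊤ a) :
    ∃ f : T ⟶ affSch (p := p) A, ∀ a : A, f.left.appTop (toΓ p A a) = φ a := by
  let g : T.left ⟶ Spec (CommRingCat.of A) := T.left.toSpecΓ ≫ Spec.map (CommRingCat.ofHom φ)
  have hg : ∀ a : A, g.appTop (toΓ p A a) = φ a := by
    intro a
    have h1 := ConcreteCategory.congr_hom
      (Scheme.ΓSpecIso_inv_naturality (CommRingCat.ofHom φ)) a
    have h2 : T.left.toSpecΓ.appTop ((Scheme.ΓSpecIso Γ(T.left, ⊤)).inv (φ a)) = φ a := by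
      rw [Scheme.toSpecΓ_appTop]
      exact ConcreteCategory.congr_hom (Scheme.ΓSpecIso Γ(T.left, ⊤)).inv_hom_id (φ a)
    refine Eq.trans ?_ h2
    change T.left.toSpecΓ.appTop ((Spec.map (CommRingCat.ofHom φ)).appTop _) = _
    exact congrArg _ h1.symm
  refine ⟨Over.homMk g ?_, hg⟩
  refine ext_to_Spec (R := GaloisField p 2) ?_
  ext a
  have h1 := ConcreteCategory.congr_hom (Scheme.ΓSpecIso_inv_naturality
    (CommRingCat.ofHom (algebraMap (GaloisField p 2) A))) a
  have h3 : g.appTop ((Spec.map (CommRingCat.ofHom (algebraMap (GaloisField p 2) A))).appTop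
      ((Scheme.ΓSpecIso (CommRingCat.of (GaloisField p 2))).inv a)) = structMap T ⊤ a := by
    rw [← hφ, ← hg]
    exact congrArg _ h1.symm
  refine Eq.trans h3 ?_
  exact appLE_top_apply (Y := Spec (CommRingCat.of (GaloisField p 2))) _ _

end Affine

/-! ### Charts of the moduli space of flags -/

section Charts

variable {R R' : Type} [CommRing R] [CommRing R'] [Algebra (ZMod p) R] [Algebra (ZMod p) R']
variable {M : Type} [AddCommGroup M] [Module (ZMod p) M] [FiniteDimensional (ZMod p) M]
variable {d e : ℕ} (B : LinearMap.BilinForm (ZMod p) M) (c : Prop)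
variable (σ : Fin d ↪ Fin (Module.finrank (ZMod p) M)) (τ : Fin e ↪ Fin (Module.finrank (ZMod p) M))

/-- `x` and `y` are normalized, the span of `x` is contained in that of `y`, the span of `y` is
totally isotropic, and, if `c` holds, `x` is orthogonal to the Frobenius transform of `y`. -/
structure IsChart (x : Fin d → R ⊗[ZMod p] M) (y : Fin e → R ⊗[ZMod p] M) : Prop where
  norm_small : IsNormalized σ x
  norm_big : IsNormalized τ y
  le : ∀ j, x j = ∑ k, coord (x j) (τ k) • y k
  isotropic : ∀ i j, B.baseChange R (y i) (y j) = 0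
  frob : c → ∀ i j, B.baseChange R (x i) (frobM (y j)) = 0

/-- The elements of `R` whose vanishing is equivalent to `IsChart`. -/
def chartRel (x : Fin d → R ⊗[ZMod p] M) (y : Fin e → R ⊗[ZMod p] M) : Set R :=
  {a | (∃ j i, coord (x j) (σ i) - (if j = i then 1 else 0) = a) ∨
    (∃ j i, coord (y j) (τ i) - (if j = i then 1 else 0) = a) ∨
    (∃ j i, coord (x j - ∑ k, coord (x j) (τ k) • y k) i = a) ∨
    (∃ i j, B.baseChange R (y i) (y j) = a) ∨
    (c ∧ ∃ i j, B.baseChange R (x i) (frobM (y j)) = a)}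

variable {B c σ τ} {x : Fin d → R ⊗[ZMod p] M} {y : Fin e → R ⊗[ZMod p] M}

theorem isChart_iff : IsChart B c σ τ x y ↔ ∀ a ∈ chartRel B c σ τ x y, a = 0 := by
  constructor
  · rintro ⟨h1, h2, h3, h4, h5⟩ a (⟨j, i, rfl⟩ | ⟨j, i, rfl⟩ | ⟨j, i, rfl⟩ | ⟨i, j, rfl⟩ | ⟨hc, i, j, rfl⟩)
    · rw [h1 j i, sub_self]
    · rw [h2 j i, sub_self]
    · rw [← h3 j, sub_self, map_zero, Pi.zero_apply]
    · exact h4 i j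
    · exact h5 hc i j
  · intro h
    refine ⟨fun j i => ?_, fun j i => ?_, fun j => ?_, fun i j => ?_, fun hc i j => ?_⟩
    · exact sub_eq_zero.1 (h _ (Or.inl ⟨j, i, rfl⟩))
    · exact sub_eq_zero.1 (h _ (Or.inr (Or.inl ⟨j, i, rfl⟩)))
    · refine sub_eq_zero.1 (coord_ext fun i => ?_)
      rw [map_zero, Pi.zero_apply]
      exact h _ (Or.inr (Or.inr (Or.inl ⟨j, i, rfl⟩)))
    · exact h _ (Or.inr (Or.inr (Or.inr (Or.inl ⟨i, j, rfl⟩))))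
    · exact h _ (Or.inr (Or.inr (Or.inr (Or.inr ⟨hc, i, j, rfl⟩))))

theorem chartRel_map (φ : R →+* R') (a : R) (ha : a ∈ chartRel B c σ τ x y) :
    φ a ∈ chartRel B c σ τ (fun j => changeScalars φ M (x j)) fun j => changeScalars φ M (y j) := by
  rcases ha with ⟨j, i, rfl⟩ | ⟨j, i, rfl⟩ | ⟨j, i, rfl⟩ | ⟨i, j, rfl⟩ | ⟨hc, i, j, rfl⟩
  · refine Or.inl ⟨j, i, ?_⟩
    rw [coord_changeScalars, map_sub]
    split_ifs <;> simp
  · refine Or.inr (Or.inl ⟨j, i, ?_⟩)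
    rw [coord_changeScalars, map_sub]
    split_ifs <;> simp
  · refine Or.inr (Or.inr (Or.inl ⟨j, i, ?_⟩))
    rw [← coord_changeScalars, map_sub (changeScalars φ M), changeScalars_sum_smul]
    simp only [coord_changeScalars]
  · exact Or.inr (Or.inr (Or.inr (Or.inl ⟨i, j, changeScalars_form _ _ _ _⟩)))
  · refine Or.inr (Or.inr (Or.inr (Or.inr ⟨hc, i, j, ?_⟩)))
    rw [← frobM_map, changeScalars_form]

theorem IsChart.map (h : IsChart B c σ τ x y) (φ : R →+* R') :
    IsChart B c σ τ (fun j => changeScalars φ M (x j)) fun j => changeScalars φ M (y j) where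
  norm_small := h.norm_small.map φ
  norm_big := h.norm_big.map φ
  le j := by
    conv_lhs => rw [h.le j]
    rw [changeScalars_sum_smul]
    simp only [coord_changeScalars]
  isotropic i j := by rw [changeScalars_form, h.isotropic, map_zero]
  frob hc i j := by
    have := changeScalars_form φ B (x i) (frobM (y j))
    rw [frobM_map, h.frob hc, map_zero] at this
    exact this

variable (B c σ τ)

/-- The polynomial ring in the coordinates of the members of `x` and `y`. -/
abbrev ChartPoly (_σ : Fin d ↪ Fin (Module.finrank (ZMod p) M))
    (_τ : Fin e ↪ Fin (Module.finrank (ZMod p) M)) : Type :=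
  MvPolynomial ((Fin d × Fin (Module.finrank (ZMod p) M)) ⊕
    (Fin e × Fin (Module.finrank (ZMod p) M))) (GaloisField p 2)

/-- The generic small tuple. -/
def polySmall (j : Fin d) : ChartPoly σ τ ⊗[ZMod p] M :=
  coord.symm fun i => MvPolynomial.X (Sum.inl (j, i))

/-- The generic big tuple. -/
def polyBig (j : Fin e) : ChartPoly σ τ ⊗[ZMod p] M :=
  coord.symm fun i => MvPolynomial.X (Sum.inr (j, i))

/-- The coordinate ring of a chart. -/
abbrev ChartRing : Type :=
  ChartPoly σ τ ⧸ Ideal.span (chartRel B c σ τ (polySmall σ τ) (polyBig σ τ))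

/-- The chart with pivots `σ` and `τ`. -/
abbrev chart : Sch p := affSch (ChartRing B c σ τ)

/-- The map from polynomials to functions on the chart. -/
def chartMap : ChartPoly σ τ →+* Γ((chart B c σ τ).left, ⊤) :=
  (toΓ p (ChartRing B c σ τ)).comp (Ideal.Quotient.mk _)

/-- The universal small tuple. -/
def chartSmall (j : Fin d) : Γ((chart B c σ τ).left, ⊤) ⊗[ZMod p] M :=
  changeScalars (chartMap B c σ τ) M (polySmall σ τ j)

/-- The universal big tuple. -/
def chartBig (j : Fin e) : Γ((chart B c σ τ).left, ⊤) ⊗[ZMod p] M :=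
  changeScalars (chartMap B c σ τ) M (polyBig σ τ j)

/-- The quotient map kills the relations of the generic tuples and commutes with coordinates, the
form and Frobenius. The result is then transported from the coordinate ring to the global functions
of its spectrum. -/
theorem isChart_univ : IsChart B c σ τ (chartSmall B c σ τ) (chartBig B c σ τ) := by
  have h : IsChart B c σ τ
      (fun j => changeScalars (Ideal.Quotient.mk (Ideal.span
        (chartRel B c σ τ (polySmall σ τ) (polyBig σ τ)))) M (polySmall σ τ j))
      (fun j => changeScalars (Ideal.Quotient.mk (Ideal.span
        (chartRel B c σ τ (polySmall σ τ) (polyBig σ τ)))) M (polyBig σ τ j)) := by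
    let φ := Ideal.Quotient.mk (Ideal.span (chartRel B c σ τ (polySmall σ τ) (polyBig σ τ)))
    have h0 : ∀ a ∈ chartRel B c σ τ (polySmall σ τ) (polyBig σ τ), φ a = 0 := fun a ha =>
      Ideal.Quotient.eq_zero_iff_mem.2 (Ideal.subset_span ha)
    refine ⟨fun j i => ?_, fun j i => ?_, fun j => ?_, fun i j => ?_, fun hc i j => ?_⟩
    · have := h0 _ (Or.inl ⟨j, i, rfl⟩)
      rw [map_sub, sub_eq_zero] at this
      rw [coord_changeScalars, this]
      split_ifs <;> simp
    · have := h0 _ (Or.inr (Or.inl ⟨j, i, rfl⟩))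
      rw [map_sub, sub_eq_zero] at this
      rw [coord_changeScalars, this]
      split_ifs <;> simp
    · refine coord_ext fun i => ?_
      have := h0 _ (Or.inr (Or.inr (Or.inl ⟨j, i, rfl⟩)))
      rw [map_sub, Pi.sub_apply, map_sub, sub_eq_zero] at this
      rw [coord_changeScalars, this, ← coord_changeScalars, changeScalars_sum_smul]
      simp only [coord_changeScalars]
      rfl
    · rw [changeScalars_form]
      exact h0 _ (Or.inr (Or.inr (Or.inr (Or.inl ⟨i, j, rfl⟩))))
    · rw [← frobM_map, changeScalars_form]
      exact h0 _ (Or.inr (Or.inr (Or.inr (Or.inr ⟨hc, i, j, rfl⟩))))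
  have h2 := h.map (toΓ p (ChartRing B c σ τ))
  have e : ∀ z : ChartPoly σ τ ⊗[ZMod p] M, changeScalars (toΓ p (ChartRing B c σ τ)) M
      (changeScalars (Ideal.Quotient.mk (Ideal.span
        (chartRel B c σ τ (polySmall σ τ) (polyBig σ τ)))) M z) =
      changeScalars (chartMap B c σ τ) M z := fun z =>
    changeScalars_comp _ _ _ (fun _ => rfl) M z
  simp only [e] at h2
  exact h2

variable {T : Sch p}

/-- A ring homomorphism out of the coordinate ring is determined on constants, where it is the
structure map, and on the variables, which are the coordinates of the universal tuples. -/
theorem chart_hom_ext {f g : T ⟶ chart B c σ τ}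
    (hs : ∀ j, pull M f ⊤ ⊤ le_top (chartSmall B c σ τ j) =
      pull M g ⊤ ⊤ le_top (chartSmall B c σ τ j))
    (hb : ∀ j, pull M f ⊤ ⊤ le_top (chartBig B c σ τ j) =
      pull M g ⊤ ⊤ le_top (chartBig B c σ τ j)) : f = g := by
  refine hom_affSch_ext fun a => ?_
  obtain ⟨a, rfl⟩ := Ideal.Quotient.mk_surjective a
  have key : ∀ (f : T ⟶ chart B c σ τ) (b : Γ((chart B c σ τ).left, ⊤)),
      f.left.appLE ⊤ ⊤ le_top b = f.left.appTop b := by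
    intro f b
    exact appLE_top_apply _ _
  have : (f.left.appTop.hom.comp (chartMap B c σ τ)) = (g.left.appTop.hom.comp (chartMap B c σ τ)) := by
    refine MvPolynomial.ringHom_ext (fun a => ?_) ?_
    · have h1 : chartMap B c σ τ (MvPolynomial.C a) = structMap (chart B c σ τ) ⊤ a :=
        (structMap_affSch a).symm
      have h2 := structMap_appLE f ⊤ ⊤ le_top a
      have h3 := structMap_appLE g ⊤ ⊤ le_top a
      rw [key] at h2 h3
      rw [RingHom.comp_apply, RingHom.comp_apply, h1]
      exact h2.trans h3.symm
    · rintro (⟨j, i⟩ | ⟨j, i⟩)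
      · have := congrArg (fun z => coord z i) (hs j)
        simp only [coord_changeScalars, chartSmall, polySmall, LinearEquiv.apply_symm_apply] at this
        exact (key f _).symm.trans (this.trans (key g _))
      · have := congrArg (fun z => coord z i) (hb j)
        simp only [coord_changeScalars, chartBig, polyBig, LinearEquiv.apply_symm_apply] at this
        exact (key f _).symm.trans (this.trans (key g _))
  exact RingHom.congr_fun this a

/-- The coordinates of the given tuples define a homomorphism from the polynomial ring. It carries
the relations of the generic tuples to relations of the given ones, which vanish by `isChart_iff`.
-/
theorem exists_chart_hom {x : Fin d → Γ(T.left, ⊤) ⊗[ZMod p] M}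
    {y : Fin e → Γ(T.left, ⊤) ⊗[ZMod p] M} (h : IsChart B c σ τ x y) :
    ∃ f : T ⟶ chart B c σ τ, (∀ j, pull M f ⊤ ⊤ le_top (chartSmall B c σ τ j) = x j) ∧
      ∀ j, pull M f ⊤ ⊤ le_top (chartBig B c σ τ j) = y j := by
  let ψ : ChartPoly σ τ →+* Γ(T.left, ⊤) := MvPolynomial.eval₂Hom (structMap T ⊤)
    (Sum.elim (fun q => coord (x q.1) q.2) fun q => coord (y q.1) q.2)
  have hx : ∀ j, changeScalars ψ M (polySmall σ τ j) = x j := fun j => coord_ext fun i => by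
    rw [coord_changeScalars, polySmall, LinearEquiv.apply_symm_apply]
    simp [ψ]
  have hy : ∀ j, changeScalars ψ M (polyBig σ τ j) = y j := fun j => coord_ext fun i => by
    rw [coord_changeScalars, polyBig, LinearEquiv.apply_symm_apply]
    simp [ψ]
  have hψ : ∀ a ∈ Ideal.span (chartRel B c σ τ (polySmall σ τ) (polyBig σ τ)), ψ a = 0 := by
    intro a ha
    refine Submodule.span_induction (p := fun a _ => ψ a = 0) ?_ (map_zero _) ?_ ?_ ha
    · intro a ha
      refine isChart_iff.1 h _ ?_
      have := chartRel_map ψ a ha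
      simpa only [hx, hy] using this
    · intro a b _ _ ha hb
      rw [map_add, ha, hb, add_zero]
    · intro a b _ hb
      rw [smul_eq_mul, map_mul, hb, mul_zero]
  let φ : ChartRing B c σ τ →+* Γ(T.left, ⊤) := Ideal.Quotient.lift _ ψ hψ
  obtain ⟨f, hf⟩ := exists_hom_affSch φ fun a => by
    change ψ (MvPolynomial.C a) = _
    simp [ψ]
  have key : ∀ z : ChartPoly σ τ ⊗[ZMod p] M,
      pull M f ⊤ ⊤ le_top (changeScalars (chartMap B c σ τ) M z) = changeScalars ψ M z := by
    intro z
    refine changeScalars_comp _ _ _ (fun a => ?_) M z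
    have h1 : f.left.appLE ⊤ ⊤ le_top (chartMap B c σ τ a) = f.left.appTop (chartMap B c σ τ a) :=
      appLE_top_apply _ _
    exact h1.trans (hf _)
  exact ⟨f, fun j => (key _).trans (hx j), fun j => (key _).trans (hy j)⟩

end Charts
end
end OrthDL

namespace OrthDL
noncomputable section
variable {p : ℕ} [Fact p.Prime]

/-! ### The moduli problem of flags -/

section Moduli

variable {M : Type} [AddCommGroup M] [Module (ZMod p) M] [FiniteDimensional (ZMod p) M]
variable {B : LinearMap.BilinForm (ZMod p) M} {X T : Sch p} {d e r : ℕ} {c : Prop}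

theorem form_eq_zero_of_span {R : Type} [CommRing R] [Algebra (ZMod p) R] {ι κ : Type}
    {x : ι → R ⊗[ZMod p] M} {y : κ → R ⊗[ZMod p] M}
    (h : ∀ i j, B.baseChange R (x i) (y j) = 0) {z w : R ⊗[ZMod p] M}
    (hz : z ∈ Submodule.span R (Set.range x)) (hw : w ∈ Submodule.span R (Set.range y)) :
    B.baseChange R z w = 0 := by
  refine Submodule.span_induction (p := fun z _ => B.baseChange R z w = 0) ?_ ?_ ?_ ?_ hz
  · rintro _ ⟨i, rfl⟩
    refine Submodule.span_induction (p := fun w _ => B.baseChange R (x i) w = 0) ?_ ?_ ?_ ?_ hw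
    · rintro _ ⟨j, rfl⟩
      exact h i j
    · rw [map_zero]
    · intro a b _ _ ha hb
      rw [map_add, ha, hb, add_zero]
    · intro a b _ hb
      rw [map_smul, hb, smul_zero]
  · rw [map_zero, LinearMap.zero_apply]
  · intro a b _ _ ha hb
    rw [map_add, LinearMap.add_apply, ha, hb, add_zero]
  · intro a b _ hb
    rw [map_smul, LinearMap.smul_apply, hb, smul_zero]

variable {L L' : SubModule M X} {U : X.left.Opens}
  {σ : Fin d ↪ Fin (Module.finrank (ZMod p) M)} {τ : Fin e ↪ Fin (Module.finrank (ZMod p) M)}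
  {x : Fin d → Γ(X.left, U) ⊗[ZMod p] M} {y : Fin e → Γ(X.left, U) ⊗[ZMod p] M}

theorem IsFrame.form_eq_zero (hx : IsFrame L U σ x) (hy : IsFrame L' U τ y)
    (h : ∀ i j, B.baseChange Γ(X.left, U) (x i) (y j) = 0) {W : X.left.Opens} (hW : W ≤ U)
    {z w : Γ(X.left, W) ⊗[ZMod p] M} (hz : z ∈ sec L W) (hw : w ∈ sec L' W) :
    B.baseChange Γ(X.left, W) z w = 0 := by
  rw [hx.span W hW] at hz
  rw [hy.span W hW] at hw
  refine form_eq_zero_of_span (fun i j => ?_) hz hw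
  rw [changeScalars_form, h, map_zero]

theorem IsFrame.form_frob_eq_zero (hx : IsFrame L U σ x) (hy : IsFrame L' U τ y)
    (h : ∀ i j, B.baseChange Γ(X.left, U) (x i) (frobM (y j)) = 0) {W : X.left.Opens} (hW : W ≤ U)
    {z w : Γ(X.left, W) ⊗[ZMod p] M} (hz : z ∈ sec L W) (hw : w ∈ sec L' W) :
    B.baseChange Γ(X.left, W) z (frobM w) = 0 :=
  hx.form_eq_zero hy.frobPullback h hW hz (mem_frobPullback hw)

theorem form_eq_zero_of_locally {z w : Γ(X.left, U) ⊗[ZMod p] M}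
    (h : ∀ s ∈ U, ∃ (W : X.left.Opens) (hW : W ≤ U), s ∈ W ∧
      B.baseChange Γ(X.left, W) (res M X hW z) (res M X hW w) = 0) :
    B.baseChange Γ(X.left, U) z w = 0 := by
  refine section_eq_of_locally fun s hs => ?_
  obtain ⟨W, hW, hsW, e⟩ := h s hs
  refine ⟨W, hW, hsW, ?_⟩
  rw [changeScalars_form] at e
  rw [map_zero]
  exact e

variable (B d e c) in
/-- Pairs of subbundles of ranks `d` and `e`, the second one totally isotropic, such that, if `c`
holds, the first one is orthogonal to the Frobenius transform of the second one. -/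
structure IsModuli (X : Sch p) (F : Flag M X) : Prop where
  small : IsSubbundle F.small d
  big : IsSubbundle F.big e
  isotropic : IsIsotropicSub B F.big
  frob : c → ∀ U : X.left.Opens, ∀ x ∈ sec F.small U, ∀ y ∈ sec F.big U,
    B.baseChange Γ(X.left, U) x (frobM y) = 0

/-- `x` and `y` are normalized frames of the members of `F`. -/
structure IsFlagFrame (F : Flag M X) (U : X.left.Opens)
    (σ : Fin d ↪ Fin (Module.finrank (ZMod p) M)) (τ : Fin e ↪ Fin (Module.finrank (ZMod p) M))
    (x : Fin d → Γ(X.left, U) ⊗[ZMod p] M) (y : Fin e → Γ(X.left, U) ⊗[ZMod p] M) : Prop where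
  small : IsFrame F.small U σ x
  big : IsFrame F.big U τ y

theorem IsFlagFrame.pullback {F : Flag M X} (h : IsFlagFrame F U σ τ x y) (f : T ⟶ X)
    {W : T.left.Opens} (hW : W ≤ f.left ⁻¹ᵁ U) :
    IsFlagFrame (F.pullback f) W σ τ (fun j => pull M f U W hW (x j))
      fun j => pull M f U W hW (y j) :=
  ⟨h.small.pullback f hW, h.big.pullback f hW⟩

theorem IsModuli.isChart {F : Flag M X} (h : IsModuli B d e c X F) (hF : IsFlagFrame F U σ τ x y) :
    IsChart B c σ τ x y where
  norm_small := hF.small.norm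
  norm_big := hF.big.norm
  le j := by
    have := (hF.big.mem_iff le_rfl _).1 (F.le (op U) (hF.small.mem j))
    simpa only [res_refl] using this
  isotropic i j := h.isotropic U _ (hF.big.mem i) _ (hF.big.mem j)
  frob hc i j := h.frob hc U _ (hF.small.mem i) _ (hF.big.mem j)

theorem IsModuli.exists_frame {F : Flag M X} (h : IsModuli B d e c X F) (s : X.left) :
    ∃ (U : X.left.Opens) (σ : Fin d ↪ Fin (Module.finrank (ZMod p) M))
      (τ : Fin e ↪ Fin (Module.finrank (ZMod p) M)) (x : Fin d → Γ(X.left, U) ⊗[ZMod p] M)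
      (y : Fin e → Γ(X.left, U) ⊗[ZMod p] M), s ∈ U ∧ IsFlagFrame F U σ τ x y := by
  obtain ⟨U, σ, x, hs, hx⟩ := (isSubbundle_iff.1 h.small).2 s
  obtain ⟨W, τ, y, hs', hy⟩ := (isSubbundle_iff.1 h.big).2 s
  exact ⟨U ⊓ W, σ, τ, _, _, ⟨hs, hs'⟩, hx.restrict inf_le_left, hy.restrict inf_le_right⟩

/-- Every condition of the moduli problem is local, and over the domain of a frame it follows from
the chart equations of that frame by bilinearity. -/
theorem isModuli_of_locally {F : Flag M X} (hs : IsSubsheaf F.small) (hb : IsSubsheaf F.big)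
    (h : ∀ s : X.left, ∃ (U : X.left.Opens) (σ : Fin d ↪ Fin (Module.finrank (ZMod p) M))
      (τ : Fin e ↪ Fin (Module.finrank (ZMod p) M)) (x : Fin d → Γ(X.left, U) ⊗[ZMod p] M)
      (y : Fin e → Γ(X.left, U) ⊗[ZMod p] M), s ∈ U ∧ IsFlagFrame F U σ τ x y ∧
        IsChart B c σ τ x y) : IsModuli B d e c X F where
  small := isSubbundle_iff.2 ⟨hs, fun s => by
    obtain ⟨U, σ, τ, x, y, hs, hF, -⟩ := h s
    exact ⟨U, σ, x, hs, hF.small⟩⟩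
  big := isSubbundle_iff.2 ⟨hb, fun s => by
    obtain ⟨U, σ, τ, x, y, hs, hF, -⟩ := h s
    exact ⟨U, τ, y, hs, hF.big⟩⟩
  isotropic W z hz w hw := form_eq_zero_of_locally fun s hs => by
    obtain ⟨U, σ, τ, x, y, hsU, hF, hc⟩ := h s
    exact ⟨W ⊓ U, inf_le_left, ⟨hs, hsU⟩, hF.big.form_eq_zero hF.big hc.isotropic inf_le_right
      (res_mem _ _ hz) (res_mem _ _ hw)⟩
  frob hc W z hz w hw := form_eq_zero_of_locally fun s hs => by
    obtain ⟨U, σ, τ, x, y, hsU, hF, hc'⟩ := h s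
    refine ⟨W ⊓ U, inf_le_left, ⟨hs, hsU⟩, ?_⟩
    rw [frobM_map]
    exact hF.small.form_frob_eq_zero hF.big (hc'.frob hc) inf_le_right
      (res_mem _ _ hz) (res_mem _ _ hw)

theorem IsModuli.pullback {F : Flag M X} (h : IsModuli B d e c X F) (f : T ⟶ X) :
    IsModuli B d e c T (F.pullback f) := by
  refine isModuli_of_locally (isSubsheaf_generated _) (isSubsheaf_generated _) fun s => ?_
  obtain ⟨U, σ, τ, x, y, hs, hF⟩ := h.exists_frame (f.left s)
  exact ⟨f.left ⁻¹ᵁ U, σ, τ, _, _, hs, hF.pullback f le_rfl, (h.isChart hF).map _⟩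

theorem IsModuli.pullback_comp {S : Sch p} {F : Flag M X} (h : IsModuli B d e c X F) (f : T ⟶ X)
    (g : S ⟶ T) : (F.pullback f).pullback g = F.pullback (g ≫ f) :=
  Flag.ext (h.small.pullback_comp f g) (h.big.pullback_comp f g)

theorem IsModuli.pullback_id {F : Flag M X} (h : IsModuli B d e c X F) : F.pullback (𝟙 X) = F :=
  Flag.ext h.small.pullback_id h.big.pullback_id

theorem IsFlagFrame.unique {F : Flag M X} (h : IsFlagFrame F U σ τ x y)
    {x' : Fin d → Γ(X.left, U) ⊗[ZMod p] M} {y' : Fin e → Γ(X.left, U) ⊗[ZMod p] M}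
    (h' : IsFlagFrame F U σ τ x' y') : x' = x ∧ y' = y :=
  ⟨h.small.unique h'.small, h.big.unique h'.big⟩

theorem Flag.eq_of_frames {F F' : Flag M X} (hF : IsModuli B d e c X F) (hF' : IsModuli B d e c X F')
    (h : ∀ s : X.left, ∃ (U : X.left.Opens) (σ : Fin d ↪ Fin (Module.finrank (ZMod p) M))
      (τ : Fin e ↪ Fin (Module.finrank (ZMod p) M)) (x : Fin d → Γ(X.left, U) ⊗[ZMod p] M)
      (y : Fin e → Γ(X.left, U) ⊗[ZMod p] M), s ∈ U ∧ IsFlagFrame F U σ τ x y ∧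
        IsFlagFrame F' U σ τ x y) : F = F' := by
  apply Flag.ext
  · refine hF.small.1.eq_of_locally hF'.small.1 fun s => ?_
    obtain ⟨U, σ, τ, x, y, hs, h1, h2⟩ := h s
    exact ⟨U, hs, fun W hW => h1.small.sec_eq h2.small hW⟩
  · refine hF.big.1.eq_of_locally hF'.big.1 fun s => ?_
    obtain ⟨U, σ, τ, x, y, hs, h1, h2⟩ := h s
    exact ⟨U, hs, fun W hW => h1.big.sec_eq h2.big hW⟩

/-! ### Flags from chart data -/

/-- The subsheaf spanned by a tuple of global sections. -/
def spanSub (x : Fin r → Γ(X.left, ⊤) ⊗[ZMod p] M) : SubModule M X :=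
  generated fun W => Set.range fun j => res M X (le_top : W ≤ ⊤) (x j)

theorem isFrame_spanSub {σ : Fin r ↪ Fin (Module.finrank (ZMod p) M)}
    {x : Fin r → Γ(X.left, ⊤) ⊗[ZMod p] M} (h : IsNormalized σ x) : IsFrame (spanSub x) ⊤ σ x := by
  refine generated_isFrame h ?_ ?_
  · rintro W' _ ⟨j, rfl⟩ W hW hU
    refine Submodule.subset_span ⟨j, ?_⟩
    exact (res_res X le_top hW (x j)).symm
  · intro s hs
    exact ⟨⊤, le_rfl, trivial, fun j => Submodule.subset_span ⟨⊤, le_rfl, _, ⟨j, rfl⟩,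
      res_res X le_top le_rfl (x j)⟩⟩

/-- The flag spanned by chart data. -/
def chartFlag {x : Fin d → Γ(X.left, ⊤) ⊗[ZMod p] M} {y : Fin e → Γ(X.left, ⊤) ⊗[ZMod p] M}
    (h : IsChart B c σ τ x y) : Flag M X where
  small := spanSub x
  big := spanSub y
  le := generated_le (isSubsheaf_generated _) (by
    rintro U _ ⟨j, rfl⟩
    refine res_mem _ _ ?_
    rw [h.le j]
    exact Submodule.sum_mem _ fun k _ => Submodule.smul_mem _ _ ((isFrame_spanSub h.norm_big).mem k))

theorem isFlagFrame_chartFlag {x : Fin d → Γ(X.left, ⊤) ⊗[ZMod p] M}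
    {y : Fin e → Γ(X.left, ⊤) ⊗[ZMod p] M} (h : IsChart B c σ τ x y) :
    IsFlagFrame (chartFlag h) ⊤ σ τ x y :=
  ⟨isFrame_spanSub h.norm_small, isFrame_spanSub h.norm_big⟩

theorem isModuli_chartFlag {x : Fin d → Γ(X.left, ⊤) ⊗[ZMod p] M}
    {y : Fin e → Γ(X.left, ⊤) ⊗[ZMod p] M} (h : IsChart B c σ τ x y) :
    IsModuli B d e c X (chartFlag h) :=
  isModuli_of_locally (isSubsheaf_generated _) (isSubsheaf_generated _) fun _ =>
    ⟨⊤, σ, τ, x, y, trivial, isFlagFrame_chartFlag h, h⟩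

/-! ### Open immersions and gluing -/

theorem pull_sum_coord (f : T ⟶ X) {W' : T.left.Opens} {W : X.left.Opens} (h : W ≤ U)
    (h' : W' ≤ f.left ⁻¹ᵁ W) (z : Γ(X.left, W) ⊗[ZMod p] M) :
    pull M f W W' h' (∑ j, coord z (σ j) • res M X h (x j)) =
      ∑ j, coord (pull M f W W' h' z) (σ j) •
        pull M f U W' (h'.trans ((Opens.map f.left.base).map (homOfLE h)).le) (x j) := by
  rw [pull, changeScalars_sum_smul]
  refine Finset.sum_congr rfl fun j _ => ?_
  rw [coord_changeScalars]
  congr 1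
  exact pull_res f h' h (x j)

theorem bijective_app (f : T ⟶ X) [IsOpenImmersion f.left] {W : X.left.Opens}
    (hW : W ≤ f.left.opensRange) :
    Function.Bijective (f.left.appLE W (f.left ⁻¹ᵁ W) le_rfl) := by
  have := Scheme.Hom.isIso_app f.left W hW
  have e : f.left.appLE W (f.left ⁻¹ᵁ W) le_rfl = f.left.app W := Scheme.Hom.appLE_eq_app _
  rw [e]
  exact ConcreteCategory.bijective_of_isIso (f.left.app W)

theorem pull_injective (f : T ⟶ X) [IsOpenImmersion f.left] {W : X.left.Opens}
    (hW : W ≤ f.left.opensRange) : Function.Injective (pull M f W (f.left ⁻¹ᵁ W) le_rfl) := by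
  intro z w h
  refine coord_ext fun i => (bijective_app f hW).1 ?_
  have := congrArg (fun t => coord t i) h
  simpa only [coord_changeScalars] using this

theorem pull_surjective (f : T ⟶ X) [IsOpenImmersion f.left] {W : X.left.Opens}
    (hW : W ≤ f.left.opensRange) : Function.Surjective (pull M f W (f.left ⁻¹ᵁ W) le_rfl) := by
  intro z
  choose a ha using fun i => (bijective_app f hW).2 (coord z i)
  refine ⟨coord.symm a, coord_ext fun i => ?_⟩
  rw [coord_changeScalars, LinearEquiv.apply_symm_apply]
  exact ha i

/-- In a frame, membership is an equation of sections, and pull-back along an open immersion is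
injective on sections over open subsets of its image. -/
theorem mem_sec_of_pull (f : T ⟶ X) [IsOpenImmersion f.left] (hL : IsSubbundle L r)
    {W : X.left.Opens} (hW : W ≤ f.left.opensRange) {z : Γ(X.left, W) ⊗[ZMod p] M}
    (hz : pull M f W (f.left ⁻¹ᵁ W) le_rfl z ∈ sec (pullbackSub f L) (f.left ⁻¹ᵁ W)) :
    z ∈ sec L W := by
  rw [isSubbundle_iff] at hL
  refine hL.1 W z fun s hs => ?_
  obtain ⟨U, σ, x, hsU, hx⟩ := hL.2 s
  refine ⟨W ⊓ U, inf_le_left, ⟨hs, hsU⟩, ?_⟩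
  rw [hx.mem_iff inf_le_right]
  refine pull_injective f (inf_le_left.trans hW) ?_
  rw [pull_sum_coord]
  refine ((hx.pullback f (W := f.left ⁻¹ᵁ U) le_rfl).mem_iff
    ((Opens.map f.left.base).map (homOfLE (inf_le_right : W ⊓ U ≤ U))).le _).1 ?_ |>.trans ?_
  · rw [pull_res]
    have := res_mem _ ((Opens.map f.left.base).map (homOfLE (inf_le_left : W ⊓ U ≤ W))).le hz
    rwa [res_pull] at this
  · simp only [res_pull]

variable {ι : Type} {Z : ι → Sch p} (f : ∀ i, Z i ⟶ X)

/-- The subsheaf of sections whose pull-backs to all `Z i` lie in `L i`. -/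
def glueSub (L : ∀ i, SubModule M (Z i)) : SubModule M X :=
  mkSub X (fun W =>
    { carrier := {z | ∀ i, pull M (f i) W ((f i).left ⁻¹ᵁ W) le_rfl z ∈ sec (L i) ((f i).left ⁻¹ᵁ W)}
      zero_mem' := fun i => by rw [map_zero]; exact Submodule.zero_mem _
      add_mem' := fun ha hb i => by rw [map_add]; exact Submodule.add_mem _ (ha i) (hb i)
      smul_mem' := fun a z hz i => by
        rw [pull, changeScalars_smul]; exact Submodule.smul_mem _ _ (hz i) })
    (fun U U' h z hz i => by
      have := res_mem (L i) ((Opens.map (f i).left.base).map (homOfLE h)).le (hz i)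
      rw [res_pull] at this
      rwa [pull_res])

variable {f} [∀ i, IsOpenImmersion (f i).left]

theorem isSubsheaf_glueSub {L : ∀ i, SubModule M (Z i)} (hL : ∀ i, IsSubsheaf (L i)) :
    IsSubsheaf (glueSub f L) := by
  intro U z hz i
  refine hL i _ _ fun s hs => ?_
  obtain ⟨W, hW, hsW, h⟩ := hz ((f i).left s) hs
  refine ⟨(f i).left ⁻¹ᵁ W, ((Opens.map (f i).left.base).map (homOfLE hW)).le, hsW, ?_⟩
  have := h i
  rw [pull_res] at this
  rwa [res_pull]

/-- A frame on `Z i` is carried to its open image in `X`. The real content is that, over this image,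
the condition that defines `glueSub` for the index `i` implies the conditions for all other indices.
-/
theorem exists_isFrame_glueSub {L : ∀ i, SubModule M (Z i)} (hL : ∀ i, IsSubbundle (L i) d)
    (hc : ∀ (i j : ι) (S : Sch p) (g : S ⟶ Z i) (g' : S ⟶ Z j), g ≫ f i = g' ≫ f j →
      pullbackSub g (L i) = pullbackSub g' (L j))
    {i : ι} {A : (Z i).left.Opens} {x : Fin d → Γ((Z i).left, A) ⊗[ZMod p] M}
    (hx : IsFrame (L i) A σ x) :
    ∃ x' : Fin d → Γ(X.left, (f i).left ''ᵁ A) ⊗[ZMod p] M,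
      (∀ j, pull M (f i) _ A (Scheme.Hom.preimage_image_eq _ A).ge (x' j) = x j) ∧
      IsFrame (glueSub f L) ((f i).left ''ᵁ A) σ x' := by
  have hr : (f i).left ''ᵁ A ≤ (f i).left.opensRange := Scheme.Hom.image_le_opensRange _ _
  have hA : (f i).left ⁻¹ᵁ ((f i).left ''ᵁ A) ≤ A := (Scheme.Hom.preimage_image_eq _ A).le
  have hA' : A ≤ (f i).left ⁻¹ᵁ ((f i).left ''ᵁ A) := (Scheme.Hom.preimage_image_eq _ A).ge
  choose x' hx' using fun j => pull_surjective (f i) hr (res M (Z i) hA (x j))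
  have hx'' : ∀ j, pull M (f i) _ A hA' (x' j) = x j := by
    intro j
    rw [← res_pull (f i) le_rfl hA', hx', res_res, res_refl]
  have hpull : ∀ (W : X.left.Opens) (h : W ≤ (f i).left ''ᵁ A) (z : Γ(X.left, W) ⊗[ZMod p] M),
      pull M (f i) W _ le_rfl z ∈ sec (L i) ((f i).left ⁻¹ᵁ W) ↔
        z = ∑ j, coord z (σ j) • res M X h (x' j) := by
    intro W h z
    have hWA : (f i).left ⁻¹ᵁ W ≤ A := ((Opens.map (f i).left.base).map (homOfLE h)).le.trans hA
    rw [hx.mem_iff hWA, ← (pull_injective (f i) (h.trans hr)).eq_iff, pull_sum_coord]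
    have e : ∀ j, res M (Z i) hWA (x j) = pull M (f i) _ _ (hWA.trans hA') (x' j) := by
      intro j
      rw [← hx'', res_pull]
    simp only [e]
  refine ⟨x', hx'', isFrame_of_mem_iff ?_ fun W h z => ⟨fun hz => (hpull W h z).1 (hz i), ?_⟩⟩
  · intro j k
    refine (bijective_app (f i) hr).1 ?_
    have := coord_changeScalars ((f i).left.appLE _ _ le_rfl).hom (x' j) (σ k)
    rw [hx', coord_res, hx.norm] at this
    refine this.symm.trans ?_
    split_ifs <;> simp
  · intro hz k
    have hzi := (hpull W h z).2 hz
    -- The part of `Z k` over `W`. As `W` lies in the image of `f i`, it also maps to `Z i`, and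
    -- `hc` compares the two pull-backs there.
    let S : Sch p := Over.mk (((f k).left ⁻¹ᵁ W).ι ≫ (Z k).hom)
    let g' : S ⟶ Z k := Over.homMk ((f k).left ⁻¹ᵁ W).ι
    have hg' : IsOpenImmersion g'.left := inferInstanceAs (IsOpenImmersion ((f k).left ⁻¹ᵁ W).ι)
    have hrange : Set.range (g'.left ≫ (f k).left) ⊆ Set.range (f i).left := by
      rintro _ ⟨t, rfl⟩
      exact hr (h (show (f k).left t.1 ∈ W from t.2))
    let g : S ⟶ Z i := Over.homMk (IsOpenImmersion.lift (f i).left (g'.left ≫ (f k).left) hrange) (by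
      have h1 := Over.w (f i)
      have h2 := Over.w (f k)
      have h3 := Over.w g'
      have h1' : (f i).left ≫ X.hom = (Z i).hom := h1
      rw [← h1', ← Category.assoc, IsOpenImmersion.lift_fac, Category.assoc]
      exact (congrArg (g'.left ≫ ·) h2).trans h3)
    have hgf : g ≫ f i = g' ≫ f k := by
      ext1
      exact IsOpenImmersion.lift_fac _ _ _
    have hS : (f k).left ⁻¹ᵁ W ≤ g'.left.opensRange := by
      rw [show g'.left.opensRange = (f k).left ⁻¹ᵁ W from Scheme.Opens.opensRange_ι _]
    refine mem_sec_of_pull g' (hL k) hS ?_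
    rw [← hc i k S g g' hgf]
    have hle : g'.left ⁻¹ᵁ ((f k).left ⁻¹ᵁ W) ≤ g.left ⁻¹ᵁ ((f i).left ⁻¹ᵁ W) := by
      have : (g ≫ f i).left ⁻¹ᵁ W = (g' ≫ f k).left ⁻¹ᵁ W := by rw [hgf]
      exact this.ge
    have e1 := pull_pull (f k) g' (le_refl ((f k).left ⁻¹ᵁ W)) le_rfl le_rfl z
    have e2 := pull_pull (f i) g (le_refl ((f i).left ⁻¹ᵁ W)) hle (by rw [hgf]; exact le_rfl) z
    have e3 : pull M (g ≫ f i) W (g'.left ⁻¹ᵁ ((f k).left ⁻¹ᵁ W)) (by rw [hgf]; exact le_rfl) z =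
        pull M (g' ≫ f k) W (g'.left ⁻¹ᵁ ((f k).left ⁻¹ᵁ W)) le_rfl z := by
      congr 2
    rw [e1, ← e3, ← e2]
    exact mem_pullbackSub g hle hzi

theorem flag_ext_of_cover {F F' : Flag M X} (hF : IsModuli B d e c X F) (hF' : IsModuli B d e c X F')
    (hcov : ∀ s : X.left, ∃ i t, (f i).left t = s) (h : ∀ i, F.pullback (f i) = F'.pullback (f i)) :
    F = F' := by
  have key : ∀ {r : ℕ} {L L' : SubModule M X}, IsSubbundle L r → IsSubbundle L' r →
      (∀ i, pullbackSub (f i) L = pullbackSub (f i) L') → L ≤ L' := by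
    intro r L L' hL hL' h
    refine hL'.1.le_of_locally fun s => ?_
    obtain ⟨i, t, rfl⟩ := hcov s
    refine ⟨(f i).left.opensRange, ⟨t, rfl⟩, fun W hW z hz => mem_sec_of_pull (f i) hL' hW ?_⟩
    rw [← h]
    exact mem_pullbackSub (f i) le_rfl hz
  apply Flag.ext
  · exact le_antisymm (key hF.small hF'.small fun i => congrArg Flag.small (h i))
      (key hF'.small hF.small fun i => congrArg Flag.small (h i).symm)
  · exact le_antisymm (key hF.big hF'.big fun i => congrArg Flag.big (h i))
      (key hF'.big hF.big fun i => congrArg Flag.big (h i).symm)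

/-- Effective descent of pairs along Zariski covers; together with `flag_ext_of_cover` it makes the
moduli functor a sheaf. -/
theorem exists_flag_glue (hcov : ∀ s : X.left, ∃ i t, (f i).left t = s) (F : ∀ i, Flag M (Z i))
    (hF : ∀ i, IsModuli B d e c (Z i) (F i))
    (hc : ∀ (i j : ι) (S : Sch p) (g : S ⟶ Z i) (g' : S ⟶ Z j), g ≫ f i = g' ≫ f j →
      (F i).pullback g = (F j).pullback g') :
    ∃ G : Flag M X, IsModuli B d e c X G ∧ ∀ i, G.pullback (f i) = F i := by
  let G : Flag M X :=
    { small := glueSub f fun i => (F i).small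
      big := glueSub f fun i => (F i).big
      le := fun U z hz i => (F i).le _ (hz i) }
  have hG : ∀ i (A : (Z i).left.Opens) (σ : Fin d ↪ Fin (Module.finrank (ZMod p) M))
      (τ : Fin e ↪ Fin (Module.finrank (ZMod p) M)) (x y), IsFlagFrame (F i) A σ τ x y →
      ∃ x' y', IsFlagFrame G ((f i).left ''ᵁ A) σ τ x' y' ∧
        (∀ j, pull M (f i) _ A (Scheme.Hom.preimage_image_eq _ A).ge (x' j) = x j) ∧
        (∀ j, pull M (f i) _ A (Scheme.Hom.preimage_image_eq _ A).ge (y' j) = y j) := by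
    intro i A σ τ x y h
    obtain ⟨x', hx', h1⟩ := exists_isFrame_glueSub (L := fun i => (F i).small)
      (fun i => (hF i).small) (fun i j S g g' hg => congrArg Flag.small (hc i j S g g' hg)) h.small
    obtain ⟨y', hy', h2⟩ := exists_isFrame_glueSub (L := fun i => (F i).big)
      (fun i => (hF i).big) (fun i j S g g' hg => congrArg Flag.big (hc i j S g g' hg)) h.big
    exact ⟨x', y', ⟨h1, h2⟩, hx', hy'⟩
  have hmod : IsModuli B d e c X G := by
    refine isModuli_of_locally (isSubsheaf_glueSub fun i => (hF i).small.1)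
      (isSubsheaf_glueSub fun i => (hF i).big.1) fun s => ?_
    obtain ⟨i, t, rfl⟩ := hcov s
    obtain ⟨A, σ, τ, x, y, ht, h⟩ := (hF i).exists_frame t
    obtain ⟨x', y', h', hx', hy'⟩ := hG i A σ τ x y h
    refine ⟨_, σ, τ, x', y', ⟨t, ht, rfl⟩, h', ?_⟩
    have hch := (hF i).isChart h
    -- Functions on the image of `A` embed into functions on `A`, so the chart equations can be
    -- verified on the cover.
    have hinj : Function.Injective ((f i).left.appLE ((f i).left ''ᵁ A) A
        (Scheme.Hom.preimage_image_eq _ A).ge) := by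
      have hr : (f i).left ''ᵁ A ≤ (f i).left.opensRange := Scheme.Hom.image_le_opensRange _ _
      intro a b hab
      refine (bijective_app (f i) hr).1 ?_
      have hA : (f i).left ⁻¹ᵁ ((f i).left ''ᵁ A) ≤ A := (Scheme.Hom.preimage_image_eq _ A).le
      have e := Scheme.Hom.appLE_map (f i).left (Scheme.Hom.preimage_image_eq _ A).ge (homOfLE hA).op
      have e1 := ConcreteCategory.congr_hom e a
      have e2 := ConcreteCategory.congr_hom e b
      refine e1.symm.trans (Eq.trans ?_ e2)
      exact congrArg ((Z i).left.presheaf.map (homOfLE hA).op) hab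
    rw [isChart_iff] at hch ⊢
    intro a ha
    have := hch _ (by
      have := chartRel_map ((f i).left.appLE ((f i).left ''ᵁ A) A
        (Scheme.Hom.preimage_image_eq _ A).ge).hom a ha
      simp only [hx', hy'] at this
      exact this)
    exact hinj (this.trans (map_zero _).symm)
  refine ⟨G, hmod, fun i => ?_⟩
  refine Flag.eq_of_frames (hmod.pullback (f i)) (hF i) fun t => ?_
  obtain ⟨A, σ, τ, x, y, ht, h⟩ := (hF i).exists_frame t
  obtain ⟨x', y', h', hx', hy'⟩ := hG i A σ τ x y h
  have := h'.pullback (f i) (Scheme.Hom.preimage_image_eq _ A).ge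
  simp only [hx', hy'] at this
  exact ⟨A, σ, τ, x, y, ht, this, h⟩

end Moduli
end
end OrthDL

namespace OrthDL
noncomputable section
variable {p : ℕ} [Fact p.Prime]

/-! ### Connected components of Noetherian spaces -/

/-- Irreducible components are connected, so each one that meets the connected component lies inside
it. The complement is the union of the others, which are closed and finite in number. -/
theorem isOpen_connectedComponent_of_noetherianSpace {α : Type} [TopologicalSpace α]
    [NoetherianSpace α] (x : α) : IsOpen (connectedComponent x) := by
  have h : (connectedComponent x)ᶜ =
      ⋃₀ {Z | Z ∈ irreducibleComponents α ∧ Disjoint Z (connectedComponent x)} := by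
    ext y
    constructor
    · intro hy
      refine ⟨irreducibleComponent y, ⟨irreducibleComponent_mem_irreducibleComponents y, ?_⟩,
        mem_irreducibleComponent⟩
      rw [Set.disjoint_left]
      intro z hz hz'
      have h1 : irreducibleComponent y ⊆ connectedComponent z :=
        isIrreducible_irreducibleComponent.isConnected.isPreconnected.subset_connectedComponent hz
      rw [← connectedComponent_eq hz'] at h1
      exact hy (h1 mem_irreducibleComponent)
    · rintro ⟨Z, ⟨-, hZ⟩, hy⟩ hy'
      exact Set.disjoint_left.1 hZ hy hy'
  rw [← isClosed_compl_iff, h]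
  rw [Set.sUnion_eq_biUnion]
  refine Set.Finite.isClosed_biUnion ?_ ?_
  · exact NoetherianSpace.finite_irreducibleComponents.subset fun Z hZ => hZ.1
  · rintro Z ⟨hZ, -⟩
    exact isClosed_of_mem_irreducibleComponents Z hZ

/-- Around a point of the component, an affine open subset is a Noetherian space. Its own component
through the point is open and, being connected, stays inside the given one. -/
theorem isOpen_connectedComponent_of_isLocallyNoetherian (X : Scheme.{0}) [IsLocallyNoetherian X]
    (x : X) : IsOpen (connectedComponent x) := by
  rw [isOpen_iff_forall_mem_open]
  intro y hy
  obtain ⟨U, hU, hyU, -⟩ := X.isBasis_affineOpens.exists_subset_of_mem_open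
    (Set.mem_univ y) isOpen_univ
  obtain ⟨U, hUa, rfl⟩ := hU
  have : IsNoetherianRing Γ(X, U) := IsLocallyNoetherian.component_noetherian ⟨U, hUa⟩
  have : NoetherianSpace (U : Set X) := noetherianSpace_of_isAffineOpen U hUa
  refine ⟨Subtype.val '' connectedComponent (⟨y, hyU⟩ : (U : Set X)), ?_, ?_, ?_⟩
  · rw [connectedComponent_eq hy]
    exact (isPreconnected_connectedComponent.image _
      continuous_subtype_val.continuousOn).subset_connectedComponent
        ⟨_, mem_connectedComponent, rfl⟩
  · exact U.isOpen.isOpenMap_subtype_val _ (isOpen_connectedComponent_of_noetherianSpace _)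
  · exact ⟨_, mem_connectedComponent, rfl⟩

/-! ### Representability of the moduli problem of flags -/

section Representability

variable {M : Type} [AddCommGroup M] [Module (ZMod p) M] [FiniteDimensional (ZMod p) M]
variable (B : LinearMap.BilinForm (ZMod p) M) (d e : ℕ) (c : Prop)

/-- An `𝔽_{p²}`-structure on `S` together with an admissible pair. -/
def FlagPoint (S : Scheme.{0}) : Type :=
  Σ h : S ⟶ Spec (CommRingCat.of (GaloisField p 2)), {F : Flag M (Over.mk h) // IsModuli B d e c _ F}

variable {B d e c}

theorem mem_basicOpen_of_isUnit {X T : Scheme.{0}} (f : T ⟶ X) {U : X.Opens} {W : T.Opens}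
    (h : W ≤ f ⁻¹ᵁ U) {a : Γ(X, U)} (ha : IsUnit (f.appLE U W h a)) {t : T} (ht : t ∈ W) :
    f t ∈ X.basicOpen a := by
  have h1 : t ∈ T.basicOpen (f.appLE U W h a) := by
    rw [Scheme.basicOpen_of_isUnit _ ha]
    exact ht
  have h2 : f.appLE U W h a = T.presheaf.map (homOfLE h).op (f.app U a) := rfl
  rw [h2, Scheme.basicOpen_res] at h1
  have h3 := Scheme.preimage_basicOpen f a
  exact h3.ge h1.2

/-- If the pull-back has a frame with pivots `σ`, the change of basis from the given frame shows
that its minor at `σ` becomes a unit on `T`. A function whose pull-back is a unit does not vanish at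
`f t`, so `σ` is a set of pivots near `f t` as well. -/
theorem IsFrame.exists_isFrame_of_pullback {X T : Sch p} {L : SubModule M X} {U : X.left.Opens}
    {σ σ' : Fin d ↪ Fin (Module.finrank (ZMod p) M)} {x : Fin d → Γ(X.left, U) ⊗[ZMod p] M}
    (hx : IsFrame L U σ' x) (f : T ⟶ X) {W : T.left.Opens} (hW : W ≤ f.left ⁻¹ᵁ U)
    {x' : Fin d → Γ(T.left, W) ⊗[ZMod p] M} (hx' : IsFrame (pullbackSub f L) W σ x') {t : T.left}
    (ht : t ∈ W) : ∃ (A : X.left.Opens) (y : Fin d → Γ(X.left, A) ⊗[ZMod p] M),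
      f.left t ∈ A ∧ IsFrame L A σ y := by
  have h1 := hx.pullback f hW
  have h2 : ∀ j, x' j = ∑ k, coord (x' j) (σ' k) • pull M f U W hW (x k) := fun j => by
    have := (h1.mem_iff le_rfl _).1 (hx'.mem j)
    simpa only [res_refl] using this
  have h3 : (Matrix.of fun j k => coord (x' j) (σ' k)) *
      minor σ (fun k => pull M f U W hW (x k)) = 1 := by
    rw [← hx'.norm.minor_eq]
    ext j i
    rw [Matrix.mul_apply]
    conv_rhs => rw [minor, Matrix.of_apply, h2 j, map_sum, Finset.sum_apply]
    refine Finset.sum_congr rfl fun k _ => ?_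
    rw [map_smul]
    rfl
  have h4 : IsUnit (f.left.appLE U W hW (minor σ x).det) := by
    have := congrArg Matrix.det h3
    rw [Matrix.det_mul, Matrix.det_one, minor_changeScalars, ← RingHom.map_det] at this
    exact IsUnit.of_mul_eq_one_right _ this
  have h5 := mem_basicOpen_of_isUnit f.left hW h4 ht
  obtain ⟨y, hy⟩ := exists_isFrame_of_det (X.left.basicOpen_le (minor σ x).det) hx.span
    (X.left.toRingedSpace.isUnit_res_basicOpen _)
  exact ⟨_, y, h5, hy⟩

variable {σ : Fin d ↪ Fin (Module.finrank (ZMod p) M)} {τ : Fin e ↪ Fin (Module.finrank (ZMod p) M)}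

variable (σ τ) in
/-- The points near which a pair has normalized frames with pivots `σ` and `τ`. -/
def frameLocus {X : Sch p} (F : Flag M X) : X.left.Opens where
  carrier := {s | ∃ (U : X.left.Opens) (x : Fin d → Γ(X.left, U) ⊗[ZMod p] M)
    (y : Fin e → Γ(X.left, U) ⊗[ZMod p] M), s ∈ U ∧ IsFlagFrame F U σ τ x y}
  is_open' := by
    rw [isOpen_iff_forall_mem_open]
    rintro s ⟨U, x, y, hs, h⟩
    exact ⟨U, fun t ht => ⟨U, x, y, ht, h⟩, U.isOpen, hs⟩

/-- The frame locus commutes with base change, and local frames with fixed pivots glue to a global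
one. Hence a morphism lands in the locus precisely when the pulled back pair is a point of the
chart. -/
theorem forall_mem_frameLocus_iff {X T : Sch p} {F : Flag M X} (hF : IsModuli B d e c X F)
    (f : T ⟶ X) : (∀ t, f.left t ∈ frameLocus σ τ F) ↔
      ∃ x y, IsFlagFrame (F.pullback f) (⊤ : T.left.Opens) σ τ x y := by
  constructor
  · intro h
    choose U x y hs hU using h
    obtain ⟨x', hx'⟩ := (hF.pullback f).small.1.exists_isFrame_of_locally (U := ⊤) (σ := σ)
      fun t _ => ⟨_, _, hs t, (hU t).small.pullback f le_rfl⟩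
    obtain ⟨y', hy'⟩ := (hF.pullback f).big.1.exists_isFrame_of_locally (U := ⊤) (σ := τ)
      fun t _ => ⟨_, _, hs t, (hU t).big.pullback f le_rfl⟩
    exact ⟨x', y', hx', hy'⟩
  · rintro ⟨x, y, h⟩ t
    obtain ⟨U, σ', τ', x', y', hs, h'⟩ := hF.exists_frame (f.left t)
    obtain ⟨A, a, ha, hA⟩ := h'.small.exists_isFrame_of_pullback f (le_refl (f.left ⁻¹ᵁ U))
      (h.small.restrict le_top) hs
    obtain ⟨A', a', ha', hA'⟩ := h'.big.exists_isFrame_of_pullback f (le_refl (f.left ⁻¹ᵁ U))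
      (h.big.restrict le_top) hs
    exact ⟨A ⊓ A', _, _, ⟨ha, ha'⟩, hA.restrict inf_le_left, hA'.restrict inf_le_right⟩

variable (B c σ τ) in
/-- The universal pair on a chart. -/
abbrev univFlag : Flag M (chart B c σ τ) := chartFlag (isChart_univ B c σ τ)

theorem univFlag_pullback {T : Sch p} (m : T ⟶ chart B c σ τ) :
    IsFlagFrame ((univFlag B c σ τ).pullback m) (⊤ : T.left.Opens) σ τ
      (fun j => pull M m ⊤ ⊤ le_top (chartSmall B c σ τ j))
      fun j => pull M m ⊤ ⊤ le_top (chartBig B c σ τ j) :=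
  (isFlagFrame_chartFlag (isChart_univ B c σ τ)).pullback m le_top

theorem chart_hom_ext_of_flag {T : Sch p} {m m' : T ⟶ chart B c σ τ}
    (h : (univFlag B c σ τ).pullback m = (univFlag B c σ τ).pullback m') : m = m' := by
  have h1 := univFlag_pullback m
  rw [h] at h1
  obtain ⟨h2, h3⟩ := (univFlag_pullback m').unique h1
  exact chart_hom_ext B c σ τ (fun j => congrFun h2 j) fun j => congrFun h3 j

theorem exists_hom_chart {T : Sch p} {F : Flag M T} (hF : IsModuli B d e c T F)
    {x : Fin d → Γ(T.left, ⊤) ⊗[ZMod p] M} {y : Fin e → Γ(T.left, ⊤) ⊗[ZMod p] M}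
    (h : IsFlagFrame F ⊤ σ τ x y) :
    ∃ m : T ⟶ chart B c σ τ, (univFlag B c σ τ).pullback m = F := by
  obtain ⟨m, hx, hy⟩ := exists_chart_hom B c σ τ (hF.isChart h)
  refine ⟨m, Flag.eq_of_frames ((isModuli_chartFlag _).pullback m) hF fun s => ?_⟩
  have := univFlag_pullback m
  simp only [hx, hy] at this
  exact ⟨⊤, σ, τ, x, y, trivial, this, h⟩

/-- The pull-back of a `FlagPoint`. -/
def FlagPoint.map {S S' : Scheme.{0}} (f : S' ⟶ S) (a : FlagPoint B d e c S) :
    FlagPoint B d e c S' :=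
  ⟨f ≫ a.1, a.2.1.pullback (Over.homMk f : Over.mk (f ≫ a.1) ⟶ Over.mk a.1), a.2.2.pullback _⟩

/-- The two structure morphisms are equal only by a proof, so the pairs live on different objects
over `𝔽_{p²}`. Pull-back along the identity of `S` moves one pair to the other object. -/
theorem FlagPoint.ext {S : Scheme.{0}} {a b : FlagPoint B d e c S} (h : b.1 = a.1)
    (h' : a.2.1.pullback (Over.homMk (𝟙 S) (by simpa using h.symm) : Over.mk b.1 ⟶ Over.mk a.1) =
      b.2.1) : a = b := by
  obtain ⟨a, F, hF⟩ := a
  obtain ⟨b, F', hF'⟩ := b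
  obtain rfl : b = a := h
  congr 2
  rw [← hF.pullback_id]
  exact h'

theorem FlagPoint.map_id {S : Scheme.{0}} (a : FlagPoint B d e c S) : a.map (𝟙 S) = a :=
  FlagPoint.ext (Category.id_comp _).symm (by
    refine (a.2.2.pullback_comp _ _).trans (Eq.trans ?_ a.2.2.pullback_id)
    congr 1)

theorem FlagPoint.map_comp {S S' S'' : Scheme.{0}} (f : S' ⟶ S) (g : S'' ⟶ S')
    (a : FlagPoint B d e c S) : a.map (g ≫ f) = (a.map f).map g :=
  FlagPoint.ext (Category.assoc _ _ _).symm (by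
    refine (a.2.2.pullback_comp _ _).trans (Eq.trans ?_ (a.2.2.pullback_comp _ _).symm)
    congr 1)

theorem FlagPoint.map_left {S : Scheme.{0}} {T : Sch p} (a : FlagPoint B d e c S)
    (f : T ⟶ Over.mk a.1) :
    a.map f.left = ⟨T.hom, a.2.1.pullback f, a.2.2.pullback f⟩ := by
  have key : ∀ (k : T.left ⟶ Spec (CommRingCat.of (GaloisField p 2))) (hk : f.left ≫ a.1 = k),
      a.map f.left = ⟨k, a.2.1.pullback (Over.homMk f.left hk : Over.mk k ⟶ Over.mk a.1),
        a.2.2.pullback _⟩ := by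
    rintro _ rfl
    rfl
  exact key T.hom (Over.w f)

theorem FlagPoint.map_left_eq_iff {S S' : Scheme.{0}} {T : Sch p} {a : FlagPoint B d e c S}
    {b : FlagPoint B d e c S'} {f : T ⟶ Over.mk a.1} {g : T ⟶ Over.mk b.1} :
    a.map f.left = b.map g.left ↔ a.2.1.pullback f = b.2.1.pullback g := by
  rw [a.map_left, b.map_left]
  constructor
  · intro h
    exact congrArg Subtype.val (eq_of_heq (Sigma.mk.inj h).2)
  · intro h
    congr 2

variable (B d e c) in
/-- The functor of `FlagPoint`s. -/
def flagFunctor : Scheme.{0}ᵒᵖ ⥤ Type where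
  obj S := FlagPoint B d e c S.unop
  map f := ↾(FlagPoint.map f.unop)
  map_id S := by ext a; exact a.map_id
  map_comp f g := by ext a; exact a.map_comp _ _

/-- The structure morphisms to `Spec 𝔽_{p²}` glue, and with respect to the glued one the cover is a
cover over `𝔽_{p²}`, to which descent of pairs applies. -/
theorem exists_flagPoint_glue {Y : Scheme.{0}} (𝓤 : Scheme.OpenCover.{0} Y)
    (a : ∀ i, FlagPoint B d e c (𝓤.X i))
    (ha : ∀ i j (T : Scheme.{0}) (g : T ⟶ 𝓤.X i) (g' : T ⟶ 𝓤.X j), g ≫ 𝓤.f i = g' ≫ 𝓤.f j →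
      (a i).map g = (a j).map g') :
    ∃ b : FlagPoint B d e c Y, (∀ i, b.map (𝓤.f i) = a i) ∧
      ∀ b' : FlagPoint B d e c Y, (∀ i, b'.map (𝓤.f i) = a i) → b' = b := by
  let h : Y ⟶ Spec (CommRingCat.of (GaloisField p 2)) := 𝓤.glueMorphisms (fun j => (a j).1) (by
    intro i j
    exact congrArg Sigma.fst (ha i j _ _ _ Limits.pullback.condition))
  have hh : ∀ i, 𝓤.f i ≫ h = (a i).1 := fun i => 𝓤.ι_glueMorphisms _ _ i
  clear_value h
  let f : ∀ i, (Over.mk (a i).1 : Sch p) ⟶ Over.mk h := fun i => Over.homMk (𝓤.f i) (hh i)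
  have hf : ∀ i, IsOpenImmersion (f i).left := fun i => inferInstanceAs (IsOpenImmersion (𝓤.f i))
  have hcov : ∀ s : (Over.mk h : Sch p).left, ∃ i t, (f i).left t = s := fun s =>
    ⟨𝓤.idx s, 𝓤.covers s⟩
  have hc : ∀ (i j : 𝓤.I₀) (S : Sch p) (g : S ⟶ Over.mk (a i).1) (g' : S ⟶ Over.mk (a j).1),
      g ≫ f i = g' ≫ f j → (a i).2.1.pullback g = (a j).2.1.pullback g' := by
    intro i j S g g' hg
    exact (FlagPoint.map_left_eq_iff (a := a i) (b := a j) (f := g) (g := g')).1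
      (ha i j S.left g.left g'.left (congrArg CommaMorphism.left hg))
  obtain ⟨G, hG, hGf⟩ := exists_flag_glue (X := Over.mk h) (Z := fun i => Over.mk (a i).1) (f := f)
    (B := B) (d := d) (e := e) (c := c) hcov (fun i => (a i).2.1) (fun i => (a i).2.2) hc
  refine ⟨⟨h, G, hG⟩, fun i => ?_, ?_⟩
  · refine (FlagPoint.map_left (⟨h, G, hG⟩ : FlagPoint B d e c Y) (f i)).trans ?_
    simp only [hGf]
    rfl
  · rintro ⟨h', G', hG'⟩ hb
    have e : h' = h := 𝓤.hom_ext _ _ fun i =>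
      (congrArg Sigma.fst (hb i)).trans (hh i).symm
    subst e
    have : G' = G := flag_ext_of_cover (f := f) hG' hG hcov fun i => by
      rw [hGf]
      have h1 := FlagPoint.map_left (⟨h', G', hG'⟩ : FlagPoint B d e c Y) (f i)
      have h2 := h1.symm.trans (hb i)
      exact congrArg Subtype.val (eq_of_heq (Sigma.mk.inj h2).2)
    subst this
    rfl

theorem flagFunctor_isSheaf : Presieve.IsSheaf Scheme.zariskiTopology (flagFunctor B d e c) := by
  rw [Precoverage.isSheaf_toGrothendieck_iff_of_isStableUnderBaseChange_of_small.{0}]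
  intro Y (𝓤 : Scheme.OpenCover.{0} Y) x hx
  obtain ⟨b, hb, hb'⟩ := exists_flagPoint_glue 𝓤 (fun i => x (𝓤.f i) (.mk i))
    fun i j T g g' h => hx g g' (.mk i) (.mk j) h
  refine ⟨b, ?_, ?_⟩
  · rintro Z g ⟨i⟩
    exact hb i
  · intro b' h
    exact hb' b' fun i => h (𝓤.f i) (.mk i)

variable (B c σ τ) in
/-- The universal pair on a chart as a point of the moduli problem. -/
abbrev chartPoint : FlagPoint B d e c (chart B c σ τ).left :=
  ⟨(chart B c σ τ).hom, univFlag B c σ τ, isModuli_chartFlag _⟩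

variable (B d e c) in
/-- The morphism from a chart to the moduli functor. -/
def chartHom (i : (Fin d ↪ Fin (Module.finrank (ZMod p) M)) ×
    (Fin e ↪ Fin (Module.finrank (ZMod p) M))) :
    yoneda.obj (chart B c i.1 i.2).left ⟶ flagFunctor B d e c :=
  yonedaEquiv.symm (chartPoint B c i.1 i.2)

theorem chartPoint_hom_ext {S : Scheme.{0}} {m m' : S ⟶ (chart B c σ τ).left}
    (h : (chartPoint B c σ τ).map m = (chartPoint B c σ τ).map m') : m = m' := by
  have e : m ≫ (chart B c σ τ).hom = m' ≫ (chart B c σ τ).hom := congrArg Sigma.fst h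
  let f : Over.mk (m ≫ (chart B c σ τ).hom) ⟶ chart B c σ τ := Over.homMk m
  let f' : Over.mk (m ≫ (chart B c σ τ).hom) ⟶ chart B c σ τ := Over.homMk m' e.symm
  have : f = f' := chart_hom_ext_of_flag
    (FlagPoint.map_left_eq_iff (a := chartPoint B c σ τ) (b := chartPoint B c σ τ) |>.1 h)
  exact congrArg CommaMorphism.left this

theorem exists_chartHom_eq (i : (Fin d ↪ Fin (Module.finrank (ZMod p) M)) ×
    (Fin e ↪ Fin (Module.finrank (ZMod p) M))) {S : Scheme.{0}} (a : FlagPoint B d e c S)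
    (h : ∀ s, s ∈ frameLocus i.1 i.2 a.2.1) : ∃ m, (chartPoint B c i.1 i.2).map m = a := by
  obtain ⟨x, y, hxy⟩ := (forall_mem_frameLocus_iff a.2.2 (𝟙 _)).1 h
  rw [a.2.2.pullback_id] at hxy
  obtain ⟨m, hm⟩ := exists_hom_chart a.2.2 hxy
  refine ⟨m.left, (FlagPoint.map_left (chartPoint B c i.1 i.2) m).trans ?_⟩
  simp only [hm]
  rfl

/-- The fibre product of the chart with an `S`-valued point of the moduli functor is the frame locus
of the corresponding pair, an open subscheme of `S`. -/
theorem chartHom_isOpenImmersion (i : (Fin d ↪ Fin (Module.finrank (ZMod p) M)) ×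
    (Fin e ↪ Fin (Module.finrank (ZMod p) M))) : IsOpenImmersion.presheaf (chartHom B d e c i) := by
  refine MorphismProperty.relative.of_exists fun S g => ?_
  obtain ⟨a, rfl⟩ := yonedaEquiv.symm.surjective g
  let a' : FlagPoint B d e c S := a
  let D : S.Opens := frameLocus i.1 i.2 a'.2.1
  have hD : ∀ {T : Scheme.{0}} (f : T ⟶ S), (∀ t, f t ∈ D) ↔
      ∀ t, t ∈ frameLocus i.1 i.2 (a'.map f).2.1 := by
    intro T f
    let f' : (Over.mk (f ≫ a'.1) : Sch p) ⟶ Over.mk a'.1 := Over.homMk f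
    refine (forall_mem_frameLocus_iff a'.2.2 f').trans ?_
    refine Iff.trans ?_ (forall_mem_frameLocus_iff (a'.map f).2.2 (𝟙 _)).symm
    rw [(a'.map f).2.2.pullback_id]
    rfl
  obtain ⟨m, hm⟩ := exists_chartHom_eq i (a'.map D.ι) ((hD _).1 fun t => t.2)
  refine ⟨D, yoneda.map m, D.ι, ?_, inferInstance⟩
  refine IsPullback.of_forall_isPullback_app fun T => ?_
  rw [Limits.Types.isPullback_iff]
  refine ⟨?_, ?_, ?_⟩
  · ext f
    change (chartPoint B c i.1 i.2).map (f ≫ m) = a'.map (f ≫ D.ι)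
    rw [FlagPoint.map_comp, hm, FlagPoint.map_comp]
  · rintro f f' ⟨-, h⟩
    exact (cancel_mono D.ι).1 h
  · intro (k : T.unop ⟶ (chart B c i.1 i.2).left) (f : T.unop ⟶ S)
      (h : (chartPoint B c i.1 i.2).map k = a'.map f)
    have hf : ∀ t, f t ∈ D := by
      rw [hD, ← h]
      refine (forall_mem_frameLocus_iff (((chartPoint B c i.1 i.2).map k).2.2) (𝟙 _)).2 ?_
      rw [((chartPoint B c i.1 i.2).map k).2.2.pullback_id]
      exact ⟨_, _, univFlag_pullback _⟩
    let l : T.unop ⟶ D := IsOpenImmersion.lift D.ι f (by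
      rintro _ ⟨t, rfl⟩
      rw [Scheme.Opens.range_ι]
      exact hf t)
    have hl : l ≫ D.ι = f := IsOpenImmersion.lift_fac _ _ _
    refine ⟨l, chartPoint_hom_ext ?_, hl⟩
    change (chartPoint B c i.1 i.2).map (l ≫ m) = _
    rw [FlagPoint.map_comp, hm, ← FlagPoint.map_comp, hl, h]

variable (B d e c) in
/-- The functor of `FlagPoint`s as a Zariski sheaf. -/
def flagSheaf : Sheaf Scheme.zariskiTopology.{0} Type :=
  ⟨flagFunctor B d e c, (isSheaf_iff_isSheaf_of_type _ _).2 flagFunctor_isSheaf⟩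

/-- Every point of the base of a pair has a neighbourhood with frames for some choice of pivots, so
the charts cover the functor. -/
instance chartHom_isLocallySurjective :
    Presheaf.IsLocallySurjective Scheme.zariskiTopology
      (Limits.Sigma.desc (chartHom (p := p) B d e c)) where
  imageSieve_mem {S} a := by
    let a' : FlagPoint B d e c S := a
    let I := (Fin d ↪ Fin (Module.finrank (ZMod p) M)) × (Fin e ↪ Fin (Module.finrank (ZMod p) M))
    let U : I → S.Opens := fun i => frameLocus i.1 i.2 a'.2.1
    have hU : IsOpenCover U := by
      refine eq_top_iff.2 fun s _ => ?_
      obtain ⟨A, σ, τ, x, y, hs, h⟩ := a'.2.2.exists_frame s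
      exact Opens.mem_iSup.2 ⟨(σ, τ), A, x, y, hs, h⟩
    refine Scheme.mem_grothendieckTopology_iff.2 ⟨S.openCoverOfIsOpenCover U hU, ?_⟩
    rintro T f ⟨i⟩
    obtain ⟨m, hm⟩ := exists_chartHom_eq i (a'.map (U i).ι) (by
      have := (forall_mem_frameLocus_iff (σ := i.1) (τ := i.2) a'.2.2
        (Over.homMk (U i).ι : Over.mk ((U i).ι ≫ a'.1) ⟶ Over.mk a'.1)).1 fun t => t.2
      refine (forall_mem_frameLocus_iff (a'.map (U i).ι).2.2 (𝟙 _)).2 ?_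
      rw [(a'.map (U i).ι).2.2.pullback_id]
      exact this)
    refine ⟨(Limits.Sigma.ι (fun i : I => yoneda.obj (chart B c i.1 i.2).left) i).app (op _) m, ?_⟩
    have h1 := Limits.Sigma.ι_desc (chartHom (p := p) B d e c) i
    have h2 := ConcreteCategory.congr_hom (NatTrans.congr_app h1 (op (U i : Scheme.{0}))) m
    exact h2.trans hm

-- A Zariski sheaf covered by open subfunctors that are schemes is a scheme. The charts are spectra
-- of finitely generated `𝔽_{p²}`-algebras, which gives local Noetherianity; this is needed for
-- connected components to be open.
variable (B d e c) in
theorem exists_represents_isModuli : ∃ (G : Sch p) (u : Flag M G), IsLocallyNoetherian G.left ∧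
    Represents (IsModuli B d e c) G u := by
  let F := flagSheaf B d e c
  let hf : ∀ i, IsOpenImmersion.presheaf (Y := F.1) (chartHom B d e c i) := chartHom_isOpenImmersion
  let r := @Scheme.LocalRepresentability.representableBy F _ _ _ hf
    (chartHom_isLocallySurjective (p := p) (B := B) (d := d) (e := e) (c := c))
  let Y := (Scheme.LocalRepresentability.glueData hf).glued
  have hN : IsLocallyNoetherian Y := by
    rw [isLocallyNoetherian_iff_openCover (Scheme.LocalRepresentability.glueData hf).openCover]
    intro i
    have : IsNoetherianRing (ChartRing B c i.1 i.2) := inferInstance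
    exact inferInstanceAs (IsLocallyNoetherian (Spec (CommRingCat.of (ChartRing B c i.1 i.2))))
  -- The universal point contains a structure morphism, which makes `Y` a scheme over `𝔽_{p²}`.
  let a : FlagPoint B d e c Y := r.homEquiv (𝟙 Y)
  have ha : ∀ (T : Scheme.{0}) (b : FlagPoint B d e c T), ∃! f : T ⟶ Y, a.map f = b := by
    intro T b
    have key : ∀ f : T ⟶ Y, a.map f = r.homEquiv f := fun f => (r.homEquiv_eq f).symm
    refine ⟨r.homEquiv.symm b, ?_, ?_⟩
    · exact (key _).trans (r.homEquiv.apply_symm_apply b)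
    · intro f hf
      exact (Equiv.eq_symm_apply _).2 ((key f).symm.trans hf)
  clear_value a
  refine ⟨Over.mk a.1, a.2.1, hN, a.2.2, fun T f => a.2.2.pullback f, fun T F hF => ?_⟩
  obtain ⟨f, hf, hf'⟩ := ha T.left ⟨T.hom, F, hF⟩
  have hw : f ≫ a.1 = T.hom := congrArg Sigma.fst hf
  let g : T ⟶ Over.mk a.1 := Over.homMk f hw
  have hg : ∀ g' : T ⟶ Over.mk a.1, a.map g'.left = ⟨T.hom, F, hF⟩ ↔ a.2.1.pullback g' = F := by
    intro g'
    rw [a.map_left]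
    constructor
    · intro h
      exact congrArg Subtype.val (eq_of_heq (Sigma.mk.inj h).2)
    · rintro rfl
      rfl
  refine ⟨g, (hg g).1 hf, fun g' h => ?_⟩
  ext1
  exact hf' _ ((hg g').2 h)

end Representability
end
end OrthDL

namespace OrthDL
noncomputable section
variable {p : ℕ} [Fact p.Prime]

/-! ### Maximal isotropic subspaces -/

section Isotropic

variable {M : Type} [AddCommGroup M] [Module (ZMod p) M] [FiniteDimensional (ZMod p) M]
variable {R : Type} [CommRing R] [Algebra (ZMod p) R]
variable {B : LinearMap.BilinForm (ZMod p) M} {r : ℕ}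

/-- Nondegeneracy survives base change: the dual basis over `𝔽_p` still represents every functional
over `R`. -/
theorem exists_form_eq (hnd : B.Nondegenerate) (f : R ⊗[ZMod p] M →ₗ[R] R) :
    ∃ z : R ⊗[ZMod p] M, ∀ x, B.baseChange R z x = f x := by
  classical
  let v := Module.finBasis (ZMod p) M
  let v' := B.dualBasis hnd v
  refine ⟨∑ i, f (1 ⊗ₜ v i) • (1 ⊗ₜ v' i), fun x => ?_⟩
  have h : B.baseChange R (∑ i, f (1 ⊗ₜ v i) • (1 ⊗ₜ v' i)) = f := by
    refine (v.baseChange R).ext fun j => ?_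
    rw [Module.Basis.baseChange_apply, map_sum, LinearMap.sum_apply]
    simp only [map_smul, LinearMap.smul_apply, LinearMap.BilinForm.baseChange_tmul]
    rw [Finset.sum_eq_single j]
    · simp [v', LinearMap.BilinForm.apply_dualBasis_left]
    · intro i _ hi
      simp [v', LinearMap.BilinForm.apply_dualBasis_left, hi.symm]
    · simp
  rw [h]

theorem IsNormalized.exists_dual (hnd : B.Nondegenerate)
    {σ : Fin r ↪ Fin (Module.finrank (ZMod p) M)} {y : Fin r → R ⊗[ZMod p] M}
    (hy : IsNormalized σ y) :
    ∃ z : Fin r → R ⊗[ZMod p] M, ∀ i j, B.baseChange R (z i) (y j) = if i = j then 1 else 0 := by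
  have h : ∀ i, ∃ z : R ⊗[ZMod p] M, ∀ x, B.baseChange R z x = coord x (σ i) := fun i =>
    exists_form_eq hnd ((LinearMap.proj (σ i)).comp (coord (R := R) (M := M)).toLinearMap)
  choose z hz using h
  refine ⟨z, fun i j => ?_⟩
  rw [hz, hy j i]
  simp only [eq_comm]

/-- The pairings with `y` and with a dual system `z` give a surjection between free modules of the
same rank `2r`, which is therefore injective. A vector orthogonal to `y` has the same image as the
combination of the `y j` with coefficients its pairings with the `z j`. -/
theorem IsNormalized.mem_span_of_form_eq_zero (hB : B.IsSymm) (hnd : B.Nondegenerate)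
    (hr : Module.finrank (ZMod p) M = 2 * r)
    {σ : Fin r ↪ Fin (Module.finrank (ZMod p) M)} {y : Fin r → R ⊗[ZMod p] M}
    (hy : IsNormalized σ y) (hiso : ∀ i j, B.baseChange R (y i) (y j) = 0)
    {x : R ⊗[ZMod p] M} (hx : ∀ j, B.baseChange R x (y j) = 0) :
    x ∈ Submodule.span R (Set.range y) := by
  classical
  obtain ⟨z, hz⟩ := hy.exists_dual hnd
  let ψ : R ⊗[ZMod p] M →ₗ[R] (Fin r ⊕ Fin r → R) :=
    LinearMap.pi (Sum.elim (fun j => (B.baseChange R).flip (y j)) fun j => (B.baseChange R).flip (z j))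
  have hψl : ∀ x j, ψ x (Sum.inl j) = B.baseChange R x (y j) := fun _ _ => rfl
  have hψr : ∀ x j, ψ x (Sum.inr j) = B.baseChange R x (z j) := fun _ _ => rfl
  have hsurj : Function.Surjective ψ := by
    intro t
    let u := ∑ i, t (Sum.inl i) • z i
    -- The vector `u` has the right pairings with `y`. The correction by the `y i` repairs the
    -- pairings with `z` and does not disturb the former, as `y` is isotropic.
    refine ⟨u + ∑ i, (t (Sum.inr i) - B.baseChange R u (z i)) • y i, ?_⟩
    have hy' : ∀ (a : Fin r → R) j, B.baseChange R (∑ i, a i • y i) (y j) = 0 := by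
      intro a j
      simp [map_sum, LinearMap.sum_apply, hiso]
    have hz' : ∀ (a : Fin r → R) j, B.baseChange R (∑ i, a i • y i) (z j) = a j := by
      intro a j
      simp [map_sum, LinearMap.sum_apply, baseChange_symm hB (y _) (z j), hz]
    ext (j | j)
    · rw [hψl, map_add, LinearMap.add_apply, hy', add_zero]
      simp [u, map_sum, LinearMap.sum_apply, hz]
    · rw [hψr, map_add, LinearMap.add_apply, hz']
      ring
  have hinj : Function.Injective ψ := by
    let e : (Fin (Module.finrank (ZMod p) M)) ≃ Fin r ⊕ Fin r :=
      (finCongr (by omega : Module.finrank (ZMod p) M = r + r)).trans finSumFinEquiv.symm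
    let E : R ⊗[ZMod p] M ≃ₗ[R] (Fin r ⊕ Fin r → R) := coord.trans (LinearEquiv.funCongrLeft R R e.symm)
    exact OrzechProperty.injective_of_surjective_of_injective E.toLinearMap ψ E.injective hsurj
  have : x = ∑ j, B.baseChange R x (z j) • y j := by
    refine hinj ?_
    ext (j | j)
    · rw [hψl, hψl, hx]
      simp [map_sum, LinearMap.sum_apply, hiso]
    · rw [hψr, hψr]
      simp [map_sum, LinearMap.sum_apply, baseChange_symm hB (y _) (z j), hz]
  rw [this]
  exact Submodule.sum_mem _ fun j _ => Submodule.smul_mem _ _ (Submodule.subset_span ⟨j, rfl⟩)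

variable {K : Type} [Field K] [Algebra (ZMod p) K]

/-- The polynomial `X ^ p - X` has at most `p` roots in `K`, and the elements of `𝔽_p` already are
`p` roots. -/
theorem exists_algebraMap_of_pow_eq {a : K} (h : a ^ p = a) : ∃ b : ZMod p, algebraMap (ZMod p) K b = a := by
  classical
  have hp := (Fact.out : p.Prime)
  let P : Polynomial K := Polynomial.X ^ p - Polynomial.X
  have hP : P ≠ 0 := FiniteField.X_pow_card_sub_X_ne_zero K hp.one_lt
  have hdeg : P.natDegree = p := FiniteField.X_pow_card_sub_X_natDegree_eq K hp.one_lt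
  let S : Finset K := Finset.univ.image (algebraMap (ZMod p) K)
  have hS : S.card = p := by
    rw [Finset.card_image_of_injective _ (algebraMap (ZMod p) K).injective, Finset.card_univ, ZMod.card]
  have hsub : S ⊆ P.roots.toFinset := by
    intro b hb
    obtain ⟨c, -, rfl⟩ := Finset.mem_image.1 hb
    rw [Multiset.mem_toFinset, Polynomial.mem_roots hP]
    simp [P, ← map_pow, ZMod.pow_card]
  have heq : S = P.roots.toFinset := by
    refine Finset.eq_of_subset_of_card_le hsub ?_
    rw [hS]
    exact (Multiset.toFinset_card_le _).trans ((Polynomial.card_roots' P).trans hdeg.le)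
  have ha : a ∈ P.roots.toFinset := by
    rw [Multiset.mem_toFinset, Polynomial.mem_roots hP]
    simp [P, h]
  rw [← heq] at ha
  obtain ⟨b, -, hb⟩ := Finset.mem_image.1 ha
  exact ⟨b, hb⟩

theorem exists_tmul_of_frobM_eq {x : K ⊗[ZMod p] M} (h : frobM x = x) : ∃ v : M, 1 ⊗ₜ v = x := by
  have h1 : ∀ i, ∃ b : ZMod p, algebraMap (ZMod p) K b = coord x i := fun i => by
    refine exists_algebraMap_of_pow_eq ?_
    have := congrArg (fun t => coord t i) h
    simp only [frobM, coord_changeScalars] at this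
    exact this
  choose b hb using h1
  refine ⟨(Module.finBasis (ZMod p) M).equivFun.symm b, coord_ext fun i => ?_⟩
  rw [coord_tmul, ← hb, Algebra.smul_def, mul_one]
  congr 1
  exact congrFun ((Module.finBasis (ZMod p) M).equivFun.apply_symm_apply b) i

/-- This is where nonsplitness enters. The Frobenius transform of a normalized tuple is normalized
with the same pivots. If it stayed in the span it would equal the tuple, whose members would then
come from `M` and span a totally isotropic subspace of half the dimension. -/
theorem IsNormalized.exists_frobM_notMem (hns : IsNonsplit B)
    (hr : Module.finrank (ZMod p) M = 2 * r)
    {σ : Fin r ↪ Fin (Module.finrank (ZMod p) M)} {y : Fin r → K ⊗[ZMod p] M}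
    (hy : IsNormalized σ y) (hiso : ∀ i j, B.baseChange K (y i) (y j) = 0) :
    ∃ j, frobM (y j) ∉ Submodule.span K (Set.range y) := by
  by_contra! h
  have h1 : (fun j => frobM (y j)) = y := hy.eq_of_mem (hy.map _) h
  choose v hv using fun j => exists_tmul_of_frobM_eq (congrFun h1 j)
  have hli : LinearIndependent (ZMod p) v := by
    have h2 := hy.linearIndependent.restrict_scalars' (ZMod p)
    let g : M →ₗ[ZMod p] K ⊗[ZMod p] M := (TensorProduct.mk (ZMod p) K M) 1
    have h3 : (g ∘ v) = y := funext hv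
    rw [← h3] at h2
    exact LinearIndependent.of_comp g h2
  refine hns (Submodule.span (ZMod p) (Set.range v)) ?_ ?_
  · rw [Submodule.span_le]
    rintro _ ⟨i, rfl⟩
    intro w hw
    refine Submodule.span_induction (p := fun w _ => B w (v i) = 0) ?_ ?_ ?_ ?_ hw
    · rintro _ ⟨j, rfl⟩
      have h4 := hiso j i
      rw [← hv, ← hv, LinearMap.BilinForm.baseChange_tmul] at h4
      simpa using h4
    · simp
    · intro a b _ _ ha hb
      rw [map_add, LinearMap.add_apply, ha, hb, add_zero]
    · intro a b _ hb
      rw [map_smul, LinearMap.smul_apply, hb, smul_zero]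
  · rw [finrank_span_eq_card hli, Fintype.card_fin, hr]

theorem exists_combination {x y : Fin r → R ⊗[ZMod p] M}
    (h : ∀ j, x j ∈ Submodule.span R (Set.range y)) :
    ∃ a : Matrix (Fin r) (Fin r) R, ∀ j, x j = ∑ k, a j k • y k := by
  have h1 : ∀ j, ∃ a : Fin r → R, ∑ k, a k • y k = x j := fun j =>
    (Submodule.mem_span_range_iff_exists_fun R).1 (h j)
  choose a ha using h1
  exact ⟨a, fun j => (ha j).symm⟩

/-- Write `x = a y`. The minor of `x` is `a` times the minor of `y`, so `a` has unit determinant and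
can be inverted. -/
theorem span_eq_of_isUnit_minor {x y : Fin r → R ⊗[ZMod p] M}
    (h : ∀ j, x j ∈ Submodule.span R (Set.range y))
    {σ : Fin r ↪ Fin (Module.finrank (ZMod p) M)} (hx : IsUnit (minor σ x).det) :
    Submodule.span R (Set.range x) = Submodule.span R (Set.range y) := by
  refine le_antisymm (Submodule.span_le.2 (by rintro _ ⟨j, rfl⟩; exact h j)) ?_
  obtain ⟨a, ha⟩ := exists_combination h
  have h1 : minor σ x = a * minor σ y := by
    ext j i
    rw [Matrix.mul_apply]
    conv_lhs => rw [minor, Matrix.of_apply, ha j, map_sum, Finset.sum_apply]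
    refine Finset.sum_congr rfl fun k _ => ?_
    rw [map_smul]
    rfl
  have h2 : IsUnit a.det := by
    rw [h1, Matrix.det_mul] at hx
    exact isUnit_of_mul_isUnit_left hx
  rw [Submodule.span_le]
  rintro _ ⟨k, rfl⟩
  have h3 : y k = ∑ j, a⁻¹ k j • x j := by
    have h4 : a⁻¹ * a = 1 := Matrix.nonsing_inv_mul a h2
    simp_rw [ha, Finset.smul_sum, smul_smul]
    rw [Finset.sum_comm]
    simp_rw [← Finset.sum_smul]
    have h5 : ∀ l, ∑ j, a⁻¹ k j * a j l = if k = l then 1 else 0 := fun l => by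
      rw [← Matrix.mul_apply, h4, Matrix.one_apply]
    simp [h5]
  rw [h3]
  exact Submodule.sum_mem _ fun j _ => Submodule.smul_mem _ _ (Submodule.subset_span ⟨j, rfl⟩)

end Isotropic

/-! ### Frames of the big member adapted to the small one -/

section Adapted

variable {M : Type} [AddCommGroup M] [Module (ZMod p) M] [FiniteDimensional (ZMod p) M]
variable {B : LinearMap.BilinForm (ZMod p) M} {X T : Sch p} {d e r : ℕ} {c : Prop}
variable {L : SubModule M X} {U : X.left.Opens}
  {σ : Fin d ↪ Fin (Module.finrank (ZMod p) M)} {τ : Fin e ↪ Fin (Module.finrank (ZMod p) M)}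

/-- Sections of `L`, as many as its rank and independent in the fibre at `s`, generate `L` near `s`,
as one of their minors is a unit there. -/
theorem IsFrame.exists_span_of_linearIndependent {y : Fin e → Γ(X.left, U) ⊗[ZMod p] M}
    (hy : IsFrame L U τ y) {s : X.left} (hs : s ∈ U) {z : Fin e → Γ(X.left, U) ⊗[ZMod p] M}
    (hz : ∀ j, z j ∈ sec L U)
    (hind : LinearIndependent (X.left.residueField s) fun j => changeScalars (evalAt X hs) M (z j)) :
    ∃ (W : X.left.Opens) (h : W ≤ U) (ρ : Fin e ↪ Fin (Module.finrank (ZMod p) M)), s ∈ W ∧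
      IsUnit (minor ρ fun j => res M X h (z j)).det ∧
      ∀ (W' : X.left.Opens) (h' : W' ≤ W),
        sec L W' = Submodule.span _ (Set.range fun j => res M X (h'.trans h) (z j)) := by
  obtain ⟨ρ, hρ⟩ := exists_minor_ne_zero hind
  rw [minor_changeScalars, ← RingHom.map_det] at hρ
  obtain ⟨W, hW, hsW, hu⟩ := exists_isUnit_res hs hρ
  have hu' : ∀ (W' : X.left.Opens) (h' : W' ≤ W),
      IsUnit (minor ρ fun j => res M X (h'.trans hW) (z j)).det := by
    intro W' h'
    have h1 := hu.map (X.left.presheaf.map (homOfLE h').op).hom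
    rw [minor_changeScalars, ← RingHom.map_det]
    convert h1 using 1
    rw [← ConcreteCategory.comp_apply, ← Functor.map_comp]
    rfl
  refine ⟨W, hW, ρ, hsW, hu' W le_rfl, fun W' h' => ?_⟩
  rw [hy.span W' (h'.trans hW)]
  refine (span_eq_of_isUnit_minor (fun j => ?_) (hu' W' h')).symm
  rw [← hy.span W' (h'.trans hW)]
  exact res_mem _ _ (hz j)

/-- A frame `x` of the small member of `F` together with a section `l` that completes it to a
basis of the big member. -/
structure IsAdapted (F : Flag M X) (U : X.left.Opens)
    (σ : Fin d ↪ Fin (Module.finrank (ZMod p) M)) (x : Fin d → Γ(X.left, U) ⊗[ZMod p] M)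
    (l : Γ(X.left, U) ⊗[ZMod p] M) : Prop where
  small : IsFrame F.small U σ x
  mem : l ∈ sec F.big U
  exists_minor : ∃ ρ : Fin (d + 1) ↪ Fin (Module.finrank (ZMod p) M),
    IsUnit (minor ρ (Fin.snoc (α := fun _ => Γ(X.left, U) ⊗[ZMod p] M) x l)).det
  span : ∀ (W : X.left.Opens) (h : W ≤ U), sec F.big W =
    Submodule.span _ (Set.range fun j =>
      res M X h (Fin.snoc (α := fun _ => Γ(X.left, U) ⊗[ZMod p] M) x l j))

/-- In the fibre at `s` the big member has dimension one more than the small one, so some member `y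
k` of its frame lies outside the small one. Together with the frame of the small member it generates
the big one near `s`. -/
theorem IsModuli.exists_adapted {F : Flag M X} (hF : IsModuli B d (d + 1) c X F) (s : X.left) :
    ∃ (U : X.left.Opens) (σ : Fin d ↪ Fin (Module.finrank (ZMod p) M))
      (x : Fin d → Γ(X.left, U) ⊗[ZMod p] M) (l : Γ(X.left, U) ⊗[ZMod p] M),
      s ∈ U ∧ IsAdapted F U σ x l := by
  obtain ⟨U, σ, τ, x, y, hs, h⟩ := hF.exists_frame s
  let ev := evalAt X hs
  have hx : LinearIndependent (X.left.residueField s) fun j => changeScalars ev M (x j) :=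
    (h.small.norm.map ev).linearIndependent
  have hy : LinearIndependent (X.left.residueField s) fun j => changeScalars ev M (y j) :=
    (h.big.norm.map ev).linearIndependent
  obtain ⟨k, hk⟩ : ∃ k, changeScalars ev M (y k) ∉
      Submodule.span (X.left.residueField s) (Set.range fun j => changeScalars ev M (x j)) := by
    by_contra! hcon
    have h1 := Submodule.finrank_mono (Submodule.span_le.2 (by rintro _ ⟨k, rfl⟩; exact hcon k) :
      Submodule.span (X.left.residueField s) (Set.range fun j => changeScalars ev M (y j)) ≤ _)
    rw [finrank_span_eq_card hx, finrank_span_eq_card hy, Fintype.card_fin, Fintype.card_fin] at h1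
    omega
  have hind : LinearIndependent (X.left.residueField s) fun j => changeScalars ev M
      (Fin.snoc (α := fun _ => Γ(X.left, U) ⊗[ZMod p] M) x (y k) j) := by
    have e : (fun j => changeScalars ev M
        (Fin.snoc (α := fun _ => Γ(X.left, U) ⊗[ZMod p] M) x (y k) j)) =
        Fin.snoc (α := fun _ => X.left.residueField s ⊗[ZMod p] M)
          (fun j => changeScalars ev M (x j)) (changeScalars ev M (y k)) :=
      Fin.comp_snoc (changeScalars ev M) x (y k)
    rw [e]
    exact hx.finSnoc hk
  obtain ⟨W, hW, ρ, hsW, hu, hsp⟩ := h.big.exists_span_of_linearIndependent hs (fun j => by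
    refine Fin.lastCases ?_ (fun i => ?_) j
    · rw [Fin.snoc_last]
      exact h.big.mem k
    · rw [Fin.snoc_castSucc]
      exact F.le (op U) (h.small.mem i)) hind
  have e : (fun j => res M X hW (Fin.snoc (α := fun _ => Γ(X.left, U) ⊗[ZMod p] M) x (y k) j)) =
      Fin.snoc (α := fun _ => Γ(X.left, W) ⊗[ZMod p] M) (fun j => res M X hW (x j))
        (res M X hW (y k)) := Fin.comp_snoc (res M X hW) x (y k)
  refine ⟨W, σ, _, res M X hW (y k), hsW, h.small.restrict hW, res_mem _ _ (h.big.mem k),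
    ⟨ρ, by rw [← e]; exact hu⟩, fun W' h' => ?_⟩
  rw [hsp W' h', ← e]
  simp only [res_res]

theorem IsAdapted.restrict {F : Flag M X} {x : Fin d → Γ(X.left, U) ⊗[ZMod p] M}
    {l : Γ(X.left, U) ⊗[ZMod p] M} (h : IsAdapted F U σ x l) {W : X.left.Opens} (hW : W ≤ U) :
    IsAdapted F W σ (fun j => res M X hW (x j)) (res M X hW l) := by
  have e : (fun j => res M X hW (Fin.snoc (α := fun _ => Γ(X.left, U) ⊗[ZMod p] M) x l j)) =
      Fin.snoc (α := fun _ => Γ(X.left, W) ⊗[ZMod p] M) (fun j => res M X hW (x j))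
        (res M X hW l) := Fin.comp_snoc (res M X hW) x l
  obtain ⟨ρ, hρ⟩ := h.exists_minor
  refine ⟨h.small.restrict hW, res_mem _ _ h.mem, ⟨ρ, ?_⟩, fun W' h' => ?_⟩
  · rw [← e, minor_changeScalars, ← RingHom.map_det]
    exact hρ.map _
  · rw [h.span W' (h'.trans hW), ← e]
    simp only [res_res]

theorem IsAdapted.exists_sum {F : Flag M X} {x : Fin d → Γ(X.left, U) ⊗[ZMod p] M}
    {l : Γ(X.left, U) ⊗[ZMod p] M} (h : IsAdapted F U σ x l) {z : Γ(X.left, U) ⊗[ZMod p] M}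
    (hz : z ∈ sec F.big U) : ∃ (a : Fin d → Γ(X.left, U)) (b : Γ(X.left, U)),
      z = ∑ j, a j • x j + b • l := by
  rw [h.span U le_rfl] at hz
  obtain ⟨a, rfl⟩ := (Submodule.mem_span_range_iff_exists_fun _).1 hz
  refine ⟨fun j => a j.castSucc, a (Fin.last d), ?_⟩
  rw [Fin.sum_univ_castSucc]
  simp only [res_refl, Fin.snoc_castSucc, Fin.snoc_last]

end Adapted
end
end OrthDL

namespace OrthDL
noncomputable section
variable {p : ℕ} [Fact p.Prime]

/-! ### The functor `𝒴_V` as an orthogonality condition -/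

section ScriptY

variable {M : Type} [AddCommGroup M] [Module (ZMod p) M] [FiniteDimensional (ZMod p) M]
variable {B : LinearMap.BilinForm (ZMod p) M} {X T : Sch p} {d e r : ℕ} {c : Prop}

theorem changeScalars_mem_span {R R' : Type} [CommRing R] [CommRing R'] [Algebra (ZMod p) R]
    [Algebra (ZMod p) R'] (φ : R →+* R') {ι : Type} {x : ι → R ⊗[ZMod p] M} {z : R ⊗[ZMod p] M}
    (hz : z ∈ Submodule.span R (Set.range x)) :
    changeScalars φ M z ∈ Submodule.span R' (Set.range fun i => changeScalars φ M (x i)) := by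
  refine Submodule.span_induction (p := fun z _ => changeScalars φ M z ∈
    Submodule.span R' (Set.range fun i => changeScalars φ M (x i))) ?_ ?_ ?_ ?_ hz
  · rintro _ ⟨i, rfl⟩
    exact Submodule.subset_span ⟨i, rfl⟩
  · rw [map_zero]
    exact Submodule.zero_mem _
  · intro a b _ _ ha hb
    rw [map_add]
    exact Submodule.add_mem _ ha hb
  · intro a b _ hb
    rw [changeScalars_smul]
    exact Submodule.smul_mem _ _ hb

theorem isOGr_iff {F : Flag M X} : IsOGr B d X F ↔ IsModuli B d (d + 1) False X F :=
  ⟨fun h => ⟨h.1, h.2.1, h.2.2.2, fun h => h.elim⟩, fun h => ⟨h.small, h.big,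
    fun U x hx y hy => h.isotropic U x (F.le _ hx) y (F.le _ hy), h.isotropic⟩⟩

/-- `Frob^* L_{d+1}` is again totally isotropic of half rank, hence equal to its orthogonal. -/
theorem IsModuli.le_frobPullback (hB : B.IsSymm) (hnd : B.Nondegenerate)
    (hr : Module.finrank (ZMod p) M = 2 * e) {F : Flag M X} (hF : IsModuli B d e True X F) :
    F.small ≤ frobPullback F.big := by
  refine (isSubsheaf_generated _).le_of_locally fun s => ?_
  obtain ⟨U, σ, τ, x, y, hs, h⟩ := hF.exists_frame s
  refine ⟨U, hs, fun W hW z hz => ?_⟩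
  have hy := h.big.restrict hW
  have h2 := hy.frobPullback
  change z ∈ sec (frobPullback F.big) W
  rw [h2.span_self]
  refine h2.norm.mem_span_of_form_eq_zero hB hnd hr (fun i j => ?_) fun j => ?_
  · rw [frobM, frobM, changeScalars_form, hF.isotropic W _ (hy.mem i) _ (hy.mem j), map_zero]
  · exact hF.frob trivial W z hz _ (hy.mem j)

/-- The local normal form behind most later arguments: `L_{d+1} = L_d + ⟨l⟩` and `Frob^* L_{d+1} =
L_d + ⟨Frob y⟩`, with `B(l, Frob y)` a unit and `L_d`, `l`, `Frob y` independent in every fibre. The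
coefficient of `l` in a section of `L_{d+1}` can thus be recovered by pairing with `Frob y`. -/
theorem IsModuli.exists_transversal (hB : B.IsSymm) (hnd : B.Nondegenerate) (hns : IsNonsplit B)
    (hr : Module.finrank (ZMod p) M = 2 * (d + 1)) {F : Flag M X}
    (hF : IsModuli B d (d + 1) True X F) (s : X.left) :
    ∃ (U : X.left.Opens) (σ : Fin d ↪ Fin (Module.finrank (ZMod p) M))
      (x : Fin d → Γ(X.left, U) ⊗[ZMod p] M) (l y : Γ(X.left, U) ⊗[ZMod p] M),
      s ∈ U ∧ IsAdapted F U σ x l ∧ y ∈ sec F.big U ∧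
      IsUnit (B.baseChange Γ(X.left, U) l (frobM y)) ∧
      (∀ (W : X.left.Opens) (h : W ≤ U), sec (frobPullback F.big) W =
        Submodule.span _ (Set.range fun j => res M X h
          (Fin.snoc (α := fun _ => Γ(X.left, U) ⊗[ZMod p] M) x (frobM y) j))) ∧
      ∃ ρ : Fin (d + 1 + 1) ↪ Fin (Module.finrank (ZMod p) M), IsUnit (minor ρ
        (Fin.snoc (α := fun _ => Γ(X.left, U) ⊗[ZMod p] M)
          (Fin.snoc (α := fun _ => Γ(X.left, U) ⊗[ZMod p] M) x l) (frobM y))).det := by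
  obtain ⟨U₁, σ, x₁, l₁, hs₁, h₁⟩ := hF.exists_adapted s
  obtain ⟨U₂, σ₂, τ, x₂, y₂, hs₂, h₂⟩ := hF.exists_frame s
  let U := U₁ ⊓ U₂
  have hs : s ∈ U := ⟨hs₁, hs₂⟩
  have hA := h₁.restrict (inf_le_left : U ≤ U₁)
  have hY := h₂.big.restrict (inf_le_right : U ≤ U₂)
  set x : Fin d → Γ(X.left, U) ⊗[ZMod p] M := fun j => res M X inf_le_left (x₁ j)
  set l : Γ(X.left, U) ⊗[ZMod p] M := res M X inf_le_left l₁
  set y : Fin (d + 1) → Γ(X.left, U) ⊗[ZMod p] M := fun j => res M X inf_le_right (y₂ j)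
  let ev := evalAt X hs
  have hyn := hY.norm.map ev
  have hiso : ∀ i j, B.baseChange (X.left.residueField s) (changeScalars ev M (y i))
      (changeScalars ev M (y j)) = 0 := fun i j => by
    rw [changeScalars_form, hF.isotropic U _ (hY.mem i) _ (hY.mem j), map_zero]
  -- In the fibre at `s`, nonsplitness provides a member of the frame whose Frobenius transform
  -- leaves `L_{d+1}`.
  obtain ⟨k, hk⟩ := hyn.exists_frobM_notMem hns hr hiso
  rw [← frobM_map] at hk
  let m := frobM (y k)
  have hm : m ∈ sec (frobPullback F.big) U := mem_frobPullback (hY.mem k)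
  have hspan : Submodule.span (X.left.residueField s) (Set.range fun j => changeScalars ev M
      (Fin.snoc (α := fun _ => Γ(X.left, U) ⊗[ZMod p] M) x l j)) =
      Submodule.span (X.left.residueField s) (Set.range fun j => changeScalars ev M (y j)) := by
    have h1 := hA.span U le_rfl
    rw [hY.span_self] at h1
    simp only [res_refl] at h1
    refine le_antisymm ?_ ?_
    · rw [Submodule.span_le]
      rintro _ ⟨j, rfl⟩
      refine changeScalars_mem_span ev ?_
      rw [h1]
      exact Submodule.subset_span ⟨j, rfl⟩
    · rw [Submodule.span_le]
      rintro _ ⟨j, rfl⟩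
      refine changeScalars_mem_span ev ?_
      rw [← h1]
      exact Submodule.subset_span ⟨j, rfl⟩
  have hli : LinearIndependent (X.left.residueField s) fun j => changeScalars ev M
      (Fin.snoc (α := fun _ => Γ(X.left, U) ⊗[ZMod p] M) x l j) := by
    obtain ⟨ρ, hρ⟩ := hA.exists_minor
    refine linearIndependent_of_minor (σ := ρ) ?_
    rw [minor_changeScalars, ← RingHom.map_det]
    exact (hρ.map ev).ne_zero
  have hli2 : LinearIndependent (X.left.residueField s) fun j => changeScalars ev M
      (Fin.snoc (α := fun _ => Γ(X.left, U) ⊗[ZMod p] M)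
        (Fin.snoc (α := fun _ => Γ(X.left, U) ⊗[ZMod p] M) x l) m j) := by
    have e : (fun j => changeScalars ev M (Fin.snoc (α := fun _ => Γ(X.left, U) ⊗[ZMod p] M)
        (Fin.snoc (α := fun _ => Γ(X.left, U) ⊗[ZMod p] M) x l) m j)) =
        Fin.snoc (α := fun _ => X.left.residueField s ⊗[ZMod p] M)
          (fun j => changeScalars ev M (Fin.snoc (α := fun _ => Γ(X.left, U) ⊗[ZMod p] M) x l j))
          (changeScalars ev M m) :=
      Fin.comp_snoc (changeScalars ev M) _ m
    rw [e]
    refine hli.finSnoc ?_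
    rw [hspan]
    exact hk
  have hxm : ∀ j, B.baseChange Γ(X.left, U) (x j) m = 0 := fun j =>
    hF.frob trivial U _ (hA.small.mem j) _ (hY.mem k)
  -- Already `m` is orthogonal to `L_d`. Were it orthogonal to `l` at `s` too, it would be
  -- orthogonal to the fibre of `L_{d+1}` and so lie in it.
  have hlm : ev (B.baseChange Γ(X.left, U) l m) ≠ 0 := by
    intro h0
    refine hk (hyn.mem_span_of_form_eq_zero hB hnd hr hiso fun j => ?_)
    refine form_eq_zero_of_span (x := fun _ : Unit => changeScalars ev M m)
      (y := fun j => changeScalars ev M (Fin.snoc (α := fun _ => Γ(X.left, U) ⊗[ZMod p] M) x l j))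
      (fun _ i => ?_) (Submodule.subset_span ⟨(), rfl⟩) ?_
    · rw [changeScalars_form, baseChange_symm hB]
      refine Fin.lastCases ?_ (fun i => ?_) i
      · rw [Fin.snoc_last, h0]
      · rw [Fin.snoc_castSucc, hxm, map_zero]
    · rw [hspan]
      exact Submodule.subset_span ⟨j, rfl⟩
  have hxm_li : LinearIndependent (X.left.residueField s) fun j => changeScalars ev M
      (Fin.snoc (α := fun _ => Γ(X.left, U) ⊗[ZMod p] M) x m j) := by
    have e : (fun j => changeScalars ev M
        (Fin.snoc (α := fun _ => Γ(X.left, U) ⊗[ZMod p] M) x m j)) =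
        Fin.snoc (α := fun _ => X.left.residueField s ⊗[ZMod p] M)
          (fun j => changeScalars ev M (x j)) (changeScalars ev M m) :=
      Fin.comp_snoc (changeScalars ev M) x m
    rw [e]
    refine (hA.small.norm.map ev).linearIndependent.finSnoc fun hmem => hk ?_
    rw [← hspan]
    refine Submodule.span_mono ?_ hmem
    rintro _ ⟨j, rfl⟩
    exact ⟨j.castSucc, by simp only [Fin.snoc_castSucc]⟩
  have hle := hF.le_frobPullback hB hnd hr
  obtain ⟨W₁, hW₁, ρ₁, hsW₁, -, hsp⟩ := hY.frobPullback.exists_span_of_linearIndependent hs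
    (fun j => by
      refine Fin.lastCases ?_ (fun i => ?_) j
      · rw [Fin.snoc_last]
        exact hm
      · rw [Fin.snoc_castSucc]
        exact hle (op U) (hA.small.mem i)) hxm_li
  obtain ⟨ρ, hρ⟩ := exists_minor_ne_zero hli2
  rw [minor_changeScalars, ← RingHom.map_det] at hρ
  obtain ⟨W₂, hW₂, hsW₂, hu₂⟩ := exists_isUnit_res hs hρ
  obtain ⟨W₃, hW₃, hsW₃, hu₃⟩ := exists_isUnit_res hs hlm
  -- On the three sets, respectively, `x` and `m` generate `Frob^* L_{d+1}`, a maximal minor of `x`,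
  -- `l`, `m` is a unit, and `B(l, m)` is a unit.
  let W := W₁ ⊓ W₂ ⊓ W₃
  have hW : W ≤ U := (inf_le_left.trans inf_le_left).trans hW₁
  have hres : ∀ {A : X.left.Opens} (hA : A ≤ U) (hW' : W ≤ A) (a : Γ(X.left, U)),
      IsUnit (X.left.presheaf.map (homOfLE hA).op a) →
      IsUnit (X.left.presheaf.map (homOfLE hW).op a) := by
    intro A hA hW' a ha
    have h1 := ha.map (X.left.presheaf.map (homOfLE hW').op).hom
    convert h1 using 1
    rw [← ConcreteCategory.comp_apply, ← Functor.map_comp]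
    rfl
  have hf : frobM (res M X hW (y k)) = res M X hW m := (frobM_map _ _).symm
  refine ⟨W, σ, _, res M X hW l, res M X hW (y k), ⟨⟨hsW₁, hsW₂⟩, hsW₃⟩, hA.restrict hW,
    res_mem _ _ (hY.mem k), ?_, fun W' h' => ?_, ρ, ?_⟩
  · rw [hf, changeScalars_form]
    exact hres hW₃ inf_le_right _ hu₃
  · rw [hsp W' (h'.trans (inf_le_left.trans inf_le_left)), hf]
    have e : (fun j => res M X hW (Fin.snoc (α := fun _ => Γ(X.left, U) ⊗[ZMod p] M) x m j)) =
      Fin.snoc (α := fun _ => Γ(X.left, W) ⊗[ZMod p] M) (fun j => res M X hW (x j))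
        (res M X hW m) := Fin.comp_snoc (res M X hW) x m
    rw [← e]
    simp only [res_res]
  · have e : (fun j => res M X hW (Fin.snoc (α := fun _ => Γ(X.left, U) ⊗[ZMod p] M)
        (Fin.snoc (α := fun _ => Γ(X.left, U) ⊗[ZMod p] M) x l) m j)) =
      Fin.snoc (α := fun _ => Γ(X.left, W) ⊗[ZMod p] M)
        (Fin.snoc (α := fun _ => Γ(X.left, W) ⊗[ZMod p] M) (fun j => res M X hW (x j))
          (res M X hW l)) (res M X hW m) :=
      (Fin.comp_snoc (res M X hW) _ m).trans
        (congrArg (fun t => Fin.snoc (α := fun _ => Γ(X.left, W) ⊗[ZMod p] M) t (res M X hW m))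
          (Fin.comp_snoc (res M X hW) x l))
    rw [hf, ← e, minor_changeScalars, ← RingHom.map_det]
    exact hres hW₂ (inf_le_left.trans inf_le_right) _ hu₂

/-- One direction holds because `Frob^* L_{d+1}` is isotropic. In the other, the summand condition
is automatic: by the local normal form the sum is generated by `L_d`, `l` and `Frob y`, which have a
unit minor of size `d + 2`. -/
theorem isScriptY_iff (hB : B.IsSymm) (hnd : B.Nondegenerate) (hns : IsNonsplit B)
    (hr : Module.finrank (ZMod p) M = 2 * (d + 1)) {F : Flag M X} :
    IsScriptY B d X F ↔ IsModuli B d (d + 1) True X F := by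
  constructor
  · rintro ⟨h, hle, -⟩
    rw [isOGr_iff] at h
    refine ⟨h.small, h.big, h.isotropic, fun _ U z hz w hw => form_eq_zero_of_locally fun s hs => ?_⟩
    obtain ⟨A, σ, τ, x, y, hsA, hA⟩ := h.exists_frame s
    refine ⟨U ⊓ A, inf_le_left, ⟨hs, hsA⟩, ?_⟩
    have hy := hA.big.frobPullback
    refine hy.form_eq_zero hy (fun i j => ?_) inf_le_right (res_mem _ _ (hle _ hz))
      (res_mem _ _ (mem_frobPullback hw))
    rw [frobM, frobM, changeScalars_form, h.isotropic A _ (hA.big.mem i) _ (hA.big.mem j), map_zero]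
  · intro h
    refine ⟨isOGr_iff.2 ⟨h.small, h.big, h.isotropic, fun h => h.elim⟩,
      h.le_frobPullback hB hnd hr, isSubsheaf_generated _, fun s => ⟨d + 1 + 1, ?_⟩⟩
    obtain ⟨U, σ, x, l, y, hs, hA, hy, -, hsp, ρ, hρ⟩ := h.exists_transversal hB hnd hns hr s
    let z : Fin (d + 1 + 1) → Γ(X.left, U) ⊗[ZMod p] M :=
      Fin.snoc (α := fun _ => Γ(X.left, U) ⊗[ZMod p] M)
        (Fin.snoc (α := fun _ => Γ(X.left, U) ⊗[ZMod p] M) x l) (frobM y)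
    obtain ⟨a, a', hn, ha⟩ := exists_isNormalized hρ
    have hz : ∀ j, z j ∈ (sec F.big U : Set (Γ(X.left, U) ⊗[ZMod p] M)) ∪
        sec (frobPullback F.big) U := by
      intro j
      refine Fin.lastCases ?_ (fun j => ?_) j
      · simp only [z, Fin.snoc_last]
        exact Or.inr (mem_frobPullback hy)
      · simp only [z, Fin.snoc_castSucc]
        left
        refine Fin.lastCases ?_ (fun j => ?_) j
        · rw [Fin.snoc_last]
          exact hA.mem
        · rw [Fin.snoc_castSucc]
          exact F.le _ (hA.small.mem j)
    refine (generated_isFrame hn ?_ ?_).isSummandAt hs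
    · intro W' w hw W hW hU
      rw [span_res_combination hU ha]
      rcases hw with hw | hw
      · have h1 := res_mem _ hW hw
        rw [hA.span W hU] at h1
        refine Submodule.span_mono ?_ h1
        rintro _ ⟨j, rfl⟩
        exact ⟨j.castSucc, by simp only [Fin.snoc_castSucc]⟩
      · have h1 := res_mem _ hW hw
        rw [hsp W hU] at h1
        refine Submodule.span_mono ?_ h1
        rintro _ ⟨j, rfl⟩
        refine Fin.lastCases ?_ (fun j => ?_) j
        · exact ⟨Fin.last _, by simp only [Fin.snoc_last]⟩
        · exact ⟨j.castSucc.castSucc, by simp only [Fin.snoc_castSucc]⟩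
    · refine fun t ht => ⟨U, le_rfl, ht, fun j => ?_⟩
      rw [res_refl]
      exact Submodule.sum_mem _ fun k _ => Submodule.smul_mem _ _
        (Submodule.subset_span ⟨U, le_rfl, _, hz k, res_refl _ _⟩)

end ScriptY
end
end OrthDL

namespace OrthDL
noncomputable section
variable {p : ℕ} [Fact p.Prime]

/-! ### Constant pairs -/

section Constant

variable {M : Type} [AddCommGroup M] [Module (ZMod p) M] [FiniteDimensional (ZMod p) M]
variable {B : LinearMap.BilinForm (ZMod p) M} {X T : Sch p} {d e r : ℕ} {c : Prop}

theorem res_constant {U W : X.left.Opens} (h : W ≤ U) (v : GaloisField p 2 ⊗[ZMod p] M) :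
    res M X h (changeScalars (structMap X U) M v) = changeScalars (structMap X W) M v :=
  changeScalars_comp _ _ _ (fun a => structMap_res h a) M v

theorem exists_isFrame_constantSub (X : Sch p) {E : Fin r → GaloisField p 2 ⊗[ZMod p] M}
    (hE : LinearIndependent (GaloisField p 2) E) :
    ∃ (σ : Fin r ↪ Fin (Module.finrank (ZMod p) M)) (x : Fin r → Γ(X.left, ⊤) ⊗[ZMod p] M),
      IsFrame (constantSub X (Set.range E)) ⊤ σ x := by
  obtain ⟨σ, hσ⟩ := exists_minor_ne_zero hE
  obtain ⟨A, A', hn, hA⟩ := exists_isNormalized hσ.isUnit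
  have hspan := span_combination hA
  refine ⟨σ, _, generated_isFrame (hn.map (structMap X ⊤)) ?_ ?_⟩
  · rintro W' _ ⟨_, ⟨j, rfl⟩, rfl⟩ W hW hU
    simp only [res_constant]
    refine changeScalars_mem_span _ ?_
    rw [hspan]
    exact Submodule.subset_span ⟨j, rfl⟩
  · refine fun s hs => ⟨⊤, le_rfl, hs, fun j => ?_⟩
    rw [res_constant]
    have h1 : ∑ k, A j k • E k ∈ Submodule.span (GaloisField p 2) (Set.range E) :=
      Submodule.sum_mem _ fun k _ => Submodule.smul_mem _ _ (Submodule.subset_span ⟨k, rfl⟩)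
    refine Submodule.span_mono ?_ (changeScalars_mem_span (structMap X ⊤) h1)
    rintro _ ⟨k, rfl⟩
    exact ⟨⊤, le_rfl, _, ⟨_, ⟨k, rfl⟩, rfl⟩, res_refl _ _⟩

theorem isIsotropicSub_constantSub (X : Sch p) {E : Set (GaloisField p 2 ⊗[ZMod p] M)}
    (hE : ∀ v ∈ E, ∀ w ∈ E, B.baseChange (GaloisField p 2) v w = 0) :
    IsIsotropicSub B (constantSub X E) := by
  intro U z hz w hw
  refine form_eq_zero_of_locally fun s hs => ?_
  obtain ⟨A, hA, hsA, h1⟩ := hz s hs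
  obtain ⟨A', hA', hsA', h2⟩ := hw s hs
  refine ⟨A ⊓ A', inf_le_left.trans hA, ⟨hsA, hsA'⟩, ?_⟩
  have hsp : ∀ (C : X.left.Opens), ∀ z ∈ spanOn (fun W => changeScalars (structMap X W) M '' E) C,
      z ∈ Submodule.span Γ(X.left, C) (Set.range fun v : E => changeScalars (structMap X C) M v.1) := by
    intro C z hz
    refine Submodule.span_mono ?_ hz
    rintro _ ⟨U, h, _, ⟨v, hv, rfl⟩, rfl⟩
    exact ⟨⟨v, hv⟩, (res_constant h v).symm⟩
  have h1' := res_mem_spanOn _ (inf_le_left : A ⊓ A' ≤ A) _ h1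
  have h2' := res_mem_spanOn _ (inf_le_right : A ⊓ A' ≤ A') _ h2
  rw [res_res] at h1' h2'
  refine form_eq_zero_of_span (fun v w => ?_) (hsp _ _ h1') (hsp _ _ h2')
  rw [changeScalars_form, hE _ v.2 _ w.2, map_zero]

theorem isSubbundle_constantSub (X : Sch p) {E : Fin r → GaloisField p 2 ⊗[ZMod p] M}
    (hE : LinearIndependent (GaloisField p 2) E) : IsSubbundle (constantSub X (Set.range E)) r := by
  obtain ⟨σ, x, h⟩ := exists_isFrame_constantSub X hE
  exact isSubbundle_iff.2 ⟨isSubsheaf_generated _, fun s => ⟨⊤, σ, x, trivial, h⟩⟩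

/-- The index of `lastVector`. -/
def Sign.index (d : ℕ) : Sign → Fin (d + 1) ⊕ Fin (d + 1)
  | .plus => Sum.inl (Fin.last d)
  | .minus => Sum.inr (Fin.last d)

theorem StandardBasis.lastVector_eq (b : StandardBasis B d) (ε : Sign) :
    b.lastVector ε = b.basis (ε.index d) := by
  cases ε <;> rfl

/-- Ensures that the standard pair has a classifying morphism, so that the component in
`InComponent` exists. -/
theorem isOGr_flag (hB : B.IsSymm) (b : StandardBasis B d) (ε : Sign) :
    IsOGr B d (basePoint p) (b.flag ε) := by
  rw [isOGr_iff]
  let i : Fin (d + 1) → Fin (d + 1) ⊕ Fin (d + 1) :=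
    Fin.snoc (α := fun _ => Fin (d + 1) ⊕ Fin (d + 1)) (fun j => Sum.inl j.castSucc) (ε.index d)
  have hi : Function.Injective i := by
    refine Fin.snoc_injective_iff.2 ⟨fun j k h => Fin.castSucc_injective _ (Sum.inl_injective h), ?_⟩
    rintro ⟨j, hj⟩
    cases ε
    · exact (Fin.castSucc_lt_last j).ne (Sum.inl_injective hj)
    · cases hj
  have hset : insert (b.lastVector ε) b.smallGen = Set.range (b.basis ∘ i) := by
    ext v
    rw [Set.mem_insert_iff, b.lastVector_eq]
    constructor
    · rintro (rfl | ⟨j, rfl⟩)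
      · exact ⟨Fin.last d, by simp [i]⟩
      · exact ⟨j.castSucc, by simp [i]⟩
    · rintro ⟨j, rfl⟩
      refine Fin.lastCases ?_ (fun j => ?_) j
      · left
        simp [i]
      · right
        exact ⟨j, by simp [i]⟩
  refine ⟨?_, ?_, ?_, fun h => h.elim⟩
  · exact isSubbundle_constantSub _ (b.basis.linearIndependent.comp _
      (Sum.inl_injective.comp (Fin.castSucc_injective d)))
  · change IsSubbundle (constantSub _ (insert (b.lastVector ε) b.smallGen)) _
    rw [hset]
    exact isSubbundle_constantSub _ (b.basis.linearIndependent.comp _ hi)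
  · refine isIsotropicSub_constantSub _ ?_
    rw [hset]
    have hne : ∀ j : Fin d, j.castSucc ≠ Fin.last d := fun j => (Fin.castSucc_lt_last j).ne
    have hsymm : ∀ j : Fin d, B.baseChange (GaloisField p 2) (b.basis (Sum.inr (Fin.last d)))
        (b.basis (Sum.inl j.castSucc)) = 0 := by
      intro j
      rw [baseChange_symm hB, b.pair_e_f, if_neg (hne j)]
    rintro _ ⟨j, rfl⟩ _ ⟨k, rfl⟩
    refine Fin.lastCases ?_ (fun j => ?_) j <;> refine Fin.lastCases ?_ (fun k => ?_) k <;>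
      cases ε <;> simp [i, Sign.index, b.pair_e_e, b.pair_f_f, b.pair_e_f, hne, hsymm]

end Constant

/-! ### Representability of `Y_V` -/

section Component

variable {M : Type} [AddCommGroup M] [Module (ZMod p) M] [FiniteDimensional (ZMod p) M]
variable {B : LinearMap.BilinForm (ZMod p) M} {X T : Sch p} {d : ℕ}

theorem isRepresentable_isModuli (B : LinearMap.BilinForm (ZMod p) M) (d e : ℕ) (c : Prop) :
    IsRepresentable (IsModuli B d e c) := by
  obtain ⟨G, u, -, h⟩ := exists_represents_isModuli B d e c
  exact ⟨G, u, h⟩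

theorem isOGr_eq (B : LinearMap.BilinForm (ZMod p) M) (d : ℕ) :
    IsOGr B d = IsModuli B d (d + 1) False := by
  ext X F
  exact isOGr_iff

theorem basePoint_point_eq (x y : (basePoint p).left) : x = y :=
  Subsingleton.elim (α := PrimeSpectrum (GaloisField p 2)) x y

/-- `InComponent` allows any representing object. The comparison morphism from it to the fixed `G`
is continuous and matches classifying morphisms, so it maps one component into the other and the
condition can be tested on `G`. -/
theorem inComponent_iff {b : StandardBasis B d} {ε : Sign} {G : Sch p} {u : Flag M G}
    (hG : Represents (IsOGr B d) G u) {f₀ : basePoint p ⟶ G} (hf₀ : u.pullback f₀ = b.flag ε)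
    (f : X ⟶ G) (x₀ : (basePoint p).left) :
    InComponent b ε X (u.pullback f) ↔ ∀ x, f.left x ∈ connectedComponent (f₀.left x₀) := by
  constructor
  · rintro ⟨G', u', hG', f', f₀', hf', hf₀', h⟩ x
    obtain ⟨φ, hφ, -⟩ := hG.2.2 G' u' hG'.1
    have hcomp : ∀ (S : Sch p) (g : S ⟶ G'), u.pullback (g ≫ φ) = u'.pullback g := fun S g => by
      rw [← hφ]
      exact ((isOGr_iff.1 hG.1).pullback_comp φ g).symm
    have e : f' ≫ φ = f := (hG.2.2 X _ (hG.2.1 X f)).unique (by rw [hcomp, hf']) rfl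
    have e₀ : f₀' ≫ φ = f₀ := (hG.2.2 _ _ (hG.2.1 _ f₀)).unique (by rw [hcomp, hf₀', hf₀]) rfl
    rw [← e, ← e₀]
    exact φ.left.continuous.image_connectedComponent_subset _ ⟨_, h x x₀, rfl⟩
  · intro h
    refine ⟨G, u, hG, f, f₀, rfl, hf₀, fun x x₁ => ?_⟩
    rw [basePoint_point_eq x₁ x₀]
    exact h x

/-- The locus is the preimage of the chosen component of `OGr(d, d+1)` under the classifying
morphism. That component is closed, and open because the space is locally Noetherian. -/
theorem exists_isY_locus (hB : B.IsSymm) (hnd : B.Nondegenerate) (hns : IsNonsplit B)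
    (hr : Module.finrank (ZMod p) M = 2 * (d + 1)) (b : StandardBasis B d) (ε : Sign)
    {F : Flag M X} (hF : IsModuli B d (d + 1) True X F) :
    ∃ D : X.left.Opens, IsClosed (D : Set X.left) ∧
      ∀ (T : Sch p) (h : T ⟶ X), IsY b ε T (F.pullback h) ↔ ∀ t, h.left t ∈ D := by
  obtain ⟨G, u, hN, hG⟩ := exists_represents_isModuli B d (d + 1) False
  rw [← isOGr_eq] at hG
  obtain ⟨f₀, hf₀, -⟩ := hG.2.2 _ _ (isOGr_flag hB b ε)
  let x₀ : (basePoint p).left := IsLocalRing.closedPoint (GaloisField p 2)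
  let C : G.left.Opens :=
    ⟨connectedComponent (f₀.left x₀), isOpen_connectedComponent_of_isLocallyNoetherian G.left _⟩
  have hC : IsClosed (C : Set G.left) := isClosed_connectedComponent
  have hF' : IsOGr B d X F := isOGr_iff.2 ⟨hF.small, hF.big, hF.isotropic, fun h => h.elim⟩
  obtain ⟨f, hf, -⟩ := hG.2.2 X F hF'
  refine ⟨f.left ⁻¹ᵁ C, hC.preimage f.left.continuous, fun T h => ?_⟩
  have e : F.pullback h = u.pullback (h ≫ f) := by
    rw [← hf]
    exact (isOGr_iff.1 hG.1).pullback_comp f h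
  rw [IsY, isScriptY_iff hB hnd hns hr, and_iff_right (hF.pullback h), e,
    inComponent_iff hG hf₀ (h ≫ f) x₀]
  rfl

/-- The open subscheme `D` of `X`. -/
abbrev openSub (X : Sch p) (D : X.left.Opens) : Sch p := Over.mk (D.ι ≫ X.hom)

/-- The inclusion of the open subscheme `D` of `X`. -/
abbrev openSubι (X : Sch p) (D : X.left.Opens) : openSub X D ⟶ X := Over.homMk D.ι

theorem exists_lift_openSub {D : X.left.Opens} (f : T ⟶ X) (h : ∀ t, f.left t ∈ D) :
    ∃ g : T ⟶ openSub X D, g ≫ openSubι X D = f := by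
  let l : T.left ⟶ D := IsOpenImmersion.lift D.ι f.left (by
    rintro _ ⟨t, rfl⟩
    rw [Scheme.Opens.range_ι]
    exact h t)
  have hl : l ≫ D.ι = f.left := IsOpenImmersion.lift_fac _ _ _
  have hw : l ≫ D.ι ≫ X.hom = T.hom := by
    rw [← Category.assoc, hl]
    exact Over.w f
  refine ⟨Over.homMk l hw, ?_⟩
  ext1
  exact hl

theorem openSub_hom_ext {D : X.left.Opens} {f g : T ⟶ openSub X D}
    (h : f ≫ openSubι X D = g ≫ openSubι X D) : f = g := by
  ext1
  exact (cancel_mono D.ι).1 (congrArg CommaMorphism.left h)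

/-- `Y_V` is the open subscheme of the scheme representing `𝒴_V` on which the universal pair lies in
the chosen component. -/
theorem isRepresentable_isY (hB : B.IsSymm) (hnd : B.Nondegenerate) (hns : IsNonsplit B)
    (hr : Module.finrank (ZMod p) M = 2 * (d + 1)) (b : StandardBasis B d) (ε : Sign) :
    IsRepresentable (IsY b ε) := by
  obtain ⟨H, v, hH⟩ := isRepresentable_isModuli B d (d + 1) True
  obtain ⟨D, -, hD⟩ := exists_isY_locus hB hnd hns hr b ε hH.1
  have hι := (hD _ (openSubι H D)).2 fun t => t.2
  have hcomp : ∀ (T : Sch p) (f : T ⟶ openSub H D), (v.pullback (openSubι H D)).pullback f =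
      v.pullback (f ≫ openSubι H D) := fun T f => hH.1.pullback_comp _ f
  refine ⟨openSub H D, v.pullback (openSubι H D), hι, fun T f => ?_, fun T F hF => ?_⟩
  · rw [hcomp, hD]
    exact fun t => (f.left t).2
  · obtain ⟨g, rfl, hg'⟩ := hH.2.2 T F ((isScriptY_iff hB hnd hns hr).1 hF.1)
    obtain ⟨l, hl⟩ := exists_lift_openSub g ((hD _ g).1 hF)
    refine ⟨l, (hcomp _ _).trans (congrArg v.pullback hl), fun l' hl' => openSub_hom_ext ?_⟩
    rw [hl]
    exact hg' _ ((hcomp _ _).symm.trans hl')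

end Component

/-! ### The space `W^⊥ / W` -/

section OrthQuot

variable {V : Type} [AddCommGroup V] [Module (ZMod p) V] [FiniteDimensional (ZMod p) V]
variable {B : LinearMap.BilinForm (ZMod p) V} {W : Submodule (ZMod p) V}

theorem inducedForm_isSymm (hB : B.IsSymm) : (inducedForm B hB W).IsSymm := by
  refine ⟨fun x y => ?_⟩
  obtain ⟨x, rfl⟩ := Submodule.Quotient.mk_surjective _ x
  obtain ⟨y, rfl⟩ := Submodule.Quotient.mk_surjective _ y
  exact hB.eq x.1 y.1

/-- A vector of `W^⊥` orthogonal to `W^⊥` lies in `W^⊥⊥ = W`. -/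
theorem inducedForm_nondegenerate (hB : B.IsSymm) (hnd : B.Nondegenerate) :
    (inducedForm B hB W).Nondegenerate := by
  refine (LinearMap.IsRefl.nondegenerate_iff_separatingLeft (inducedForm_isSymm hB).isRefl).2 ?_
  intro x hx
  obtain ⟨x, rfl⟩ := Submodule.Quotient.mk_surjective _ x
  rw [Submodule.Quotient.mk_eq_zero]
  change x.1 ∈ W
  refine (LinearMap.BilinForm.orthogonal_orthogonal hnd hB.isRefl W).le ?_
  intro y hy
  exact (hB.eq _ _).trans (hx (Submodule.Quotient.mk ⟨y, hy⟩))

theorem finrank_orthQuot (hnd : B.Nondegenerate) (hW : W ≤ B.orthogonal W) :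
    Module.finrank (ZMod p) (OrthQuot B W) + 2 * Module.finrank (ZMod p) W =
      Module.finrank (ZMod p) V := by
  have h1 := LinearMap.BilinForm.finrank_orthogonal hnd W
  have h2 : Module.finrank (ZMod p) (OrthQuot B W) + Module.finrank (ZMod p) W =
      Module.finrank (ZMod p) (B.orthogonal W) := by
    rw [← Submodule.finrank_quotient_add_finrank (W.submoduleOf (B.orthogonal W)),
      (Submodule.submoduleOfEquivOfLe hW).finrank_eq]
  have h4 := Submodule.finrank_le W
  have h5 := Submodule.finrank_mono hW
  omega

/-- The preimage in `W^⊥` of a totally isotropic subspace `U` is totally isotropic of dimension `dim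
U + dim W`. If `U` had half the dimension of `W^⊥/W`, the preimage would have half the dimension of
`V`. -/
theorem inducedForm_isNonsplit (hB : B.IsSymm) (hnd : B.Nondegenerate) (hW : W ≤ B.orthogonal W)
    (hns : IsNonsplit B) : IsNonsplit (inducedForm B hB W) := by
  intro U hU h
  let U' : Submodule (ZMod p) V :=
    (U.comap (W.submoduleOf (B.orthogonal W)).mkQ).map (B.orthogonal W).subtype
  refine hns U' ?_ ?_
  · rintro _ ⟨x, hx, rfl⟩ _ ⟨y, hy, rfl⟩
    exact hU hx _ hy
  · have h1 := finrank_orthQuot hnd hW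
    have h2 : Module.finrank (ZMod p) U' = Module.finrank (ZMod p) U + Module.finrank (ZMod p) W := by
      let N := W.submoduleOf (B.orthogonal W)
      let P := U.comap N.mkQ
      have hP : N ≤ P := fun x hx => by
        change Submodule.Quotient.mk x ∈ U
        rw [(Submodule.Quotient.mk_eq_zero N).2 hx]
        exact Submodule.zero_mem _
      have h3 := LinearMap.finrank_range_add_finrank_ker (N.mkQ.domRestrict P)
      have h4 : LinearMap.range (N.mkQ.domRestrict P) = U := by
        rw [LinearMap.range_domRestrict]
        exact Submodule.map_comap_eq_of_surjective (Submodule.mkQ_surjective N) U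
      have h5 : LinearMap.ker (N.mkQ.domRestrict P) = N.submoduleOf P := by
        rw [LinearMap.ker_domRestrict, Submodule.ker_mkQ]
        rfl
      rw [h4, h5, (Submodule.submoduleOfEquivOfLe hP).finrank_eq,
        (Submodule.submoduleOfEquivOfLe hW).finrank_eq] at h3
      rw [h3]
      exact Submodule.finrank_map_subtype_eq _ _
    omega

theorem finrank_of_standardBasis {M : Type} [AddCommGroup M] [Module (ZMod p) M]
    {B : LinearMap.BilinForm (ZMod p) M} {d : ℕ}
    (b : StandardBasis B d) : Module.finrank (ZMod p) M = 2 * (d + 1) := by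
  have h := Module.finrank_eq_card_basis b.basis
  rw [Module.finrank_baseChange] at h
  simp at h
  omega

end OrthQuot
end
end OrthDL

namespace OrthDL
noncomputable section
variable {p : ℕ} [Fact p.Prime]

/-! ### Inverse images of pairs -/

section InverseImage

variable {V : Type} [AddCommGroup V] [Module (ZMod p) V] [FiniteDimensional (ZMod p) V]
variable {B : LinearMap.BilinForm (ZMod p) V} {W : Submodule (ZMod p) V}

variable (B W) in
/-- A basis of `W`, vectors of `V` dual to it, and linear maps that split `W^⊥ ⊆ V` and
`W^⊥ ⟶ W^⊥ / W`. -/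
structure Splitting where
  /-- a basis of `W` -/
  w : Module.Basis (Fin (Module.finrank (ZMod p) W)) (ZMod p) W
  /-- vectors dual to the basis -/
  u : Fin (Module.finrank (ZMod p) W) → V
  form_w_u : ∀ i j, B (w i) (u j) = if i = j then 1 else 0
  /-- a projection onto `W^⊥` -/
  proj : V →ₗ[ZMod p] B.orthogonal W
  proj_apply : ∀ x, (proj x : V) = x - ∑ i, B (w i) x • u i
  /-- a section of `W^⊥ ⟶ W^⊥ / W` -/
  lift : OrthQuot B W →ₗ[ZMod p] B.orthogonal W
  mk_lift : ∀ z, (W.submoduleOf (B.orthogonal W)).mkQ (lift z) = z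

/-- The coordinate functionals of `W` extend to `V` and are represented by vectors `u i`, as the
form is nondegenerate. Subtracting `∑ B(w i, x) • u i` makes `x` orthogonal to `W`. -/
theorem nonempty_splitting (hB : B.IsSymm) (hnd : B.Nondegenerate) : Nonempty (Splitting B W) := by
  classical
  let w := Module.finBasis (ZMod p) W
  have h1 : ∀ j, ∃ u : V, ∀ i, B (w i) u = if i = j then 1 else 0 := by
    intro j
    obtain ⟨f, hf⟩ := LinearMap.exists_extend (w.coord j)
    refine ⟨(LinearMap.BilinForm.toDual B hnd).symm f, fun i => ?_⟩
    rw [← hB.eq, LinearMap.BilinForm.apply_toDual_symm_apply]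
    have := LinearMap.congr_fun hf (w i)
    simp only [LinearMap.comp_apply, Submodule.subtype_apply] at this
    rw [this, Module.Basis.coord_apply, w.repr_self, Finsupp.single_apply]
  choose u hu using h1
  let P : V →ₗ[ZMod p] V := LinearMap.id - ∑ i, (B (w i)).smulRight (u i)
  have hP : ∀ x, P x = x - ∑ i, B (w i) x • u i := fun x => by simp [P]
  have hmem : ∀ x, P x ∈ B.orthogonal W := by
    intro x z hz
    have h2 : ∀ i, B (w i) (P x) = 0 := by
      intro i
      rw [hP, map_sub, map_sum]
      simp [hu]
    have h3 := w.sum_repr ⟨z, hz⟩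
    have h4 : z = ∑ i, w.repr ⟨z, hz⟩ i • (w i : V) := by
      have := congrArg Subtype.val h3
      rw [Submodule.coe_sum] at this
      exact this.symm
    change B z (P x) = 0
    rw [h4, map_sum, LinearMap.sum_apply]
    simp [h2]
  obtain ⟨s, hs⟩ := LinearMap.exists_rightInverse_of_surjective
    (W.submoduleOf (B.orthogonal W)).mkQ (Submodule.range_mkQ _)
  exact ⟨⟨w, u, fun i j => hu j i, P.codRestrict _ hmem, hP, s, LinearMap.congr_fun hs⟩⟩

/-! ### Splittings after base change to an `𝔽_p`-algebra -/

namespace Splitting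

variable (S : Splitting B W) (R : Type) [CommRing R] [Algebra (ZMod p) R]

/-- The basis of `W` in `R ⊗ V`. -/
def wR (i : Fin (Module.finrank (ZMod p) W)) : R ⊗[ZMod p] V := 1 ⊗ₜ (S.w i : V)

/-- The projection `R ⊗ V ⟶ R ⊗ (W^⊥ / W)`. -/
def qR : R ⊗[ZMod p] V →ₗ[R] R ⊗[ZMod p] OrthQuot B W :=
  ((W.submoduleOf (B.orthogonal W)).mkQ.comp S.proj).baseChange R

/-- A section of `R ⊗ W^⊥ ⟶ R ⊗ (W^⊥ / W)`, as a map to `R ⊗ V`. -/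
def tR : R ⊗[ZMod p] OrthQuot B W →ₗ[R] R ⊗[ZMod p] V :=
  ((B.orthogonal W).subtype.comp S.lift).baseChange R

variable {R} {R' : Type} [CommRing R'] [Algebra (ZMod p) R']

theorem wR_map (φ : R →+* R') (i) : changeScalars φ V (S.wR R i) = S.wR R' i := by
  simp [wR, changeScalars]

theorem qR_map (φ : R →+* R') (x : R ⊗[ZMod p] V) :
    changeScalars φ _ (S.qR R x) = S.qR R' (changeScalars φ V x) := changeScalars_baseChange _ _ _

theorem tR_map (φ : R →+* R') (x : R ⊗[ZMod p] OrthQuot B W) :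
    changeScalars φ _ (S.tR R x) = S.tR R' (changeScalars φ _ x) := changeScalars_baseChange _ _ _

theorem mk_proj (x : B.orthogonal W) : S.proj x.1 = x := by
  apply Subtype.ext
  rw [S.proj_apply, sub_eq_self]
  refine Finset.sum_eq_zero fun i _ => ?_
  rw [show B (S.w i) x = 0 from x.2 _ (S.w i).2, zero_smul]

theorem qR_subtype (y : R ⊗[ZMod p] B.orthogonal W) :
    S.qR R ((B.orthogonal W).subtype.baseChange R y) =
      (W.submoduleOf (B.orthogonal W)).mkQ.baseChange R y := by
  rw [qR, ← LinearMap.comp_apply, ← LinearMap.baseChange_comp]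
  congr 2
  ext x
  simp [S.mk_proj]

theorem qR_tR (x : R ⊗[ZMod p] OrthQuot B W) : S.qR R (S.tR R x) = x := by
  rw [qR, tR, ← LinearMap.comp_apply, ← LinearMap.baseChange_comp]
  have : ((W.submoduleOf (B.orthogonal W)).mkQ.comp S.proj).comp
      ((B.orthogonal W).subtype.comp S.lift) = LinearMap.id := by
    refine LinearMap.ext fun x => ?_
    have := S.mk_lift x
    simp only [LinearMap.comp_apply, Submodule.subtype_apply, S.mk_proj]
    exact this
  rw [this, LinearMap.baseChange_id]
  rfl

theorem qR_wR (hW : W ≤ B.orthogonal W) (i) : S.qR R (S.wR R i) = 0 := by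
  have h : (W.submoduleOf (B.orthogonal W)).mkQ (S.proj (S.w i)) = 0 := by
    have := S.mk_proj ⟨S.w i, hW (S.w i).2⟩
    simp only at this
    rw [this, Submodule.mkQ_apply, Submodule.Quotient.mk_eq_zero]
    exact (S.w i).2
  simp only [qR, wR, LinearMap.baseChange_tmul, LinearMap.comp_apply]
  rw [h, TensorProduct.tmul_zero]

theorem form_wR_subtype (y : R ⊗[ZMod p] B.orthogonal W) (i) :
    B.baseChange R (S.wR R i) ((B.orthogonal W).subtype.baseChange R y) = 0 := by
  induction y with
  | zero => simp
  | tmul a x =>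
    simp only [wR, LinearMap.baseChange_tmul, LinearMap.BilinForm.baseChange_tmul,
      Submodule.subtype_apply]
    rw [show B (S.w i) x = 0 from x.2 _ (S.w i).2]
    simp
  | add x y hx hy => rw [map_add, map_add, hx, hy, add_zero]

/-- Taking the orthogonal of `W` commutes with base change: the formula for the projection holds
over `R`, and it fixes every vector orthogonal to the `w i`. -/
theorem exists_eq_subtype {x : R ⊗[ZMod p] V} (hx : ∀ i, B.baseChange R (S.wR R i) x = 0) :
    (B.orthogonal W).subtype.baseChange R (S.proj.baseChange R x) = x := by
  have h : ∀ x : R ⊗[ZMod p] V, (B.orthogonal W).subtype.baseChange R (S.proj.baseChange R x) =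
      x - ∑ i, B.baseChange R (S.wR R i) x • (1 ⊗ₜ S.u i) := by
    intro x
    induction x with
    | zero => simp
    | tmul a x =>
      simp only [wR, LinearMap.baseChange_tmul, LinearMap.BilinForm.baseChange_tmul,
        Submodule.subtype_apply, S.proj_apply, TensorProduct.tmul_sub, TensorProduct.tmul_sum]
      congr 1
      refine Finset.sum_congr rfl fun i _ => ?_
      rw [TensorProduct.tmul_smul, TensorProduct.smul_tmul', TensorProduct.smul_tmul']
      simp
    | add x y hx hy =>
      simp only [map_add, hx, hy, add_smul, Finset.sum_add_distrib]
      abel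
  rw [h]
  simp [hx]

theorem form_wR_tR (z : R ⊗[ZMod p] OrthQuot B W) (i) :
    B.baseChange R (S.wR R i) (S.tR R z) = 0 := by
  rw [tR, LinearMap.baseChange_comp]
  exact S.form_wR_subtype _ i

theorem form_wR_wR (hW : W ≤ B.orthogonal W) (i j) :
    B.baseChange R (S.wR R i) (S.wR R j) = 0 := by
  simp only [wR, LinearMap.BilinForm.baseChange_tmul]
  rw [show B (S.w i) (S.w j) = 0 from hW (S.w j).2 _ (S.w i).2]
  simp

theorem form_qR (hB : B.IsSymm) {x y : R ⊗[ZMod p] V} (hx : ∀ i, B.baseChange R (S.wR R i) x = 0)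
    (hy : ∀ i, B.baseChange R (S.wR R i) y = 0) :
    (inducedForm B hB W).baseChange R (S.qR R x) (S.qR R y) = B.baseChange R x y := by
  rw [← S.exists_eq_subtype hx, ← S.exists_eq_subtype hy, qR_subtype, qR_subtype]
  generalize S.proj.baseChange R x = x
  generalize S.proj.baseChange R y = y
  induction x with
  | zero => simp
  | add x x' hx hx' => simp only [map_add, LinearMap.add_apply, hx, hx']
  | tmul a x =>
    induction y with
    | zero => simp
    | add y y' hy hy' => simp only [map_add, hy, hy']
    | tmul b y => rfl

/-- `R ⊗ W^⊥` is the sum of `R ⊗ W` and the image of the section. -/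
theorem exists_sum {x : R ⊗[ZMod p] V} (hx : ∀ i, B.baseChange R (S.wR R i) x = 0) :
    ∃ a : Fin (Module.finrank (ZMod p) W) → R, x = ∑ i, a i • S.wR R i + S.tR R (S.qR R x) := by
  have h : ∀ y : R ⊗[ZMod p] B.orthogonal W, ∃ a : Fin (Module.finrank (ZMod p) W) → R,
      (B.orthogonal W).subtype.baseChange R y = ∑ i, a i • S.wR R i +
        S.tR R ((W.submoduleOf (B.orthogonal W)).mkQ.baseChange R y) := by
    intro y
    induction y with
    | zero => exact ⟨0, by simp⟩
    | add x y hx hy =>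
      obtain ⟨a, ha⟩ := hx
      obtain ⟨b, hb⟩ := hy
      refine ⟨a + b, ?_⟩
      simp only [map_add, ha, hb, Pi.add_apply, add_smul, Finset.sum_add_distrib]
      abel
    | tmul r x =>
      have h1 : (x - S.lift ((W.submoduleOf (B.orthogonal W)).mkQ x) : B.orthogonal W).1 ∈ W := by
        have : (W.submoduleOf (B.orthogonal W)).mkQ
            (x - S.lift ((W.submoduleOf (B.orthogonal W)).mkQ x)) = 0 := by
          rw [map_sub, S.mk_lift, sub_self]
        exact (Submodule.Quotient.mk_eq_zero (W.submoduleOf (B.orthogonal W))).1 this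
      let c := S.w.repr ⟨_, h1⟩
      have h2 : (x : V) - S.lift ((W.submoduleOf (B.orthogonal W)).mkQ x) = ∑ i, c i • (S.w i : V) := by
        have := congrArg Subtype.val (S.w.sum_repr ⟨_, h1⟩)
        rw [Submodule.coe_sum] at this
        exact this.symm
      refine ⟨fun i => c i • r, ?_⟩
      have h3 : ∑ i, (c i • r) • S.wR R i = r ⊗ₜ (∑ i, c i • (S.w i : V)) := by
        rw [TensorProduct.tmul_sum]
        refine Finset.sum_congr rfl fun i _ => ?_
        rw [wR, TensorProduct.smul_tmul', TensorProduct.tmul_smul, TensorProduct.smul_tmul']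
        simp
      rw [h3, ← h2, TensorProduct.tmul_sub]
      simp [tR]
  obtain ⟨a, ha⟩ := h (S.proj.baseChange R x)
  rw [S.exists_eq_subtype hx, ← S.qR_subtype, S.exists_eq_subtype hx] at ha
  exact ⟨a, ha⟩

/-- The projection `qR` isolates `z`, and then the pairings with the dual vectors `u j` isolate the
coefficients. -/
theorem eq_zero_of_sum (hW : W ≤ B.orthogonal W) {a : Fin (Module.finrank (ZMod p) W) → R}
    {z : R ⊗[ZMod p] OrthQuot B W} (h : ∑ i, a i • S.wR R i + S.tR R z = 0) : a = 0 ∧ z = 0 := by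
  have hz : z = 0 := by
    have := congrArg (S.qR R) h
    simpa [map_add, map_sum, S.qR_wR hW, S.qR_tR] using this
  subst hz
  refine ⟨?_, rfl⟩
  rw [map_zero, add_zero] at h
  ext j
  have := congrArg (fun x => B.baseChange R x (1 ⊗ₜ S.u j)) h
  simpa [map_sum, LinearMap.sum_apply, wR, S.form_w_u] using this

end Splitting

variable {X T : Sch p} {d e r : ℕ} {c : Prop}

/-- Replaces the image of a preimage by two conditions on `x` that visibly commute with restriction
and base change: orthogonality to `W`, and membership of the class in `L`. -/
theorem mem_inverseImage_iff (S : Splitting B W)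
    {L : SubModule (OrthQuot B W) X} {U : X.left.Opens} {x : Γ(X.left, U) ⊗[ZMod p] V} :
    x ∈ sec (inverseImage B W L) U ↔
      (∀ i, B.baseChange Γ(X.left, U) (S.wR _ i) x = 0) ∧ S.qR _ x ∈ sec L U := by
  constructor
  · rintro ⟨y, hy, rfl⟩
    refine ⟨fun i => S.form_wR_subtype y i, ?_⟩
    rw [S.qR_subtype]
    exact hy
  · rintro ⟨h1, h2⟩
    refine ⟨S.proj.baseChange _ x, ?_, S.exists_eq_subtype h1⟩
    change (W.submoduleOf (B.orthogonal W)).mkQ.baseChange _ (S.proj.baseChange _ x) ∈ sec L U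
    rw [← S.qR_subtype, S.exists_eq_subtype h1]
    exact h2

theorem wR_mem_inverseImage (S : Splitting B W) (hW : W ≤ B.orthogonal W)
    {L : SubModule (OrthQuot B W) X} {U : X.left.Opens} (i) :
    S.wR _ i ∈ sec (inverseImage B W L) U := by
  rw [mem_inverseImage_iff S, S.qR_wR hW]
  exact ⟨fun j => S.form_wR_wR hW j i, Submodule.zero_mem _⟩

theorem tR_mem_inverseImage (S : Splitting B W)
    {L : SubModule (OrthQuot B W) X} {U : X.left.Opens} {z : Γ(X.left, U) ⊗[ZMod p] OrthQuot B W}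
    (hz : z ∈ sec L U) : S.tR _ z ∈ sec (inverseImage B W L) U := by
  rw [mem_inverseImage_iff S, S.qR_tR]
  exact ⟨S.form_wR_tR z, hz⟩

theorem res_qR (S : Splitting B W) {U U' : X.left.Opens} (h : U' ≤ U)
    (x : Γ(X.left, U) ⊗[ZMod p] V) : res _ X h (S.qR _ x) = S.qR _ (res V X h x) := S.qR_map _ _

theorem form_wR_res (S : Splitting B W) {U U' : X.left.Opens} (h : U' ≤ U)
    (x : Γ(X.left, U) ⊗[ZMod p] V) (i) :
    B.baseChange _ (S.wR _ i) (res V X h x) =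
      X.left.presheaf.map (homOfLE h).op (B.baseChange _ (S.wR _ i) x) := by
  rw [← S.wR_map (X.left.presheaf.map (homOfLE h).op).hom, changeScalars_form]

theorem isSubsheaf_inverseImage (S : Splitting B W)
    {L : SubModule (OrthQuot B W) X} (hL : IsSubsheaf L) : IsSubsheaf (inverseImage B W L) := by
  intro U x hx
  rw [mem_inverseImage_iff S]
  constructor
  · intro i
    refine section_eq_of_locally fun s hs => ?_
    obtain ⟨A, hA, hsA, h⟩ := hx s hs
    refine ⟨A, hA, hsA, ?_⟩
    rw [map_zero, ← form_wR_res S hA]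
    exact ((mem_inverseImage_iff S).1 h).1 i
  · refine hL U _ fun s hs => ?_
    obtain ⟨A, hA, hsA, h⟩ := hx s hs
    refine ⟨A, hA, hsA, ?_⟩
    rw [res_qR]
    exact ((mem_inverseImage_iff S).1 h).2

/-- The tuple that consists of the basis of `W` and a lift of `y`. -/
def Splitting.tuple (S : Splitting B W) {R : Type} [CommRing R] [Algebra (ZMod p) R]
    (y : Fin r → R ⊗[ZMod p] OrthQuot B W) : Fin (Module.finrank (ZMod p) W + r) → R ⊗[ZMod p] V :=
  Fin.append (S.wR R) fun j => S.tR R (y j)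

theorem Splitting.tuple_map (S : Splitting B W) {R R' : Type} [CommRing R] [Algebra (ZMod p) R]
    [CommRing R'] [Algebra (ZMod p) R'] (φ : R →+* R') (y : Fin r → R ⊗[ZMod p] OrthQuot B W) (j) :
    changeScalars φ V (S.tuple y j) = S.tuple (fun j => changeScalars φ _ (y j)) j := by
  refine Fin.addCases (fun i => ?_) (fun i => ?_) j
  · simp only [tuple, Fin.append_left, S.wR_map]
  · simp only [tuple, Fin.append_right, S.tR_map]

theorem IsFrame.sec_inverseImage (S : Splitting B W) (hW : W ≤ B.orthogonal W)
    {L : SubModule (OrthQuot B W) X} {U : X.left.Opens} {τ : Fin r ↪ _}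
    {y : Fin r → Γ(X.left, U) ⊗[ZMod p] OrthQuot B W} (hy : IsFrame L U τ y) {A : X.left.Opens}
    (hA : A ≤ U) : sec (inverseImage B W L) A =
      Submodule.span _ (Set.range fun j => res V X hA (S.tuple y j)) := by
  refine le_antisymm (fun x hx => ?_) (Submodule.span_le.2 ?_)
  · rw [mem_inverseImage_iff S] at hx
    obtain ⟨a, ha⟩ := S.exists_sum hx.1
    rw [ha]
    refine Submodule.add_mem _ (Submodule.sum_mem _ fun i _ => Submodule.smul_mem _ _
      (Submodule.subset_span ⟨Fin.castAdd r i, ?_⟩)) ?_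
    · simp only [Splitting.tuple, Fin.append_left, res, S.wR_map]
    · have h1 := (hy.mem_iff hA _).1 hx.2
      rw [h1, map_sum]
      refine Submodule.sum_mem _ fun j _ => ?_
      rw [map_smul]
      refine Submodule.smul_mem _ _ (Submodule.subset_span ⟨Fin.natAdd _ j, ?_⟩)
      simp only [Splitting.tuple, Fin.append_right, res, S.tR_map]
  · rintro _ ⟨j, rfl⟩
    refine res_mem _ hA ?_
    refine Fin.addCases (fun i => ?_) (fun i => ?_) j
    · simp only [Splitting.tuple, Fin.append_left]
      exact wR_mem_inverseImage S hW i
    · simp only [Splitting.tuple, Fin.append_right]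
      exact tR_mem_inverseImage S (hy.mem i)

theorem Splitting.linearIndependent_tuple (S : Splitting B W) (hW : W ≤ B.orthogonal W)
    {R : Type} [CommRing R] [Algebra (ZMod p) R] {y : Fin r → R ⊗[ZMod p] OrthQuot B W}
    (hy : LinearIndependent R y) : LinearIndependent R (S.tuple y) := by
  rw [Fintype.linearIndependent_iff] at hy ⊢
  intro a ha
  rw [Fin.sum_univ_add] at ha
  simp only [tuple, Fin.append_left, Fin.append_right] at ha
  simp only [← map_smul, ← map_sum] at ha
  obtain ⟨h1, h2⟩ := S.eq_zero_of_sum hW ha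
  intro j
  refine Fin.addCases (fun i => ?_) (fun i => ?_) j
  · exact congrFun h1 i
  · exact hy _ h2 i

theorem IsSubbundle.inverseImage (S : Splitting B W) (hW : W ≤ B.orthogonal W)
    {L : SubModule (OrthQuot B W) X} (hL : IsSubbundle L r) :
    IsSubbundle (inverseImage B W L) (Module.finrank (ZMod p) W + r) := by
  rw [isSubbundle_iff] at hL ⊢
  refine ⟨isSubsheaf_inverseImage S hL.1, fun s => ?_⟩
  obtain ⟨U, τ, y, hs, hy⟩ := hL.2 s
  obtain ⟨A, -, ρ, z, hsA, hz⟩ := exists_isFrame hs (fun A hA => hy.sec_inverseImage S hW hA) (by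
    simp only [S.tuple_map]
    exact S.linearIndependent_tuple hW (hy.norm.map _).linearIndependent)
  exact ⟨A, ρ, z, hsA, hz⟩

/-- The chosen lift `tR` and the vectors of `W` commute with base change, so that inverse images do
too, for arbitrary `L`. -/
theorem pullbackSub_inverseImage (S : Splitting B W) (hW : W ≤ B.orthogonal W)
    (L : SubModule (OrthQuot B W) X) (f : T ⟶ X) :
    pullbackSub f (inverseImage B W L) = inverseImage B W (pullbackSub f L) := by
  have hmem : ∀ (U : X.left.Opens) (A : T.left.Opens) (h : A ≤ f.left ⁻¹ᵁ U),
      ∀ x ∈ sec (inverseImage B W L) U,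
        pull V f U A h x ∈ sec (inverseImage B W (pullbackSub f L)) A := by
    intro U A h x hx
    rw [mem_inverseImage_iff S] at hx ⊢
    constructor
    · intro i
      rw [← S.wR_map (f.left.appLE U A h).hom, changeScalars_form, hx.1, map_zero]
    · rw [← S.qR_map (f.left.appLE U A h).hom]
      exact mem_pullbackSub f h hx.2
  refine le_antisymm ?_ ?_
  · refine generated_le (isSubsheaf_inverseImage S (isSubsheaf_generated _)) ?_
    rintro A _ ⟨U, h, x, hx, rfl⟩
    exact hmem U A h x hx
  · have hsub : IsSubsheaf (pullbackSub f (inverseImage B W L)) := isSubsheaf_generated _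
    -- The sections whose lift lies in the left-hand side. They form a subsheaf that contains the
    -- generators of `f^* L`, hence all of it.
    let K : SubModule (OrthQuot B W) T := mkSub T
      (fun A => (sec (pullbackSub f (inverseImage B W L)) A).comap (S.tR _)) (by
        intro A A' h x hx
        have h1 : S.tR _ (res _ T h x) ∈ sec (pullbackSub f (inverseImage B W L)) A' := by
          rw [← S.tR_map]
          exact res_mem _ h hx
        exact h1)
    have hK : pullbackSub f L ≤ K := by
      refine generated_le (fun A x hx => ?_) ?_
      · refine hsub A _ fun s hs => ?_
        obtain ⟨A', h, hsA, hx⟩ := hx s hs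
        refine ⟨A', h, hsA, ?_⟩
        rw [res, S.tR_map]
        exact hx
      · rintro A _ ⟨U, h, x, hx, rfl⟩
        have h1 : S.tR _ (pull _ f U A h x) ∈ sec (pullbackSub f (inverseImage B W L)) A := by
          rw [← S.tR_map]
          exact mem_pullbackSub f h (tR_mem_inverseImage S hx)
        exact h1
    intro A x hx
    have hx' := (mem_inverseImage_iff S (U := A.unop)).1 hx
    obtain ⟨a, ha⟩ := S.exists_sum hx'.1
    have h2 : S.tR _ (S.qR _ x) ∈ sec (pullbackSub f (inverseImage B W L)) A.unop := hK A hx'.2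
    change x ∈ sec (pullbackSub f (inverseImage B W L)) A.unop
    rw [ha]
    refine Submodule.add_mem _ (Submodule.sum_mem _ fun i _ => Submodule.smul_mem _ _ ?_) h2
    have h3 := mem_pullbackSub (W := A.unop) f (U := ⊤) le_top
      (wR_mem_inverseImage S hW (L := L) (U := ⊤) i)
    rw [show pull V f ⊤ A.unop le_top (S.wR _ i) = S.wR _ i from S.wR_map _ i] at h3
    exact h3

theorem Flag.pullback_inverseImage (S : Splitting B W) (hW : W ≤ B.orthogonal W)
    (F : Flag (OrthQuot B W) X) (f : T ⟶ X) :
    (F.inverseImage B W).pullback f = (F.pullback f).inverseImage B W :=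
  Flag.ext (pullbackSub_inverseImage S hW _ f) (pullbackSub_inverseImage S hW _ f)

theorem frobM_qR (S : Splitting B W) {R : Type} [CommRing R] [Algebra (ZMod p) R]
    (x : R ⊗[ZMod p] V) : frobM (S.qR R x) = S.qR R (frobM x) := S.qR_map _ _

/-- The vectors of `W` are fixed by Frobenius. Hence `W^⊥` is stable under Frobenius, and the
equations of `Y_{W^⊥/W}` become `p`-th powers on `Frob^* L_{d+1}`. -/
theorem form_wR_frobM (S : Splitting B W) {R : Type} [CommRing R] [Algebra (ZMod p) R]
    (x : R ⊗[ZMod p] V) (i) :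
    B.baseChange R (S.wR R i) (frobM x) = frob (p := p) R (B.baseChange R (S.wR R i) x) := by
  conv_lhs => rw [← S.wR_map (frob (p := p) R) i]
  exact changeScalars_form _ _ _ _

theorem IsModuli.inverseImage (S : Splitting B W) (hW : W ≤ B.orthogonal W) (hB : B.IsSymm)
    {F : Flag (OrthQuot B W) X} (hF : IsModuli (inducedForm B hB W) d e c X F) :
    IsModuli B (Module.finrank (ZMod p) W + d) (Module.finrank (ZMod p) W + e) c X
      (F.inverseImage B W) where
  small := hF.small.inverseImage S hW
  big := hF.big.inverseImage S hW
  isotropic U x hx y hy := by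
    replace hx := (mem_inverseImage_iff S).1 hx
    replace hy := (mem_inverseImage_iff S).1 hy
    rw [← S.form_qR hB hx.1 hy.1]
    exact hF.isotropic U _ hx.2 _ hy.2
  frob hc U x hx y hy := by
    replace hx := (mem_inverseImage_iff S).1 hx
    replace hy := (mem_inverseImage_iff S).1 hy
    rw [← S.form_qR hB hx.1 fun i => by rw [form_wR_frobM, hy.1, map_zero], ← frobM_qR]
    exact hF.frob hc U _ hx.2 _ hy.2

end InverseImage
end
end OrthDL

namespace OrthDL
noncomputable section
variable {p : ℕ} [Fact p.Prime]

section Quotient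

variable {V : Type} [AddCommGroup V] [Module (ZMod p) V] [FiniteDimensional (ZMod p) V]
variable {B : LinearMap.BilinForm (ZMod p) V} {W : Submodule (ZMod p) V}
variable {X T : Sch p} {d e r : ℕ} {c : Prop}

/-! ### Quotients of pairs by `W` -/

/-- The submodule of `(W^⊥ / W) ⊗ 𝒪` of sections whose lifts lie in `L`. -/
def quotSub (S : Splitting B W) (L : SubModule V X) : SubModule (OrthQuot B W) X :=
  mkSub X (fun U => (sec L U).comap (S.tR _)) (by
    intro U U' h x hx
    have h1 : S.tR _ (res _ X h x) ∈ sec L U' := by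
      rw [← S.tR_map]
      exact res_mem _ h hx
    exact h1)

variable (S : Splitting B W) {L : SubModule V X}

theorem mem_quotSub {U : X.left.Opens} {z : Γ(X.left, U) ⊗[ZMod p] OrthQuot B W} :
    z ∈ sec (quotSub S L) U ↔ S.tR _ z ∈ sec L U := Iff.rfl

theorem isSubsheaf_quotSub (hL : IsSubsheaf L) : IsSubsheaf (quotSub S L) := by
  intro U z hz
  refine hL U _ fun s hs => ?_
  obtain ⟨A, hA, hsA, h⟩ := hz s hs
  refine ⟨A, hA, hsA, ?_⟩
  rw [res, S.tR_map]
  exact h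

theorem quotSub_inverseImage (L : SubModule (OrthQuot B W) X) :
    quotSub S (inverseImage B W L) = L := by
  refine le_antisymm (fun U z hz => ?_) fun U z hz => ?_
  · have := (mem_inverseImage_iff S).1 ((mem_quotSub S (U := U.unop)).1 hz)
    exact Eq.mp (congrArg (· ∈ sec L U.unop) (S.qR_tR (R := Γ(X.left, U.unop)) z)) this.2
  · exact (mem_quotSub S (U := U.unop)).2 (tR_mem_inverseImage S hz)

variable {S}

theorem tR_qR_mem (hw : ∀ (U : X.left.Opens) i, S.wR _ i ∈ sec L U)
    (hp : ∀ (U : X.left.Opens), ∀ x ∈ sec L U, ∀ i, B.baseChange _ (S.wR _ i) x = 0)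
    {U : X.left.Opens} {x : Γ(X.left, U) ⊗[ZMod p] V} (hx : x ∈ sec L U) :
    S.tR _ (S.qR _ x) ∈ sec L U := by
  obtain ⟨a, ha⟩ := S.exists_sum (hp U x hx)
  have h1 : S.tR _ (S.qR _ x) = x - ∑ i, a i • S.wR _ i := by
    rw [eq_sub_iff_add_eq, add_comm]
    exact ha.symm
  rw [h1]
  exact Submodule.sub_mem _ hx (Submodule.sum_mem _ fun i _ => Submodule.smul_mem _ _ (hw U i))

theorem inverseImage_quotSub (hw : ∀ (U : X.left.Opens) i, S.wR _ i ∈ sec L U)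
    (hp : ∀ (U : X.left.Opens), ∀ x ∈ sec L U, ∀ i, B.baseChange _ (S.wR _ i) x = 0) :
    inverseImage B W (quotSub S L) = L := by
  refine le_antisymm (fun U x hx => ?_) fun U x hx => ?_
  · have h1 := (mem_inverseImage_iff S (U := U.unop)).1 hx
    obtain ⟨a, ha⟩ := S.exists_sum h1.1
    change x ∈ sec L U.unop
    rw [ha]
    exact Submodule.add_mem _ (Submodule.sum_mem _ fun i _ => Submodule.smul_mem _ _ (hw _ i)) h1.2
  · exact (mem_inverseImage_iff S (U := U.unop)).2 ⟨hp _ x hx, tR_qR_mem hw hp hx⟩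

/-- The span of `x` contains `W` and lies in `W^⊥`, so it is `W` plus the lifts of the classes of
the `x j`. By dimension these classes span a space of dimension `r`, and a basis can be chosen among
them. -/
theorem exists_linearIndependent_qR {K : Type} [Field K] [Algebra (ZMod p) K]
    (hW : W ≤ B.orthogonal W)
    {x : Fin (Module.finrank (ZMod p) W + r) → K ⊗[ZMod p] V} (hx : LinearIndependent K x)
    (hw : ∀ i, S.wR K i ∈ Submodule.span K (Set.range x))
    (hp : ∀ i j, B.baseChange K (S.wR K i) (x j) = 0) :
    ∃ J : Fin r → Fin (Module.finrank (ZMod p) W + r),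
      LinearIndependent K fun k => S.qR K (x (J k)) := by
  obtain ⟨f, hf, hfs, hfi⟩ := Submodule.exists_fun_fin_finrank_span_eq K
    (Set.range fun j => S.qR K (x j))
  choose J hJ using hf
  have hspan : Submodule.span K (Set.range (S.tuple f)) = Submodule.span K (Set.range x) := by
    refine le_antisymm (Submodule.span_le.2 ?_) (Submodule.span_le.2 ?_)
    · rintro _ ⟨k, rfl⟩
      refine Fin.addCases (fun i => ?_) (fun i => ?_) k
      · simp only [Splitting.tuple, Fin.append_left]
        exact hw i
      · simp only [Splitting.tuple, Fin.append_right]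
        obtain ⟨a, ha⟩ := S.exists_sum (x := x (J i)) fun k => hp k _
        rw [← hJ i]
        have h1 : S.tR _ (S.qR _ (x (J i))) = x (J i) - ∑ i, a i • S.wR _ i := by
          rw [eq_sub_iff_add_eq, add_comm]
          exact ha.symm
        change S.tR _ (S.qR _ (x (J i))) ∈ _
        rw [h1]
        exact Submodule.sub_mem _ (Submodule.subset_span ⟨_, rfl⟩)
          (Submodule.sum_mem _ fun i _ => Submodule.smul_mem _ _ (hw i))
    · rintro _ ⟨k, rfl⟩
      obtain ⟨a, ha⟩ := S.exists_sum (x := x k) fun i => hp i _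
      rw [ha]
      refine Submodule.add_mem _ (Submodule.sum_mem _ fun i _ => Submodule.smul_mem _ _
        (Submodule.subset_span ⟨Fin.castAdd _ i, by simp [Splitting.tuple]⟩)) ?_
      have h2 : S.qR K (x k) ∈ Submodule.span K (Set.range f) := by
        rw [hfs]
        exact Submodule.subset_span ⟨k, rfl⟩
      obtain ⟨b, hb⟩ := (Submodule.mem_span_range_iff_exists_fun K).1 h2
      rw [← hb, map_sum]
      refine Submodule.sum_mem _ fun i _ => ?_
      rw [map_smul]
      exact Submodule.smul_mem _ _ (Submodule.subset_span ⟨Fin.natAdd _ i, by simp [Splitting.tuple]⟩)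
  have hcard := congrArg (fun N : Submodule K (K ⊗[ZMod p] V) => Module.finrank K N) hspan
  simp only [finrank_span_eq_card (S.linearIndependent_tuple hW hfi), finrank_span_eq_card hx,
    Fintype.card_fin] at hcard
  have hm : r = Module.finrank K (Submodule.span K (Set.range fun j => S.qR K (x j))) := by omega
  refine ⟨fun k => J (Fin.cast hm k), ?_⟩
  have : (fun k => S.qR K (x (J (Fin.cast hm k)))) = f ∘ Fin.cast hm := funext fun k => hJ _
  rw [this]
  exact hfi.comp _ (Fin.cast_injective hm)

/-- In the fibre at `s`, choose `r` members of a frame of `L` with independent classes. With the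
vectors of `W` they generate `L` near `s`, so their classes generate the quotient there. -/
theorem IsSubbundle.quotSub (hW : W ≤ B.orthogonal W)
    (hL : IsSubbundle L (Module.finrank (ZMod p) W + r))
    (hw : ∀ (U : X.left.Opens) i, S.wR _ i ∈ sec L U)
    (hp : ∀ (U : X.left.Opens), ∀ x ∈ sec L U, ∀ i, B.baseChange _ (S.wR _ i) x = 0) :
    IsSubbundle (quotSub S L) r := by
  rw [isSubbundle_iff] at hL ⊢
  refine ⟨isSubsheaf_quotSub S hL.1, fun s => ?_⟩
  obtain ⟨U, σ, x, hs, hx⟩ := hL.2 s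
  let ev := evalAt X hs
  obtain ⟨J, hJ⟩ := exists_linearIndependent_qR (S := S) hW (hx.norm.map ev).linearIndependent
    (fun i => by
      have := hw U i
      rw [hx.span_self] at this
      have h2 := changeScalars_mem_span ev this
      rwa [S.wR_map] at h2)
    fun i j => by
      rw [← S.wR_map ev, changeScalars_form, hp U _ (hx.mem j), map_zero]
  let z : Fin (Module.finrank (ZMod p) W + r) → Γ(X.left, U) ⊗[ZMod p] V :=
    Fin.append (S.wR _) fun k => x (J k)
  have hz : LinearIndependent (X.left.residueField s) fun j => changeScalars ev V (z j) := by
    rw [Fintype.linearIndependent_iff] at hJ ⊢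
    intro a ha
    rw [Fin.sum_univ_add] at ha
    simp only [z, Fin.append_left, Fin.append_right, S.wR_map] at ha
    have h1 := congrArg (S.qR _) ha
    simp only [map_add, map_sum, map_smul, S.qR_wR hW, smul_zero, Finset.sum_const_zero, zero_add,
      map_zero] at h1
    have h2 := hJ _ h1
    simp only [h2, zero_smul, Finset.sum_const_zero, add_zero] at ha
    have h3 := (S.eq_zero_of_sum hW (R := X.left.residueField s) (z := 0) (by
      rw [map_zero, add_zero]
      exact ha)).1
    intro j
    refine Fin.addCases (fun i => ?_) (fun i => ?_) j
    · exact congrFun h3 i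
    · exact h2 i
  obtain ⟨A, hA, ρ, hsA, -, hsp⟩ := hx.exists_span_of_linearIndependent hs (fun j => by
    refine Fin.addCases (fun i => ?_) (fun i => ?_) j
    · simp only [z, Fin.append_left]
      exact hw U i
    · simp only [z, Fin.append_right]
      exact hx.mem _) hz
  refine Exists.imp (fun A' ⟨_, τ, y, hsA', hy⟩ => ⟨τ, y, hsA', hy⟩) (exists_isFrame (L := OrthDL.quotSub S L) (U := A) (s := s) hsA
    (x := fun k => S.qR _ (res V X hA (x (J k)))) (fun C hC => ?_) (by
      have : ∀ k, changeScalars (evalAt X hsA) _ (S.qR _ (res V X hA (x (J k)))) =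
          S.qR _ (changeScalars ev V (x (J k))) := fun k => by
        rw [S.qR_map]
        congr 1
        exact changeScalars_comp _ _ _ (fun a => evalAt_map hsA hA a) V _
      simp only [this]
      exact hJ))
  · have hsec := hsp C hC
    refine le_antisymm (fun t ht => ?_) (Submodule.span_le.2 ?_)
    · have h1 := (mem_quotSub S).1 ht
      rw [hsec] at h1
      obtain ⟨a, ha⟩ := (Submodule.mem_span_range_iff_exists_fun _).1 h1
      have h2 := congrArg (S.qR _) ha
      rw [S.qR_tR] at h2
      rw [← h2, map_sum]
      refine Submodule.sum_mem _ fun j _ => ?_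
      rw [map_smul]
      refine Submodule.smul_mem _ _ ?_
      refine Fin.addCases (fun i => ?_) (fun i => ?_) j
      · simp only [z, Fin.append_left]
        rw [res, S.wR_map, S.qR_wR hW]
        exact Submodule.zero_mem _
      · simp only [z, Fin.append_right]
        refine Submodule.subset_span ⟨i, ?_⟩
        change res _ X hC (S.qR _ (res V X hA (x (J i)))) = _
        rw [res_qR, res_res]
    · rintro _ ⟨k, rfl⟩
      refine (mem_quotSub S).2 ?_
      change S.tR _ (res _ X hC (S.qR _ (res V X hA (x (J k))))) ∈ _
      rw [res_qR, res_res]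
      exact tR_qR_mem hw hp (res_mem _ _ (hx.mem _))

theorem frobM_tR (S : Splitting B W) {R : Type} [CommRing R] [Algebra (ZMod p) R]
    (x : R ⊗[ZMod p] OrthQuot B W) : frobM (S.tR R x) = S.tR R (frobM x) := S.tR_map _ _

-- Conversely to `IsModuli.inverseImage`, a pair with `W ⊆ L_d` comes from `W^⊥/W`: since `L_{d+1}`
-- is isotropic and contains `W`, it lies in `W^⊥`.
variable (S) in
theorem IsModuli.exists_quotient (hW : W ≤ B.orthogonal W) (hB : B.IsSymm) {F : Flag V X}
    (hF : IsModuli B (Module.finrank (ZMod p) W + d) (Module.finrank (ZMod p) W + e) c X F)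
    (hw : ∀ i, S.wR _ i ∈ sec F.small ⊤) :
    ∃ F' : Flag (OrthQuot B W) X, IsModuli (inducedForm B hB W) d e c X F' ∧
      F'.inverseImage B W = F := by
  have hw1 : ∀ (U : X.left.Opens) i, S.wR _ i ∈ sec F.small U := fun U i => by
    have := res_mem _ (le_top : U ≤ ⊤) (hw i)
    rwa [res, S.wR_map] at this
  have hw2 : ∀ (U : X.left.Opens) i, S.wR _ i ∈ sec F.big U := fun U i => F.le _ (hw1 U i)
  have hp2 : ∀ (U : X.left.Opens), ∀ x ∈ sec F.big U, ∀ i, B.baseChange _ (S.wR _ i) x = 0 :=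
    fun U x hx i => hF.isotropic U _ (hw2 U i) _ hx
  have hp1 : ∀ (U : X.left.Opens), ∀ x ∈ sec F.small U, ∀ i, B.baseChange _ (S.wR _ i) x = 0 :=
    fun U x hx i => hp2 U x (F.le _ hx) i
  have hq : ∀ {U : X.left.Opens} {z z' : Γ(X.left, U) ⊗[ZMod p] OrthQuot B W},
      (inducedForm B hB W).baseChange _ z z' = B.baseChange _ (S.tR _ z) (S.tR _ z') := by
    intro U z z'
    rw [← S.form_qR hB (S.form_wR_tR z) (S.form_wR_tR z'), S.qR_tR, S.qR_tR]
  refine ⟨⟨quotSub S F.small, quotSub S F.big, fun U z hz => F.le _ hz⟩,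
    ⟨hF.small.quotSub hW hw1 hp1, hF.big.quotSub hW hw2 hp2, fun U z hz z' hz' => ?_,
      fun hc U z hz z' hz' => ?_⟩,
    Flag.ext (inverseImage_quotSub hw1 hp1) (inverseImage_quotSub hw2 hp2)⟩
  · rw [hq]
    exact hF.isotropic U _ hz _ hz'
  · rw [hq, ← frobM_tR]
    exact hF.frob hc U _ hz _ hz'

theorem Flag.inverseImage_injective (S : Splitting B W) {F F' : Flag (OrthQuot B W) X}
    (h : F.inverseImage B W = F'.inverseImage B W) : F = F' := by
  refine Flag.ext ?_ ?_
  · rw [← quotSub_inverseImage S F.small, ← quotSub_inverseImage S F'.small]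
    exact congrArg _ (congrArg Flag.small h)
  · rw [← quotSub_inverseImage S F.big, ← quotSub_inverseImage S F'.big]
    exact congrArg _ (congrArg Flag.big h)

/-- Write `z` locally as a section of `L_d` plus `b • l`. As `z = Frob z`, it is orthogonal to `Frob
y` by isotropy of `Frob^* L_{d+1}`, and so is `L_d`. Hence `b B(l, Frob y) = 0` with a unit factor,
and `b = 0`. -/
theorem IsModuli.mem_small_of_mem_big (hB : B.IsSymm) (hnd : B.Nondegenerate)
    (hns : IsNonsplit B) (hr : Module.finrank (ZMod p) V = 2 * (d + 1)) {F : Flag V X}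
    (hF : IsModuli B d (d + 1) True X F) {U : X.left.Opens} {z : Γ(X.left, U) ⊗[ZMod p] V}
    (hz : z ∈ sec F.big U) (hz' : frobM z = z) : z ∈ sec F.small U := by
  refine hF.small.1 U z fun s hs => ?_
  obtain ⟨A, σ, x, l, y, hsA, hA, hy, hu, hsp, -⟩ := hF.exists_transversal hB hnd hns hr s
  let C := A ⊓ U
  have hCA : C ≤ A := inf_le_left
  have hC := hA.restrict hCA
  refine ⟨C, inf_le_right, ⟨hsA, hs⟩, ?_⟩
  have hzC := res_mem _ (inf_le_right : C ≤ U) hz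
  obtain ⟨a, b, hab⟩ := hC.exists_sum hzC
  have hyC := res_mem _ hCA hy
  have h0 : B.baseChange _ (res V X (inf_le_right : C ≤ U) z) (frobM (res V X hCA y)) = 0 := by
    rw [← hz', frobM_map, frobM, frobM, changeScalars_form, hF.isotropic C _ hzC _ hyC, map_zero]
  have hx0 : ∀ j, B.baseChange _ (res V X hCA (x j)) (frobM (res V X hCA y)) = 0 := fun j =>
    hF.frob trivial C _ (res_mem _ hCA (hA.small.mem j)) _ hyC
  have hb : b = 0 := by
    rw [hab, map_add, LinearMap.add_apply, map_sum, LinearMap.sum_apply] at h0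
    simp only [map_smul, LinearMap.smul_apply] at h0
    rw [Finset.sum_eq_zero fun j _ => by rw [hx0 j, smul_zero], zero_add] at h0
    have hu' : IsUnit (B.baseChange _ (res V X hCA l) (frobM (res V X hCA y))) := by
      rw [← frobM_map, changeScalars_form]
      exact hu.map _
    exact hu'.mul_left_eq_zero.1 h0
  rw [hab, hb, zero_smul, add_zero]
  exact Submodule.sum_mem _ fun j _ => Submodule.smul_mem _ _ (hC.small.mem j)

end Quotient
end
end OrthDL

namespace OrthDL
noncomputable section
variable {p : ℕ} [Fact p.Prime]

/-! ### Closed subschemes of affine open subschemes -/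

section Affine

variable {X T : Sch p}

theorem toSpecΓ_map_appLE_fromSpec {X S : Scheme.{0}} {A : X.Opens} (hA : IsAffineOpen A) (f : S ⟶ X)
    (hf : ⊤ ≤ f ⁻¹ᵁ A) : S.toSpecΓ ≫ Spec.map (f.appLE A ⊤ hf) ≫ hA.fromSpec = f := by
  have h1 := Scheme.Opens.toSpecΓ_SpecMap_appLE f A ⊤ hf
  rw [Scheme.Opens.toSpecΓ_top] at h1
  have : IsIso (⊤ : S.Opens).ι := S.topIso.isIso_hom
  rw [← cancel_epi (⊤ : S.Opens).ι, ← Category.assoc, ← Category.assoc, h1, Category.assoc,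
    hA.toSpecΓ_fromSpec, Scheme.Hom.resLE_comp_ι]

/-- The zero locus of `I` in `A`, with the universal property in terms of morphisms to `X` instead
of `A`, as the moduli problem is posed on `X`. -/
theorem exists_closed_subscheme {A : X.left.Opens} (hA : IsAffineOpen A) (I : Ideal Γ(X.left, A)) :
    ∃ (T : Sch p) (φ : T ⟶ X) (h : ⊤ ≤ φ.left ⁻¹ᵁ A) (c : T.left ⟶ (A : Scheme.{0})),
      IsClosedImmersion c ∧ c ≫ A.ι = φ.left ∧
      (∀ a, φ.left.appLE A ⊤ h a = 0 ↔ a ∈ I) ∧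
      ∀ (S : Sch p) (f : S ⟶ X) (hf : ⊤ ≤ f.left ⁻¹ᵁ A),
        (∀ a ∈ I, f.left.appLE A ⊤ hf a = 0) → ∃ g : S ⟶ T, g ≫ φ = f := by
  let q : Γ(X.left, A) ⟶ CommRingCat.of (Γ(X.left, A) ⧸ I) :=
    CommRingCat.ofHom (Ideal.Quotient.mk I)
  let g : Spec (CommRingCat.of (Γ(X.left, A) ⧸ I)) ⟶ X.left := Spec.map q ≫ hA.fromSpec
  let c : Spec (CommRingCat.of (Γ(X.left, A) ⧸ I)) ⟶ (A : Scheme.{0}) :=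
    Spec.map q ≫ hA.isoSpec.inv
  have hq : IsClosedImmersion (Spec.map q) :=
    IsClosedImmersion.spec_of_surjective q Ideal.Quotient.mk_surjective
  have hcg : c ≫ A.ι = g := by
    simp only [c, g, Category.assoc, hA.isoSpec_inv_ι]
  have hgA : ⊤ ≤ g ⁻¹ᵁ A := by
    rintro t -
    change g t ∈ A
    rw [← hcg]
    exact (c t).2
  refine ⟨Over.mk (g ≫ X.hom), Over.homMk g, hgA, c, inferInstance, hcg, fun a => ?_,
    fun S f hf hI => ?_⟩
  · have e : g.appLE A ⊤ hgA ≫ (Scheme.ΓSpecIso _).hom = q := by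
      refine Spec.map_injective ?_
      rw [Spec.map_comp, SpecMap_ΓSpecIso_hom, ← cancel_mono hA.fromSpec, Category.assoc]
      exact toSpecΓ_map_appLE_fromSpec hA g hgA
    have := ConcreteCategory.congr_hom e a
    rw [CommRingCat.comp_apply] at this
    rw [← Ideal.Quotient.eq_zero_iff_mem]
    change _ = 0 ↔ q a = 0
    rw [← this]
    let θ := Scheme.ΓSpecIso (CommRingCat.of (Γ(X.left, A) ⧸ I))
    change g.appLE A ⊤ hgA a = 0 ↔ θ.hom (g.appLE A ⊤ hgA a) = 0
    refine ⟨fun h => by rw [h, map_zero], fun h => ?_⟩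
    exact (ConcreteCategory.bijective_of_isIso θ.hom).injective (h.trans (map_zero θ.hom.hom).symm)
  · let ψ : Γ(X.left, A) ⧸ I →+* Γ(S.left, ⊤) := Ideal.Quotient.lift I (f.left.appLE A ⊤ hf).hom hI
    let k : S.left ⟶ Spec (CommRingCat.of (Γ(X.left, A) ⧸ I)) :=
      S.left.toSpecΓ ≫ Spec.map (CommRingCat.ofHom ψ)
    have hψ : q ≫ CommRingCat.ofHom ψ = f.left.appLE A ⊤ hf := by
      ext a
      exact Ideal.Quotient.lift_mk I _ hI
    have hk : k ≫ g = f.left := by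
      simp only [k, g, Category.assoc]
      rw [← Spec.map_comp_assoc, hψ]
      exact toSpecΓ_map_appLE_fromSpec hA f.left hf
    refine ⟨Over.homMk k ?_, ?_⟩
    · change k ≫ g ≫ X.hom = S.hom
      rw [← Category.assoc, hk]
      exact Over.w f
    · ext1
      exact hk

end Affine

/-! ### The morphism `j_{W,V}` -/

section Cycle

variable {V : Type} [AddCommGroup V] [Module (ZMod p) V] [FiniteDimensional (ZMod p) V]
variable {B : LinearMap.BilinForm (ZMod p) V} {W : Submodule (ZMod p) V} {X Y Y' : Sch p} {d : ℕ}

local notation "n" => Module.finrank (ZMod p) W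

theorem IsY.isModuli {M : Type} [AddCommGroup M] [Module (ZMod p) M] [FiniteDimensional (ZMod p) M]
    {B : LinearMap.BilinForm (ZMod p) M} (hB : B.IsSymm) (hnd : B.Nondegenerate)
    (hns : IsNonsplit B) {b : StandardBasis B d} {ε : Sign} {F : Flag M X} (h : IsY b ε X F) :
    IsModuli B d (d + 1) True X F :=
  (isScriptY_iff hB hnd hns (finrank_of_standardBasis b)).1 h.1

/-- Inverse images define a morphism `k` between the spaces `OGr` for `W^⊥/W` and for `V`. By
compatibility of the bases it maps the standard point into the chosen component, hence by continuity
also the whole component of that point. -/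
theorem IsY.inverseImage (hB : B.IsSymm) (hnd : B.Nondegenerate) (hns : IsNonsplit B)
    (hW : W ≤ B.orthogonal W) {b : StandardBasis B (n + d)}
    {b' : StandardBasis (inducedForm B hB W) d} {ε : Sign}
    (hcomp : InComponent b ε (basePoint p) ((b'.flag ε).inverseImage B W))
    {F : Flag (OrthQuot B W) X} (hF : IsY b' ε X F) : IsY b ε X (F.inverseImage B W) := by
  obtain ⟨S⟩ := nonempty_splitting (W := W) hB hnd
  have hF' := hF.isModuli (inducedForm_isSymm hB) (inducedForm_nondegenerate hB hnd)
    (inducedForm_isNonsplit hB hnd hW hns)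
  refine ⟨(isScriptY_iff hB hnd hns (finrank_of_standardBasis b)).2 (hF'.inverseImage S hW hB), ?_⟩
  obtain ⟨-, G', v', hG', f, f₀, hf, hf₀, h⟩ := hF
  obtain ⟨G, v, hG⟩ := isRepresentable_isModuli B (n + d) (n + d + 1) False
  rw [← isOGr_eq] at hG
  have hv' := (isOGr_iff.1 hG'.1).inverseImage S hW hB
  obtain ⟨k, hk, -⟩ := hG.2.2 G' _ (isOGr_iff.2 hv')
  obtain ⟨g₀, hg₀, -⟩ := hG.2.2 _ _ (isOGr_flag hB b ε)
  have key : ∀ {T : Sch p} (t : T ⟶ G'), v.pullback (t ≫ k) = (v'.pullback t).inverseImage B W :=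
    fun t => by
      rw [← Flag.pullback_inverseImage S hW, ← hk]
      exact ((isOGr_iff.1 hG.1).pullback_comp k t).symm
  let x₀ : (basePoint p).left := IsLocalRing.closedPoint (GaloisField p 2)
  rw [← hf₀, ← key, inComponent_iff hG hg₀ _ x₀] at hcomp
  rw [← hf, ← key, inComponent_iff hG hg₀ _ x₀]
  intro x
  rw [connectedComponent_eq (hcomp x₀)]
  exact k.left.continuous.image_connectedComponent_subset _ ⟨_, h x x₀, rfl⟩

/-- `j` is the morphism from pairs for `W^⊥ / W` to pairs for `V` given by inverse images; the pairs
are those in some open and closed part of the space of all pairs. -/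
structure IsCycle (hB : B.IsSymm) (d : ℕ) (u : Flag V Y)
    (u' : Flag (OrthQuot B W) Y') (j : Y' ⟶ Y) : Prop where
  moduli : IsModuli B (n + d) (n + d + 1) True Y u
  moduli' : IsModuli (inducedForm B hB W) d (d + 1) True Y' u'
  pull_eq : u.pullback j = u'.inverseImage B W
  cancel : ∀ {T : Sch p} {f g : T ⟶ Y'}, f ≫ j = g ≫ j → f = g
  factor : ∀ {T : Sch p} (f : T ⟶ Y) (F : Flag (OrthQuot B W) T),
    IsModuli (inducedForm B hB W) d (d + 1) True T F → u.pullback f = F.inverseImage B W →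
      ∃ D : T.left.Opens, IsClosed (D : Set T.left) ∧
        ∀ (S : Sch p) (g : S ⟶ T), (∃ k : S ⟶ Y', k ≫ j = g ≫ f) ↔ ∀ s, g.left s ∈ D
  extend : ∀ {T S : Sch p} (F : Flag V T), IsModuli B (n + d) (n + d + 1) True T F →
    ∀ i : S ⟶ T, Function.Surjective i.left → ∀ k : S ⟶ Y, u.pullback k = F.pullback i →
      ∃ f : T ⟶ Y, u.pullback f = F ∧ i ≫ f = k

/-- Yoneda: inverse images commute with pull-back, so the condition on all points reduces to the
universal pair. -/
theorem isSpecialCycleMap_iff (S : Splitting B W) (hW : W ≤ B.orthogonal W) {c : Prop} {e r : ℕ}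
    {u : Flag V Y} (hu : IsModuli B r e c Y u) {c' : Prop} {e' r' : ℕ}
    {B' : LinearMap.BilinForm (ZMod p) (OrthQuot B W)} {u' : Flag (OrthQuot B W) Y'}
    (hu' : IsModuli B' r' e' c' Y' u') {j : Y' ⟶ Y} :
    IsSpecialCycleMap B W u u' j ↔ u.pullback j = u'.inverseImage B W := by
  constructor
  · intro h
    have := h Y' (𝟙 Y')
    rwa [Category.id_comp, hu'.pullback_id] at this
  · intro h T g
    rw [← hu.pullback_comp, h, Flag.pullback_inverseImage S hW]

theorem existsUnique_specialCycleMap (hB : B.IsSymm) (hnd : B.Nondegenerate) (hns : IsNonsplit B)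
    (hW : W ≤ B.orthogonal W) {b : StandardBasis B (n + d)}
    {b' : StandardBasis (inducedForm B hB W) d} {ε : Sign}
    (hcomp : InComponent b ε (basePoint p) ((b'.flag ε).inverseImage B W))
    {u : Flag V Y} (hY : Represents (IsY b ε) Y u) {u' : Flag (OrthQuot B W) Y'}
    (hY' : Represents (IsY b' ε) Y' u') : ∃! j : Y' ⟶ Y, IsSpecialCycleMap B W u u' j := by
  obtain ⟨S⟩ := nonempty_splitting (W := W) hB hnd
  have hu' := hY'.1.isModuli (inducedForm_isSymm hB) (inducedForm_nondegenerate hB hnd)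
    (inducedForm_isNonsplit hB hnd hW hns)
  simp only [isSpecialCycleMap_iff S hW (hY.1.isModuli hB hnd hns) hu']
  exact hY.2.2 _ _ (hY'.1.inverseImage hB hnd hns hW hcomp)

/-- From here on the components enter only through `factor` and `extend`. The first is the open and
closed locus of `exists_isY_locus`; the second holds because a surjective `i` detects on points
whether a pair lies in the component. -/
theorem isCycle_of_isSpecialCycleMap (hB : B.IsSymm) (hnd : B.Nondegenerate) (hns : IsNonsplit B)
    (hW : W ≤ B.orthogonal W) {b : StandardBasis B (n + d)}
    {b' : StandardBasis (inducedForm B hB W) d} {ε : Sign}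
    {u : Flag V Y} (hY : Represents (IsY b ε) Y u) {u' : Flag (OrthQuot B W) Y'}
    (hY' : Represents (IsY b' ε) Y' u') {j : Y' ⟶ Y} (hj : IsSpecialCycleMap B W u u' j) :
    IsCycle hB d u u' j := by
  obtain ⟨S⟩ := nonempty_splitting (W := W) hB hnd
  have hns' := inducedForm_isNonsplit hB hnd hW hns
  have hsy' := inducedForm_isSymm (W := W) hB
  have hnd' := inducedForm_nondegenerate (W := W) hB hnd
  have hu := hY.1.isModuli hB hnd hns
  have hu' := hY'.1.isModuli hsy' hnd' hns'
  refine ⟨hu, hu', (isSpecialCycleMap_iff S hW hu hu').1 hj, fun {T f g} h => ?_,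
    fun {T} f F hF hf => ?_, fun {T S'} F hF i hi k hk => ?_⟩
  · refine (hY'.2.2 T _ (hY'.2.1 T g)).unique ?_ rfl
    refine Flag.inverseImage_injective S ?_
    rw [← hj, ← hj, h]
  · obtain ⟨D, hD, h⟩ := exists_isY_locus hsy' hnd' hns' (finrank_of_standardBasis b') b' ε hF
    refine ⟨D, hD, fun S' g => ?_⟩
    rw [← h]
    have e : u.pullback (g ≫ f) = (F.pullback g).inverseImage B W := by
      rw [← hu.pullback_comp, hf, Flag.pullback_inverseImage S hW]
    constructor
    · rintro ⟨k, hk⟩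
      have : F.pullback g = u'.pullback k := Flag.inverseImage_injective S (by rw [← e, ← hj, hk])
      rw [this]
      exact hY'.2.1 _ k
    · intro hg
      obtain ⟨k, hk, -⟩ := hY'.2.2 _ _ hg
      refine ⟨k, (hY.2.2 _ _ (hY.2.1 _ (g ≫ f))).unique ?_ rfl⟩
      rw [hj, hk, e]
  · obtain ⟨D, -, h⟩ := exists_isY_locus hB hnd hns (finrank_of_standardBasis b) b ε hF
    have h1 := (h _ i).1 (hk ▸ hY.2.1 _ k)
    have h2 : IsY b ε T F := by
      have := (h T (𝟙 T)).2 fun t => by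
        obtain ⟨s, rfl⟩ := hi t
        exact h1 s
      rwa [hF.pullback_id] at this
    obtain ⟨f, hf, -⟩ := hY.2.2 _ _ h2
    refine ⟨f, hf, (hY.2.2 _ _ (hY.2.1 _ k)).unique ?_ rfl⟩
    rw [← hu.pullback_comp, hf, hk]

end Cycle
end
end OrthDL

namespace OrthDL
noncomputable section
variable {p : ℕ} [Fact p.Prime]

/-! ### The equations of `Y_{W^⊥/W}` in `Y_V` -/

section Equations

variable {V : Type} [AddCommGroup V] [Module (ZMod p) V] [FiniteDimensional (ZMod p) V]
variable {B : LinearMap.BilinForm (ZMod p) V} {W : Submodule (ZMod p) V} {X Y Y' T : Sch p} {d : ℕ}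

local notation "n" => Module.finrank (ZMod p) W

variable {hB : B.IsSymm} {u : Flag V Y} {u' : Flag (OrthQuot B W) Y'} {j : Y' ⟶ Y}
  {A : Y.left.Opens} {r : ℕ} {σ : Fin r ↪ Fin (Module.finrank (ZMod p) V)}
  {y : Fin r → Γ(Y.left, A) ⊗[ZMod p] V}

/-- The ideal generated by the products of the vectors of `W` with the sections `y`. -/
def Splitting.formIdeal (S : Splitting B W) (y : Fin r → Γ(Y.left, A) ⊗[ZMod p] V) :
    Ideal Γ(Y.left, A) :=
  Ideal.span (Set.range fun i : Fin n × Fin r => B.baseChange _ (S.wR _ i.1) (y i.2))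

theorem Splitting.form_wR_pull (S : Splitting B W) (f : T ⟶ Y) {C : T.left.Opens}
    (h : C ≤ f.left ⁻¹ᵁ A) (i) (z : Γ(Y.left, A) ⊗[ZMod p] V) :
    B.baseChange _ (S.wR _ i) (pull V f A C h z) =
      f.left.appLE A C h (B.baseChange _ (S.wR _ i) z) := by
  rw [← S.wR_map (f.left.appLE A C h).hom]
  exact changeScalars_form _ _ _ _

theorem IsCycle.appLE_eq_zero (S : Splitting B W) (hW : W ≤ B.orthogonal W) (hc : IsCycle hB d u u' j) (k : T ⟶ Y')
    {f : T ⟶ Y} (hk : k ≫ j = f) {C : T.left.Opens} (h : C ≤ f.left ⁻¹ᵁ A)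
    {z : Γ(Y.left, A) ⊗[ZMod p] V} (hz : z ∈ sec u.big A) (i) :
    f.left.appLE A C h (B.baseChange _ (S.wR _ i) z) = 0 := by
  rw [← S.form_wR_pull]
  have h1 := mem_pullbackSub f h hz
  have h2 : u.pullback f = (u'.inverseImage B W).pullback k := by
    rw [← hk, ← hc.pull_eq]
    exact (hc.moduli.pullback_comp j k).symm
  have h3 : pullbackSub f u.big = pullbackSub k (inverseImage B W u'.big) := congrArg Flag.big h2
  rw [h3, pullbackSub_inverseImage S hW] at h1
  exact ((mem_inverseImage_iff S).1 h1).1 i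

/-- The equations `B(w_i, y_k) = 0` suffice. They make `w_i` orthogonal to `L_{d+1}`, so it lies in
`L_{d+1}` by maximality; being fixed by Frobenius, it lies in `L_d`. -/
theorem IsCycle.exists_quotient (S : Splitting B W) (hnd : B.Nondegenerate) (hns : IsNonsplit B)
    (hW : W ≤ B.orthogonal W) (hr : Module.finrank (ZMod p) V = 2 * (n + d + 1))
    (hc : IsCycle hB d u u' j) {σ : Fin (n + d + 1) ↪ Fin (Module.finrank (ZMod p) V)}
    {y : Fin (n + d + 1) → Γ(Y.left, A) ⊗[ZMod p] V}
    (hy : IsFrame u.big A σ y) (f : T ⟶ Y) (hf : ⊤ ≤ f.left ⁻¹ᵁ A)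
    (h0 : ∀ a ∈ S.formIdeal y, f.left.appLE A ⊤ hf a = 0) :
    ∃ F : Flag (OrthQuot B W) T, IsModuli (inducedForm B hB W) d (d + 1) True T F ∧
      u.pullback f = F.inverseImage B W := by
  have hF := hc.moduli.pullback f
  have hy' := hy.pullback f hf
  obtain ⟨F, hF', h⟩ := hF.exists_quotient S (e := d + 1) hW hB fun i => by
    refine hF.mem_small_of_mem_big hB hnd hns hr ?_ ?_
    · change _ ∈ sec (pullbackSub f u.big) ⊤
      rw [hy'.span_self]
      refine hy'.norm.mem_span_of_form_eq_zero hB hnd hr (fun k l => ?_) fun k => ?_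
      · exact hF.isotropic ⊤ _ (hy'.mem k) _ (hy'.mem l)
      · rw [S.form_wR_pull]
        exact h0 _ (Ideal.subset_span ⟨(i, k), rfl⟩)
    · exact S.wR_map _ i
  exact ⟨F, hF', h.symm⟩

theorem exists_affine_le {s : Y.left} {U : Y.left.Opens} (hs : s ∈ U) :
    ∃ A : Y.left.Opens, IsAffineOpen A ∧ s ∈ A ∧ A ≤ U := exists_isAffineOpen_mem_and_subset hs

theorem Splitting.formIdeal_res (S : Splitting B W) {A₁ : Y.left.Opens} (h : A₁ ≤ A)
    (f : T ⟶ Y) (hf : ⊤ ≤ f.left ⁻¹ᵁ A₁) (hf' : ⊤ ≤ f.left ⁻¹ᵁ A)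
    (h0 : ∀ a ∈ S.formIdeal fun k => res V Y h (y k), f.left.appLE A₁ ⊤ hf a = 0) :
    ∀ a ∈ S.formIdeal y, f.left.appLE A ⊤ hf' a = 0 := by
  have : S.formIdeal y ≤ RingHom.ker (f.left.appLE A ⊤ hf').hom := by
    refine Ideal.span_le.2 ?_
    rintro _ ⟨i, rfl⟩
    refine (S.form_wR_pull f hf' i.1 (y i.2)).symm.trans ?_
    rw [← pull_res f hf h, S.form_wR_pull]
    exact h0 _ (Ideal.subset_span ⟨i, rfl⟩)
  exact fun a ha => this ha

/-- Over a small affine open subset, the zero locus of `formIdeal` carries a pair for `W^⊥/W`,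
possibly in the wrong component. The points in the right component form an open and closed subset
`D`. After shrinking around `s`, either everything outside `D` disappears, or no point of
`Y_{W^⊥/W}` remains. -/
theorem IsCycle.exists_local_model (S : Splitting B W) (hnd : B.Nondegenerate) (hns : IsNonsplit B)
    (hW : W ≤ B.orthogonal W) (hr : Module.finrank (ZMod p) V = 2 * (n + d + 1))
    (hc : IsCycle hB d u u' j) {s : Y.left} {U : Y.left.Opens} (hs : s ∈ U) :
    ∃ A ≤ U, s ∈ A ∧ ((∀ z, j.left z ∉ A) ∨
      ∃ (σ : Fin (n + d + 1) ↪ Fin (Module.finrank (ZMod p) V))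
        (y : Fin (n + d + 1) → Γ(Y.left, A) ⊗[ZMod p] V) (T : Sch p) (φ : T ⟶ Y)
        (h : ⊤ ≤ φ.left ⁻¹ᵁ A) (c : T.left ⟶ (A : Scheme.{0})) (k : T ⟶ Y'),
      IsFrame u.big A σ y ∧ IsClosedImmersion c ∧ c ≫ A.ι = φ.left ∧ k ≫ j = φ ∧
      (∀ a, φ.left.appLE A ⊤ h a = 0 ↔ a ∈ S.formIdeal y) ∧
      ∀ (S' : Sch p) (f : S' ⟶ Y) (hf : ⊤ ≤ f.left ⁻¹ᵁ A),
        (∀ a ∈ S.formIdeal y, f.left.appLE A ⊤ hf a = 0) → ∃ g : S' ⟶ T, g ≫ φ = f) := by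
  obtain ⟨A', σ, y', hsA', hy'⟩ := (isSubbundle_iff.1 hc.moduli.big).2 s
  obtain ⟨A, hA, hsA, hAle⟩ := exists_affine_le (s := s) (U := A' ⊓ U) ⟨hsA', hs⟩
  obtain ⟨T, φ, h, c, hci, hcφ, hφ, hlift⟩ := exists_closed_subscheme hA
    (S.formIdeal fun k => res V Y (hAle.trans inf_le_left) (y' k))
  have hy := hy'.restrict (hAle.trans inf_le_left)
  obtain ⟨F, hF, hFu⟩ := hc.exists_quotient S hnd hns hW hr hy φ h fun a ha => (hφ a).2 ha
  obtain ⟨D, hD, hDk⟩ := hc.factor φ F hF hFu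
  have hcl := c.isClosedEmbedding
  have hval : ∀ t, (c t).1 = φ.left t := fun t => by rw [← hcφ]; rfl
  -- The image of a closed subset of the zero locus is closed in `A`, so it can be removed from the
  -- neighbourhood of `s`.
  have hopen : ∀ C : Set T.left, IsClosed C → s ∉ φ.left '' C →
      ∃ A₁, IsAffineOpen A₁ ∧ s ∈ A₁ ∧ A₁ ≤ A ∧ ∀ t ∈ C, φ.left t ∉ A₁ := by
    intro C hC hsC
    let O : (A : Scheme.{0}).Opens := ⟨(c '' C)ᶜ, (hcl.isClosedMap C hC).isOpen_compl⟩
    have hO : ∀ t ∈ C, φ.left t ∉ A.ι ''ᵁ O := by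
      rintro t ht ⟨x, hx, hxt⟩
      refine hx ⟨t, ht, Subtype.ext ?_⟩
      exact (hval t).trans hxt.symm
    obtain ⟨A₁, h1, h2, h3⟩ := exists_affine_le (s := s) (U := A.ι ''ᵁ O) ⟨⟨s, hsA⟩, by
      rintro ⟨t, ht, hts⟩
      exact hsC ⟨t, ht, (hval t).symm.trans (congrArg Subtype.val hts)⟩, rfl⟩
    refine ⟨A₁, h1, h2, h3.trans ?_, fun t ht h => hO t ht (h3 h)⟩
    rintro _ ⟨x, -, rfl⟩
    exact x.2
  by_cases hsD : s ∈ φ.left '' (D : Set T.left)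
  -- The point of `T` over `s` is unique and lies in `D`, so `s` is not in the image of the closed
  -- complement of `D`.
  · obtain ⟨A₁, hA₁, hsA₁, hle, hno⟩ := hopen (D : Set T.left)ᶜ D.2.isClosed_compl (by
      obtain ⟨t, ht, hts⟩ := hsD
      rintro ⟨t', ht', hts'⟩
      refine ht' ?_
      have : t' = t := hcl.injective (Subtype.ext (by rw [hval, hval, hts, hts']))
      rwa [this])
    obtain ⟨T₁, φ₁, h₁, c₁, hci₁, hcφ₁, hφ₁, hlift₁⟩ := exists_closed_subscheme hA₁
      (S.formIdeal fun k => res V Y (hle.trans (hAle.trans inf_le_left)) (y' k))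
    have hy₁ := hy'.restrict (hle.trans (hAle.trans inf_le_left))
    have h₁' : ⊤ ≤ φ₁.left ⁻¹ᵁ A := fun t ht => hle (h₁ ht)
    obtain ⟨g, hg⟩ := hlift T₁ φ₁ h₁' (S.formIdeal_res hle φ₁ h₁ h₁' fun a ha => by
      refine (hφ₁ a).2 ?_
      simpa only [res_res] using ha)
    obtain ⟨k, hk⟩ := (hDk T₁ g).2 fun t => by
      by_contra ht
      refine hno _ ht ?_
      have := h₁ (show t ∈ ⊤ from trivial)
      rwa [← hg] at this
    exact ⟨A₁, hle.trans (hAle.trans inf_le_right), hsA₁, Or.inr ⟨σ, _, T₁, φ₁, h₁, c₁, k, hy₁, hci₁,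
      hcφ₁, hk.trans hg, hφ₁, hlift₁⟩⟩
  · obtain ⟨A₁, hA₁, hsA₁, hle, hno⟩ := hopen D hD hsD
    refine ⟨A₁, hle.trans (hAle.trans inf_le_right), hsA₁, Or.inl fun z hz => ?_⟩
    let O : Y'.left.Opens := j.left ⁻¹ᵁ A₁
    let f := openSubι Y' O ≫ j
    have hf : ⊤ ≤ f.left ⁻¹ᵁ A := fun t _ => hle t.2
    have hI : S.formIdeal (fun k => res V Y (hAle.trans inf_le_left) (y' k)) ≤
        RingHom.ker (f.left.appLE A ⊤ hf).hom := by
      refine Ideal.span_le.2 ?_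
      rintro _ ⟨i, rfl⟩
      exact hc.appLE_eq_zero S hW (openSubι Y' O) rfl hf (hy.mem i.2) i.1
    obtain ⟨g, hg⟩ := hlift _ f hf fun a ha => hI ha
    have hgD := (hDk _ g).1 ⟨openSubι Y' O, hg.symm⟩ ⟨z, hz⟩
    refine hno _ hgD ?_
    have : (g ≫ φ).left ⟨z, hz⟩ ∈ A₁ := by
      rw [hg]
      exact hz
    exact this

/-- The claim is local on the target. Over a local model, `Y_{W^⊥/W}` and the zero locus map to each
other over `Y_V`. Both map to `Y_V` by monomorphisms, so these maps are mutually inverse. -/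
theorem IsCycle.isClosedImmersion (S : Splitting B W) (hnd : B.Nondegenerate) (hns : IsNonsplit B)
    (hW : W ≤ B.orthogonal W) (hr : Module.finrank (ZMod p) V = 2 * (n + d + 1))
    (hc : IsCycle hB d u u' j) : IsClosedImmersion j.left := by
  choose A hAle hsA hA using fun s : Y.left =>
    hc.exists_local_model S hnd hns hW hr (show s ∈ (⊤ : Y.left.Opens) from trivial)
  refine IsZariskiLocalAtTarget.of_iSup_eq_top A
    (top_le_iff.1 fun s _ => Opens.mem_iSup.2 ⟨s, hsA s⟩) fun s => ?_
  rcases hA s with hemp | ⟨σ, y, T, φ, h, c, k, hy, hci, hcφ, hk, hφ, hlift⟩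
  · have : IsEmpty (j.left ⁻¹ᵁ A s) := ⟨fun z => hemp z.1 z.2⟩
    infer_instance
  · let O : Y'.left.Opens := j.left ⁻¹ᵁ A s
    let f := openSubι Y' O ≫ j
    have hf : ⊤ ≤ f.left ⁻¹ᵁ A s := fun t _ => t.2
    have hI : S.formIdeal y ≤ RingHom.ker (f.left.appLE (A s) ⊤ hf).hom := by
      refine Ideal.span_le.2 ?_
      rintro _ ⟨i, rfl⟩
      exact hc.appLE_eq_zero S hW (openSubι Y' O) rfl hf (hy.mem i.2) i.1
    obtain ⟨g, hg⟩ := hlift _ f hf fun a ha => hI ha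
    obtain ⟨l, hl⟩ := exists_lift_openSub (D := O) k fun t => by
      have := h (show t ∈ ⊤ from trivial)
      rwa [← hk] at this
    have hgc : g.left ≫ c = j.left ∣_ A s := by
      rw [← cancel_mono (A s).ι, Category.assoc, hcφ, morphismRestrict_ι]
      exact congrArg CommaMorphism.left hg
    have h1 : g ≫ l = 𝟙 _ := by
      refine openSub_hom_ext (hc.cancel ?_)
      calc ((g ≫ l) ≫ openSubι Y' O) ≫ j = g ≫ (l ≫ openSubι Y' O) ≫ j := by
            simp only [Category.assoc]
        _ = (𝟙 _ ≫ openSubι Y' O) ≫ j := by rw [hl, hk, hg, Category.id_comp]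
    have h2 : l ≫ g = 𝟙 _ := by
      ext1
      rw [← cancel_mono c, ← cancel_mono (A s).ι]
      simp only [Category.assoc, hcφ]
      have : (l ≫ g) ≫ φ = 𝟙 T ≫ φ := by
        rw [Category.assoc, hg, ← Category.assoc, hl, hk, Category.id_comp]
      exact congrArg CommaMorphism.left this
    have : IsIso g.left := ⟨l.left, congrArg CommaMorphism.left h1, congrArg CommaMorphism.left h2⟩
    rw [← hgc]
    infer_instance

/-- The local zero locus of the equations maps to `Y_{W^⊥/W}`. A function that vanishes on the
latter therefore vanishes on the former, which means that it lies in `formIdeal`. -/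
theorem IsCycle.exists_mem_formIdeal (S : Splitting B W) (hnd : B.Nondegenerate) (hns : IsNonsplit B)
    (hW : W ≤ B.orthogonal W) (hr : Module.finrank (ZMod p) V = 2 * (n + d + 1))
    (hc : IsCycle hB d u u' j) {s : Y.left} {U : Y.left.Opens} (hs : s ∈ U) {a : Γ(Y.left, U)}
    (ha : j.left.app U a = 0) :
    ∃ (A : Y.left.Opens) (h : A ≤ U), s ∈ A ∧ ((∀ z, j.left z ∉ A) ∨
      ∃ (σ : Fin (n + d + 1) ↪ Fin (Module.finrank (ZMod p) V))
        (y : Fin (n + d + 1) → Γ(Y.left, A) ⊗[ZMod p] V), IsFrame u.big A σ y ∧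
        Y.left.presheaf.map (homOfLE h).op a ∈ S.formIdeal y) := by
  obtain ⟨A, hAle, hsA, hA⟩ := hc.exists_local_model S hnd hns hW hr hs
  refine ⟨A, hAle, hsA, hA.imp_right ?_⟩
  rintro ⟨σ, y, T, φ, h, c, k, hy, hci, hcφ, rfl, hφ, hlift⟩
  refine ⟨σ, y, hy, (hφ _).1 ?_⟩
  rw [← CommRingCat.comp_apply, Scheme.Hom.map_appLE]
  have : (k ≫ j).left.appLE U ⊤ (fun t ht => hAle (h ht)) =
      j.left.app U ≫ k.left.appLE (j.left ⁻¹ᵁ U) ⊤ (fun t ht => hAle (h ht)) := by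
    rw [Scheme.Hom.app_eq_appLE]
    exact (Scheme.Hom.appLE_comp_appLE k.left j.left U (j.left ⁻¹ᵁ U) ⊤ _ _).symm
  rw [this, CommRingCat.comp_apply, ha, map_zero]

end Equations
end
end OrthDL

namespace OrthDL
noncomputable section
variable {p : ℕ} [Fact p.Prime]

/-! ### Infinitesimal rotations -/

section Rotation

variable {V : Type} [AddCommGroup V] [Module (ZMod p) V] [FiniteDimensional (ZMod p) V]
variable {R R' : Type} [CommRing R] [Algebra (ZMod p) R] [CommRing R'] [Algebra (ZMod p) R']

/-- The skew-symmetric endomorphism `x ↦ B(x, v) m - B(x, m) v`. -/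
def skew (B : LinearMap.BilinForm (ZMod p) V) (v m : R ⊗[ZMod p] V) :
    R ⊗[ZMod p] V →ₗ[R] R ⊗[ZMod p] V :=
  ((B.baseChange R).flip v).smulRight m - ((B.baseChange R).flip m).smulRight v

/-- The infinitesimal rotation `x ↦ x + e (B(x, v) m - B(x, m) v)`, for `e` of square zero. -/
def rotate (B : LinearMap.BilinForm (ZMod p) V) (e : R) (v m : R ⊗[ZMod p] V) :
    R ⊗[ZMod p] V →ₗ[R] R ⊗[ZMod p] V :=
  LinearMap.id + e • skew B v m

variable {B : LinearMap.BilinForm (ZMod p) V} {e : R} {v m : R ⊗[ZMod p] V}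

theorem skew_apply (x : R ⊗[ZMod p] V) :
    skew B v m x = B.baseChange R x v • m - B.baseChange R x m • v := rfl

theorem rotate_apply (x : R ⊗[ZMod p] V) : rotate B e v m x = x + e • skew B v m x := rfl

theorem changeScalars_rotate (φ : R →+* R') (x : R ⊗[ZMod p] V) :
    changeScalars φ V (rotate B e v m x) =
      rotate B (φ e) (changeScalars φ V v) (changeScalars φ V m) (changeScalars φ V x) := by
  simp only [rotate_apply, skew_apply, map_add, map_sub, changeScalars_smul, changeScalars_form]

theorem rotate_zero (x : R ⊗[ZMod p] V) : rotate B 0 v m x = x := by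
  rw [rotate_apply, zero_smul, add_zero]

theorem rotate_rotate {e' : R} (he : e * e' = 0) (h : e + e' = 0) (x : R ⊗[ZMod p] V) :
    rotate B e v m (rotate B e' v m x) = x := by
  have h1 : e • skew B v m x + e' • skew B v m x = 0 := by rw [← add_smul, h, zero_smul]
  rw [rotate_apply, rotate_apply, map_add, map_smul, smul_add, smul_smul, he, zero_smul, add_zero,
    add_assoc, add_comm (e' • _), h1, add_zero]

/-- An infinitesimal rotation as an automorphism. -/
def rotateEquiv (B : LinearMap.BilinForm (ZMod p) V) (he : e * e = 0) (v m : R ⊗[ZMod p] V) :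
    (R ⊗[ZMod p] V) ≃ₗ[R] R ⊗[ZMod p] V :=
  { rotate B e v m with
    invFun := rotate B (-e) v m
    left_inv := fun x => rotate_rotate (e := -e) (e' := e) (by rw [neg_mul, he, neg_zero])
      (neg_add_cancel e) x
    right_inv := fun x => rotate_rotate (e := e) (e' := -e) (by rw [mul_neg, he, neg_zero])
      (add_neg_cancel e) x }

theorem form_skew (hB : B.IsSymm) (x y : R ⊗[ZMod p] V) :
    B.baseChange R (skew B v m x) y + B.baseChange R x (skew B v m y) = 0 := by
  rw [skew_apply, skew_apply, map_sub, map_sub, map_smul, map_smul, map_smul, map_smul,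
    LinearMap.sub_apply, LinearMap.smul_apply, LinearMap.smul_apply, smul_eq_mul, smul_eq_mul,
    smul_eq_mul, smul_eq_mul, baseChange_symm hB m y, baseChange_symm hB v y]
  ring

/-- The first-order term vanishes by skew-symmetry and the second-order term because `e² = 0`. -/
theorem form_rotate (hB : B.IsSymm) (he : e * e = 0) (x y : R ⊗[ZMod p] V) :
    B.baseChange R (rotate B e v m x) (rotate B e v m y) = B.baseChange R x y := by
  rw [rotate_apply, rotate_apply, map_add, map_add, map_smul, map_smul, LinearMap.add_apply,
    LinearMap.add_apply, LinearMap.smul_apply, LinearMap.smul_apply, smul_eq_mul, smul_eq_mul,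
    smul_eq_mul]
  linear_combination e * form_skew (v := v) (m := m) hB x y +
    B.baseChange R (skew B v m x) (skew B v m y) * he

/-- As `p ≥ 2`, the Frobenius kills `e` and does not see the rotation. This makes first-order
deformations of points of `Y_V` easy to write down. -/
theorem frobM_rotate (he : e * e = 0) (x : R ⊗[ZMod p] V) : frobM (rotate B e v m x) = frobM x := by
  have h : frob (p := p) R e = 0 := by
    change e ^ p = 0
    obtain ⟨k, hk⟩ := Nat.exists_eq_add_of_le (Fact.out : p.Prime).two_le
    rw [hk, pow_add, sq, he, zero_mul]
  rw [frobM, changeScalars_rotate, h, rotate_zero]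

end Rotation

/-! ### Infinitesimal rotations of pairs -/

section RotateFlag

variable {V : Type} [AddCommGroup V] [Module (ZMod p) V] [FiniteDimensional (ZMod p) V]
variable {B : LinearMap.BilinForm (ZMod p) V} {X T : Sch p} {d r : ℕ} {c : Prop}
  {ε : Γ(X.left, ⊤)} {v m : Γ(X.left, ⊤) ⊗[ZMod p] V}

variable (B ε v m) in
/-- An infinitesimal rotation of the sections over `U`. -/
abbrev rotateOn (U : X.left.Opens) :
    Γ(X.left, U) ⊗[ZMod p] V →ₗ[Γ(X.left, U)] Γ(X.left, U) ⊗[ZMod p] V :=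
  rotate B (X.left.presheaf.map (homOfLE (le_top : U ≤ ⊤)).op ε) (res V X le_top v)
    (res V X le_top m)

theorem res_rotateOn {U U' : X.left.Opens} (h : U' ≤ U) (x : Γ(X.left, U) ⊗[ZMod p] V) :
    res V X h (rotateOn B ε v m U x) = rotateOn B ε v m U' (res V X h x) := by
  rw [rotateOn, res, changeScalars_rotate, res_res, res_res, ← CommRingCat.comp_apply,
    ← Functor.map_comp]
  rfl

theorem res_mul_self (hε : ε * ε = 0) (U : X.left.Opens) :
    X.left.presheaf.map (homOfLE (le_top : U ≤ ⊤)).op ε *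
      X.left.presheaf.map (homOfLE (le_top : U ≤ ⊤)).op ε = 0 := by
  rw [← map_mul, hε, map_zero]

variable (B ε v m) in
/-- The rotation of a submodule. -/
def rotateSub (L : SubModule V X) : SubModule V X :=
  mkSub X (fun U => (sec L U).map (rotateOn B ε v m U)) (by
    rintro U U' h _ ⟨x, hx, rfl⟩
    exact ⟨res V X h x, res_mem L h hx, (res_rotateOn h x).symm⟩)

theorem mem_rotateSub {L : SubModule V X} {U : X.left.Opens} {x : Γ(X.left, U) ⊗[ZMod p] V} :
    x ∈ sec (rotateSub B ε v m L) U ↔ ∃ z ∈ sec L U, rotateOn B ε v m U z = x := Iff.rfl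

theorem IsSubbundle.rotateSub (hε : ε * ε = 0) {L : SubModule V X} (hL : IsSubbundle L r) :
    IsSubbundle (rotateSub B ε v m L) r := by
  refine ⟨fun U x hx => ?_, fun s => ?_⟩
  · let g := rotateEquiv B (res_mul_self hε U) (res V X le_top v) (res V X le_top m)
    refine mem_rotateSub.2 ⟨g.symm x, hL.1 U _ fun s hs => ?_, g.apply_symm_apply x⟩
    obtain ⟨A, hA, hsA, z, hz, hzx⟩ := hx s hs
    refine ⟨A, hA, hsA, ?_⟩
    have h1 : rotateOn B ε v m A (res V X hA (g.symm x)) = res V X hA x := by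
      rw [← res_rotateOn]
      exact congrArg _ (g.apply_symm_apply x)
    rw [← hzx] at h1
    let g' := rotateEquiv B (res_mul_self hε A) (res V X le_top v) (res V X le_top m)
    rwa [g'.injective h1]
  · obtain ⟨U, hs, k, b, hb⟩ := hL.2 s
    refine ⟨U, hs, k, b.map (rotateEquiv B (res_mul_self hε U) (res V X le_top v)
      (res V X le_top m)), fun A hA => ?_⟩
    change (sec L A).map _ = _
    rw [hb A hA, Submodule.map_span, ← Set.range_comp]
    congr 2
    funext i
    exact (res_rotateOn hA _).symm

variable (B ε v m) in
/-- The rotation of a pair. -/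
def Flag.rotate (F : Flag V X) : Flag V X where
  small := rotateSub B ε v m F.small
  big := rotateSub B ε v m F.big
  le := fun _ => Submodule.map_mono (F.le _)

/-- The rotation is an isometry, so isotropy persists. It leaves `Frob^* L_{d+1}` unchanged and
moves `x` in `L_d` by a multiple of `Frob y`, since the other term contains `B(x, Frob y) = 0`. And
`Frob y` is orthogonal to `Frob^* L_{d+1}`. -/
theorem IsModuli.rotate (hB : B.IsSymm) (hε : ε * ε = 0) {F : Flag V X} {e : ℕ}
    (hF : IsModuli B d e True X F) {y : Γ(X.left, ⊤) ⊗[ZMod p] V} (hy : y ∈ sec F.big ⊤) :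
    IsModuli B d e True X (F.rotate B ε v (frobM y)) := by
  refine ⟨hF.small.rotateSub hε, hF.big.rotateSub hε, ?_, ?_⟩
  · rintro U _ ⟨x, hx, rfl⟩ _ ⟨z, hz, rfl⟩
    rw [form_rotate hB (res_mul_self hε U)]
    exact hF.isotropic U x hx z hz
  · rintro - U _ ⟨x, hx, rfl⟩ _ ⟨z, hz, rfl⟩
    have hyU := res_mem _ (le_top : U ≤ ⊤) hy
    rw [frobM_rotate (res_mul_self hε U), rotate_apply, skew_apply, res, frobM_map, map_add, map_smul,
      map_sub, map_smul, map_smul, LinearMap.add_apply, LinearMap.smul_apply, LinearMap.sub_apply,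
      LinearMap.smul_apply, LinearMap.smul_apply, hF.frob trivial U x hx z hz, hF.frob trivial U x hx _ hyU, frobM, frobM,
      changeScalars_form, hF.isotropic U _ hyU z hz, map_zero]
    simp

theorem Flag.pullback_rotate (f : T ⟶ X) (hf : f.left.appTop ε = 0) (F : Flag V X) :
    (F.rotate B ε v m).pullback f = F.pullback f := by
  have h : ∀ (U : X.left.Opens) (A : T.left.Opens) (hA : A ≤ f.left ⁻¹ᵁ U)
      (x : Γ(X.left, U) ⊗[ZMod p] V), pull V f U A hA (rotateOn B ε v m U x) = pull V f U A hA x := by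
    intro U A hA x
    have h0 : f.left.appLE U A hA (X.left.presheaf.map (homOfLE (le_top : U ≤ ⊤)).op ε) = 0 := by
      rw [← CommRingCat.comp_apply, Scheme.Hom.map_appLE, ← map_zero (T.left.presheaf.map
        (homOfLE (le_top : A ≤ ⊤)).op).hom, ← hf]
      exact (ConcreteCategory.congr_hom (Scheme.Hom.appLE_map f.left le_top
        (homOfLE (le_top : A ≤ ⊤)).op) ε).symm.trans (by rw [appLE_top]; rfl)
    exact (changeScalars_rotate _ _).trans (by
      refine Eq.trans (congrArg (fun t => OrthDL.rotate B t _ _ _) h0) (rotate_zero _))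
  have key : ∀ L : SubModule V X, pullbackSub f (rotateSub B ε v m L) = pullbackSub f L := by
    intro L
    refine le_antisymm (generated_mono ?_) (generated_mono ?_)
    · rintro A _ ⟨U, hA, _, ⟨x, hx, rfl⟩, rfl⟩
      exact ⟨U, hA, x, hx, (h U A hA x).symm⟩
    · rintro A _ ⟨U, hA, x, hx, rfl⟩
      exact ⟨U, hA, _, ⟨x, hx, rfl⟩, h U A hA x⟩
  exact Flag.ext (key _) (key _)

end RotateFlag

/-! ### First-order thickenings of affine schemes -/

/-- `T` is the spectrum of the dual numbers over the functions of `S`, with its zero section `i` and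
its retraction `ρ`. The last clause is how an equation multiplied by `ε` is brought back to `S`. -/
theorem exists_thickening (S : Sch p) [IsAffine S.left] :
    ∃ (T : Sch p) (i : S ⟶ T) (ρ : T ⟶ S) (ε : Γ(T.left, ⊤)), i ≫ ρ = 𝟙 S ∧
      Function.Surjective i.left ∧ ε * ε = 0 ∧ i.left.appTop ε = 0 ∧
      ∀ a, ε * a = 0 → i.left.appTop a = 0 := by
  let R := Γ(S.left, ⊤)
  let D := CommRingCat.of (DualNumber R)
  let φ : D ⟶ R := CommRingCat.ofHom (TrivSqZeroExt.fstHom R R R).toRingHom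
  let ι : R ⟶ D := CommRingCat.ofHom (TrivSqZeroExt.inlHom R R)
  let i₀ : S.left ⟶ Spec D := S.left.toSpecΓ ≫ Spec.map φ
  let ρ₀ : Spec D ⟶ S.left := Spec.map ι ≫ S.left.isoSpec.inv
  have hιφ : ι ≫ φ = 𝟙 R := by
    ext a
    rfl
  have hi : i₀ ≫ ρ₀ = 𝟙 S.left := by
    simp only [i₀, ρ₀, Category.assoc]
    rw [← Spec.map_comp_assoc, hιφ, Spec.map_id, Category.id_comp, Scheme.toSpecΓ_isoSpec_inv]
  let T : Sch p := Over.mk (ρ₀ ≫ S.hom)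
  let i : S ⟶ T := Over.homMk i₀ (by
    change i₀ ≫ ρ₀ ≫ S.hom = S.hom
    rw [← Category.assoc, hi, Category.id_comp])
  let θ := Scheme.ΓSpecIso D
  have happ : ∀ a : D, i₀.appTop (θ.inv a) = φ a := by
    intro a
    have h1 := ConcreteCategory.congr_hom (Scheme.ΓSpecIso_inv_naturality φ) a
    have h2 : S.left.toSpecΓ.appTop ((Scheme.ΓSpecIso Γ(S.left, ⊤)).inv (φ a)) = φ a := by
      rw [Scheme.toSpecΓ_appTop]
      exact ConcreteCategory.congr_hom (Scheme.ΓSpecIso Γ(S.left, ⊤)).inv_hom_id (φ a)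
    refine Eq.trans ?_ h2
    exact congrArg S.left.toSpecΓ.appTop h1.symm
  refine ⟨T, i, Over.homMk ρ₀, θ.inv (DualNumber.eps : DualNumber R), ?_, ?_, ?_, ?_, ?_⟩
  · ext1
    exact hi
  · have h1 : Function.Surjective (Spec.map φ) := by
      change Function.Surjective (PrimeSpectrum.comap φ.hom)
      rw [← Set.range_eq_univ, range_comap_of_surjective _ φ.hom
        (TrivSqZeroExt.fst_surjective), Set.eq_univ_iff_forall]
      -- Elements of the kernel of the reduction have square zero, hence lie in every prime ideal.
      intro x a ha
      have h0 : a * a = 0 := by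
        have h2 : TrivSqZeroExt.fst (show DualNumber R from a) = 0 := ha
        refine TrivSqZeroExt.ext ?_ ?_
        · exact (TrivSqZeroExt.fst_mul _ _).trans (by rw [h2, mul_zero]; rfl)
        · refine (TrivSqZeroExt.snd_mul _ _).trans ?_
          rw [h2]
          simp
      have := x.2.mem_or_mem (show a * a ∈ x.asIdeal from h0 ▸ zero_mem _)
      exact this.elim id id
    have h2 : Function.Surjective S.left.toSpecΓ := S.left.isoSpec.hom.homeomorph.surjective
    exact h1.comp h2
  · rw [← map_mul, DualNumber.eps_mul_eps, map_zero]
  · refine (happ _).trans ?_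
    exact DualNumber.fst_eps
  · intro a ha
    obtain ⟨a, rfl⟩ := (ConcreteCategory.bijective_of_isIso θ.inv).surjective a
    refine (happ _).trans ?_
    have h1 : (DualNumber.eps : DualNumber R) * a = 0 :=
      (ConcreteCategory.bijective_of_isIso θ.inv).injective (by rw [map_mul, ha, map_zero])
    have h2 := congrArg TrivSqZeroExt.snd h1
    rw [TrivSqZeroExt.snd_mul] at h2
    simp at h2
    exact h2

end
end OrthDL

namespace OrthDL
noncomputable section
variable {p : ℕ} [Fact p.Prime]

/-! ### Independence of the equations to first order -/

section FirstOrder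

variable {V : Type} [AddCommGroup V] [Module (ZMod p) V] [FiniteDimensional (ZMod p) V]
variable {B : LinearMap.BilinForm (ZMod p) V} {W : Submodule (ZMod p) V} {X Y Y' T : Sch p} {d : ℕ}

local notation "n" => Module.finrank (ZMod p) W

variable {hB : B.IsSymm} {u : Flag V Y} {u' : Flag (OrthQuot B W) Y'} {j : Y' ⟶ Y}

theorem form_pull (f : T ⟶ X) {U : X.left.Opens} {C : T.left.Opens} (h : C ≤ f.left ⁻¹ᵁ U)
    (x y : Γ(X.left, U) ⊗[ZMod p] V) :
    B.baseChange _ (pull V f U C h x) (pull V f U C h y) =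
      f.left.appLE U C h (B.baseChange _ x y) := changeScalars_form _ _ _ _

theorem pull_frobM (f : T ⟶ X) {U : X.left.Opens} {C : T.left.Opens} (h : C ≤ f.left ⁻¹ᵁ U)
    (x : Γ(X.left, U) ⊗[ZMod p] V) : pull V f U C h (frobM x) = frobM (pull V f U C h x) :=
  frobM_map _ _

theorem pull_congr {f f' : T ⟶ X} (hf : f = f') {U : X.left.Opens} {C : T.left.Opens}
    (h : C ≤ f.left ⁻¹ᵁ U) (h' : C ≤ f'.left ⁻¹ᵁ U) (x : Γ(X.left, U) ⊗[ZMod p] V) :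
    pull V f U C h x = pull V f' U C h' x := by
  subst hf
  rfl

theorem changeScalars_rotate_of_eq_zero {R R' : Type} [CommRing R] [CommRing R'] [Algebra (ZMod p) R]
    [Algebra (ZMod p) R'] (φ : R →+* R') {e : R} (he : φ e = 0) {v m : R ⊗[ZMod p] V}
    (x : R ⊗[ZMod p] V) : changeScalars φ V (rotate B e v m x) = changeScalars φ V x := by
  rw [changeScalars_rotate, he, rotate_zero]

theorem rotateOn_top {ε : Γ(X.left, ⊤)} {v m : Γ(X.left, ⊤) ⊗[ZMod p] V} :
    rotateOn B ε v m ⊤ = rotate B ε v m := by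
  have h : X.left.presheaf.map (homOfLE (le_top : (⊤ : X.left.Opens) ≤ ⊤)).op ε = ε :=
    ConcreteCategory.congr_hom (X.left.presheaf.map_id (op ⊤)) ε
  rw [rotateOn, h, res_refl, res_refl]

set_option maxHeartbeats 1000000 in
/-- If `∑ B(w_i, L_i)` vanishes, then the products of the restrictions of the `L_i` to
`Y_{W^⊥/W}` with the Frobenius pull-back of `L_{d+1}` vanish. -/
theorem IsCycle.form_eq_zero_of_sum_eq_zero (S : Splitting B W) (hW : W ≤ B.orthogonal W)
    (hc : IsCycle hB d u u' j) {U : Y.left.Opens} {L : Fin n → Γ(Y.left, U) ⊗[ZMod p] V}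
    (hL : ∀ i, L i ∈ sec u.big U) (h0 : ∑ i, B.baseChange _ (S.wR _ i) (L i) = 0)
    (g : T ⟶ Y') [IsAffine T.left] (hg : ⊤ ≤ (g ≫ j).left ⁻¹ᵁ U)
    {y : Γ(T.left, ⊤) ⊗[ZMod p] V} (hy : y ∈ sec (u.pullback (g ≫ j)).big ⊤) (i : Fin n) :
    B.baseChange _ (pull V (g ≫ j) U ⊤ hg (L i)) (frobM y) = 0 := by
  obtain ⟨D, ι, ρ, ε, hιρ, hsurj, hε, hιε, hann⟩ := exists_thickening T
  have hpull : u.pullback (g ≫ j) = (u'.pullback g).inverseImage B W := by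
    rw [← Flag.pullback_inverseImage S hW, ← hc.pull_eq]
    exact (hc.moduli.pullback_comp j g).symm
  -- The constant deformation of the given point of `Y_{W^⊥/W}`; its big member is still orthogonal
  -- to `W`.
  let F := (u.pullback (g ≫ j)).pullback ρ
  have hF : IsModuli B (n + d) (n + d + 1) True D F := (hc.moduli.pullback _).pullback ρ
  have hFι : F.pullback ι = u.pullback (g ≫ j) := by
    rw [(hc.moduli.pullback _).pullback_comp, hιρ, (hc.moduli.pullback _).pullback_id]
  have hι : (⊤ : T.left.Opens) ≤ ι.left ⁻¹ᵁ ⊤ := le_top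
  have hρ : (⊤ : D.left.Opens) ≤ ρ.left ⁻¹ᵁ ⊤ := le_top
  let y₀ := pull V ρ ⊤ ⊤ hρ y
  have hy₀ : y₀ ∈ sec F.big ⊤ := mem_pullbackSub ρ hρ hy
  have hy₀ι : pull V ι ⊤ ⊤ hι y₀ = y := by
    have h1 : (⊤ : T.left.Opens) ≤ (ι ≫ ρ).left ⁻¹ᵁ ⊤ := le_top
    have h2 : (⊤ : T.left.Opens) ≤ (𝟙 T : T ⟶ T).left ⁻¹ᵁ ⊤ := le_top
    refine (pull_pull ρ ι hρ hι h1 y).trans ((pull_congr hιρ h1 h2 y).trans ?_)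
    exact (pull_id le_rfl y).trans (res_refl _ y)
  -- Since `u i` is dual to the basis of `W`, the rotation changes only the `i`-th equation.
  let v : Γ(D.left, ⊤) ⊗[ZMod p] V := 1 ⊗ₜ S.u i
  have hrot := hF.rotate (v := v) hB hε hy₀
  -- The rotated pair restricts to the original one on the zero section, which has the same points;
  -- so it is classified by a morphism to `Y_V` that extends the given one.
  obtain ⟨f, hf, hfι⟩ := hc.extend _ hrot ι hsurj (g ≫ j)
    (by rw [Flag.pullback_rotate ι hιε, hFι])
  have hfU : ⊤ ≤ f.left ⁻¹ᵁ U := by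
    intro t _
    obtain ⟨s, rfl⟩ := hsurj t
    have h1 : s ∈ (g ≫ j).left ⁻¹ᵁ U := hg trivial
    rw [← hfι] at h1
    exact h1
  have hz : ∀ k, ∃ z ∈ sec F.big ⊤, OrthDL.rotate B ε v (frobM y₀) z = pull V f U ⊤ hfU (L k) := by
    intro k
    have h1 : pull V f U ⊤ hfU (L k) ∈ sec (u.pullback f).big ⊤ := mem_pullbackSub f hfU (hL k)
    rw [hf] at h1
    obtain ⟨z, hz, h2⟩ := mem_rotateSub.1 h1
    rw [rotateOn_top] at h2
    exact ⟨z, hz, h2⟩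
  choose z hz hzL using hz
  have hwF : ∀ k, ∀ x ∈ sec F.big ⊤, B.baseChange _ (S.wR _ k) x = 0 := by
    have h1 : F = ((u'.pullback g).pullback ρ).inverseImage B W := by
      change (u.pullback (g ≫ j)).pullback ρ = _
      rw [hpull, Flag.pullback_inverseImage S hW]
    intro k x hx
    rw [h1] at hx
    exact ((mem_inverseImage_iff S).1 hx).1 k
  have hwm : ∀ k, B.baseChange _ (S.wR _ k) (frobM y₀) = 0 := fun k => by
    rw [form_wR_frobM, hwF k _ hy₀, map_zero]
  have hwv : ∀ k, B.baseChange _ (S.wR _ k) v = if k = i then 1 else 0 := fun k => by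
    simp [v, Splitting.wR, S.form_w_u]
  -- `L k` pulls back to the rotation of `z k`. Both `z k` and `Frob y₀` are orthogonal to `W`, so
  -- only the term with `B(w_k, v)` survives.
  have hterm : ∀ k, f.left.appLE U ⊤ hfU (B.baseChange _ (S.wR _ k) (L k)) =
      if k = i then - (ε * B.baseChange _ (z i) (frobM y₀)) else 0 := by
    intro k
    rw [← S.form_wR_pull, ← hzL, rotate_apply, skew_apply, map_add, hwF k _ (hz k), zero_add, map_smul,
      map_sub, map_smul, map_smul, hwm, hwv, smul_zero, zero_sub]
    split_ifs with h
    · rw [h, smul_neg, smul_eq_mul, smul_eq_mul, mul_one]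
    · rw [smul_zero, neg_zero, smul_zero]
  have hsum : ε * B.baseChange _ (z i) (frobM y₀) = 0 := by
    have h1 := congrArg (f.left.appLE U ⊤ hfU) h0
    rw [map_sum, map_zero] at h1
    simp only [hterm] at h1
    rwa [Finset.sum_ite_eq' Finset.univ i, if_pos (Finset.mem_univ i), neg_eq_zero] at h1
  have h2 := hann _ hsum
  rw [← appLE_top_apply ι.left, ← form_pull ι hι, pull_frobM ι hι, hy₀ι] at h2
  have h3 : pull V ι ⊤ ⊤ hι (z i) = pull V (g ≫ j) U ⊤ hg (L i) := by
    have h4 : pull V ι ⊤ ⊤ hι (OrthDL.rotate B ε v (frobM y₀) (z i)) = pull V ι ⊤ ⊤ hι (z i) :=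
      changeScalars_rotate_of_eq_zero _ ((appLE_top_apply ι.left ε).trans hιε) _
    have h5 : (⊤ : T.left.Opens) ≤ (ι ≫ f).left ⁻¹ᵁ U := fun _ _ => hfU trivial
    rw [← h4, hzL]
    exact (pull_pull f ι hfU hι h5 (L i)).trans (pull_congr hfι h5 hg _)
  rwa [h3] at h2

theorem IsAdapted.mem_small {r : ℕ} {F : Flag V X} {U : X.left.Opens}
    {σ : Fin r ↪ Fin (Module.finrank (ZMod p) V)} {x : Fin r → Γ(X.left, U) ⊗[ZMod p] V}
    {l : Γ(X.left, U) ⊗[ZMod p] V} (h : IsAdapted F U σ x l) {z m : Γ(X.left, U) ⊗[ZMod p] V}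
    (hz : z ∈ sec F.big U) (hx : ∀ j, B.baseChange _ (x j) m = 0)
    (hl : IsUnit (B.baseChange _ l m)) (hm : B.baseChange _ z m = 0) : z ∈ sec F.small U := by
  obtain ⟨a, b, rfl⟩ := h.exists_sum hz
  have h1 : B.baseChange _ (∑ j, a j • x j) m = 0 := by
    rw [map_sum, LinearMap.sum_apply]
    exact Finset.sum_eq_zero fun k _ => by rw [map_smul, LinearMap.smul_apply, hx, smul_zero]
  rw [map_add, LinearMap.add_apply, h1, zero_add, map_smul, LinearMap.smul_apply, smul_eq_mul,
    hl.mul_left_eq_zero] at hm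
  rw [hm, zero_smul, add_zero]
  exact Submodule.sum_mem _ fun k _ => Submodule.smul_mem _ _ (h.small.mem k)

/-- The equations `B(w_i, ·)` of `Y_{W^⊥/W}` in `Y_V` are independent modulo their squares. -/
theorem IsCycle.pull_mem_small (S : Splitting B W) (hnd : B.Nondegenerate) (hns : IsNonsplit B)
    (hW : W ≤ B.orthogonal W) (hr : Module.finrank (ZMod p) V = 2 * (n + d + 1))
    (hc : IsCycle hB d u u' j) {U : Y.left.Opens} {L : Fin n → Γ(Y.left, U) ⊗[ZMod p] V}
    (hL : ∀ i, L i ∈ sec u.big U) (h0 : ∑ i, B.baseChange _ (S.wR _ i) (L i) = 0) (i : Fin n) :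
    pull V j U (j.left ⁻¹ᵁ U) le_rfl (L i) ∈ sec (u.pullback j).small (j.left ⁻¹ᵁ U) := by
  have hF := hc.moduli.pullback j
  refine hF.small.1 _ _ fun t ht => ?_
  obtain ⟨A, σ, x, l, y, htA, hA, hy, hu, -⟩ := hF.exists_transversal hB hnd hns hr t
  -- The deformation argument needs an affine base, while membership in `L_d` is local.
  obtain ⟨C, hCaff, htC, hC⟩ := exists_affine_le (s := t) (U := A ⊓ j.left ⁻¹ᵁ U) ⟨htA, ht⟩
  have hCA : C ≤ A := hC.trans inf_le_left
  have hCU : C ≤ j.left ⁻¹ᵁ U := hC.trans inf_le_right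
  refine ⟨C, hCU, htC, ?_⟩
  have hxC : ∀ k, B.baseChange _ (res V Y' hCA (x k)) (frobM (res V Y' hCA y)) = 0 := fun k =>
    hF.frob trivial C _ (res_mem _ hCA (hA.small.mem k)) _ (res_mem _ hCA hy)
  have huC : IsUnit (B.baseChange _ (res V Y' hCA l) (frobM (res V Y' hCA y))) := by
    rw [← frobM_map, changeScalars_form]
    exact hu.map _
  have hzC := res_mem _ hCU (mem_pullbackSub j le_rfl (hL i))
  refine (hA.restrict hCA).mem_small hzC hxC huC ?_
  let g := openSubι Y' C
  have : IsAffine (openSub Y' C).left := hCaff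
  have hgC : (⊤ : (openSub Y' C).left.Opens) ≤ g.left ⁻¹ᵁ C := fun s _ => s.2
  have hg : ⊤ ≤ (g ≫ j).left ⁻¹ᵁ U := fun s _ => hCU s.2
  have h1 : pull V g C ⊤ hgC (res V Y' hCA y) ∈ sec (u.pullback (g ≫ j)).big ⊤ := by
    rw [← hc.moduli.pullback_comp j g]
    exact mem_pullbackSub g hgC (res_mem _ hCA hy)
  have h2 := hc.form_eq_zero_of_sum_eq_zero S hW hL h0 g hg h1 i
  have h3 : pull V (g ≫ j) U ⊤ hg (L i) =
      pull V g C ⊤ hgC (res V Y' hCU (pull V j U (j.left ⁻¹ᵁ U) le_rfl (L i))) := by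
    rw [res_pull, pull_pull]
  rw [h3, ← pull_frobM, form_pull] at h2
  have : IsOpenImmersion g.left := inferInstanceAs (IsOpenImmersion C.ι)
  have hinj : Function.Injective (g.left.appLE C ⊤ hgC) := by
    have key : ∀ (D : (openSub Y' C).left.Opens) (hD : D ≤ g.left ⁻¹ᵁ C), D = g.left ⁻¹ᵁ C →
        Function.Injective (g.left.appLE C D hD) := by
      rintro D hD rfl
      exact (bijective_app g (Scheme.Opens.opensRange_ι C).ge).1
    exact key _ _ (le_antisymm hgC le_top)
  exact hinj (h2.trans (map_zero _).symm)

end FirstOrder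
end
end OrthDL

namespace OrthDL
noncomputable section
variable {p : ℕ} [Fact p.Prime]

/-! ### Morphisms into a sheaf of modules -/

section Generators

variable {X : Scheme.{0}} {P : X.PresheafOfModules} {G H : X.Modules}

instance (P : X.PresheafOfModules) (U : X.Opens) : Module Γ(X, U) (P.presheaf.obj (op U)) :=
  (P.obj (op U)).isModule

/-- Restriction of sections of a presheaf of modules. -/
def presheafRes (P : X.PresheafOfModules) {U V : X.Opens} (h : V ≤ U) :
    P.presheaf.obj (op U) →+ P.presheaf.obj (op V) := (P.presheaf.map (homOfLE h).op).hom

/-- Restriction of sections of a sheaf of modules. -/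
def sheafRes (G : X.Modules) {U V : X.Opens} (h : V ≤ U) : Γ(G, U) →+ Γ(G, V) :=
  (G.presheaf.map (homOfLE h).op).hom

/-- Restriction of functions. -/
abbrev ringRes (X : Scheme.{0}) {U V : X.Opens} (h : V ≤ U) : Γ(X, U) →+* Γ(X, V) :=
  (X.presheaf.map (homOfLE h).op).hom

theorem presheafRes_smul {U V : X.Opens} (h : V ≤ U) (r : Γ(X, U)) (x : P.presheaf.obj (op U)) :
    presheafRes P h (r • x) = ringRes X h r • presheafRes P h x :=
  P.map_smul (homOfLE h).op r x

theorem sheafRes_smul {U V : X.Opens} (h : V ≤ U) (r : Γ(X, U)) (x : Γ(G, U)) :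
    sheafRes G h (r • x) = ringRes X h r • sheafRes G h x :=
  G.map_smul (homOfLE h) r x

theorem presheafRes_trans {U V W : X.Opens} (h : V ≤ U) (h' : W ≤ V) (x : P.presheaf.obj (op U)) :
    presheafRes P h' (presheafRes P h x) = presheafRes P (h'.trans h) x := by
  have e : P.presheaf.map (homOfLE (h'.trans h)).op =
      P.presheaf.map (homOfLE h).op ≫ P.presheaf.map (homOfLE h').op := by
    rw [← Functor.map_comp]; rfl
  exact (ConcreteCategory.congr_hom e x).symm

theorem sheafRes_trans {U V W : X.Opens} (h : V ≤ U) (h' : W ≤ V) (x : Γ(G, U)) :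
    sheafRes G h' (sheafRes G h x) = sheafRes G (h'.trans h) x :=
  presheafRes_trans (P := G.val) h h' x

theorem presheafRes_refl {U : X.Opens} (h : U ≤ U) (x : P.presheaf.obj (op U)) :
    presheafRes P h x = x :=
  ConcreteCategory.congr_hom (P.presheaf.map_id (op U)) x

theorem sheafRes_refl {U : X.Opens} (h : U ≤ U) (x : Γ(G, U)) : sheafRes G h x = x :=
  presheafRes_refl (P := G.val) h x

theorem eq_of_sheafRes_eq {U : X.Opens} {x y : Γ(G, U)}
    (h : ∀ s ∈ U, ∃ (V : X.Opens) (hV : V ≤ U), s ∈ V ∧ sheafRes G hV x = sheafRes G hV y) :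
    x = y := by
  let GS : TopCat.Sheaf Ab.{0} X := ⟨G.presheaf, G.isSheaf⟩
  choose V hV hs hxy using h
  exact GS.eq_of_locally_eq' (fun i : U => V i.1 i.2) U (fun i => homOfLE (hV i.1 i.2))
    (fun s hs' => Opens.mem_iSup.2 ⟨⟨s, hs'⟩, hs s hs'⟩) x y fun i => hxy i.1 i.2

theorem subsingleton_of_eq_bot {U : X.Opens} (hU : ∀ s, s ∉ U) (x y : Γ(G, U)) : x = y :=
  eq_of_sheafRes_eq fun s hs => (hU s hs).elim

theorem exists_sheafRes_eq {U : X.Opens} (V : U → X.Opens) (hV : ∀ i, V i ≤ U)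
    (hs : ∀ i : U, i.1 ∈ V i) (x : ∀ i, Γ(G, V i))
    (h : ∀ i j, sheafRes G (inf_le_left : V i ⊓ V j ≤ V i) (x i) =
      sheafRes G (inf_le_right : V i ⊓ V j ≤ V j) (x j)) :
    ∃ y : Γ(G, U), ∀ i, sheafRes G (hV i) y = x i := by
  let GS : TopCat.Sheaf Ab.{0} X := ⟨G.presheaf, G.isSheaf⟩
  obtain ⟨y, hy, -⟩ := GS.existsUnique_gluing' V U (fun i => homOfLE (hV i))
    (fun s hs' => Opens.mem_iSup.2 ⟨⟨s, hs'⟩, hs ⟨s, hs'⟩⟩) x h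
  exact ⟨y, hy⟩

/-- The action of a morphism into a sheaf of modules on sections. -/
def homApp (f : P ⟶ G.val) (U : X.Opens) : P.presheaf.obj (op U) →ₗ[Γ(X, U)] Γ(G, U) :=
  (f.app (op U)).hom

theorem homApp_res (f : P ⟶ G.val) {U V : X.Opens} (h : V ≤ U) (x : P.presheaf.obj (op U)) :
    homApp f V (presheafRes P h x) = sheafRes G h (homApp f U x) :=
  ConcreteCategory.congr_hom (f.naturality (homOfLE h).op) x

theorem hom_ext_of_homApp {f g : P ⟶ G.val} (h : ∀ U x, homApp f U x = homApp g U x) : f = g := by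
  ext U x
  exact h U.unop x

/-- A morphism given by its values on local generators. -/
theorem exists_hom_of_generators (T : ∀ U : X.Opens, Set (P.presheaf.obj (op U) × Γ(G, U)))
    (hT : ∀ (U V : X.Opens) (h : V ≤ U), ∀ a ∈ T U, (presheafRes P h a.1, sheafRes G h a.2) ∈ T V)
    (hfun : ∀ (U : X.Opens) (g : Γ(G, U)), (0, g) ∈ Submodule.span Γ(X, U) (T U) → g = 0)
    (htot : ∀ (U : X.Opens) (m : P.presheaf.obj (op U)), ∀ s ∈ U, ∃ (V : X.Opens) (h : V ≤ U), s ∈ V ∧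
      ∃ g, (presheafRes P h m, g) ∈ Submodule.span Γ(X, V) (T V)) :
    ∃ f : P ⟶ G.val, ∀ U, ∀ a ∈ T U, homApp f U a.1 = a.2 := by
  have hspan : ∀ (U V : X.Opens) (h : V ≤ U), ∀ a ∈ Submodule.span Γ(X, U) (T U),
      (presheafRes P h a.1, sheafRes G h a.2) ∈ Submodule.span Γ(X, V) (T V) := by
    intro U V h a ha
    induction ha using Submodule.span_induction with
    | mem a ha => exact Submodule.subset_span (hT U V h a ha)
    | zero =>
      rw [Prod.fst_zero, Prod.snd_zero, map_zero, map_zero]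
      exact Submodule.zero_mem _
    | add a b _ _ ha hb =>
      rw [Prod.fst_add, Prod.snd_add, map_add, map_add]
      exact Submodule.add_mem _ ha hb
    | smul r a _ ha =>
      rw [Prod.smul_fst, Prod.smul_snd, presheafRes_smul, sheafRes_smul]
      exact Submodule.smul_mem _ _ ha
  have huniq : ∀ (U : X.Opens) (m : P.presheaf.obj (op U)) (g g' : Γ(G, U)),
      (m, g) ∈ Submodule.span Γ(X, U) (T U) → (m, g') ∈ Submodule.span Γ(X, U) (T U) → g = g' := by
    intro U m g g' hg hg'
    refine sub_eq_zero.1 (hfun U _ ?_)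
    have := Submodule.sub_mem _ hg hg'
    rwa [Prod.mk_sub_mk, sub_self] at this
  -- The spans are graphs: `hfun` makes them single-valued and `htot` makes them locally total, so
  -- the local values agree on overlaps and glue.
  have hex : ∀ (U : X.Opens) (m : P.presheaf.obj (op U)), ∃ g : Γ(G, U),
      ∀ s ∈ U, ∃ (V : X.Opens) (h : V ≤ U), s ∈ V ∧
        (presheafRes P h m, sheafRes G h g) ∈ Submodule.span Γ(X, V) (T V) := by
    intro U m
    choose V hV hsV g hg using htot U m
    obtain ⟨y, hy⟩ := exists_sheafRes_eq (fun i : U => V i.1 i.2) (fun i => hV i.1 i.2)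
      (fun i => hsV i.1 i.2) (fun i => g i.1 i.2) (by
        intro i j
        have h1 := hspan _ _ (inf_le_left : V i.1 i.2 ⊓ V j.1 j.2 ≤ _) _ (hg i.1 i.2)
        have h2 := hspan _ _ (inf_le_right : V i.1 i.2 ⊓ V j.1 j.2 ≤ _) _ (hg j.1 j.2)
        rw [presheafRes_trans] at h1 h2
        exact huniq _ _ _ _ h1 h2)
    refine ⟨y, fun s hs => ⟨V s hs, hV s hs, hsV s hs, ?_⟩⟩
    rw [hy ⟨s, hs⟩]
    exact hg s hs
  have huniq' : ∀ (U : X.Opens) (m : P.presheaf.obj (op U)) (g g' : Γ(G, U)),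
      (∀ s ∈ U, ∃ (V : X.Opens) (h : V ≤ U), s ∈ V ∧
        (presheafRes P h m, sheafRes G h g) ∈ Submodule.span Γ(X, V) (T V)) →
      (∀ s ∈ U, ∃ (V : X.Opens) (h : V ≤ U), s ∈ V ∧
        (presheafRes P h m, sheafRes G h g') ∈ Submodule.span Γ(X, V) (T V)) → g = g' := by
    intro U m g g' h h'
    refine eq_of_sheafRes_eq fun s hs => ?_
    obtain ⟨V, hV, hsV, h1⟩ := h s hs
    obtain ⟨V', hV', hsV', h2⟩ := h' s hs
    have h1 := hspan _ _ (inf_le_left : V ⊓ V' ≤ _) _ h1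
    have h2 := hspan _ _ (inf_le_right : V ⊓ V' ≤ _) _ h2
    rw [presheafRes_trans, sheafRes_trans] at h1 h2
    exact ⟨V ⊓ V', inf_le_left.trans hV, ⟨hsV, hsV'⟩, huniq _ _ _ _ h1 h2⟩
  choose f hf using hex
  let F : ∀ U : X.Opens, P.presheaf.obj (op U) →ₗ[Γ(X, U)] Γ(G, U) := fun U =>
    { toFun := f U
      map_add' := by
        intro x y
        refine huniq' U (x + y) _ _ (hf U _) fun s hs => ?_
        obtain ⟨V, hV, hsV, h1⟩ := hf U x s hs
        obtain ⟨V', hV', hsV', h2⟩ := hf U y s hs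
        have h1 := hspan _ _ (inf_le_left : V ⊓ V' ≤ _) _ h1
        have h2 := hspan _ _ (inf_le_right : V ⊓ V' ≤ _) _ h2
        rw [presheafRes_trans, sheafRes_trans] at h1 h2
        refine ⟨V ⊓ V', inf_le_left.trans hV, ⟨hsV, hsV'⟩, ?_⟩
        rw [map_add, map_add]
        exact Submodule.add_mem _ h1 h2
      map_smul' := by
        intro r x
        refine huniq' U (r • x) _ _ (hf U _) fun s hs => ?_
        obtain ⟨V, hV, hsV, h1⟩ := hf U x s hs
        refine ⟨V, hV, hsV, ?_⟩
        rw [RingHom.id_apply, presheafRes_smul, sheafRes_smul]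
        exact Submodule.smul_mem _ _ h1 }
  have hF : ∀ (U V : X.Opens) (h : V ≤ U) (x : P.presheaf.obj (op U)),
      F V (presheafRes P h x) = sheafRes G h (F U x) := by
    intro U V h x
    refine huniq' V (presheafRes P h x) _ _ (hf V _) fun s hs => ?_
    obtain ⟨W, hW, hsW, h1⟩ := hf U x s (h hs)
    have h1 := hspan _ _ (inf_le_left : W ⊓ V ≤ _) _ h1
    rw [presheafRes_trans, sheafRes_trans] at h1
    refine ⟨W ⊓ V, inf_le_right, ⟨hsW, hs⟩, ?_⟩
    rw [presheafRes_trans, sheafRes_trans]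
    exact h1
  refine ⟨{ app := fun U => ModuleCat.ofHom (F U.unop), naturality := ?_ }, fun U a ha => ?_⟩
  · intro U V i
    ext x
    exact hF _ _ (leOfHom i.unop) x
  · change f U a.1 = a.2
    refine huniq' U a.1 _ _ (hf U _) fun s hs => ⟨U, le_rfl, hs, ?_⟩
    exact hspan _ _ _ _ (Submodule.subset_span ha)

end Generators

end
end OrthDL

namespace OrthDL
noncomputable section
variable {p : ℕ} [Fact p.Prime]

/-! ### Morphisms out of quotients of subsheaves -/

section Adjunction

universe u₁ v₁ u₂ v₂

variable {C : Type u₁} {D : Type u₂} [Category.{v₁} C] [Category.{v₂} D] {L : C ⥤ D} {R : D ⥤ C}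

theorem exists_unit_comp_eq (adj : L ⊣ R) {A : C} {G : D} (f : A ⟶ R.obj G) :
    ∃ g : L.obj A ⟶ G, adj.unit.app A ≫ R.map g = f :=
  ⟨(adj.homEquiv _ _).symm f, (adj.homEquiv_unit _ _ _).symm.trans (Equiv.apply_symm_apply _ _)⟩

theorem hom_ext_of_unit_comp (adj : L ⊣ R) {A : C} {G : D} {f g : L.obj A ⟶ G}
    (h : adj.unit.app A ≫ R.map f = adj.unit.app A ≫ R.map g) : f = g :=
  (adj.homEquiv _ _).injective (by rw [Adjunction.homEquiv_unit, Adjunction.homEquiv_unit, h])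

theorem comp_unit_app (adj : L ⊣ R) {A B : C} (i : A ⟶ B) :
    i ≫ adj.unit.app B = adj.unit.app A ≫ R.map (L.map i) := adj.unit.naturality i

variable [Limits.HasZeroMorphisms D] (adj : L ⊣ R) {A B : C} (i : A ⟶ B) [Limits.HasCokernel (L.map i)]

/-- The adjoint of the projection to the cokernel of `L.map i`. -/
def cokernelProj : B ⟶ R.obj (Limits.cokernel (L.map i)) :=
  adj.unit.app B ≫ R.map (Limits.cokernel.π (L.map i))

/-- The zero morphism appears as the adjoint of `0`, because `C` is not assumed to have zero
morphisms. -/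
theorem comp_cokernelProj : i ≫ cokernelProj adj i = adj.unit.app A ≫ R.map 0 := by
  rw [cokernelProj, ← Category.assoc, comp_unit_app adj, Category.assoc, ← R.map_comp,
    Limits.cokernel.condition]

theorem cokernelProj_hom_ext {G : D} {f g : Limits.cokernel (L.map i) ⟶ G}
    (h : cokernelProj adj i ≫ R.map f = cokernelProj adj i ≫ R.map g) : f = g := by
  rw [← cancel_epi (Limits.cokernel.π (L.map i))]
  refine hom_ext_of_unit_comp adj ?_
  rw [R.map_comp, R.map_comp, ← Category.assoc, ← Category.assoc]
  exact h

theorem exists_cokernelProj_comp_eq {G : D} (f : B ⟶ R.obj G)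
    (hf : i ≫ f = adj.unit.app A ≫ R.map 0) :
    ∃ g : Limits.cokernel (L.map i) ⟶ G, cokernelProj adj i ≫ R.map g = f := by
  obtain ⟨k, rfl⟩ := exists_unit_comp_eq adj f
  have hk : L.map i ≫ k = 0 := by
    refine hom_ext_of_unit_comp adj ?_
    rw [← hf, R.map_comp, ← Category.assoc, ← Category.assoc, comp_unit_app adj]
  refine ⟨Limits.cokernel.desc _ k hk, ?_⟩
  rw [cokernelProj, Category.assoc, ← R.map_comp, Limits.cokernel.π_desc]

end Adjunction

section Quotient

variable {M : Type} [AddCommGroup M] [Module (ZMod p) M] {X : Sch p}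

/-- Sheafification is left adjoint to the forgetful functor. -/
def sheafifyAdj (X : Scheme.{0}) : sheafify X ⊣ Scheme.Modules.toPresheafOfModules X :=
  PresheafOfModules.sheafificationAdjunction (𝟙 X.ringCatSheaf.obj)

/-- The projection from `L_{d+1}` to `L_{d+1} / L_d`. -/
def Flag.proj (F : Flag M X) : F.big.toPresheafOfModules ⟶ F.quotient.val :=
  cokernelProj (sheafifyAdj X.left) _

/-- The projection from `L_{d+1}` to `L_{d+1} / L_d` on sections. -/
def Flag.quot (F : Flag M X) {U : X.left.Opens} (x : Γ(X.left, U) ⊗[ZMod p] M) (hx : x ∈ sec F.big U) :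
    Γ(F.quotient, U) :=
  homApp F.proj U ⟨x, hx⟩

theorem Flag.quot_smul (F : Flag M X) {U : X.left.Opens} (r : Γ(X.left, U))
    {x : Γ(X.left, U) ⊗[ZMod p] M} (hx : x ∈ sec F.big U) :
    F.quot (r • x) (Submodule.smul_mem _ r hx) = r • F.quot x hx :=
  (homApp F.proj U).map_smul r ⟨x, hx⟩

theorem Flag.quot_add (F : Flag M X) {U : X.left.Opens}
    {x y : Γ(X.left, U) ⊗[ZMod p] M} (hx : x ∈ sec F.big U) (hy : y ∈ sec F.big U) :
    F.quot (x + y) (Submodule.add_mem _ hx hy) = F.quot x hx + F.quot y hy :=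
  (homApp F.proj U).map_add ⟨x, hx⟩ ⟨y, hy⟩

theorem Flag.sheafRes_quot (F : Flag M X) {U V : X.left.Opens} (h : V ≤ U)
    {x : Γ(X.left, U) ⊗[ZMod p] M} (hx : x ∈ sec F.big U) :
    sheafRes F.quotient h (F.quot x hx) = F.quot (res M X h x) (res_mem _ h hx) :=
  (homApp_res F.proj h _).symm

theorem Flag.quot_eq_zero (F : Flag M X) {U : X.left.Opens}
    {x : Γ(X.left, U) ⊗[ZMod p] M} (hx : x ∈ sec F.small U) : F.quot x (F.le _ hx) = 0 :=
  congrArg (fun f : F.small.toPresheafOfModules ⟶ F.quotient.val => homApp f U ⟨x, hx⟩)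
    (comp_cokernelProj (sheafifyAdj X.left) (PresheafOfModules.Submodule.homOfLE F.le))

/-- Sections of the quotient sheaf need not lift to `L_{d+1}`, but by adjunction the liftable ones
determine every morphism to a sheaf. -/
theorem Flag.quotient_hom_ext (F : Flag M X) {G : X.left.Modules} {f g : F.quotient ⟶ G}
    (h : ∀ (U : X.left.Opens) (x : Γ(X.left, U) ⊗[ZMod p] M) (hx : x ∈ sec F.big U),
      f.app U (F.quot x hx) = g.app U (F.quot x hx)) : f = g :=
  cokernelProj_hom_ext (sheafifyAdj X.left) (PresheafOfModules.Submodule.homOfLE F.le)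
    (hom_ext_of_homApp fun U x => h U x.1 x.2)

theorem Flag.exists_desc (F : Flag M X) {G : X.left.Modules} (f : F.big.toPresheafOfModules ⟶ G.val)
    (hf : ∀ (U : X.left.Opens) (x : Γ(X.left, U) ⊗[ZMod p] M) (hx : x ∈ sec F.small U),
      homApp f U ⟨x, F.le _ hx⟩ = 0) :
    ∃ g : F.quotient ⟶ G, ∀ (U : X.left.Opens) (x : Γ(X.left, U) ⊗[ZMod p] M) (hx : x ∈ sec F.big U),
      g.app U (F.quot x hx) = homApp f U ⟨x, hx⟩ := by
  obtain ⟨g, hg⟩ := exists_cokernelProj_comp_eq (sheafifyAdj X.left)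
    (PresheafOfModules.Submodule.homOfLE F.le) f (hom_ext_of_homApp fun U x => hf U x.1 x.2)
  exact ⟨g, fun U x hx =>
    congrArg (fun f : F.big.toPresheafOfModules ⟶ G.val => homApp f U ⟨x, hx⟩) hg⟩

end Quotient

/-! ### The ideal and the conormal sheaf of a morphism -/

section Conormal

variable {Z Y : Scheme.{0}} (j : Z ⟶ Y)

/-- The kernel of `𝒪_Y ⟶ j_* 𝒪_Z`. -/
abbrev idealSheaf : Y.Modules := Limits.kernel (comorphism j)

/-- A section of the ideal, as a function. -/
def idealVal (U : Y.Opens) : Γ(idealSheaf j, U) →ₗ[Γ(Y, U)] Γ(Y, U) :=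
  homApp (G := structureSheaf Y) (P := (idealSheaf j).val) (Limits.kernel.ι (comorphism j)).val U

/-- Taking sections over `U` preserves limits, so it turns the kernel of sheaves into the kernel on
sections. -/
theorem exact_idealVal (U : Y.Opens) : Function.Injective (idealVal j U) ∧
    ∀ r : Γ(Y, U), j.app U r = 0 → ∃ x, idealVal j U x = r := by
  let S : ShortComplex Y.Modules := ShortComplex.mk (Limits.kernel.ι (comorphism j)) (comorphism j)
    (Limits.kernel.condition _)
  have hS : S.Exact := ShortComplex.exact_of_f_is_kernel _ (Limits.kernelIsKernel _)
  let E : Y.Modules ⥤ Ab.{0} := Scheme.Modules.toPresheaf Y ⋙ (evaluation _ Ab.{0}).obj (op U)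
  have hE0 : E.PreservesZeroMorphisms := ⟨fun _ _ => rfl⟩
  have hE1 : Limits.PreservesLimits E := by
    have : Limits.PreservesLimits ((evaluation (Y.Opens)ᵒᵖ Ab.{0}).obj (op U)) := inferInstance
    exact Limits.comp_preservesLimits _ _
  have hf : Mono S.f := inferInstanceAs (Mono (Limits.kernel.ι (comorphism j)))
  have hE : (S.map E).Exact := hS.map_of_mono_of_preservesKernel E hf inferInstance
  have hm : Mono (E.map S.f) := inferInstance
  refine ⟨(AddCommGrpCat.mono_iff_injective _).1 hm, fun r hr => ?_⟩
  exact (ShortComplex.ab_exact_iff _).1 hE r hr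

theorem idealVal_injective (U : Y.Opens) : Function.Injective (idealVal j U) := (exact_idealVal j U).1

theorem app_idealVal (U : Y.Opens) (x : Γ(idealSheaf j, U)) : j.app U (idealVal j U x) = 0 :=
  congrArg (fun f : idealSheaf j ⟶ (Scheme.Modules.pushforward j).obj (structureSheaf Z) => f.app U x)
    (Limits.kernel.condition (comorphism j))

/-- A function that vanishes on `Z`, as a section of the ideal. -/
def idealMk {U : Y.Opens} (r : Γ(Y, U)) (hr : j.app U r = 0) : Γ(idealSheaf j, U) :=
  ((exact_idealVal j U).2 r hr).choose

@[simp]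
theorem idealVal_idealMk {U : Y.Opens} (r : Γ(Y, U)) (hr : j.app U r = 0) :
    idealVal j U (idealMk j r hr) = r :=
  ((exact_idealVal j U).2 r hr).choose_spec

theorem idealVal_res {U V : Y.Opens} (h : V ≤ U) (x : Γ(idealSheaf j, U)) :
    idealVal j V (sheafRes _ h x) = ringRes Y h (idealVal j U x) :=
  homApp_res (G := structureSheaf Y) (P := (idealSheaf j).val) _ h x

/-- The pull-back of sections of the ideal to the conormal sheaf. -/
def conormalMk (U : Y.Opens) : Γ(idealSheaf j, U) →+ Γ(conormalSheaf j, j ⁻¹ᵁ U) :=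
  (((Scheme.Modules.pullbackPushforwardAdjunction j).unit.app (idealSheaf j)).app U).hom

theorem conormalMk_smul {U : Y.Opens} (r : Γ(Y, U)) (x : Γ(idealSheaf j, U)) :
    conormalMk j U (r • x) = j.app U r • conormalMk j U x :=
  Scheme.Modules.Hom.app_smul _ r x

theorem conormalMk_res {U V : Y.Opens} (h : V ≤ U) (x : Γ(idealSheaf j, U)) :
    conormalMk j V (sheafRes _ h x) =
      sheafRes _ (fun _ hz => h hz : j ⁻¹ᵁ V ≤ j ⁻¹ᵁ U) (conormalMk j U x) :=
  homApp_res (G := (Scheme.Modules.pushforward j).obj (conormalSheaf j)) (P := (idealSheaf j).val)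
    ((Scheme.Modules.pullbackPushforwardAdjunction j).unit.app (idealSheaf j)).val h x

variable {j} {G : Z.Modules}

theorem conormal_hom_ext {f g : conormalSheaf j ⟶ G} (h : ∀ (U : Y.Opens) (x : Γ(idealSheaf j, U)),
    f.app _ (conormalMk j U x) = g.app _ (conormalMk j U x)) : f = g :=
  hom_ext_of_unit_comp (Scheme.Modules.pullbackPushforwardAdjunction j)
    (Scheme.Modules.hom_ext _ _ fun U => by ext x; exact h U x)

theorem exists_conormal_desc (f : idealSheaf j ⟶ (Scheme.Modules.pushforward j).obj G) :
    ∃ g : conormalSheaf j ⟶ G, ∀ (U : Y.Opens) (x : Γ(idealSheaf j, U)),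
      g.app _ (conormalMk j U x) = f.app U x := by
  obtain ⟨g, hg⟩ := exists_unit_comp_eq (Scheme.Modules.pullbackPushforwardAdjunction j) f
  exact ⟨g, fun U x =>
    congrArg (fun f : idealSheaf j ⟶ (Scheme.Modules.pushforward j).obj G => f.app U x) hg⟩

end Conormal

end
end OrthDL

namespace OrthDL
noncomputable section
variable {p : ℕ} [Fact p.Prime]

/-! ### The map from the conormal sheaf to the universal quotient -/

section ConormalToQuotient

variable {V : Type} [AddCommGroup V] [Module (ZMod p) V] [FiniteDimensional (ZMod p) V]
variable {B : LinearMap.BilinForm (ZMod p) V} {W : Submodule (ZMod p) V} {X Y Y' T : Sch p} {d : ℕ}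

local notation "n" => Module.finrank (ZMod p) W

variable {hB : B.IsSymm} {u : Flag V Y} {u' : Flag (OrthQuot B W) Y'} {j : Y' ⟶ Y}

theorem Flag.quot_congr {M : Type} [AddCommGroup M] [Module (ZMod p) M] (F : Flag M X)
    {U : X.left.Opens} {x y : Γ(X.left, U) ⊗[ZMod p] M} (h : x = y) (hx : x ∈ sec F.big U)
    (hy : y ∈ sec F.big U) : F.quot x hx = F.quot y hy := by
  subst h
  rfl

theorem IsCycle.app_form_eq_zero (S : Splitting B W) (hW : W ≤ B.orthogonal W)
    (hc : IsCycle hB d u u' j) {U : Y.left.Opens} {x : Γ(Y.left, U) ⊗[ZMod p] V}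
    (hx : x ∈ sec u.big U) (i : Fin n) : j.left.app U (B.baseChange _ (S.wR _ i) x) = 0 := by
  rw [Scheme.Hom.app_eq_appLE]
  exact hc.appLE_eq_zero S hW (𝟙 Y') (Category.id_comp j) _ hx i

/-- The section `B(w_i, x)` of the ideal of `Y_{W^⊥/W}`. -/
def IsCycle.eqn (S : Splitting B W) (hW : W ≤ B.orthogonal W) (hc : IsCycle hB d u u' j) (i : Fin n)
    (U : Y.left.Opens) : sec u.big U →ₗ[Γ(Y.left, U)] Γ(idealSheaf j.left, U) where
  toFun x := idealMk j.left (B.baseChange _ (S.wR _ i) x.1) (hc.app_form_eq_zero S hW x.2 i)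
  map_add' x y := idealVal_injective _ _ (by simp)
  map_smul' r x := idealVal_injective _ _ (by simp)

theorem IsCycle.idealVal_eqn (S : Splitting B W) (hW : W ≤ B.orthogonal W)
    (hc : IsCycle hB d u u' j) (i : Fin n) {U : Y.left.Opens} (x : sec u.big U) :
    idealVal j.left U (hc.eqn S hW i U x) = B.baseChange _ (S.wR _ i) x.1 := idealVal_idealMk _ _ (hc.app_form_eq_zero S hW x.2 i)

theorem IsCycle.eqn_res (S : Splitting B W) (hW : W ≤ B.orthogonal W)
    (hc : IsCycle hB d u u' j) (i : Fin n) {U U' : Y.left.Opens} (h : U' ≤ U) (x : sec u.big U) :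
    sheafRes _ h (hc.eqn S hW i U x) = hc.eqn S hW i U' ⟨res V Y h x.1, res_mem _ h x.2⟩ := by
  refine idealVal_injective _ _ ?_
  rw [idealVal_res, idealVal_eqn, idealVal_eqn]
  exact (form_wR_res S h _ _).symm

theorem IsCycle.qR_pull_mem (S : Splitting B W) (hc : IsCycle hB d u u' j) {U : Y.left.Opens}
    {C : Y'.left.Opens} (h : C ≤ j.left ⁻¹ᵁ U) {x : Γ(Y.left, U) ⊗[ZMod p] V}
    (hx : x ∈ sec u.big U) : S.qR _ (pull V j U C h x) ∈ sec u'.big C := by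
  have h1 : pull V j U C h x ∈ sec (u.pullback j).big C := mem_pullbackSub j h hx
  rw [hc.pull_eq] at h1
  exact ((mem_inverseImage_iff S).1 h1).2

/-- The class in `L_{d+1} / L_d` of the image of a section `x` of `L_{d+1}` on `Y_V`. -/
def IsCycle.red (S : Splitting B W) (hc : IsCycle hB d u u' j) {U : Y.left.Opens}
    {C : Y'.left.Opens} (h : C ≤ j.left ⁻¹ᵁ U) (x : sec u.big U) : Γ(u'.quotient, C) :=
  u'.quot _ (hc.qR_pull_mem S h x.2)

theorem IsCycle.red_add (S : Splitting B W) (hc : IsCycle hB d u u' j) {U : Y.left.Opens}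
    {C : Y'.left.Opens} (h : C ≤ j.left ⁻¹ᵁ U) (x y : sec u.big U) :
    hc.red S h (x + y) = hc.red S h x + hc.red S h y := by
  rw [red, red, red, ← Flag.quot_add]
  refine Flag.quot_congr _ ?_ _ _
  rw [Submodule.coe_add, map_add, map_add]

theorem IsCycle.red_smul (S : Splitting B W) (hc : IsCycle hB d u u' j) {U : Y.left.Opens}
    {C : Y'.left.Opens} (h : C ≤ j.left ⁻¹ᵁ U) (r : Γ(Y.left, U)) (x : sec u.big U) :
    hc.red S h (r • x) = j.left.appLE U C h r • hc.red S h x := by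
  rw [red, red, ← Flag.quot_smul]
  refine Flag.quot_congr _ ?_ _ _
  rw [Submodule.coe_smul, pull, changeScalars_smul, map_smul]

theorem IsCycle.red_zero (S : Splitting B W) (hc : IsCycle hB d u u' j) {U : Y.left.Opens}
    {C : Y'.left.Opens} (h : C ≤ j.left ⁻¹ᵁ U) : hc.red S h (0 : sec u.big U) = 0 := by
  simpa using hc.red_add S h (0 : sec u.big U) 0

theorem IsCycle.sheafRes_red (S : Splitting B W) (hc : IsCycle hB d u u' j) {U U' : Y.left.Opens}
    {C C' : Y'.left.Opens} (h : C ≤ j.left ⁻¹ᵁ U) (hU : U' ≤ U) (hC : C' ≤ C)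
    (h' : C' ≤ j.left ⁻¹ᵁ U') (x : sec u.big U) :
    sheafRes _ hC (hc.red S h x) = hc.red S h' ⟨res V Y hU x.1, res_mem _ hU x.2⟩ := by
  rw [red, red, Flag.sheafRes_quot]
  refine Flag.quot_congr _ ?_ _ _
  rw [res_qR, res_pull, pull_res]

/-- The generators of the graph of the `i`-th component of the map from the ideal of `Y_{W^⊥/W}`
to the universal quotient. -/
def IsCycle.coordGraph (S : Splitting B W) (hc : IsCycle hB d u u' j) (i : Fin n) (U : Y.left.Opens) :
    Set ((idealSheaf j.left).val.presheaf.obj (op U) ×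
      Γ((Scheme.Modules.pushforward j.left).obj u'.quotient, U)) :=
  {a | (∃ (k : Fin n) (x : sec u.big U), idealVal j.left U a.1 = B.baseChange _ (S.wR _ k) x.1 ∧
    a.2 = if k = i then hc.red S (le_refl (j.left ⁻¹ᵁ U)) x else 0) ∨ ∀ z, j.left z ∉ U}

/-- Collecting the generators with the same `w_k` puts every element of the span in the form to
which `IsCycle.pull_mem_small` applies. -/
theorem IsCycle.exists_of_mem_span_coordGraph (S : Splitting B W) (hc : IsCycle hB d u u' j)
    (i : Fin n) {U : Y.left.Opens} {z : Y'.left} (hz : j.left z ∈ U)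
    {a : (idealSheaf j.left).val.presheaf.obj (op U) ×
      Γ((Scheme.Modules.pushforward j.left).obj u'.quotient, U)}
    (ha : a ∈ Submodule.span Γ(Y.left, U) (hc.coordGraph S i U)) :
    ∃ L : Fin n → sec u.big U, idealVal j.left U a.1 = ∑ k, B.baseChange _ (S.wR _ k) (L k).1 ∧
      a.2 = hc.red S (le_refl (j.left ⁻¹ᵁ U)) (L i) := by
  induction ha using Submodule.span_induction with
  | mem a ha =>
    -- The second kind of generator exists only over open subsets that miss `Y_{W^⊥/W}`.
    obtain ⟨k, x, h1, h2⟩ := ha.resolve_right fun h => h z hz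
    refine ⟨Pi.single k x, ?_, ?_⟩
    · rw [h1, Finset.sum_eq_single k, Pi.single_eq_same]
      · intro k' _ hk
        rw [Pi.single_eq_of_ne hk, Submodule.coe_zero, map_zero]
      · exact fun h => (h (Finset.mem_univ k)).elim
    · rw [h2]
      split_ifs with h
      · rw [h, Pi.single_eq_same]
      · rw [Pi.single_eq_of_ne (Ne.symm h), red_zero]
  | zero =>
    refine ⟨0, ?_, (hc.red_zero S _).symm⟩
    refine (map_zero (idealVal j.left U)).trans ?_
    simp
  | add a b _ _ ha hb =>
    obtain ⟨L, h1, h2⟩ := ha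
    obtain ⟨L', h1', h2'⟩ := hb
    refine ⟨L + L', ?_, ?_⟩
    · refine (map_add (idealVal j.left U) a.1 b.1).trans ((congrArg₂ (· + ·) h1 h1').trans ?_)
      rw [← Finset.sum_add_distrib]
      simp
    · rw [Prod.snd_add, h2, h2', Pi.add_apply, red_add]
      rfl
  | smul r a _ ha =>
    obtain ⟨L, h1, h2⟩ := ha
    refine ⟨r • L, ?_, ?_⟩
    · refine (map_smul (idealVal j.left U) r a.1).trans ((congrArg (r • ·) h1).trans ?_)
      rw [Finset.smul_sum]
      simp
    · rw [Prod.smul_snd, h2, Pi.smul_apply, red_smul, ← Scheme.Hom.app_eq_appLE]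
      rfl

theorem IsCycle.exists_mem_span_coordGraph (S : Splitting B W) (hW : W ≤ B.orthogonal W)
    (hc : IsCycle hB d u u' j)
    (i : Fin n) {A : Y.left.Opens} {r : ℕ} {σ : Fin r ↪ Fin (Module.finrank (ZMod p) V)}
    {y : Fin r → Γ(Y.left, A) ⊗[ZMod p] V} (hy : IsFrame u.big A σ y) {f : Γ(Y.left, A)}
    (hf : f ∈ S.formIdeal y) : ∃ a ∈ Submodule.span Γ(Y.left, A) (hc.coordGraph S i A),
      idealVal j.left A a.1 = f := by
  induction hf using Submodule.span_induction with
  | mem f hf =>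
    obtain ⟨⟨k, t⟩, rfl⟩ := hf
    exact ⟨(hc.eqn S hW k A ⟨y t, hy.mem t⟩, _), Submodule.subset_span
      (.inl ⟨k, ⟨y t, hy.mem t⟩, hc.idealVal_eqn S hW k _, rfl⟩), hc.idealVal_eqn S hW k _⟩
  | zero => exact ⟨0, Submodule.zero_mem _, map_zero _⟩
  | add f g _ _ hf hg =>
    obtain ⟨a, ha, rfl⟩ := hf
    obtain ⟨b, hb, rfl⟩ := hg
    exact ⟨a + b, Submodule.add_mem _ ha hb, map_add _ _ _⟩
  | smul r f _ hf =>
    obtain ⟨a, ha, rfl⟩ := hf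
    exact ⟨r • a, Submodule.smul_mem _ _ ha, map_smul _ _ _⟩

/-- The rule on the generators `B(w_k, x)` is single-valued by `IsCycle.pull_mem_small` and defined
on all of the ideal by `IsCycle.exists_mem_formIdeal`. The adjunction between pull-back and
push-forward turns it into a map on the conormal sheaf. -/
theorem IsCycle.exists_coord (S : Splitting B W) (hnd : B.Nondegenerate) (hns : IsNonsplit B)
    (hW : W ≤ B.orthogonal W) (hr : Module.finrank (ZMod p) V = 2 * (n + d + 1))
    (hc : IsCycle hB d u u' j) (i : Fin n) :
    ∃ θ : conormalSheaf j.left ⟶ u'.quotient, ∀ (U : Y.left.Opens) (k : Fin n) (x : sec u.big U),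
      θ.app _ (conormalMk j.left U (hc.eqn S hW k U x)) =
        if k = i then hc.red S (le_refl (j.left ⁻¹ᵁ U)) x else 0 := by
  obtain ⟨f, hf⟩ := exists_hom_of_generators (P := (idealSheaf j.left).val)
    (G := (Scheme.Modules.pushforward j.left).obj u'.quotient) (hc.coordGraph S i) (by
      rintro U U' h ⟨a, g⟩ (⟨k, x, h1, h2⟩ | ha)
      · refine .inl ⟨k, ⟨res V Y h x.1, res_mem _ h x.2⟩, ?_, ?_⟩
        · refine (idealVal_res j.left h a).trans ?_
          rw [h1]
          exact (form_wR_res S h _ _).symm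
        · change sheafRes _ h g = _
          have h2 : g = _ := h2
          rw [h2]
          split_ifs
          · exact hc.sheafRes_red S _ h (fun z hz => h hz) _ x
          · exact map_zero _
      · exact .inr fun z hz => ha z (h hz)) (by
      intro U g hg
      by_cases hU : ∀ z, j.left z ∉ U
      · exact subsingleton_of_eq_bot (G := u'.quotient) (U := j.left ⁻¹ᵁ U) hU _ _
      · push Not at hU
        obtain ⟨z, hz⟩ := hU
        obtain ⟨L, h1, h2⟩ := hc.exists_of_mem_span_coordGraph S i hz hg
        have h3 := hc.pull_mem_small S hnd hns hW hr (fun i => (L i).2)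
          (h1.symm.trans (map_zero _)) i
        rw [hc.pull_eq] at h3
        refine Eq.trans h2 (u'.quot_eq_zero ((mem_inverseImage_iff S).1 h3).2)) (by
      intro U m s hs
      obtain ⟨A, hA, hsA, h⟩ := hc.exists_mem_formIdeal S hnd hns hW hr hs (app_idealVal j.left U m)
      refine ⟨A, hA, hsA, ?_⟩
      rcases h with h | ⟨σ, y, hy, h⟩
      -- Over an open subset that misses `Y_{W^⊥/W}`, the ideal contains every function and the
      -- target has only the section zero.
      · exact ⟨0, Submodule.subset_span (.inr h)⟩
      · obtain ⟨a, ha, h1⟩ := hc.exists_mem_span_coordGraph S hW i hy h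
        refine ⟨a.2, ?_⟩
        have h2 : a.1 = presheafRes _ hA m :=
          idealVal_injective _ _ (h1.trans (idealVal_res j.left hA m).symm)
        rw [← h2]
        exact ha)
  obtain ⟨θ, hθ⟩ := exists_conormal_desc (j := j.left) (G := u'.quotient) ⟨f⟩
  refine ⟨θ, fun U k x => (hθ _ _).trans ?_⟩
  exact hf U (hc.eqn S hW k U x, _) (.inl ⟨k, x, hc.idealVal_eqn S hW k x, rfl⟩)

end ConormalToQuotient

end
end OrthDL

namespace OrthDL
noncomputable section
variable {p : ℕ} [Fact p.Prime]

/-! ### The map from the universal quotient to the conormal sheaf -/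

theorem app_sheafRes {X : Scheme.{0}} {F G : X.Modules} (f : F ⟶ G) {U U' : X.Opens} (h : U' ≤ U)
    (x : Γ(F, U)) : f.app U' (sheafRes F h x) = sheafRes G h (f.app U x) :=
  homApp_res (P := F.val) f.val h x

theorem sum_app {X : Scheme.{0}} {F G : X.Modules} {ι : Type} (s : Finset ι) (f : ι → (F ⟶ G))
    (U : X.Opens) (x : Γ(F, U)) : (∑ i ∈ s, f i).app U x = ∑ i ∈ s, (f i).app U x := by
  classical
  induction s using Finset.induction_on with
  | empty => rfl
  | insert i s hi ih =>
    rw [Finset.sum_insert hi, Finset.sum_insert hi, ← ih]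
    rfl

section QuotientToConormal

variable {V : Type} [AddCommGroup V] [Module (ZMod p) V] [FiniteDimensional (ZMod p) V]
variable {B : LinearMap.BilinForm (ZMod p) V} {W : Submodule (ZMod p) V} {X Y Y' T : Sch p} {d : ℕ}

local notation "n" => Module.finrank (ZMod p) W

variable {hB : B.IsSymm} {u : Flag V Y} {u' : Flag (OrthQuot B W) Y'} {j : Y' ⟶ Y}
  (S : Splitting B W) (hW : W ≤ B.orthogonal W) (hc : IsCycle hB d u u' j)

/-- The class of `B(w_i, x)` in the conormal sheaf. -/
def IsCycle.con (i : Fin n) {U : Y.left.Opens} {C : Y'.left.Opens} (h : C ≤ j.left ⁻¹ᵁ U)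
    (x : sec u.big U) : Γ(conormalSheaf j.left, C) :=
  sheafRes _ h (conormalMk j.left U (hc.eqn S hW i U x))

variable {U : Y.left.Opens} {C C' : Y'.left.Opens} (h : C ≤ j.left ⁻¹ᵁ U)
  (i : Fin (Module.finrank (ZMod p) W))

theorem IsCycle.con_add (x y : sec u.big U) :
    hc.con S hW i h (x + y) = hc.con S hW i h x + hc.con S hW i h y := by
  rw [con, map_add, map_add, map_add]
  rfl

theorem IsCycle.con_smul (r : Γ(Y.left, U)) (x : sec u.big U) :
    hc.con S hW i h (r • x) = j.left.appLE U C h r • hc.con S hW i h x := by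
  rw [con, map_smul, conormalMk_smul, sheafRes_smul]
  rfl

theorem IsCycle.sheafRes_con (hC : C' ≤ C) (x : sec u.big U) :
    sheafRes _ hC (hc.con S hW i h x) = hc.con S hW i (hC.trans h) x := sheafRes_trans _ _ _

theorem IsCycle.con_res {U' : Y.left.Opens} (hU : U' ≤ U) (h' : C ≤ j.left ⁻¹ᵁ U')
    (x : sec u.big U) :
    hc.con S hW i h' ⟨res V Y hU x.1, res_mem _ hU x.2⟩ = hc.con S hW i h x := by
  rw [con, ← hc.eqn_res S hW i hU, conormalMk_res]
  exact sheafRes_trans _ _ _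

/-- A section of `L_d` is a combination of sections `Frob y` with `y` in `L_{d+1}`, and `B(w, Frob
y) = B(w, y)^(p-1) B(w, y)`. The first factor vanishes on `Y_{W^⊥/W}` because `p > 1`, so the
product is zero in the conormal sheaf. -/
theorem IsCycle.con_eq_zero (hnd : B.Nondegenerate)
    (hr : Module.finrank (ZMod p) V = 2 * (n + d + 1)) (x : sec u.big U)
    (hx : x.1 ∈ sec u.small U) : hc.con S hW i h x = 0 := by
  refine eq_of_sheafRes_eq fun z hz => ?_
  obtain ⟨U₁, σ, τ, _, y, hs, hf⟩ := hc.moduli.exists_frame (j.left z)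
  obtain ⟨U', hU, hU₁, hsU⟩ : ∃ U' : Y.left.Opens, U' ≤ U ∧ U' ≤ U₁ ∧ j.left z ∈ U' :=
    ⟨U ⊓ U₁, inf_le_left, inf_le_right, h hz, hs⟩
  have hy := hf.big.restrict hU₁
  set y' := fun t => res V Y hU₁ (y t) with hy'
  have hC : C ⊓ j.left ⁻¹ᵁ U' ≤ j.left ⁻¹ᵁ U' := inf_le_right
  refine ⟨C ⊓ j.left ⁻¹ᵁ U', inf_le_left, ⟨hz, hsU⟩, ?_⟩
  rw [map_zero, sheafRes_con, ← hc.con_res S hW _ i hU hC]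
  have h1 : res V Y hU x.1 ∈ sec (frobPullback u.big) U' :=
    hc.moduli.le_frobPullback hB hnd hr _ (res_mem _ hU hx)
  rw [hy.frobPullback.span_self] at h1
  obtain ⟨a, ha⟩ := (Submodule.mem_span_range_iff_exists_fun _).1 h1
  have h2 : hc.eqn S hW i U' ⟨res V Y hU x.1, res_mem _ hU x.2⟩ =
      ∑ t, (a t * (B.baseChange _ (S.wR _ i) (y' t)) ^ (p - 1)) •
        hc.eqn S hW i U' ⟨y' t, hy.mem t⟩ := by
    refine idealVal_injective _ _ ?_
    rw [idealVal_eqn, map_sum]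
    change B.baseChange _ _ (res V Y hU x.1) = _
    rw [← ha, map_sum]
    refine Finset.sum_congr rfl fun t _ => ?_
    rw [map_smul, map_smul, idealVal_eqn, form_wR_frobM, smul_eq_mul, smul_eq_mul, mul_assoc,
      ← pow_succ, Nat.sub_add_cancel (Fact.out : p.Prime).one_lt.le]
    rfl
  have h3 : ∀ t, j.left.app U' (a t * (B.baseChange _ (S.wR _ i) (y' t)) ^ (p - 1)) = 0 := by
    intro t
    rw [map_mul, map_pow, hc.app_form_eq_zero S hW (hy.mem t),
      zero_pow (Nat.sub_pos_of_lt (Fact.out : p.Prime).one_lt).ne', mul_zero]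
  rw [con, h2, map_sum, Finset.sum_eq_zero, map_zero]
  intro t _
  rw [conormalMk_smul, h3, zero_smul]

/-- Two morphisms out of the conormal sheaf agree if they agree on the classes of `B(w_i, x)`. -/
theorem IsCycle.conormal_hom_ext (hnd : B.Nondegenerate) (hns : IsNonsplit B)
    (hr : Module.finrank (ZMod p) V = 2 * (n + d + 1)) {G : Y'.left.Modules}
    {f g : conormalSheaf j.left ⟶ G}
    (hfg : ∀ (U : Y.left.Opens) (i : Fin n) (x : sec u.big U),
      f.app _ (hc.con S hW i (le_refl (j.left ⁻¹ᵁ U)) x) =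
        g.app _ (hc.con S hW i (le_refl (j.left ⁻¹ᵁ U)) x)) : f = g := by
  refine OrthDL.conormal_hom_ext fun U x => eq_of_sheafRes_eq fun z hz => ?_
  obtain ⟨A, hA, hsA, hA'⟩ := hc.exists_mem_formIdeal S hnd hns hW hr (s := j.left z) hz
    (app_idealVal j.left U x)
  obtain ⟨σ, y, hy, hf⟩ := hA'.resolve_left fun h => h z hsA
  have hjA : j.left ⁻¹ᵁ A ≤ j.left ⁻¹ᵁ U := fun _ ht => hA ht
  refine ⟨j.left ⁻¹ᵁ A, hjA, hsA, ?_⟩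
  rw [← app_sheafRes, ← app_sheafRes]
  have key : ∀ r ∈ S.formIdeal y, ∃ a : Γ(idealSheaf j.left, A), idealVal j.left A a = r ∧
      f.app _ (conormalMk j.left A a) = g.app _ (conormalMk j.left A a) := by
    intro r hr
    induction hr using Submodule.span_induction with
    | mem r hr =>
      obtain ⟨⟨k, t⟩, rfl⟩ := hr
      refine ⟨hc.eqn S hW k A ⟨y t, hy.mem t⟩, hc.idealVal_eqn S hW k _, ?_⟩
      have := hfg A k ⟨y t, hy.mem t⟩
      rwa [con, sheafRes_refl] at this
    | zero => exact ⟨0, map_zero _, by rw [map_zero, map_zero, map_zero]⟩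
    | add r s _ _ hr hs =>
      obtain ⟨a, rfl, ha⟩ := hr
      obtain ⟨b, rfl, hb⟩ := hs
      exact ⟨a + b, map_add _ _ _, by rw [map_add, map_add, map_add, ha, hb]⟩
    | smul c r _ hr =>
      obtain ⟨a, rfl, ha⟩ := hr
      refine ⟨c • a, map_smul _ _ _, ?_⟩
      rw [conormalMk_smul, Scheme.Modules.Hom.app_smul, Scheme.Modules.Hom.app_smul, ha]
  obtain ⟨a, ha, h1⟩ := key _ hf
  have h2 : a = sheafRes _ hA x := idealVal_injective _ _ (ha.trans (idealVal_res j.left hA x).symm)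
  rw [h2, conormalMk_res] at h1
  exact h1

/-- The pull-back of `L_{d+1}` from `Y_V` is the inverse image of its analogue for `W^⊥/W`. Sections
of the latter are thus locally combinations of classes of sections on `Y_V`, which suffice to define
and compare morphisms. -/
theorem IsCycle.exists_mem_span_qR_pull (hc : IsCycle hB d u u' j) {D : Y'.left.Opens}
    {z : Γ(Y'.left, D) ⊗[ZMod p] OrthQuot B W} (hz : z ∈ sec u'.big D) {s : Y'.left} (hs : s ∈ D) :
    ∃ (C : Y'.left.Opens) (hC : C ≤ D), s ∈ C ∧ res _ Y' hC z ∈ Submodule.span Γ(Y'.left, C)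
      {q | ∃ (U : Y.left.Opens) (h : C ≤ j.left ⁻¹ᵁ U) (x : sec u.big U),
        S.qR _ (pull V j U C h x.1) = q} := by
  have h1 : S.tR _ z ∈ sec (u.pullback j).big D := by
    rw [hc.pull_eq]
    exact tR_mem_inverseImage S hz
  obtain ⟨C, hC, hsC, h2⟩ := h1 s hs
  refine ⟨C, hC, hsC, ?_⟩
  have h3 : res _ Y' hC z = S.qR _ (res V Y' hC (S.tR _ z)) := by rw [← res_qR, S.qR_tR]
  rw [h3]
  have h4 := Submodule.mem_map_of_mem (f := S.qR Γ(Y'.left, C)) h2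
  rw [spanOn, Submodule.map_span] at h4
  refine Submodule.span_mono ?_ h4
  rintro _ ⟨_, ⟨D', hD, _, ⟨U, h, x, hx, rfl⟩, rfl⟩, rfl⟩
  exact ⟨U, hD.trans h, ⟨x, hx⟩, congrArg _ (res_pull (f := j) h hD x).symm⟩

/-- Two morphisms out of the universal quotient agree if they agree on the classes of the sections
of `L_{d+1}` on `Y_V`. -/
theorem IsCycle.quotient_hom_ext {G : Y'.left.Modules} {f g : u'.quotient ⟶ G}
    (hfg : ∀ (U : Y.left.Opens) (C : Y'.left.Opens) (h : C ≤ j.left ⁻¹ᵁ U) (x : sec u.big U),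
      f.app _ (hc.red S h x) = g.app _ (hc.red S h x)) : f = g := by
  refine u'.quotient_hom_ext fun D z hz => eq_of_sheafRes_eq fun s hs => ?_
  obtain ⟨C, hC, hsC, h⟩ := hc.exists_mem_span_qR_pull S hz hs
  refine ⟨C, hC, hsC, ?_⟩
  rw [← app_sheafRes, ← app_sheafRes, Flag.sheafRes_quot]
  have key : ∀ q ∈ Submodule.span Γ(Y'.left, C)
      {q | ∃ (U : Y.left.Opens) (h : C ≤ j.left ⁻¹ᵁ U) (x : sec u.big U),
        S.qR _ (pull V j U C h x.1) = q}, ∃ hq : q ∈ sec u'.big C,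
      f.app C (u'.quot q hq) = g.app C (u'.quot q hq) := by
    intro q hq
    induction hq using Submodule.span_induction with
    | mem q hq =>
      obtain ⟨U, h, x, rfl⟩ := hq
      exact ⟨hc.qR_pull_mem S h x.2, hfg U C h x⟩
    | zero =>
      refine ⟨Submodule.zero_mem _, ?_⟩
      have h0 : u'.quot (0 : Γ(Y'.left, C) ⊗[ZMod p] OrthQuot B W) (Submodule.zero_mem _) = 0 :=
        map_zero (homApp u'.proj C)
      rw [h0, map_zero, map_zero]
    | add q r _ _ hq hr =>
      obtain ⟨hq, h1⟩ := hq
      obtain ⟨hr, h2⟩ := hr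
      exact ⟨Submodule.add_mem _ hq hr, by rw [Flag.quot_add _ hq hr, map_add, map_add, h1, h2]⟩
    | smul c q _ hq =>
      obtain ⟨hq, h1⟩ := hq
      refine ⟨Submodule.smul_mem _ _ hq, ?_⟩
      rw [Flag.quot_smul _ _ hq, Scheme.Modules.Hom.app_smul, Scheme.Modules.Hom.app_smul, h1]
  obtain ⟨hq, h1⟩ := key _ h
  exact h1

/-- The value on `(W^⊥ / W)`-components: the `W`-component of a section orthogonal to `W` does not
contribute to the product with a Frobenius transform. -/
theorem Splitting.form_tR_qR {R : Type} [CommRing R] [Algebra (ZMod p) R] {x y : R ⊗[ZMod p] V}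
    (hx : ∀ i, B.baseChange R (S.wR R i) x = 0) (hy : ∀ i, B.baseChange R (S.wR R i) y = 0) :
    B.baseChange R (S.tR R (S.qR R x)) (frobM y) = B.baseChange R x (frobM y) := by
  obtain ⟨a, ha⟩ := S.exists_sum hx
  conv_rhs => rw [ha]
  rw [map_add, LinearMap.add_apply, map_sum, LinearMap.sum_apply, Finset.sum_eq_zero, zero_add]
  intro i _
  rw [map_smul, LinearMap.smul_apply, form_wR_frobM, hy, map_zero, smul_zero]

/-- Near a point of `Y_{W^⊥/W}`, the class of `B(w_i, x)` is a fixed section, multiplied by the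
product of `x` with the Frobenius transform of a fixed section of `L_{d+1}`. -/
theorem IsCycle.exists_con_eq (hnd : B.Nondegenerate) (hns : IsNonsplit B)
    (hr : Module.finrank (ZMod p) V = 2 * (n + d + 1)) (z : Y'.left) :
    ∃ (A : Y.left.Opens) (y : sec u.big A) (e : Γ(conormalSheaf j.left, j.left ⁻¹ᵁ A)),
      j.left z ∈ A ∧ ∀ (U : Y.left.Opens) (x : sec u.big U) (C : Y'.left.Opens)
        (h : C ≤ j.left ⁻¹ᵁ U) (hA : C ≤ j.left ⁻¹ᵁ A),
        hc.con S hW i h x = B.baseChange _ (S.tR _ (S.qR _ (pull V j U C h x.1)))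
          (frobM (pull V j A C hA y.1)) • sheafRes _ hA e := by
  obtain ⟨A, σ, x, l, y, hzA, ha, hy, hu, -⟩ := hc.moduli.exists_transversal hB hnd hns hr (j.left z)
  obtain ⟨c, hc'⟩ := hu.exists_right_inv
  -- Here `c` is the inverse of `B(l, Frob y)`. A section `x` is `b • l` up to `L_d`, with `b = c
  -- B(x, Frob y)`, and `L_d` contributes nothing.
  refine ⟨A, ⟨y, hy⟩, hc.con S hW i (le_refl (j.left ⁻¹ᵁ A)) (c • ⟨l, ha.mem⟩), hzA, ?_⟩
  intro U v C h hA
  obtain ⟨U', hU, hUA, hCU⟩ : ∃ U' : Y.left.Opens, U' ≤ U ∧ U' ≤ A ∧ C ≤ j.left ⁻¹ᵁ U' :=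
    ⟨U ⊓ A, inf_le_left, inf_le_right, le_inf h hA⟩
  have ha' := ha.restrict hUA
  obtain ⟨a, b, hab⟩ := ha'.exists_sum (res_mem _ hU v.2)
  have hbig : ∀ {U : Y.left.Opens} (h : C ≤ j.left ⁻¹ᵁ U) (x : sec u.big U) (i),
      B.baseChange _ (S.wR _ i) (pull V j U C h x.1) = 0 := by
    intro U h x i
    rw [S.form_wR_pull]
    exact hc.appLE_eq_zero S hW (𝟙 Y') (Category.id_comp j) _ x.2 i
  rw [S.form_tR_qR (hbig h v) (hbig hA ⟨y, hy⟩), sheafRes_con, con_smul, ← hc.con_res S hW h i hU hCU]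
  have h1 : (⟨res V Y hU v.1, res_mem _ hU v.2⟩ : sec u.big U') =
      ∑ t, a t • ⟨res V Y hUA (x t), u.le _ (ha'.small.mem t)⟩ + b • ⟨res V Y hUA l, ha'.mem⟩ := by
    refine Subtype.ext ?_
    rw [Submodule.coe_add, Submodule.coe_sum]
    exact hab
  have h2 : hc.con S hW i hCU (∑ t, a t • ⟨res V Y hUA (x t), u.le _ (ha'.small.mem t)⟩) = 0 := by
    refine hc.con_eq_zero S hW hCU i hnd hr _ ?_
    rw [Submodule.coe_sum]
    exact Submodule.sum_mem _ fun t _ => Submodule.smul_mem _ _ (ha'.small.mem t)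
  rw [h1, con_add, h2, zero_add, con_smul, hc.con_res S hW hA i hUA hCU ⟨l, ha.mem⟩, smul_smul]
  congr 1
  have h3 : B.baseChange _ (res V Y hU v.1) (frobM (res V Y hUA y)) =
      b * B.baseChange _ (res V Y hUA l) (frobM (res V Y hUA y)) := by
    rw [hab, map_add, LinearMap.add_apply, map_sum, LinearMap.sum_apply, Finset.sum_eq_zero, zero_add,
      map_smul, LinearMap.smul_apply, smul_eq_mul]
    intro t _
    rw [map_smul, LinearMap.smul_apply,
      hc.moduli.frob trivial U' _ (ha'.small.mem t) _ (res_mem _ hUA hy), smul_zero]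
  have h4 := congrArg (j.left.appLE U' C hCU) h3
  rw [map_mul, ← form_pull, ← form_pull, pull_frobM, pull_res, pull_res, pull_res, ← pull_frobM,
    form_pull j hA l] at h4
  rw [← pull_frobM, h4, mul_assoc, ← map_mul, hc', map_one, mul_one]

end QuotientToConormal

end
end OrthDL

namespace OrthDL
noncomputable section
variable {p : ℕ} [Fact p.Prime]

/-! ### The conormal sheaf as a sum of copies of the universal quotient -/

section Decomposition

theorem sheafRes_smul_of_eq {X : Scheme.{0}} {G : X.Modules} {U U' : X.Opens} (h : U' ≤ U)
    (r : Γ(X, U)) {x : Γ(G, U)} {b : Γ(X, U')} {e : Γ(G, U')} (hx : sheafRes G h x = b • e) :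
    sheafRes G h (r • x) = (ringRes X h r * b) • e := by
  rw [sheafRes_smul, hx, smul_smul]

/-- A section of a submodule, as a section of the ambient module. -/
def secVal {M : Type} [AddCommGroup M] [Module (ZMod p) M] {X : Sch p} (L : SubModule M X)
    (U : X.left.Opens) :
    L.toPresheafOfModules.presheaf.obj (op U) →ₗ[Γ(X.left, U)] Γ(X.left, U) ⊗[ZMod p] M :=
  (sec L U).subtype

theorem secVal_res {M : Type} [AddCommGroup M] [Module (ZMod p) M] {X : Sch p} (L : SubModule M X)
    {U U' : X.left.Opens} (h : U' ≤ U) (a : L.toPresheafOfModules.presheaf.obj (op U)) :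
    secVal L U' (presheafRes _ h a) = res M X h (secVal L U a) := rfl

theorem secVal_mem {M : Type} [AddCommGroup M] [Module (ZMod p) M] {X : Sch p} (L : SubModule M X)
    {U : X.left.Opens} (a : L.toPresheafOfModules.presheaf.obj (op U)) :
    secVal L U a ∈ sec L U := a.2

variable {V : Type} [AddCommGroup V] [Module (ZMod p) V] [FiniteDimensional (ZMod p) V]
variable {B : LinearMap.BilinForm (ZMod p) V} {W : Submodule (ZMod p) V} {X Y Y' T : Sch p} {d : ℕ}

local notation "n" => Module.finrank (ZMod p) W

variable {hB : B.IsSymm} {u : Flag V Y} {u' : Flag (OrthQuot B W) Y'} {j : Y' ⟶ Y}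
  (S : Splitting B W) (hW : W ≤ B.orthogonal W) (hc : IsCycle hB d u u' j)
  (i : Fin (Module.finrank (ZMod p) W))

theorem form_smul_left {R : Type} [CommRing R] [Algebra (ZMod p) R] (r : R) (x y : R ⊗[ZMod p] V) :
    B.baseChange R (r • x) y = r * B.baseChange R x y := by
  rw [map_smul, LinearMap.smul_apply, smul_eq_mul]

/-- The generators of the graph of the map from `L_{d+1}` to the conormal sheaf. -/
def IsCycle.conGraph (C : Y'.left.Opens) :
    Set (u'.big.toPresheafOfModules.presheaf.obj (op C) × Γ(conormalSheaf j.left, C)) :=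
  {a | ∃ (U : Y.left.Opens) (h : C ≤ j.left ⁻¹ᵁ U) (x : sec u.big U),
    secVal u'.big C a.1 = S.qR _ (pull V j U C h x.1) ∧ a.2 = hc.con S hW i h x}

/-- By `IsCycle.exists_con_eq` the second component is locally a fixed section times the product of
a lift of the first with some `Frob y`. That product is linear in the first component and vanishes
on `L_d`. -/
theorem IsCycle.eq_zero_of_mem_span_conGraph (hnd : B.Nondegenerate) (hns : IsNonsplit B)
    (hr : Module.finrank (ZMod p) V = 2 * (n + d + 1)) {D : Y'.left.Opens}
    {a : u'.big.toPresheafOfModules.presheaf.obj (op D) × Γ(conormalSheaf j.left, D)}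
    (ha : a ∈ Submodule.span Γ(Y'.left, D) (hc.conGraph S hW i D))
    (h0 : secVal u'.big D a.1 ∈ sec u'.small D) : a.2 = 0 := by
  refine eq_of_sheafRes_eq fun z hz => ?_
  obtain ⟨A, y, e, hzA, key⟩ := hc.exists_con_eq S hW i hnd hns hr z
  obtain ⟨C, hCD, hCA, hzC⟩ : ∃ C : Y'.left.Opens, C ≤ D ∧ C ≤ j.left ⁻¹ᵁ A ∧ z ∈ C :=
    ⟨D ⊓ j.left ⁻¹ᵁ A, inf_le_left, inf_le_right, hz, hzA⟩
  refine ⟨C, hCD, hzC, ?_⟩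
  have h1 : sheafRes _ hCD a.2 = B.baseChange _ (S.tR _ (res _ Y' hCD (secVal u'.big D a.1)))
      (frobM (pull V j A C hCA y.1)) • sheafRes _ hCA e := by
    clear h0
    induction ha using Submodule.span_induction with
    | mem a ha =>
      obtain ⟨U, h, x, h1, h2⟩ := ha
      rw [h1, h2, sheafRes_con, key U x C (hCD.trans h) hCA, res_qR, res_pull]
    | zero =>
      refine (map_zero (sheafRes _ hCD)).trans ?_
      have : secVal u'.big D 0 = 0 := map_zero _
      rw [Prod.fst_zero, this, map_zero, map_zero, map_zero, LinearMap.zero_apply, zero_smul]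
    | add a b _ _ ha hb =>
      refine (map_add (sheafRes _ hCD) a.2 b.2).trans ?_
      have : secVal u'.big D (a.1 + b.1) = secVal u'.big D a.1 + secVal u'.big D b.1 :=
        (secVal u'.big D).map_add a.1 b.1
      rw [Prod.fst_add, this, ha, hb, map_add, map_add, map_add, LinearMap.add_apply, add_smul]
    | smul r a _ ha =>
      refine (sheafRes_smul_of_eq hCD r ha).trans (congrArg (· • sheafRes _ hCA e) ?_)
      have : secVal u'.big D (r • a.1) = r • secVal u'.big D a.1 :=
        (secVal u'.big D).map_smul r a.1
      rw [Prod.smul_fst, this, res_smul, (S.tR _).map_smul]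
      exact (form_smul_left (ringRes Y'.left hCD r) _ _).symm
  have h2 : S.tR _ (res _ Y' hCD (secVal u'.big D a.1)) ∈ sec (u.pullback j).small C := by
    rw [hc.pull_eq]
    exact tR_mem_inverseImage S (res_mem _ hCD h0)
  rw [h1, (hc.moduli.pullback j).frob trivial C _ h2 _ (mem_pullbackSub j hCA y.2), zero_smul, map_zero]

theorem IsCycle.exists_mem_span_conGraph {C : Y'.left.Opens}
    {q : Γ(Y'.left, C) ⊗[ZMod p] OrthQuot B W} (hq : q ∈ Submodule.span Γ(Y'.left, C)
      {q | ∃ (U : Y.left.Opens) (h : C ≤ j.left ⁻¹ᵁ U) (x : sec u.big U),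
        S.qR _ (pull V j U C h x.1) = q}) :
    ∃ a ∈ Submodule.span Γ(Y'.left, C) (hc.conGraph S hW i C), secVal u'.big C a.1 = q := by
  induction hq using Submodule.span_induction with
  | mem q hq =>
    obtain ⟨U, h, x, rfl⟩ := hq
    exact ⟨(⟨_, hc.qR_pull_mem S h x.2⟩, hc.con S hW i h x), Submodule.subset_span ⟨U, h, x, rfl, rfl⟩,
      rfl⟩
  | zero => exact ⟨0, Submodule.zero_mem _, map_zero _⟩
  | add q r _ _ hq hr =>
    obtain ⟨a, ha, rfl⟩ := hq
    obtain ⟨b, hb, rfl⟩ := hr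
    exact ⟨a + b, Submodule.add_mem _ ha hb, map_add _ _ _⟩
  | smul c q _ hq =>
    obtain ⟨a, ha, rfl⟩ := hq
    exact ⟨c • a, Submodule.smul_mem _ _ ha, map_smul _ _ _⟩

/-- The inclusion of the `i`-th copy of the universal quotient: the class of `x` goes to that of
`B(w_i, x)`. It is first defined on `L_{d+1}` by generators and then shown to kill `L_d`. -/
theorem IsCycle.exists_incl (hnd : B.Nondegenerate) (hns : IsNonsplit B)
    (hr : Module.finrank (ZMod p) V = 2 * (n + d + 1)) :
    ∃ χ : u'.quotient ⟶ conormalSheaf j.left, ∀ (U : Y.left.Opens) (C : Y'.left.Opens)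
      (h : C ≤ j.left ⁻¹ᵁ U) (x : sec u.big U), χ.app _ (hc.red S h x) = hc.con S hW i h x := by
  have htot : ∀ (D : Y'.left.Opens) (m : u'.big.toPresheafOfModules.presheaf.obj (op D)), ∀ s ∈ D,
      ∃ (C : Y'.left.Opens) (h : C ≤ D), s ∈ C ∧
      ∃ g, (presheafRes _ h m, g) ∈ Submodule.span Γ(Y'.left, C) (hc.conGraph S hW i C) := by
    intro D m s hs
    obtain ⟨C, hC, hsC, h⟩ := hc.exists_mem_span_qR_pull S (secVal_mem _ m) hs
    obtain ⟨a, ha, h1⟩ := hc.exists_mem_span_conGraph S hW i h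
    refine ⟨C, hC, hsC, a.2, ?_⟩
    have h2 : a.1 = presheafRes _ hC m := Subtype.ext h1
    rw [← h2]
    exact ha
  obtain ⟨f, hf⟩ := exists_hom_of_generators (P := u'.big.toPresheafOfModules)
    (G := conormalSheaf j.left) (hc.conGraph S hW i) (by
      rintro C C' hC ⟨a, g⟩ ⟨U, h, x, h1, h2⟩
      refine ⟨U, hC.trans h, x, ?_, ?_⟩
      · rw [secVal_res]
        refine (congrArg _ h1).trans ?_
        rw [res_qR, res_pull]
      · exact (congrArg (sheafRes _ hC) h2).trans (hc.sheafRes_con S hW h i hC x))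
    (fun D g hg => hc.eq_zero_of_mem_span_conGraph S hW i hnd hns hr hg (by
      have : secVal u'.big D 0 = 0 := map_zero _
      rw [this]
      exact Submodule.zero_mem _)) htot
  have hf' : ∀ (C : Y'.left.Opens), ∀ a ∈ Submodule.span Γ(Y'.left, C) (hc.conGraph S hW i C),
      homApp f C a.1 = a.2 := by
    intro C a ha
    induction ha using Submodule.span_induction with
    | mem a ha => exact hf C a ha
    | zero => exact map_zero _
    | add a b _ _ ha hb => exact (map_add (homApp f C) a.1 b.1).trans (congrArg₂ (· + ·) ha hb)
    | smul r a _ ha => exact (map_smul (homApp f C) r a.1).trans (congrArg (r • ·) ha)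
  obtain ⟨χ, hχ⟩ := u'.exists_desc f (by
    intro D m hm
    refine eq_of_sheafRes_eq fun s hs => ?_
    obtain ⟨C, hC, hsC, g, hg⟩ := htot D ⟨m, u'.le _ hm⟩ s hs
    refine ⟨C, hC, hsC, ?_⟩
    rw [map_zero]
    refine (homApp_res f hC _).symm.trans ?_
    refine (hf' C _ hg).trans (hc.eq_zero_of_mem_span_conGraph S hW i hnd hns hr hg ?_)
    exact res_mem _ hC hm)
  exact ⟨χ, fun U C h x => (hχ _ _ _).trans (hf C (⟨_, hc.qR_pull_mem S h x.2⟩, hc.con S hW i h x)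
    ⟨U, h, x, rfl, rfl⟩)⟩

/-- The conormal sheaf is a sum of `dim W` copies of the universal quotient. -/
theorem IsCycle.exists_decomposition (S : Splitting B W) (hW : W ≤ B.orthogonal W)
    (hc : IsCycle hB d u u' j) (hnd : B.Nondegenerate) (hns : IsNonsplit B)
    (hr : Module.finrank (ZMod p) V = 2 * (n + d + 1)) :
    ∃ (θ : Fin n → (conormalSheaf j.left ⟶ u'.quotient))
      (χ : Fin n → (u'.quotient ⟶ conormalSheaf j.left)),
      (∀ k i, χ k ≫ θ i = if k = i then 𝟙 _ else 0) ∧ ∑ i, θ i ≫ χ i = 𝟙 _ := by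
  choose θ hθ using fun i => hc.exists_coord S hnd hns hW hr i
  choose χ hχ using fun i => hc.exists_incl S hW i hnd hns hr
  have hθ' : ∀ (i k : Fin n) (U : Y.left.Opens) (C : Y'.left.Opens) (h : C ≤ j.left ⁻¹ᵁ U)
      (x : sec u.big U), (θ i).app C (hc.con S hW k h x) = if k = i then hc.red S h x else 0 := by
    intro i k U C h x
    rw [con, app_sheafRes, hθ]
    split_ifs
    · rw [hc.sheafRes_red S _ le_rfl h h x]
      congr 1
      exact Subtype.ext (res_refl _ _)
    · exact map_zero _
  refine ⟨θ, χ, fun k i => ?_, ?_⟩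
  · refine hc.quotient_hom_ext S fun U C h x => ?_
    refine (congrArg ((θ i).app C) (hχ k U C h x)).trans ((hθ' i k U C h x).trans ?_)
    split_ifs <;> rfl
  · refine hc.conormal_hom_ext S hW hnd hns hr fun U i x => ?_
    rw [sum_app, Finset.sum_eq_single i]
    · refine (congrArg ((χ i).app _) (hθ' i i U _ _ x)).trans ?_
      rw [if_pos rfl, hχ]
      rfl
    · intro k _ hk
      refine (congrArg ((χ k).app _) (hθ' k i U _ _ x)).trans ?_
      rw [if_neg (Ne.symm hk), map_zero]
    · exact fun h => (h (Finset.mem_univ i)).elim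

end Decomposition

end
end OrthDL

namespace OrthDL
noncomputable section
variable {p : ℕ} [Fact p.Prime]

/-! ### Local freeness -/

section LocallyFree

/-! ### Morphisms from the structure sheaf and restriction to open subschemes -/

section General

variable {X : Scheme.{0}} {G : X.Modules}

/-- A morphism given by compatible linear maps on sections. -/
def homOfLinearMaps {P : X.PresheafOfModules}
    (f : ∀ U : X.Opens, P.presheaf.obj (op U) →ₗ[Γ(X, U)] Γ(G, U))
    (hf : ∀ (U V : X.Opens) (h : V ≤ U) (x : P.presheaf.obj (op U)),
      f V (presheafRes P h x) = sheafRes G h (f U x)) : P ⟶ G.val where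
  app U := ModuleCat.ofHom (f U.unop)
  naturality i := by
    ext x
    exact hf _ _ (leOfHom i.unop) x

/-- The morphism `𝒪_X ⟶ G` that corresponds to a global section. -/
def unitHom (s : Γ(G, ⊤)) : structureSheaf X ⟶ G :=
  ⟨homOfLinearMaps (P := (structureSheaf X).val)
    (fun U => LinearMap.toSpanSingleton Γ(X, U) Γ(G, U) (sheafRes G le_top s))
    (fun U V h (x : Γ(X, U)) => by
      refine Eq.trans ?_ (sheafRes_smul h (show Γ(X, U) from x) (sheafRes G le_top s)).symm
      rw [sheafRes_trans]
      rfl)⟩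

theorem unitHom_app (s : Γ(G, ⊤)) (U : X.Opens) (r : Γ(X, U)) :
    (unitHom s).app U r = r • sheafRes G le_top s := rfl

/-- The unit section of the structure sheaf. -/
def unitOne (X : Scheme.{0}) (U : X.Opens) : Γ(structureSheaf X, U) := (1 : Γ(X, U))

theorem sheafRes_unitOne {U V : X.Opens} (h : V ≤ U) :
    sheafRes (structureSheaf X) h (unitOne X U) = unitOne X V := map_one (ringRes X h)

theorem smul_unitOne {U : X.Opens} (r : Γ(X, U)) : r • unitOne X U = r := mul_one r

theorem unit_hom_ext {f g : structureSheaf X ⟶ G}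
    (h : ∀ U : X.Opens, f.app U (unitOne X U) = g.app U (unitOne X U)) : f = g := by
  ext U x
  let r : Γ(X, U) := x
  have key : ∀ k : structureSheaf X ⟶ G, k.app U x = r • k.app U (unitOne X U) := by
    intro k
    rw [← Scheme.Modules.Hom.app_smul]
    exact congrArg _ (smul_unitOne r).symm
  rw [key f, key g, h U]

theorem sheafRes_restrict (A : X.Opens) {U V : (A : Scheme.{0}).Opens} (h : V ≤ U)
    (x : Γ(G.restrict A.ι, U)) : sheafRes (G.restrict A.ι) h x =
      sheafRes (U := A.ι ''ᵁ U) (V := A.ι ''ᵁ V) G (A.ι.image_mono h) x := rfl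

theorem sheafRes_restrict_trans (A : X.Opens) {U : X.Opens} {C D : (A : Scheme.{0}).Opens}
    (h : D ≤ C) (hC : A.ι ''ᵁ C ≤ U) (hD : A.ι ''ᵁ D ≤ U) (x : Γ(G, U)) :
    sheafRes (G.restrict A.ι) h (show Γ(G.restrict A.ι, C) from sheafRes G hC x) =
      (show Γ(G.restrict A.ι, D) from sheafRes G hD x) := by
  rw [sheafRes_restrict]
  exact sheafRes_trans _ _ _

theorem smul_restrict (A : X.Opens) {U : (A : Scheme.{0}).Opens} (r : Γ(X, A.ι ''ᵁ U))
    (x : Γ(G, A.ι ''ᵁ U)) : (r • x : Γ(G, A.ι ''ᵁ U)) =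
      ((A.ι.appIso U).hom r • (show Γ(G.restrict A.ι, U) from x) : Γ(G.restrict A.ι, U)) := by
  have h : (A.ι.appIso U).inv ((A.ι.appIso U).hom r) = r :=
    ConcreteCategory.congr_hom (A.ι.appIso U).hom_inv_id r
  change r • x = (A.ι.appIso U).inv ((A.ι.appIso U).hom r) • x
  rw [h]

end General

variable {M : Type} [AddCommGroup M] [Module (ZMod p) M] {X : Sch p}

theorem Flag.quot_eq_smul (F : Flag M X) {U : X.left.Opens} {x y z : Γ(X.left, U) ⊗[ZMod p] M}
    {b : Γ(X.left, U)} (hx : x ∈ sec F.big U) (hz : z ∈ sec F.big U) (hy : y ∈ sec F.small U)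
    (h : x = y + b • z) : F.quot x hx = b • F.quot z hz := by
  subst h
  rw [F.quot_add (F.le _ hy) (Submodule.smul_mem _ b hz), F.quot_eq_zero hy, zero_add, F.quot_smul]

/-- The section `s` generates `L_{d+1}` modulo `L_d` over `A`, and `f` is a functional that kills
`L_d` and takes the value one at `s`. The morphisms induced by `f` and by the class of `s` are
mutually inverse. -/
theorem Flag.nonempty_quotient_restrict_iso (F : Flag M X) (A : X.left.Opens)
    (f : F.big.toPresheafOfModules ⟶
      ((Scheme.Modules.pushforward A.ι).obj (structureSheaf (A : Scheme.{0}))).val)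
    (hf : ∀ (U : X.left.Opens) (x : Γ(X.left, U) ⊗[ZMod p] M) (hx : x ∈ sec F.small U),
      homApp f U ⟨x, F.le _ hx⟩ = 0)
    (s : Γ(X.left, A) ⊗[ZMod p] M) (hs : s ∈ sec F.big A)
    (h1 : homApp f A ⟨s, hs⟩ = unitOne (A : Scheme.{0}) (A.ι ⁻¹ᵁ A))
    (h2 : ∀ (E : X.left.Opens) (hE : E ≤ A), ∀ x ∈ sec F.big E, ∃ b : Γ(X.left, E),
      ∃ y ∈ sec F.small E, x = y + b • res M X hE s) :
    Nonempty (F.quotient.restrict A.ι ≅ structureSheaf (A : Scheme.{0})) := by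
  obtain ⟨q, hq⟩ := F.exists_desc f hf
  obtain ⟨k, hk⟩ := exists_unit_comp_eq (Scheme.Modules.restrictAdjunction A.ι) q
  have hk' : ∀ (U : X.left.Opens) (x : Γ(F.quotient, U)),
      k.app (A.ι ⁻¹ᵁ U) (sheafRes F.quotient (A.ι.image_preimage_le U) x) = q.app U x := fun U x =>
    congrArg (fun g : F.quotient ⟶ (Scheme.Modules.pushforward A.ι).obj
      (structureSheaf (A : Scheme.{0})) => g.app U x) hk
  have hA : A.ι ''ᵁ ⊤ ≤ A := by simp
  let t : Γ(F.quotient.restrict A.ι, ⊤) := sheafRes F.quotient hA (F.quot s hs)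
  have hE : ∀ D : (A : Scheme.{0}).Opens, A.ι ''ᵁ D ≤ A := fun D => (A.ι.image_mono le_top).trans hA
  have ht : ∀ D : (A : Scheme.{0}).Opens, sheafRes (F.quotient.restrict A.ι) (le_top : D ≤ ⊤) t =
      sheafRes F.quotient (hE D) (F.quot s hs) := fun D =>
    sheafRes_restrict_trans A le_top hA (hE D) (F.quot s hs)
  have hkt : ∀ D : (A : Scheme.{0}).Opens,
      k.app D (sheafRes (F.quotient.restrict A.ι) (le_top : D ≤ ⊤) t) = unitOne (A : Scheme.{0}) D := by
    intro D
    have h3 := hk' A (F.quot s hs)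
    rw [hq, h1] at h3
    have hD : D ≤ A.ι ⁻¹ᵁ A := fun x _ => x.2
    have h4 := (app_sheafRes k hD (sheafRes F.quotient (A.ι.image_preimage_le A) (F.quot s hs))).trans
      (congrArg (sheafRes (structureSheaf (A : Scheme.{0})) hD) h3)
    rw [ht D]
    refine Eq.trans (congrArg (k.app D) ?_) (h4.trans (sheafRes_unitOne hD))
    exact (sheafRes_restrict_trans A hD _ _ (F.quot s hs)).symm
  refine ⟨⟨k, unitHom t, ?_, ?_⟩⟩
  · refine hom_ext_of_unit_comp (Scheme.Modules.restrictAdjunction A.ι) (F.quotient_hom_ext ?_)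
    intro U x hx
    let D := A.ι ⁻¹ᵁ U
    have hDU : A.ι ''ᵁ D ≤ U := A.ι.image_preimage_le U
    obtain ⟨b, y, hy, hb⟩ := h2 _ (hE D) _ (res_mem F.big hDU hx)
    have h5 : sheafRes F.quotient hDU (F.quot x hx) =
        b • sheafRes F.quotient (hE D) (F.quot s hs) := by
      rw [F.sheafRes_quot, F.sheafRes_quot]
      exact F.quot_eq_smul _ _ hy hb
    have h7 : sheafRes F.quotient hDU (F.quot x hx) =
        (A.ι.appIso D).hom b • sheafRes (F.quotient.restrict A.ι) (le_top : D ≤ ⊤) t := by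
      rw [h5, ht D]
      exact smul_restrict A b _
    change (unitHom t).app D (k.app D (sheafRes F.quotient hDU (F.quot x hx))) =
      sheafRes F.quotient hDU (F.quot x hx)
    rw [h7]
    refine (congrArg ((unitHom t).app D) ((Scheme.Modules.Hom.app_smul k _ _).trans
      (congrArg ((A.ι.appIso D).hom b • ·) (hkt D)))).trans ?_
    exact (unitHom_app t D _).trans (congrArg (· • _) (smul_unitOne _))
  · refine unit_hom_ext fun D => ?_
    refine Eq.trans (congrArg (k.app D) ?_) (hkt D)
    exact (unitHom_app t D (1 : Γ((A : Scheme.{0}), D))).trans (one_smul _ _)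

/-- The quotient of the members of a pair in `𝒴_V` is an invertible sheaf. -/
theorem IsModuli.exists_quotient_restrict_iso [FiniteDimensional (ZMod p) M]
    {B : LinearMap.BilinForm (ZMod p) M} {d : ℕ} (hB : B.IsSymm) (hnd : B.Nondegenerate)
    (hns : IsNonsplit B) (hr : Module.finrank (ZMod p) M = 2 * (d + 1)) {F : Flag M X}
    (hF : IsModuli B d (d + 1) True X F) (s : X.left) : ∃ A : X.left.Opens, s ∈ A ∧
      Nonempty (F.quotient.restrict A.ι ≅ structureSheaf (A : Scheme.{0})) := by
  obtain ⟨A, σ, x, l, y, hsA, ha, hy, hu, -⟩ := hF.exists_transversal hB hnd hns hr s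
  obtain ⟨c, hc⟩ := hu.exists_right_inv
  refine ⟨A, hsA, ?_⟩
  let ι := openSubι X A
  have hA : ∀ U : X.left.Opens, ι.left ⁻¹ᵁ U ≤ ι.left ⁻¹ᵁ A := fun U t _ => t.2
  -- Scaled so that `B(l, m) = 1`; pairing with `m` kills `L_d` and trivializes the quotient.
  let m : Γ(X.left, A) ⊗[ZMod p] M := c • frobM y
  let f : ∀ U : X.left.Opens, F.big.toPresheafOfModules.presheaf.obj (op U) →ₗ[Γ(X.left, U)]
      Γ((Scheme.Modules.pushforward A.ι).obj (structureSheaf (A : Scheme.{0})), U) := fun U =>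
    { toFun := fun x => show Γ((openSub X A).left, ι.left ⁻¹ᵁ U) from
        B.baseChange _ (pull M ι U (ι.left ⁻¹ᵁ U) le_rfl (secVal F.big U x)) (pull M ι A _ (hA U) m)
      map_add' := fun x x' => by
        have : secVal F.big U (x + x') = secVal F.big U x + secVal F.big U x' :=
          (secVal F.big U).map_add x x'
        rw [this, map_add, map_add, LinearMap.add_apply]
        rfl
      map_smul' := fun r x => by
        have : secVal F.big U (r • x) = r • secVal F.big U x := (secVal F.big U).map_smul r x
        rw [this, pull, changeScalars_smul, form_smul_left, ← Scheme.Hom.app_eq_appLE]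
        rfl }
  refine F.nonempty_quotient_restrict_iso A (homOfLinearMaps f fun U U' h x => ?_) ?_ l ha.mem ?_ ?_
  · change B.baseChange _ (pull M ι U' (ι.left ⁻¹ᵁ U') le_rfl (res M X h (secVal F.big U x)))
      (pull M ι A _ (hA U') m) = ringRes (openSub X A).left (fun _ ht => h ht)
        (B.baseChange _ (pull M ι U (ι.left ⁻¹ᵁ U) le_rfl (secVal F.big U x)) (pull M ι A _ (hA U) m))
    have h' : ι.left ⁻¹ᵁ U' ≤ ι.left ⁻¹ᵁ U := fun _ ht => h ht
    refine Eq.trans ?_ (changeScalars_form (ringRes (openSub X A).left h') B _ _)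
    refine congrArg₂ (fun a b => B.baseChange _ a b) ?_ (res_pull ι (hA U) h' m).symm
    exact (pull_res ι le_rfl h _).trans (res_pull ι le_rfl h' _).symm
  · intro U x hx
    change B.baseChange _ (pull M ι U (ι.left ⁻¹ᵁ U) le_rfl x) (pull M ι A _ (hA U) (c • frobM y)) = 0
    rw [pull, pull, changeScalars_smul, map_smul, pull_frobM,
      (hF.pullback ι).frob trivial _ _ (mem_pullbackSub ι le_rfl hx) _ (mem_pullbackSub ι (hA U) hy),
      smul_zero]
  · change B.baseChange _ (pull M ι A (ι.left ⁻¹ᵁ A) le_rfl l) (pull M ι A _ (hA A) (c • frobM y)) =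
      (1 : Γ((openSub X A).left, ι.left ⁻¹ᵁ A))
    rw [form_pull, map_smul, smul_eq_mul, mul_comm, hc, map_one]
  · intro E hE x hx
    have ha' := ha.restrict hE
    obtain ⟨a, b, h⟩ := ha'.exists_sum hx
    exact ⟨b, _, Submodule.sum_mem _ fun t _ => Submodule.smul_mem _ (a t) (ha'.small.mem t), h⟩

theorem nonempty_iso_of_decomposition {C : Type*} [Category C] [Preadditive C] {r : ℕ} {N O : C}
    {c : Limits.Cofan fun _ : Fin r => O} (hc : Limits.IsColimit c) (θ : Fin r → (N ⟶ O))
    (χ : Fin r → (O ⟶ N)) (h1 : ∀ k i, χ k ≫ θ i = if k = i then 𝟙 _ else 0)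
    (h2 : ∑ i, θ i ≫ χ i = 𝟙 _) : Nonempty (N ≅ c.pt) := by
  refine ⟨⟨∑ i, θ i ≫ c.inj i, Limits.Cofan.IsColimit.desc hc χ, ?_, ?_⟩⟩
  · rw [Preadditive.sum_comp, ← h2]
    refine Finset.sum_congr rfl fun i _ => ?_
    rw [Category.assoc, Limits.Cofan.IsColimit.fac]
  · refine Limits.Cofan.IsColimit.hom_ext hc _ _ fun k => ?_
    rw [← Category.assoc, Limits.Cofan.IsColimit.fac, Preadditive.comp_sum, Finset.sum_eq_single k]
    · rw [← Category.assoc, h1, if_pos rfl, Category.id_comp, Category.comp_id]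
    · intro i _ hi
      rw [← Category.assoc, h1, if_neg (Ne.symm hi), Limits.zero_comp]
    · exact fun h => (h (Finset.mem_univ k)).elim

theorem map_decomposition {C D : Type*} [Category C] [Preadditive C] [Category D] [Preadditive D]
    (R : C ⥤ D) [R.Additive] {r : ℕ} {N Q : C} {O : D} (e : R.obj Q ≅ O) (θ : Fin r → (N ⟶ Q))
    (χ : Fin r → (Q ⟶ N)) (h1 : ∀ k i, χ k ≫ θ i = if k = i then 𝟙 _ else 0)
    (h2 : ∑ i, θ i ≫ χ i = 𝟙 _) :
    (∀ k i, (e.inv ≫ R.map (χ k)) ≫ R.map (θ i) ≫ e.hom = if k = i then 𝟙 O else 0) ∧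
      ∑ i, (R.map (θ i) ≫ e.hom) ≫ e.inv ≫ R.map (χ i) = 𝟙 (R.obj N) := by
  refine ⟨fun k i => ?_, ?_⟩
  · rw [Category.assoc, ← Category.assoc (R.map _), ← R.map_comp, h1]
    split_ifs
    · rw [R.map_id, Category.id_comp, e.inv_hom_id]
    · rw [R.map_zero, Limits.zero_comp, Limits.comp_zero]
  · simp only [Category.assoc, e.hom_inv_id_assoc, ← R.map_comp]
    rw [← R.map_sum, h2, R.map_id]

theorem isLocallyFreeOfRank_of_decomposition {X : Scheme.{0}} {r : ℕ} {N Q : X.Modules}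
    (hQ : ∀ s : X, ∃ A : X.Opens, s ∈ A ∧
      Nonempty (Q.restrict A.ι ≅ structureSheaf (A : Scheme.{0})))
    (θ : Fin r → (N ⟶ Q)) (χ : Fin r → (Q ⟶ N))
    (h1 : ∀ k i, χ k ≫ θ i = if k = i then 𝟙 _ else 0) (h2 : ∑ i, θ i ≫ χ i = 𝟙 _) :
    IsLocallyFreeOfRank N r := by
  intro s
  obtain ⟨A, hs, ⟨e⟩⟩ := hQ s
  refine ⟨A, hs, ?_⟩
  have hR : (Scheme.Modules.restrictFunctor A.ι).Additive := ⟨rfl⟩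
  obtain ⟨h3, h4⟩ := map_decomposition (Scheme.Modules.restrictFunctor A.ι) e θ χ h1 h2
  let c : Limits.Cofan (C := (A : Scheme.{0}).Modules)
      fun _ : Fin r => structureSheaf (A : Scheme.{0}) :=
    @Limits.Cofan.mk (Fin r) (A : Scheme.{0}).Modules _ _
      (SheafOfModules.free (R := (A : Scheme.{0}).ringCatSheaf) (Fin r))
      fun i => (SheafOfModules.freeCofan (R := (A : Scheme.{0}).ringCatSheaf) (Fin r)).inj i
  have hc : Limits.IsColimit c :=
    SheafOfModules.isColimitFreeCofan (R := (A : Scheme.{0}).ringCatSheaf) (Fin r)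
  obtain ⟨k⟩ := nonempty_iso_of_decomposition hc _ _ h3 h4
  exact ⟨k⟩

end LocallyFree

end
end OrthDL

namespace OrthDL
noncomputable section
variable {p : ℕ} [Fact p.Prime]

/-! ### The normal bundle -/

section NormalBundle

/-! ### Functoriality of the sheaf of homomorphisms -/

section General

variable {X : Scheme.{0}} {F F' F'' G G' G'' : X.Modules}

/-- The linear map on sections over `U` that a morphism of sheaves of modules induces. -/
def appLinear (f : F ⟶ G) (U : X.Opens) : Γ(F, U) →ₗ[Γ(X, U)] Γ(G, U) where
  toFun := f.app U
  map_add' := map_add _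
  map_smul' := f.app_smul

/-- The action of morphisms on the sheaf of homomorphisms. -/
def sheafHomMap (f : F' ⟶ F) (g : G ⟶ G') : sheafHom F G ⟶ sheafHom F' G' :=
  ⟨homOfLinearMaps (P := (sheafHom F G).val) (G := sheafHom F' G') (fun U =>
    { toFun := fun φ => show HomSections F' G' U from
        ⟨fun W => appLinear g W.1 ∘ₗ (show HomSections F G U from φ).1 W ∘ₗ appLinear f W.1,
        fun W W' h x => by
          have h1 : f.app W'.1 (sheafRes F' h x) = sheafRes F h (f.app W.1 x) := app_sheafRes f h x
          have h2 := (show HomSections F G U from φ).2 W W' h (f.app W.1 x)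
          exact (congrArg (fun t => g.app W'.1 ((show HomSections F G U from φ).1 W' t)) h1).trans
            ((congrArg (g.app W'.1) h2).trans (app_sheafRes g h _))⟩
      map_add' := fun φ ψ => by
        refine Subtype.ext (funext fun W => LinearMap.ext fun x => ?_)
        exact map_add (appLinear g W.1) _ _
      map_smul' := fun r φ => by
        refine Subtype.ext (funext fun W => LinearMap.ext fun x => ?_)
        exact map_smul (appLinear g W.1) _ _ })
    fun _ _ _ _ => rfl⟩

theorem sheafHom_hom_ext {f g : sheafHom F G ⟶ sheafHom F' G'}
    (h : ∀ (U : X.Opens) (φ : HomSections F G U) (W : {W : X.Opens // W ≤ U}) (x : Γ(F', W.1)),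
      (show HomSections F' G' U from f.app U φ).1 W x =
        (show HomSections F' G' U from g.app U φ).1 W x) : f = g := by
  ext U φ
  exact Subtype.ext (funext fun W => LinearMap.ext fun x => h U φ W x)

theorem sheafHomMap_id : sheafHomMap (𝟙 F) (𝟙 G) = 𝟙 (sheafHom F G) := rfl

theorem sheafHomMap_comp (f : F' ⟶ F) (g : G ⟶ G') (f' : F'' ⟶ F') (g' : G' ⟶ G'') :
    sheafHomMap f g ≫ sheafHomMap f' g' = sheafHomMap (f' ≫ f) (g ≫ g') := rfl

theorem sheafHomMap_add_left (f f' : F' ⟶ F) (g : G ⟶ G') :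
    sheafHomMap (f + f') g = sheafHomMap f g + sheafHomMap f' g := by
  refine sheafHom_hom_ext fun U φ W x => ?_
  exact map_add (appLinear g W.1 ∘ₗ φ.1 W) (f.app W.1 x) (f'.app W.1 x)

theorem sheafHomMap_add_right (f : F' ⟶ F) (g g' : G ⟶ G') :
    sheafHomMap f (g + g') = sheafHomMap f g + sheafHomMap f g' := rfl

theorem sheafHomMap_sum_left {r : ℕ} (f : Fin r → (F' ⟶ F)) (g : G ⟶ G') :
    sheafHomMap (∑ i, f i) g = ∑ i, sheafHomMap (f i) g :=
  map_sum (AddMonoidHom.mk' (fun f => sheafHomMap f g) fun f f' => sheafHomMap_add_left f f' g) _ _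

theorem sheafHomMap_sum_right {r : ℕ} (f : F' ⟶ F) (g : Fin r → (G ⟶ G')) :
    sheafHomMap f (∑ i, g i) = ∑ i, sheafHomMap f (g i) :=
  map_sum (AddMonoidHom.mk' (fun g => sheafHomMap f g) (sheafHomMap_add_right f)) _ _

theorem sheafHomMap_zero_left (g : G ⟶ G') : sheafHomMap (0 : F' ⟶ F) g = 0 :=
  map_zero (AddMonoidHom.mk' (fun f => sheafHomMap f g) fun f f' => sheafHomMap_add_left f f' g)

theorem sheafHomMap_zero_right (f : F' ⟶ F) : sheafHomMap f (0 : G ⟶ G') = 0 :=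
  map_zero (AddMonoidHom.mk' (fun g => sheafHomMap f g) (sheafHomMap_add_right f))

/-- If `N` is a direct sum of `r` copies of `Q` and `C` is a direct sum of `r` copies of `O`, then
`Hom(N, O) ≅ Hom(Q, C)`. -/
theorem nonempty_sheafHom_iso {r : ℕ} {N Q O C : X.Modules} (θ : Fin r → (N ⟶ Q))
    (χ : Fin r → (Q ⟶ N)) (h1 : ∀ k i, χ k ≫ θ i = if k = i then 𝟙 _ else 0)
    (h2 : ∑ i, θ i ≫ χ i = 𝟙 _) (α : Fin r → (O ⟶ C)) (β : Fin r → (C ⟶ O))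
    (h3 : ∀ k i, α k ≫ β i = if k = i then 𝟙 _ else 0) (h4 : ∑ i, β i ≫ α i = 𝟙 _) :
    Nonempty (sheafHom N O ≅ sheafHom Q C) := by
  refine ⟨⟨∑ i, sheafHomMap (χ i) (α i), ∑ i, sheafHomMap (θ i) (β i), ?_, ?_⟩⟩
  · rw [Preadditive.sum_comp]
    have : ∀ k, sheafHomMap (χ k) (α k) ≫ ∑ i, sheafHomMap (θ i) (β i) =
        sheafHomMap (θ k ≫ χ k) (𝟙 _) := by
      intro k
      rw [Preadditive.comp_sum, Finset.sum_eq_single k]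
      · rw [sheafHomMap_comp, h3, if_pos rfl]
      · intro i _ hi
        rw [sheafHomMap_comp, h3, if_neg (Ne.symm hi), sheafHomMap_zero_right]
      · exact fun h => (h (Finset.mem_univ k)).elim
    rw [Finset.sum_congr rfl fun k _ => this k, ← sheafHomMap_sum_left, h2, sheafHomMap_id]
  · rw [Preadditive.sum_comp]
    have : ∀ k, sheafHomMap (θ k) (β k) ≫ ∑ i, sheafHomMap (χ i) (α i) =
        sheafHomMap (𝟙 _) (β k ≫ α k) := by
      intro k
      rw [Preadditive.comp_sum, Finset.sum_eq_single k]
      · rw [sheafHomMap_comp, h1, if_pos rfl]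
      · intro i _ hi
        rw [sheafHomMap_comp, h1, if_neg hi, sheafHomMap_zero_left]
      · exact fun h => (h (Finset.mem_univ k)).elim
    rw [Finset.sum_congr rfl fun k _ => this k, ← sheafHomMap_sum_right, h4, sheafHomMap_id]

end General

variable {M : Type} [AddCommGroup M] [Module (ZMod p) M] [FiniteDimensional (ZMod p) M] {X : Sch p}

/-- The `i`-th coordinate `M ⊗ 𝒪_X ⟶ 𝒪_X`, on the presheaf of modules `U ↦ Γ(X, U) ⊗ M`. -/
def presheafCoord (M : Type) [AddCommGroup M] [Module (ZMod p) M] [FiniteDimensional (ZMod p) M]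
    (X : Sch p) (i : Fin (Module.finrank (ZMod p) M)) :
    constModule M X ⟶ (structureSheaf X.left).val :=
  homOfLinearMaps (P := constModule M X) (G := structureSheaf X.left)
    (fun U => LinearMap.proj i ∘ₗ (coord : Γ(X.left, U) ⊗[ZMod p] M ≃ₗ[_] _).toLinearMap)
    fun _ _ h _ => coord_changeScalars (ringRes X.left h) _ _

/-- The section of `M ⊗ 𝒪_X` that an element of `Γ(X, U) ⊗ M` defines. -/
def toConst (M : Type) [AddCommGroup M] [Module (ZMod p) M] (X : Sch p) (U : X.left.Opens) :
    Γ(X.left, U) ⊗[ZMod p] M →ₗ[Γ(X.left, U)] Γ(constSheaf M X, U) :=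
  homApp (P := constModule M X) (G := constSheaf M X)
    ((sheafifyAdj X.left).unit.app (constModule M X)) U

theorem sheafRes_toConst {U U' : X.left.Opens} (h : U' ≤ U) (x : Γ(X.left, U) ⊗[ZMod p] M) :
    sheafRes (constSheaf M X) h (toConst M X U x) = toConst M X U' (res M X h x) :=
  (homApp_res (P := constModule M X) (G := constSheaf M X)
    ((sheafifyAdj X.left).unit.app (constModule M X)) h x).symm

theorem constSheaf_hom_ext {G : X.left.Modules} {f g : constSheaf M X ⟶ G}
    (h : ∀ (U : X.left.Opens) (x : Γ(X.left, U) ⊗[ZMod p] M),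
      f.app U (toConst M X U x) = g.app U (toConst M X U x)) : f = g := by
  refine hom_ext_of_unit_comp (sheafifyAdj X.left) ?_
  exact hom_ext_of_homApp (P := constModule M X) fun U x => h U x

theorem exists_constSheaf_coord (M : Type) [AddCommGroup M] [Module (ZMod p) M]
    [FiniteDimensional (ZMod p) M] (X : Sch p) (i : Fin (Module.finrank (ZMod p) M)) :
    ∃ β : constSheaf M X ⟶ structureSheaf X.left,
      ∀ (U : X.left.Opens) (x : Γ(X.left, U) ⊗[ZMod p] M),
        β.app U (toConst M X U x) = (show Γ(X.left, U) from coord x i) := by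
  obtain ⟨β, hβ⟩ :=
    exists_unit_comp_eq (G := structureSheaf X.left) (sheafifyAdj X.left) (presheafCoord M X i)
  exact ⟨β, fun U x => congrArg (fun f : constModule M X ⟶ (structureSheaf X.left).val =>
    homApp (P := constModule M X) (G := structureSheaf X.left) f U x) hβ⟩

theorem coord_one_tmul {R : Type} [CommRing R] [Algebra (ZMod p) R]
    (i k : Fin (Module.finrank (ZMod p) M)) :
    coord ((1 : R) ⊗ₜ[ZMod p] Module.finBasis (ZMod p) M k) i = if k = i then 1 else 0 := by
  rw [coord_tmul, Module.Basis.repr_self, Finsupp.single_apply, ite_smul, one_smul, zero_smul]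

theorem sum_coord_smul {R : Type} [CommRing R] [Algebra (ZMod p) R] (x : R ⊗[ZMod p] M) :
    ∑ i, coord x i • ((1 : R) ⊗ₜ[ZMod p] Module.finBasis (ZMod p) M i) = x := by
  refine coord_ext fun k => ?_
  rw [map_sum, Finset.sum_apply, Finset.sum_eq_single k]
  · rw [map_smul, Pi.smul_apply, coord_one_tmul, if_pos rfl, smul_eq_mul, mul_one]
  · intro i _ hi
    rw [map_smul, Pi.smul_apply, coord_one_tmul, if_neg hi, smul_zero]
  · exact fun h => (h (Finset.mem_univ k)).elim

/-- Coordinates and constant sections of a basis of `M`. The identities are checked on the presheaf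
`U ↦ Γ(X, U) ⊗ M`, which is enough by the sheafification adjunction. -/
theorem exists_constSheaf_decomposition (M : Type) [AddCommGroup M] [Module (ZMod p) M]
    [FiniteDimensional (ZMod p) M] (X : Sch p) {r : ℕ} (hr : Module.finrank (ZMod p) M = r) :
    ∃ (α : Fin r → (structureSheaf X.left ⟶ constSheaf M X))
      (β : Fin r → (constSheaf M X ⟶ structureSheaf X.left)),
      (∀ k i, α k ≫ β i = if k = i then 𝟙 _ else 0) ∧ ∑ i, β i ≫ α i = 𝟙 _ := by
  subst hr
  choose β hβ using exists_constSheaf_coord M X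
  let b := fun (i : Fin (Module.finrank (ZMod p) M)) (U : X.left.Opens) =>
    (1 : Γ(X.left, U)) ⊗ₜ[ZMod p] Module.finBasis (ZMod p) M i
  let α := fun i => unitHom (toConst M X ⊤ (b i ⊤))
  have hα : ∀ i (U : X.left.Opens) (r : Γ(X.left, U)),
      (α i).app U r = r • toConst M X U (b i U) := by
    intro i U r
    refine (unitHom_app _ U r).trans (congrArg (r • ·) ?_)
    rw [sheafRes_toConst]
    refine congrArg (toConst M X U) ?_
    change changeScalars _ M _ = _
    simp [changeScalars, b]
  refine ⟨α, β, fun k i => unit_hom_ext fun U => ?_, constSheaf_hom_ext fun U x => ?_⟩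
  · have h1 : (α k).app U (unitOne X.left U) = toConst M X U (b k U) :=
      (hα k U (1 : Γ(X.left, U))).trans (one_smul _ _)
    refine (congrArg ((β i).app U) h1).trans ((hβ i U _).trans ?_)
    refine (coord_one_tmul (R := Γ(X.left, U)) i k).trans ?_
    split_ifs <;> rfl
  · rw [sum_app]
    have h1 : ∀ i, (β i ≫ α i).app U (toConst M X U x) = toConst M X U (coord x i • b i U) := by
      intro i
      refine (congrArg ((α i).app U) (hβ i U x)).trans ((hα i U _).trans ?_)
      exact ((toConst M X U).map_smul _ _).symm
    refine (Finset.sum_congr rfl fun i _ => h1 i).trans ?_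
    rw [← map_sum]
    exact congrArg (toConst M X U) (sum_coord_smul x)

theorem finrank_quotient_orthogonal {V : Type} [AddCommGroup V] [Module (ZMod p) V]
    [FiniteDimensional (ZMod p) V] {B : LinearMap.BilinForm (ZMod p) V}
    (hnd : B.Nondegenerate) (W : Submodule (ZMod p) V) :
    Module.finrank (ZMod p) (V ⧸ B.orthogonal W) = Module.finrank (ZMod p) W := by
  have h1 := LinearMap.BilinForm.finrank_orthogonal hnd W
  have h2 := Submodule.finrank_quotient_add_finrank (B.orthogonal W)
  have h3 := Submodule.finrank_le W
  omega

end NormalBundle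

end
end OrthDL

/-! ### The final theorem -/

theorem corollary2p6 (p : ℕ) [Fact p.Prime] (hp : p ≠ 2) (d : ℕ)
    (V : Type) [AddCommGroup V] [Module (ZMod p) V] [FiniteDimensional (ZMod p) V]
    (hV : Module.finrank (ZMod p) V = 2 * (d + 1))
    (B : LinearMap.BilinForm (ZMod p) V) (hB : B.IsSymm) (hnd : B.Nondegenerate)
    (hns : OrthDL.IsNonsplit B) (b : OrthDL.StandardBasis B d)
    (W : Submodule (ZMod p) V) (hW : W ≤ B.orthogonal W)
    (d' : ℕ) (b' : OrthDL.StandardBasis (OrthDL.inducedForm B hB W) d') (ε : OrthDL.Sign) :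
    OrthDL.IsRepresentable (OrthDL.IsOGr B d) ∧
    OrthDL.IsRepresentable (OrthDL.IsY b ε) ∧
    OrthDL.IsRepresentable (OrthDL.IsY b' ε) ∧
    (OrthDL.InComponent b ε (OrthDL.basePoint p) ((b'.flag ε).inverseImage B W) →
      ∀ (Y : OrthDL.Sch p) (u : OrthDL.Flag V Y), OrthDL.Represents (OrthDL.IsY b ε) Y u →
      ∀ (Y' : OrthDL.Sch p) (u' : OrthDL.Flag (OrthDL.OrthQuot B W) Y'),
        OrthDL.Represents (OrthDL.IsY b' ε) Y' u' →
      (∃! j : Y' ⟶ Y, OrthDL.IsSpecialCycleMap B W u u' j) ∧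
      ∀ j : Y' ⟶ Y, OrthDL.IsSpecialCycleMap B W u u' j →
        AlgebraicGeometry.IsClosedImmersion j.left ∧
        OrthDL.IsLocallyFreeOfRank (OrthDL.conormalSheaf j.left) (Module.finrank (ZMod p) W) ∧
        Nonempty (OrthDL.normalBundle j.left ≅
          OrthDL.sheafHom u'.quotient (OrthDL.constSheaf (V ⧸ B.orthogonal W) Y'))) := by
  obtain ⟨S⟩ := OrthDL.nonempty_splitting (W := W) hB hnd
  have hd := OrthDL.finrank_orthQuot hnd hW
  rw [OrthDL.finrank_of_standardBasis b', hV] at hd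
  -- The dimension of `W^⊥/W` is that of `V` minus `2 dim W`, and both are prescribed by standard
  -- bases.
  obtain rfl : d = Module.finrank (ZMod p) W + d' := by omega
  have hsy' := OrthDL.inducedForm_isSymm (W := W) hB
  have hnd' := OrthDL.inducedForm_nondegenerate (W := W) hB hnd
  have hns' := OrthDL.inducedForm_isNonsplit hB hnd hW hns
  refine ⟨?_, OrthDL.isRepresentable_isY hB hnd hns hV b ε,
    OrthDL.isRepresentable_isY hsy' hnd' hns' (OrthDL.finrank_of_standardBasis b') b' ε, ?_⟩
  · rw [OrthDL.isOGr_eq]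
    exact OrthDL.isRepresentable_isModuli B _ _ _
  intro hcomp Y u hY Y' u' hY'
  refine ⟨OrthDL.existsUnique_specialCycleMap hB hnd hns hW hcomp hY hY', fun j hj => ?_⟩
  have hc := OrthDL.isCycle_of_isSpecialCycleMap hB hnd hns hW hY hY' hj
  obtain ⟨θ, χ, h1, h2⟩ := hc.exists_decomposition S hW hnd hns hV
  -- Since `V / W^⊥` has the dimension of `W`, its constant bundle has as many summands `𝒪` as the
  -- conormal sheaf has copies of the universal quotient.
  obtain ⟨α, β, h3, h4⟩ := OrthDL.exists_constSheaf_decomposition (V ⧸ B.orthogonal W) Y'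
    (OrthDL.finrank_quotient_orthogonal hnd W)
  refine ⟨hc.isClosedImmersion S hnd hns hW hV, ?_, ?_⟩
  · exact OrthDL.isLocallyFreeOfRank_of_decomposition (hc.moduli'.exists_quotient_restrict_iso
      hsy' hnd' hns' (OrthDL.finrank_of_standardBasis b')) θ χ h1 h2
  · exact OrthDL.nonempty_sheafHom_iso θ χ h1 h2 α β h3 h4
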